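/- Let $n\ge 0$ and let $M$ be a real-analytic $n$-dimensional manifold; put $M_0=M\times\{0\}\subset M\times\mathbb R$. Let $\bar g_0$ be an analytic Riemannian metric and $K_0$ an analytic symmetric covariant 2-tensor field on $M$. Below, a *neighbourhood* $V$ of $M_0$ is an open subset of $M\times\mathbb R$ containing $M_0$, each connected component of which meets $M_0$. (a) and (b): Let $U\subset M\times\mathbb R$ be any open set containing $M_0$, and let an analytic lapse $N>0$, an analytic shift $\beta$ (a $t$-dependent vector field tangent to the slices $M\times\{t\}$) and an analytic symmetric covariant 2-tensor field $\rho$ on spacetime (the sources) be given on $U$. For $t$-dependent symmetric 2-tensor fields $g_{ij}$ (Riemannian) and $K_{ij}$ on the slices consider the evolution equations $$\partial_t g_{ij}=-2NK_{ij}+\bar\nabla_i\beta_j+\bar\nabla_j\beta_i,$$ $$\partial_t K_{ij}=N\{\bar R_{ij}-2K_{ih}K^h{}_j+K_{ij}K^h{}_h\}-\bar\nabla_i\partial_jN+\beta^h\bar\nabla_hK_{ij}+K_{ih}\bar\nabla_j\beta^h+K_{hj}\bar\nabla_i\beta^h-N\rho_{ij},$$ where $\bar\nabla$ and $\bar R_{ij}$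 are the covariant derivative and the Ricci tensor of $g_{ij}$ on the slices. (a) There is a neighbourhood $V\subset U$ of $M_0$ on which the evolution equations have an analytic solution $(g,K)$, with $g$ Riemannian and $K$ symmetric, such that $g=\bar g_0$ and $K=K_0$ on $M_0$. (b) Let $(g,K)$ be any such solution, on any neighbourhood $V\subset U$ of $M_0$, and let $$G=-N^2dt^2+g_{ij}(dx^i+\beta^idt)(dx^j+\beta^jdt).$$ Suppose that the stress energy tensor $T_{\alpha\beta}=\rho_{\alpha\beta}-\tfrac12G_{\alpha\beta}\,G^{\lambda\mu}\rho_{\lambda\mu}$ is conserved, $\nabla_\alpha T^{\alpha\beta}=0$ on $V$ ($\nabla$ the covariant derivative of $G$), and that the initial data satisfy on $M_0$ the constraints $$-\bar\nabla_hK^h{}_i+\partial_iK^h{}_h-N^{-1}\rho_{0i}=0,\qquad \bar R-K^i{}_jK^j{}_i+(K^h{}_h)^2+2T_0{}^0=0,$$ where $g_{ij}=\bar g_{0,ij}$, $K=K_0$, and the index $0$ refers to the frame vector $e_0=\partial_t-\beta^j\partial_j$. Then $G$ satisfies the full Einstein equations $\mathrm{Ricci}(G)=\rho$ on $V$. (c)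 If $(\bar g_0,K_0)$ satisfies the vacuum constraints $$-\bar\nabla_hK^h{}_i+\partial_iK^h{}_h=0,\qquad \bar R-K^i{}_jK^j{}_i+(K^h{}_h)^2=0,$$ then $(M,\bar g_0,K_0)$ has a vacuum Einsteinian development: there are a neighbourhood $V$ of $M_0$ in $M\times\mathbb R$ and an analytic metric $G$ of signature $(-,+,\dots,+)$ on $V$ with $\mathrm{Ricci}(G)=0$ that induces $\bar g_0$ on $M_0$ and for which $K_0$ is the extrinsic curvature $K_{ij}=\tfrac12(\nabla_i\nu_j+\nabla_j\nu_i)$ of $M_0$, with $\nu$ the past-oriented unit normal. -/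

import Mathlib

open scoped Manifold ContDiff

namespace EinsteinCauchy

noncomputable section

/-! Tensor calculus in local coordinates. The coordinate space is a normed space `F` with a family
`b` of coordinate directions indexed by `ι`; tensors are given by their components. -/

section Coordinates

variable {ι F : Type*} [Fintype ι] [DecidableEq ι] [NormedAddCommGroup F] [NormedSpace ℝ F]

/-- The partial derivative `∂_i f`. -/
def pd (b : ι → F) (i : ι) (f : F → ℝ) (x : F) : ℝ := fderiv ℝ f x (b i)

/-- The Christoffel symbol `Γ^l_{ij}` of the metric `g`. -/
def christoffel (b : ι → F) (g : F → Matrix ι ι ℝ) (l i j : ι) (x : F) : ℝ :=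
  1 / 2 * ∑ m, (g x)⁻¹ l m *
    (pd b i (fun z => g z j m) x + pd b j (fun z => g z i m) x - pd b m (fun z => g z i j) x)

/-- The Ricci tensor
`R_{ij} = ∂_l Γ^l_{ij} - ∂_i Γ^l_{jl} + Γ^l_{ij} Γ^m_{lm} - Γ^l_{im} Γ^m_{jl}`. -/
def ricci (b : ι → F) (g : F → Matrix ι ι ℝ) (i j : ι) (x : F) : ℝ :=
  ∑ l, (pd b l (christoffel b g l i j) x - pd b i (christoffel b g l j l) x)
    + ∑ l, ∑ m, (christoffel b g l i j x * christoffel b g m l m x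
        - christoffel b g l i m x * christoffel b g m j l x)

/-- The trace `g^{ij} h_{ij}`. -/
def tr (g h : F → Matrix ι ι ℝ) (x : F) : ℝ := ∑ i, ∑ j, (g x)⁻¹ i j * h x i j

/-- The scalar curvature `g^{ij} R_{ij}`. -/
def scalarCurvature (b : ι → F) (g : F → Matrix ι ι ℝ) (x : F) : ℝ :=
  tr g (fun z i j => ricci b g i j z) x

/-- `∇_i w_j` for a covector field `w`. -/
def covDerivCovector (b : ι → F) (g : F → Matrix ι ι ℝ) (w : F → ι → ℝ) (i j : ι) (x : F) : ℝ :=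
  pd b i (fun z => w z j) x - ∑ l, christoffel b g l i j x * w x l

/-- `∇_i v^j` for a vector field `v`. -/
def covDerivVector (b : ι → F) (g : F → Matrix ι ι ℝ) (v : F → ι → ℝ) (i j : ι) (x : F) : ℝ :=
  pd b i (fun z => v z j) x + ∑ l, christoffel b g j i l x * v x l

/-- `∇_l h_{ij}` for a covariant 2-tensor field `h`. -/
def covDerivTensor (b : ι → F) (g h : F → Matrix ι ι ℝ) (l i j : ι) (x : F) : ℝ :=
  pd b l (fun z => h z i j) x
    - ∑ m, (christoffel b g m l i x * h x m j + christoffel b g m l j x * h x i m)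

/-- The divergence `∇_i h^i_j = g^{ik} ∇_i h_{kj}` of a covariant 2-tensor field `h`. -/
def divergence (b : ι → F) (g h : F → Matrix ι ι ℝ) (j : ι) (x : F) : ℝ :=
  ∑ i, ∑ k, (g x)⁻¹ i k * covDerivTensor b g h i k j x

end Coordinates

section Directions

variable {n : ℕ}

/-- The coordinate directions of `ℝⁿ`. -/
def spaceDir (i : Fin n) : EuclideanSpace ℝ (Fin n) := EuclideanSpace.single i 1

/-- The spatial coordinate directions of `ℝⁿ × ℝ`. -/
def sliceDir (i : Fin n) : EuclideanSpace ℝ (Fin n) × ℝ := (spaceDir i, 0)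

/-- All coordinate directions of `ℝⁿ × ℝ`; the index `Sum.inr ()` is that of the time `t`. -/
def spacetimeDir : Fin n ⊕ Unit → EuclideanSpace ℝ (Fin n) × ℝ :=
  Sum.elim sliceDir (fun _ => (0, 1))

end Directions

section Components

variable {n : ℕ} {M : Type*} [TopologicalSpace M] [ChartedSpace (EuclideanSpace ℝ (Fin n)) M]

/-- The coordinate vector `∂/∂x^i` of the chart `e` at the point with coordinates `y`. -/
def coordVec (e : OpenPartialHomeomorph M (EuclideanSpace ℝ (Fin n)))
    (y : EuclideanSpace ℝ (Fin n)) (i : Fin n) : TangentSpace (𝓡 n) (e.symm y) :=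
  mfderiv (𝓡 n) (𝓡 n) e.symm y (spaceDir i)

/-- The coordinate vectors of the coordinates `(x^i, t)` on `M × ℝ`, where `x^i` are those of the
chart `e`. The tangent space of `M × ℝ` at `(x, t)` is `T_x M × ℝ`. -/
def spacetimeVec (e : OpenPartialHomeomorph M (EuclideanSpace ℝ (Fin n)))
    (y : EuclideanSpace ℝ (Fin n)) :
    Fin n ⊕ Unit → TangentSpace (𝓡 n) (e.symm y) × ℝ :=
  Sum.elim (fun i => (coordVec e y i, 0)) (fun _ => (0, 1))

/-- The part of `V ⊆ M × ℝ` covered by the coordinates `(x^i, t)`, in these coordinates. -/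
def chartDomain (e : OpenPartialHomeomorph M (EuclideanSpace ℝ (Fin n))) (V : Set (M × ℝ)) :
    Set (EuclideanSpace ℝ (Fin n) × ℝ) :=
  {q | q.1 ∈ e.target ∧ (e.symm q.1, q.2) ∈ V}

/-- The components `h_{ij}` of a covariant 2-tensor field on `M`. -/
def dataComp (e : OpenPartialHomeomorph M (EuclideanSpace ℝ (Fin n)))
    (h : (x : M) → LinearMap.BilinForm ℝ (TangentSpace (𝓡 n) x))
    (y : EuclideanSpace ℝ (Fin n)) : Matrix (Fin n) (Fin n) ℝ :=
  fun i j => h (e.symm y) (coordVec e y i) (coordVec e y j)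

/-- A time-dependent function on `M`, in coordinates. -/
def scalarComp (e : OpenPartialHomeomorph M (EuclideanSpace ℝ (Fin n))) (f : M × ℝ → ℝ)
    (q : EuclideanSpace ℝ (Fin n) × ℝ) : ℝ := f (e.symm q.1, q.2)

/-- The components `β^i` of a time-dependent vector field on `M`. -/
def vecComp (e : OpenPartialHomeomorph M (EuclideanSpace ℝ (Fin n)))
    (β : (p : M × ℝ) → TangentSpace (𝓡 n) p.1)
    (q : EuclideanSpace ℝ (Fin n) × ℝ) : Fin n → ℝ :=
  let w : EuclideanSpace ℝ (Fin n) :=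
    mfderiv (𝓡 n) (𝓡 n) e (e.symm q.1) (β (e.symm q.1, q.2))
  fun i => w i

/-- The components `h_{ij}` of a time-dependent covariant 2-tensor field on `M`. -/
def spaceComp (e : OpenPartialHomeomorph M (EuclideanSpace ℝ (Fin n)))
    (h : (p : M × ℝ) → LinearMap.BilinForm ℝ (TangentSpace (𝓡 n) p.1))
    (q : EuclideanSpace ℝ (Fin n) × ℝ) : Matrix (Fin n) (Fin n) ℝ :=
  fun i j => h (e.symm q.1, q.2) (coordVec e q.1 i) (coordVec e q.1 j)

/-- The components `h_{αβ}` of a covariant 2-tensor field on `M × ℝ`. -/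
def spacetimeComp (e : OpenPartialHomeomorph M (EuclideanSpace ℝ (Fin n)))
    (h : (p : M × ℝ) → LinearMap.BilinForm ℝ (TangentSpace (𝓡 n) p.1 × ℝ))
    (q : EuclideanSpace ℝ (Fin n) × ℝ) : Matrix (Fin n ⊕ Unit) (Fin n ⊕ Unit) ℝ :=
  fun i j => h (e.symm q.1, q.2) (spacetimeVec e q.1 i) (spacetimeVec e q.1 j)

/-- The spatial components `ρ_{ij}` of a covariant 2-tensor field on `M × ℝ`. -/
def spatialPart (e : OpenPartialHomeomorph M (EuclideanSpace ℝ (Fin n)))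
    (ρ : (p : M × ℝ) → LinearMap.BilinForm ℝ (TangentSpace (𝓡 n) p.1 × ℝ))
    (q : EuclideanSpace ℝ (Fin n) × ℝ) : Matrix (Fin n) (Fin n) ℝ :=
  fun i j => spacetimeComp e ρ q (Sum.inl i) (Sum.inl j)

/-- A positive definite symmetric bilinear form. -/
def IsInnerForm {T : Type*} [AddCommGroup T] [Module ℝ T] (h : LinearMap.BilinForm ℝ T) : Prop :=
  (∀ v w, h v w = h w v) ∧ ∀ v, v ≠ 0 → 0 < h v v

/-- A symmetric bilinear form of signature `(-, +, …, +)`. -/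
def IsLorentzForm {T : Type*} [AddCommGroup T] [Module ℝ T] (h : LinearMap.BilinForm ℝ T) : Prop :=
  (∀ v w, h v w = h w v) ∧ ∃ v, h v v < 0 ∧ ∀ w, h v w = 0 → w ≠ 0 → 0 < h w w

/-- An open neighbourhood of `M₀ = M × {0}` in `M × ℝ` each of whose connected components
meets `M₀`. -/
structure IsSliceNeighborhood (V : Set (M × ℝ)) : Prop where
  isOpen : IsOpen V
  slice_mem : ∀ x : M, (x, (0 : ℝ)) ∈ V
  component : ∀ p ∈ V, ∃ x : M, (x, (0 : ℝ)) ∈ connectedComponentIn V p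

/-- Analytic geometric initial data on `M`: an analytic Riemannian metric and an analytic symmetric
2-tensor field. -/
structure IsAnalyticInitialData
    (g₀ K₀ : (x : M) → LinearMap.BilinForm ℝ (TangentSpace (𝓡 n) x)) : Prop where
  metric : ∀ x, IsInnerForm (g₀ x)
  symm : ∀ x v w, K₀ x v w = K₀ x w v
  analytic_metric : ∀ e ∈ IsManifold.maximalAtlas (𝓡 n) ω M, ∀ i j,
    AnalyticOnNhd ℝ (fun y => dataComp e g₀ y i j) e.target
  analytic_curvature : ∀ e ∈ IsManifold.maximalAtlas (𝓡 n) ω M, ∀ i j,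
    AnalyticOnNhd ℝ (fun y => dataComp e K₀ y i j) e.target

/-- An analytic positive lapse `N` and an analytic shift `β` on `U`. -/
structure IsAnalyticGauge (U : Set (M × ℝ)) (N : M × ℝ → ℝ)
    (β : (p : M × ℝ) → TangentSpace (𝓡 n) p.1) : Prop where
  lapse_pos : ∀ p ∈ U, 0 < N p
  analytic_lapse : ∀ e ∈ IsManifold.maximalAtlas (𝓡 n) ω M,
    AnalyticOnNhd ℝ (scalarComp e N) (chartDomain e U)
  analytic_shift : ∀ e ∈ IsManifold.maximalAtlas (𝓡 n) ω M, ∀ i,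
    AnalyticOnNhd ℝ (fun q => vecComp e β q i) (chartDomain e U)

/-- An analytic symmetric covariant 2-tensor field on `U ⊆ M × ℝ`. -/
structure IsAnalyticSymmetric (U : Set (M × ℝ))
    (ρ : (p : M × ℝ) → LinearMap.BilinForm ℝ (TangentSpace (𝓡 n) p.1 × ℝ)) : Prop where
  symm : ∀ p ∈ U, ∀ v w, ρ p v w = ρ p w v
  analytic : ∀ e ∈ IsManifold.maximalAtlas (𝓡 n) ω M, ∀ i j,
    AnalyticOnNhd ℝ (fun q => spacetimeComp e ρ q i j) (chartDomain e U)

/-- The evolution equations on `V`, in all local coordinates of `M`: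
`∂_t g_{ij} = -2 N K_{ij} + ∇_i β_j + ∇_j β_i` and
`∂_t K_{ij} = N (R_{ij} - 2 K_{ih} K^h_j + K_{ij} K^h_h) - ∇_i ∂_j N
  + β^h ∇_h K_{ij} + K_{ih} ∇_j β^h + K_{hj} ∇_i β^h - N ρ_{ij}`,
where `∇` and `R_{ij}` are those of the space metric `g` at fixed `t`. -/
def EvolutionEquations (V : Set (M × ℝ)) (N : M × ℝ → ℝ)
    (β : (p : M × ℝ) → TangentSpace (𝓡 n) p.1)
    (ρ : (p : M × ℝ) → LinearMap.BilinForm ℝ (TangentSpace (𝓡 n) p.1 × ℝ))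
    (g K : (p : M × ℝ) → LinearMap.BilinForm ℝ (TangentSpace (𝓡 n) p.1)) : Prop :=
  ∀ e ∈ IsManifold.maximalAtlas (𝓡 n) ω M, ∀ q ∈ chartDomain e V, ∀ i j : Fin n,
    let gc := spaceComp e g
    let Kc := spaceComp e K
    let Nc := scalarComp e N
    let βc := vecComp e β
    let βlow : EuclideanSpace ℝ (Fin n) × ℝ → Fin n → ℝ := fun z => (gc z).mulVec (βc z)
    pd spacetimeDir (Sum.inr ()) (fun z => gc z i j) q =
        -2 * Nc q * Kc q i j
          + covDerivCovector sliceDir gc βlow i j q + covDerivCovector sliceDir gc βlow j i q ∧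
    pd spacetimeDir (Sum.inr ()) (fun z => Kc z i j) q =
        Nc q * (ricci sliceDir gc i j q - 2 * (Kc q * (gc q)⁻¹ * Kc q) i j
            + Kc q i j * tr gc Kc q)
          - covDerivCovector sliceDir gc (fun z k => pd sliceDir k Nc z) i j q
          + ∑ h, (βc q h * covDerivTensor sliceDir gc Kc h i j q
            + Kc q i h * covDerivVector sliceDir gc βc j h q
            + Kc q h j * covDerivVector sliceDir gc βc i h q)
          - Nc q * spatialPart e ρ q i j

/-- An analytic solution `(g, K)` on `V` of the evolution equations, with `g` Riemannian on the
slices, taking the Cauchy data `(g₀, K₀)`. -/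
structure IsAnalyticEvolution (V : Set (M × ℝ)) (N : M × ℝ → ℝ)
    (β : (p : M × ℝ) → TangentSpace (𝓡 n) p.1)
    (ρ : (p : M × ℝ) → LinearMap.BilinForm ℝ (TangentSpace (𝓡 n) p.1 × ℝ))
    (g₀ K₀ : (x : M) → LinearMap.BilinForm ℝ (TangentSpace (𝓡 n) x))
    (g K : (p : M × ℝ) → LinearMap.BilinForm ℝ (TangentSpace (𝓡 n) p.1)) : Prop where
  metric : ∀ p ∈ V, IsInnerForm (g p)
  symm : ∀ p ∈ V, ∀ v w, K p v w = K p w v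
  analytic_metric : ∀ e ∈ IsManifold.maximalAtlas (𝓡 n) ω M, ∀ i j,
    AnalyticOnNhd ℝ (fun q => spaceComp e g q i j) (chartDomain e V)
  analytic_curvature : ∀ e ∈ IsManifold.maximalAtlas (𝓡 n) ω M, ∀ i j,
    AnalyticOnNhd ℝ (fun q => spaceComp e K q i j) (chartDomain e V)
  initial_metric : ∀ x, g (x, 0) = g₀ x
  initial_curvature : ∀ x, K (x, 0) = K₀ x
  evolution : EvolutionEquations V N β ρ g K

/-- The spacetime metric `-N² dt² + g_{ij} (dx^i + β^i dt) (dx^j + β^j dt)`. -/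
def spacetimeMetric (N : M × ℝ → ℝ) (β : (p : M × ℝ) → TangentSpace (𝓡 n) p.1)
    (g : (p : M × ℝ) → LinearMap.BilinForm ℝ (TangentSpace (𝓡 n) p.1)) (p : M × ℝ) :
    LinearMap.BilinForm ℝ (TangentSpace (𝓡 n) p.1 × ℝ) :=
  let θ : TangentSpace (𝓡 n) p.1 × ℝ →ₗ[ℝ] TangentSpace (𝓡 n) p.1 :=
    LinearMap.fst ℝ _ ℝ + (LinearMap.snd ℝ _ ℝ).smulRight (β p)
  let θ₀ : TangentSpace (𝓡 n) p.1 × ℝ →ₗ[ℝ] ℝ := LinearMap.snd ℝ _ ℝ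
  LinearMap.BilinForm.comp (g p) θ θ - (N p) ^ 2 • LinearMap.BilinForm.linMulLin θ₀ θ₀

/-- The Einstein equations `Ricci(G) = ρ` on `V`, in the coordinates `(x^i, t)`. -/
def EinsteinEquations (V : Set (M × ℝ))
    (G ρ : (p : M × ℝ) → LinearMap.BilinForm ℝ (TangentSpace (𝓡 n) p.1 × ℝ)) : Prop :=
  ∀ e ∈ IsManifold.maximalAtlas (𝓡 n) ω M, ∀ q ∈ chartDomain e V, ∀ i j,
    ricci spacetimeDir (spacetimeComp e G) i j q = spacetimeComp e ρ q i j

/-- The conservation laws `∇_α T^{αβ} = 0` on `V` (with the index `β` lowered) of the stress energy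
tensor `T_{αβ} = ρ_{αβ} - (1/2) G_{αβ} G^{λμ} ρ_{λμ}`, for the spacetime metric `G`. -/
def ConservationLaws (V : Set (M × ℝ))
    (G ρ : (p : M × ℝ) → LinearMap.BilinForm ℝ (TangentSpace (𝓡 n) p.1 × ℝ)) : Prop :=
  ∀ e ∈ IsManifold.maximalAtlas (𝓡 n) ω M, ∀ q ∈ chartDomain e V, ∀ j,
    let Gc := spacetimeComp e G
    let ρc := spacetimeComp e ρ
    divergence spacetimeDir Gc (fun z => ρc z - (1 / 2 * tr Gc ρc z) • Gc z) j q = 0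

/-- The momentum expression `-∇_h K^h_i + ∂_i K^h_h` of the initial data. -/
def momentum (e : OpenPartialHomeomorph M (EuclideanSpace ℝ (Fin n)))
    (g₀ K₀ : (x : M) → LinearMap.BilinForm ℝ (TangentSpace (𝓡 n) x)) (i : Fin n)
    (y : EuclideanSpace ℝ (Fin n)) : ℝ :=
  -divergence spaceDir (dataComp e g₀) (dataComp e K₀) i y
    + pd spaceDir i (tr (dataComp e g₀) (dataComp e K₀)) y

/-- The Hamiltonian expression `R - K^i_j K^j_i + (K^h_h)²` of the initial data. -/
def hamiltonian (e : OpenPartialHomeomorph M (EuclideanSpace ℝ (Fin n)))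
    (g₀ K₀ : (x : M) → LinearMap.BilinForm ℝ (TangentSpace (𝓡 n) x))
    (y : EuclideanSpace ℝ (Fin n)) : ℝ :=
  scalarCurvature spaceDir (dataComp e g₀) y
    - ((dataComp e g₀ y)⁻¹ * dataComp e K₀ y * ((dataComp e g₀ y)⁻¹ * dataComp e K₀ y)).trace
    + tr (dataComp e g₀) (dataComp e K₀) y ^ 2

/-- The constraints on `M₀` with lapse `N`, shift `β` and sources `ρ`:
`-∇_h K^h_i + ∂_i K^h_h - N⁻¹ ρ_{0i} = 0` and `R - K^i_j K^j_i + (K^h_h)² + 2 T_0^0 = 0`.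
The index `0` refers to the frame vector `e₀ = ∂_t - β^j ∂_j`, so that in the frame `e₀, ∂_i` the
metric has `g_{00} = -N²`, `g_{0i} = 0`; again `T_{αβ} = ρ_{αβ} - (1/2) g_{αβ} g^{λμ} ρ_{λμ}`. -/
def Constraints (N : M × ℝ → ℝ) (β : (p : M × ℝ) → TangentSpace (𝓡 n) p.1)
    (ρ : (p : M × ℝ) → LinearMap.BilinForm ℝ (TangentSpace (𝓡 n) p.1 × ℝ))
    (g₀ K₀ : (x : M) → LinearMap.BilinForm ℝ (TangentSpace (𝓡 n) x)) : Prop :=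
  ∀ e ∈ IsManifold.maximalAtlas (𝓡 n) ω M, ∀ y ∈ e.target,
    let p : M × ℝ := (e.symm y, 0)
    let e₀ : TangentSpace (𝓡 n) (e.symm y) × ℝ := (-β p, 1)
    let traceρ : ℝ := -(N p ^ 2)⁻¹ * ρ p e₀ e₀
      + ∑ i, ∑ j, (dataComp e g₀ y)⁻¹ i j * spatialPart e ρ (y, 0) i j
    let T₀₀ : ℝ := ρ p e₀ e₀ - 1 / 2 * (-(N p ^ 2)) * traceρ
    (∀ i, momentum e g₀ K₀ i y - (N p)⁻¹ * ρ p e₀ (coordVec e y i, 0) = 0) ∧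
      hamiltonian e g₀ K₀ y + 2 * (-(N p ^ 2)⁻¹ * T₀₀) = 0

/-- The vacuum constraints. -/
def VacuumConstraints (g₀ K₀ : (x : M) → LinearMap.BilinForm ℝ (TangentSpace (𝓡 n) x)) : Prop :=
  ∀ e ∈ IsManifold.maximalAtlas (𝓡 n) ω M, ∀ y ∈ e.target,
    (∀ i, momentum e g₀ K₀ i y = 0) ∧ hamiltonian e g₀ K₀ y = 0

/-- The past-oriented unit conormal `ν = (-G^{tt})^{-1/2} dt` of the slices `t = const`. -/
def unitConormal (e : OpenPartialHomeomorph M (EuclideanSpace ℝ (Fin n)))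
    (G : (p : M × ℝ) → LinearMap.BilinForm ℝ (TangentSpace (𝓡 n) p.1 × ℝ))
    (q : EuclideanSpace ℝ (Fin n) × ℝ) : Fin n ⊕ Unit → ℝ :=
  Sum.elim (fun _ => 0)
    (fun _ => (Real.sqrt (-(spacetimeComp e G q)⁻¹ (Sum.inr ()) (Sum.inr ())))⁻¹)

/-- The extrinsic curvature `(1/2) (∇_i ν_j + ∇_j ν_i)` of the slices `t = const` for the spacetime
metric `G`. -/
def extrinsicCurvature (e : OpenPartialHomeomorph M (EuclideanSpace ℝ (Fin n)))
    (G : (p : M × ℝ) → LinearMap.BilinForm ℝ (TangentSpace (𝓡 n) p.1 × ℝ)) (i j : Fin n)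
    (q : EuclideanSpace ℝ (Fin n) × ℝ) : ℝ :=
  1 / 2 *
    (covDerivCovector spacetimeDir (spacetimeComp e G) (unitConormal e G) (Sum.inl i) (Sum.inl j) q
      + covDerivCovector spacetimeDir (spacetimeComp e G) (unitConormal e G)
          (Sum.inl j) (Sum.inl i) q)

/-- `(V, G)` is an analytic vacuum Einsteinian development of `(M, g₀, K₀)`: `V` is a neighbourhood
of `M₀ = M × {0}` in `M × ℝ` and `G` is an analytic Lorentzian metric on `V` with vanishing Ricci
tensor, which induces `g₀` on `M₀` and for which `M₀` has the extrinsic curvature `K₀`. -/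
structure IsVacuumDevelopment (V : Set (M × ℝ))
    (G : (p : M × ℝ) → LinearMap.BilinForm ℝ (TangentSpace (𝓡 n) p.1 × ℝ))
    (g₀ K₀ : (x : M) → LinearMap.BilinForm ℝ (TangentSpace (𝓡 n) x)) : Prop where
  nhd : IsSliceNeighborhood V
  lorentzian : ∀ p ∈ V, IsLorentzForm (G p)
  analytic : IsAnalyticSymmetric V G
  vacuum : EinsteinEquations V G (fun _ => 0)
  induced_metric : ∀ x v w, G (x, 0) (v, 0) (w, 0) = g₀ x v w
  extrinsic_curvature : ∀ e ∈ IsManifold.maximalAtlas (𝓡 n) ω M, ∀ y ∈ e.target, ∀ i j,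
    extrinsicCurvature e G i j (y, 0) = dataComp e K₀ y i j

end Components

end

end EinsteinCauchy

open EinsteinCauchy

/-! Part (a) is a Cauchy–Kovalevskaya argument. The Ricci tensor contains second space derivatives
of `g`, but with `g`, `g⁻¹`, `K` and `d = ∂g` as independent unknowns the evolution equations become
a first order system, polynomial in the unknowns and linear in their space derivatives
(`exists_formal_evolution`). It is solved in formal power series. A monomial of total degree `m` and
degree `k` in `t` gets the weight `r^m ε^k / C(m,k)`. The resulting `ℓ¹` norm is submultiplicative,
and the map `u ↦ ∫ a ∂_i u dt` has norm at most `ε ‖a‖` (`wnorm_tint_mul_pderiv_le`), so time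
integration pays for the lost derivative with no shrinking of `r`. For small `ε` the Picard iterates
therefore stay in a ball. Each iteration settles one more power of `t`, so they converge
coefficientwise, and the limit is in the ball as well (`formal_cauchy_kovalevskaya`). The norm
dominates the `ℓ¹` norm of a smaller polydisc, so the limit is a convergent series. The relations `d
= ∂g`, `γ = g⁻¹` and the symmetry of `g` and `K` hold at `t = 0` and are propagated by the
equations.

An analytic solution is determined order by order in `t` (`evolution_local_unique`). Local solutions
are taken on sets that contain with each point the vertical segment to `M₀`. Two of them agree along
such segments by the identity theorem in one variable (`IsEvolutionOn.eq`), hence they glue.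

Independence of the chart is not checked term by term. In terms of the spacetime metric `G` the
evolution equations say `K_{ij} = -N Γ^t_{ij}` and `R_{ij}(G) = ρ_{ij}` for space indices
(`eventually_evolutionAt_iff`), and both relations are tensorial under changes of the space
coordinates alone.

For part (b) the Ricci tensor of `G` is computed in the frame `∂_i`, `e₀ = ∂_t - β^j ∂_j`. Its space
components are the evolution equation of `K` (`frameRicci_space`). Its mixed components give the
momentum constraint (`frameRicci_mixed`), and `R_00 + N² g^{ij} R_{ij}`, which is twice the `00`
component of the Einstein tensor, gives the Hamiltonian constraint (`frameRicci_hamiltonian`). Hence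
`D = Ricci(G) - ρ` has no space components, and it vanishes on `M₀`. The contracted Bianchi identity
and the conservation law give `∇^α D_{αβ} = ½ ∂_β tr D` (`divergence_ricci_sub`). As `D_{ij} = 0`,
these equations can be solved for the time derivatives of the remaining components, linearly and
homogeneously in `D` and its space derivatives. So `D` vanishes to every order in `t`, and near `M₀`
by analyticity (`eventually_zero_of_bianchi`). The identity theorem carries this over `V`, because
every component of `V` meets `M₀` (`einsteinEquations_of_near_slice`).

One piece of differential geometry serves both needs. Along a map `Ψ`, the connection coefficients
of a frame are determined by metric compatibility and vanishing torsion, and they determine the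
curvature (`frame_connection`, `frame_riemann`). If `Ψ` is a change of coordinates this yields the
covariance of all the objects involved. If `Ψ` is the identity it yields the decomposition in the
frame `∂_i`, `e₀`. Covariance also reduces the contracted Bianchi identity to a point where the
Christoffel symbols vanish.

Part (c) is the case `N = 1`, `β = 0`, `ρ = 0`. -/

namespace EinsteinCauchy

noncomputable section

set_option linter.unusedSectionVars false

/-! Formal power series in space variables indexed by `ι` and a time variable, with a weighted
`ℓ¹` norm for which integration in time gains one space derivative. -/

section FormalSeries

open MvPowerSeries Finset
open scoped NNReal ENNReal

variable {ι : Type*} [Fintype ι]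

/-- The exponent of the time variable itself. -/
abbrev timeExp : ι ⊕ Unit →₀ ℕ := Finsupp.single (Sum.inr ()) 1

/-- The weight of a monomial. -/
def weight (r ε : ℝ≥0) (m : ι ⊕ Unit →₀ ℕ) : ℝ≥0 :=
  r ^ m.degree * ε ^ m (Sum.inr ()) / (m.degree.choose (m (Sum.inr ())))

/-- The weighted `ℓ¹` norm of a formal power series. -/
def wnorm (r ε : ℝ≥0) (u : MvPowerSeries (ι ⊕ Unit) ℝ) : ℝ≥0∞ :=
  ∑' m, ‖coeff m u‖ₑ * weight r ε m

/-- Integration in time. -/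
def tint (u : MvPowerSeries (ι ⊕ Unit) ℝ) : MvPowerSeries (ι ⊕ Unit) ℝ :=
  fun m => if m (Sum.inr ()) = 0 then 0 else coeff (m - timeExp) u / m (Sum.inr ())

theorem coeff_tint_add (u : MvPowerSeries (ι ⊕ Unit) ℝ) (m : ι ⊕ Unit →₀ ℕ) :
    coeff (m + timeExp) (tint u) = coeff m u / (m (Sum.inr ()) + 1) := by
  change (if _ then _ else _) = _
  simp

theorem coeff_tint_of_eq_zero (u : MvPowerSeries (ι ⊕ Unit) ℝ) (m : ι ⊕ Unit →₀ ℕ)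
    (h : m (Sum.inr ()) = 0) : coeff m (tint u) = 0 := by
  change (if _ then _ else _) = _
  simp [h]

theorem degree_pos_choose (m : ι ⊕ Unit →₀ ℕ) : 0 < m.degree.choose (m (Sum.inr ())) :=
  Nat.choose_pos (Finsupp.le_degree _ _)

/-- The left side is a single term of Vandermonde's identity for the right side. -/
theorem choose_mul_choose_le (a b k l : ℕ) :
    a.choose k * b.choose l ≤ (a + b).choose (k + l) := by
  rw [Nat.add_choose_eq]
  exact Finset.single_le_sum (f := fun ij : ℕ × ℕ => a.choose ij.1 * b.choose ij.2)
    (fun _ _ => Nat.zero_le _) (HasAntidiagonal.mem_antidiagonal.2 (rfl : (k, l).1 + (k, l).2 = k + l))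

/-- This makes `wnorm` submultiplicative. The powers of `r` and `ε` are multiplicative, and the
binomial denominators go the right way by `choose_mul_choose_le`. -/
theorem weight_add_le (r ε : ℝ≥0) (p q : ι ⊕ Unit →₀ ℕ) :
    weight r ε (p + q) ≤ weight r ε p * weight r ε q := by
  have hp := degree_pos_choose p
  have hq := degree_pos_choose q
  have hpq := degree_pos_choose (p + q)
  have h := choose_mul_choose_le p.degree q.degree (p (Sum.inr ())) (q (Sum.inr ()))
  rw [← map_add, ← Finsupp.add_apply] at h
  unfold weight
  rw [div_mul_div_comm]
  have h2 : ((p.degree.choose (p (Sum.inr ())) : ℝ≥0) * (q.degree.choose (q (Sum.inr ())))) ≤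
      ((p + q).degree.choose ((p + q) (Sum.inr ()))) := by exact_mod_cast h
  rw [map_add] at *
  rw [show r ^ (p.degree + q.degree) * ε ^ (p + q) (Sum.inr ())
    = r ^ p.degree * ε ^ p (Sum.inr ()) * (r ^ q.degree * ε ^ q (Sum.inr ())) by
      rw [Finsupp.add_apply, pow_add, pow_add]; ring]
  gcongr

/-- The estimate for which the weight is made. A derivative in `x^i` costs the factor `q_i + 1`, and
time integration divides by `k + l + 1`, where `k`, `l` are the exponents of `t` in `p`, `q`. With
`n = |p| + |q| + 1`, the change from `C(n, k + l)` to `C(n, k + l + 1)` contributes `(n - k - l) /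
(k + l + 1)`, and `n - k - l ≥ q_i + 1`. The power of `r` is the same on both sides, so one factor
`ε` is gained. -/
theorem weight_int_le (r ε : ℝ≥0) (i : ι) (p q : ι ⊕ Unit →₀ ℕ) :
    weight r ε (p + q + timeExp) * (q (Sum.inl i) + 1) ≤
      ε * ((p + q) (Sum.inr ()) + 1) *
        (weight r ε p * weight r ε (q + Finsupp.single (Sum.inl i) 1)) := by
  classical
  have hp := degree_pos_choose p
  have hq := degree_pos_choose (q + Finsupp.single (Sum.inl i) 1)
  have hpq := degree_pos_choose (p + q + timeExp)
  have h := choose_mul_choose_le p.degree (q + Finsupp.single (Sum.inl i) 1).degree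
    (p (Sum.inr ())) (q (Sum.inr ()))
  unfold weight
  have e1 : (q + Finsupp.single (Sum.inl i) 1 : ι ⊕ Unit →₀ ℕ) (Sum.inr ()) = q (Sum.inr ()) := by simp
  have e2 : (p + q + timeExp : ι ⊕ Unit →₀ ℕ) (Sum.inr ()) = p (Sum.inr ()) + q (Sum.inr ()) + 1 := by simp
  have e3 : (p + q + timeExp).degree = p.degree + q.degree + 1 := by simp [timeExp]
  have e4 : (q + Finsupp.single (Sum.inl i) 1).degree = q.degree + 1 := by simp
  rw [e1, e4] at hq
  rw [e2, e3] at hpq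
  rw [e4] at h
  rw [e1, e2, e3, e4, Finsupp.add_apply]
  set k := p (Sum.inr ())
  set l := q (Sum.inr ())
  have hle : l + (q (Sum.inl i)) ≤ q.degree := by
    rw [Finsupp.degree_eq_sum, Fintype.sum_sum_type]
    have := Finset.single_le_sum (f := fun j => q (Sum.inl j)) (fun _ _ => Nat.zero_le _)
      (Finset.mem_univ i)
    simp only [Finset.univ_unique, Finset.sum_singleton]
    change _ ≤ _ + l
    linarith
  have hk : k ≤ p.degree := Finsupp.le_degree _ _
  have key : (p.degree.choose k * (q.degree + 1).choose l) * (q (Sum.inl i) + 1) ≤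
      (p.degree + q.degree + 1).choose (k + l + 1) * (k + l + 1) := by
    rw [Nat.choose_succ_right_eq]
    have : q (Sum.inl i) + 1 ≤ p.degree + q.degree + 1 - (k + l) := by omega
    exact Nat.mul_le_mul h this
  have key2 : ((p.degree.choose k * (q.degree + 1).choose l) * (q (Sum.inl i) + 1) : ℝ≥0) ≤
      (p.degree + q.degree + 1).choose (k + l + 1) * (k + l + 1) := by exact_mod_cast key
  rw [div_mul_div_comm, div_mul_eq_mul_div, ← mul_div_assoc,
    div_le_div_iff₀ (by exact_mod_cast hpq) (by exact_mod_cast Nat.mul_pos hp hq)]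
  calc r ^ (p.degree + q.degree + 1) * ε ^ (k + l + 1) * (q (Sum.inl i) + 1) *
        (p.degree.choose k * (q.degree + 1).choose l)
      = r ^ (p.degree + q.degree + 1) * ε ^ (k + l + 1) *
        ((p.degree.choose k * (q.degree + 1).choose l) * (q (Sum.inl i) + 1)) := by ring
    _ ≤ r ^ (p.degree + q.degree + 1) * ε ^ (k + l + 1) *
        ((p.degree + q.degree + 1).choose (k + l + 1) * (k + l + 1)) := by gcongr
    _ = _ := by push_cast; ring

/-- By `(k + 1) C(n + 1, k + 1) = (n + 1) C(n, k)`. When no derivative is lost, integration gains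
`r` besides `ε`. -/
theorem weight_tint_le (r ε : ℝ≥0) (m : ι ⊕ Unit →₀ ℕ) :
    weight r ε (m + timeExp) ≤ ε * r * (m (Sum.inr ()) + 1) * weight r ε m := by
  have hm := degree_pos_choose m
  have hm' := degree_pos_choose (m + timeExp)
  have e2 : (m + timeExp : ι ⊕ Unit →₀ ℕ) (Sum.inr ()) = m (Sum.inr ()) + 1 := by simp
  have e3 : (m + timeExp).degree = m.degree + 1 := by simp [timeExp]
  unfold weight
  rw [e2, e3] at hm' ⊢
  set k := m (Sum.inr ())
  have key : m.degree.choose k ≤ (m.degree + 1).choose (k + 1) * (k + 1) := by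
    rw [← Nat.add_one_mul_choose_eq]
    exact Nat.le_mul_of_pos_left _ (by omega)
  have key2 : (m.degree.choose k : ℝ≥0) ≤ (m.degree + 1).choose (k + 1) * (k + 1) := by
    exact_mod_cast key
  rw [← mul_div_assoc, div_le_div_iff₀ (by exact_mod_cast hm') (by exact_mod_cast hm)]
  calc r ^ (m.degree + 1) * ε ^ (k + 1) * (m.degree.choose k)
      ≤ r ^ (m.degree + 1) * ε ^ (k + 1) * ((m.degree + 1).choose (k + 1) * (k + 1)) := by gcongr
    _ = _ := by ring

/-- The weight `W` is arbitrary because the bound is used both for `weight` and for the weight that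
results from time integration. -/
theorem tsum_coeff_mul_le (u v : MvPowerSeries (ι ⊕ Unit) ℝ) (W : (ι ⊕ Unit →₀ ℕ) → ℝ≥0∞) :
    ∑' m, ‖coeff m (u * v)‖ₑ * W m ≤ ∑' p, ∑' q, ‖coeff p u‖ₑ * ‖coeff q v‖ₑ * W (p + q) := by
  classical
  rw [← ENNReal.tsum_prod (f := fun p q => ‖coeff p u‖ₑ * ‖coeff q v‖ₑ * W (p + q)),
    ← Finset.HasAntidiagonal.sigmaAntidiagonalEquivProd.tsum_eq, ENNReal.tsum_sigma']
  refine ENNReal.tsum_le_tsum fun m => ?_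
  rw [tsum_fintype, coeff_mul]
  calc ‖∑ x ∈ antidiagonal m, coeff x.1 u * coeff x.2 v‖ₑ * W m
      ≤ (∑ x ∈ antidiagonal m, ‖coeff x.1 u * coeff x.2 v‖ₑ) * W m := by
        gcongr; exact enorm_sum_le _ _
    _ = ∑ x ∈ antidiagonal m, ‖coeff x.1 u‖ₑ * ‖coeff x.2 v‖ₑ * W (x.1 + x.2) := by
        rw [Finset.sum_mul]
        refine Finset.sum_congr rfl fun x hx => ?_
        rw [enorm_mul, HasAntidiagonal.mem_antidiagonal.1 hx]
    _ = _ := by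
        rw [← Finset.sum_coe_sort]; rfl
    _ ≤ _ := le_rfl

theorem wnorm_mul_le (r ε : ℝ≥0) (u v : MvPowerSeries (ι ⊕ Unit) ℝ) :
    wnorm r ε (u * v) ≤ wnorm r ε u * wnorm r ε v := by
  refine (tsum_coeff_mul_le u v _).trans ?_
  unfold wnorm
  rw [← ENNReal.tsum_mul_right]
  refine ENNReal.tsum_le_tsum fun p => ?_
  rw [← ENNReal.tsum_mul_left]
  refine ENNReal.tsum_le_tsum fun q => ?_
  calc _ ≤ ‖coeff p u‖ₑ * ‖coeff q v‖ₑ * ((weight r ε p * weight r ε q : ℝ≥0) : ℝ≥0∞) := by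
        gcongr; exact weight_add_le r ε p q
    _ = _ := by push_cast; ring

theorem wnorm_add_le (r ε : ℝ≥0) (u v : MvPowerSeries (ι ⊕ Unit) ℝ) :
    wnorm r ε (u + v) ≤ wnorm r ε u + wnorm r ε v := by
  unfold wnorm
  rw [← ENNReal.tsum_add]
  refine ENNReal.tsum_le_tsum fun p => ?_
  rw [← add_mul, map_add]
  gcongr
  exact enorm_add_le _ _

theorem wnorm_tint (r ε : ℝ≥0) (u : MvPowerSeries (ι ⊕ Unit) ℝ) :
    wnorm r ε (tint u) =
      ∑' m, ‖coeff m u‖ₑ * ((weight r ε (m + timeExp) / (m (Sum.inr ()) + 1) : ℝ≥0) : ℝ≥0∞) := by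
  classical
  unfold wnorm
  have hinj : Function.Injective (fun m : ι ⊕ Unit →₀ ℕ => m + timeExp) := add_left_injective _
  -- Only monomials divisible by `t` occur in `tint u`, so the sum can be indexed by `m + timeExp`.
  rw [← hinj.tsum_eq (f := fun m => ‖coeff m (tint u)‖ₑ * (weight r ε m : ℝ≥0∞))]
  · refine tsum_congr fun m => ?_
    rw [coeff_tint_add, div_eq_mul_inv, enorm_mul, mul_assoc]
    congr 1
    rw [div_eq_mul_inv, mul_comm, ENNReal.coe_mul]
    congr 1
    rw [← ofReal_norm, norm_inv, Real.norm_of_nonneg (by positivity), ENNReal.ofReal,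
      Real.toNNReal_inv, Real.toNNReal_add (by positivity) (by positivity)]
    simp
  · intro m hm
    by_cases h : m (Sum.inr ()) = 0
    · exact absurd (by simp [coeff_tint_of_eq_zero _ _ h]) hm
    · refine ⟨m - timeExp, tsub_add_cancel_of_le ?_⟩
      rw [Finsupp.single_le_iff]
      omega

theorem wnorm_tint_le (r ε : ℝ≥0) (u : MvPowerSeries (ι ⊕ Unit) ℝ) :
    wnorm r ε (tint u) ≤ ε * r * wnorm r ε u := by
  rw [wnorm_tint]
  unfold wnorm
  rw [← ENNReal.tsum_mul_left]
  refine ENNReal.tsum_le_tsum fun m => ?_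
  calc _ ≤ ‖coeff m u‖ₑ * ((ε * r * weight r ε m : ℝ≥0) : ℝ≥0∞) := by
        gcongr
        rw [div_le_iff₀ (by positivity)]
        refine (weight_tint_le r ε m).trans_eq (by ring)
    _ = _ := by push_cast; ring

/-- One space derivative is absorbed by time integration at fixed `r`, so a single norm suffices
where a scale of norms would otherwise be needed. The coefficient `a` has to stand inside the
integral, since integration does not commute with multiplication by a time-dependent factor. -/
theorem wnorm_tint_mul_pderiv_le (r ε : ℝ≥0) (i : ι) (a u : MvPowerSeries (ι ⊕ Unit) ℝ) :
    wnorm r ε (tint (a * pderiv ℝ (Sum.inl i) u)) ≤ ε * wnorm r ε a * wnorm r ε u := by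
  rw [wnorm_tint]
  refine (tsum_coeff_mul_le a _ _).trans ?_
  have hinj : Function.Injective
      (fun m : ι ⊕ Unit →₀ ℕ => m + Finsupp.single (Sum.inl i) 1) := add_left_injective _
  have h2 : ∑' q, ‖coeff (q + Finsupp.single (Sum.inl i) 1) u‖ₑ *
      (weight r ε (q + Finsupp.single (Sum.inl i) 1) : ℝ≥0∞) ≤ wnorm r ε u :=
    ENNReal.tsum_comp_le_tsum_of_injective hinj _
  refine le_trans ?_ (mul_le_mul_right h2 _)
  unfold wnorm
  rw [← ENNReal.tsum_mul_left (a := (ε : ℝ≥0∞)), ← ENNReal.tsum_mul_right]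
  refine ENNReal.tsum_le_tsum fun p => ?_
  rw [← ENNReal.tsum_mul_left]
  refine ENNReal.tsum_le_tsum fun q => ?_
  rw [coeff_pderiv, enorm_mul]
  have h3 : ‖((q (Sum.inl i) : ℝ) + 1)‖ₑ = ((q (Sum.inl i) + 1 : ℝ≥0) : ℝ≥0∞) := by
    rw [← ofReal_norm, Real.norm_of_nonneg (by positivity), ENNReal.ofReal,
      Real.toNNReal_add (by positivity) (by positivity)]
    simp
  rw [h3]
  have h4 : (q (Sum.inl i) + 1 : ℝ≥0) *
      (weight r ε (p + q + timeExp) / ((p + q) (Sum.inr ()) + 1)) ≤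
      ε * (weight r ε p * weight r ε (q + Finsupp.single (Sum.inl i) 1)) := by
    rw [← mul_div_assoc, div_le_iff₀ (by positivity), mul_comm]
    exact (weight_int_le r ε i p q).trans_eq (by ring)
  calc _ = ‖coeff p a‖ₑ * ‖coeff (q + Finsupp.single (Sum.inl i) 1) u‖ₑ *
        (((q (Sum.inl i) + 1 : ℝ≥0) *
      (weight r ε (p + q + timeExp) / ((p + q) (Sum.inr ()) + 1)) : ℝ≥0) : ℝ≥0∞) := by
        rw [ENNReal.coe_mul]; ring
    _ ≤ ‖coeff p a‖ₑ * ‖coeff (q + Finsupp.single (Sum.inl i) 1) u‖ₑ *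
        ((ε * (weight r ε p * weight r ε (q + Finsupp.single (Sum.inl i) 1)) : ℝ≥0) : ℝ≥0∞) := by
        gcongr
    _ = _ := by push_cast; ring

theorem wnorm_mono (r : ℝ≥0) {ε ε' : ℝ≥0} (h : ε ≤ ε') (u : MvPowerSeries (ι ⊕ Unit) ℝ) :
    wnorm r ε u ≤ wnorm r ε' u := by
  unfold wnorm weight
  gcongr

end FormalSeries

/-! ### The Cauchy–Kovalevskaya theorem for formal power series. -/

section FormalCauchyKovalevskaya

open MvPowerSeries Finset
open scoped NNReal ENNReal

variable {ι : Type*} [Fintype ι]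

theorem wnorm_zero (r ε : ℝ≥0) : wnorm r ε (0 : MvPowerSeries (ι ⊕ Unit) ℝ) = 0 := by
  simp [wnorm]

theorem wnorm_one (r ε : ℝ≥0) : wnorm r ε (1 : MvPowerSeries (ι ⊕ Unit) ℝ) = 1 := by
  classical
  unfold wnorm
  rw [tsum_eq_single 0]
  · simp [weight]
  · intro m hm
    simp [coeff_one, hm]

theorem wnorm_smul (r ε : ℝ≥0) (c : ℝ) (u : MvPowerSeries (ι ⊕ Unit) ℝ) :
    wnorm r ε (c • u) = ‖c‖ₑ * wnorm r ε u := by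
  unfold wnorm
  rw [← ENNReal.tsum_mul_left]
  refine tsum_congr fun m => ?_
  rw [coeff_smul, enorm_mul, mul_assoc]

/-- The formal time variable. -/
abbrev timeVar : MvPowerSeries (ι ⊕ Unit) ℝ := X (Sum.inr ())

theorem coeff_tint (u : MvPowerSeries (ι ⊕ Unit) ℝ) (m : ι ⊕ Unit →₀ ℕ) :
    coeff m (tint u) =
      if m (Sum.inr ()) = 0 then 0 else coeff (m - timeExp) u / m (Sum.inr ()) := rfl

theorem tint_add (u v : MvPowerSeries (ι ⊕ Unit) ℝ) : tint (u + v) = tint u + tint v := by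
  ext m
  simp only [map_add, coeff_tint]
  split_ifs <;> simp [add_div]

theorem tint_smul (c : ℝ) (u : MvPowerSeries (ι ⊕ Unit) ℝ) : tint (c • u) = c • tint u := by
  ext m
  simp only [coeff_smul, coeff_tint]
  split_ifs <;> simp [mul_div_assoc]

/-- The gain of one power of `t` is what makes the Picard iteration converge. -/
theorem timeVar_pow_dvd_tint {k : ℕ} {u : MvPowerSeries (ι ⊕ Unit) ℝ} (h : timeVar ^ k ∣ u) :
    timeVar ^ (k + 1) ∣ tint u := by
  rw [X_pow_dvd_iff] at h ⊢
  intro m hm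
  rw [coeff_tint]
  split_ifs with h0
  · rfl
  · rw [h, zero_div]
    rw [Finsupp.tsub_apply, Finsupp.single_eq_same]
    omega

theorem pderiv_tint (u : MvPowerSeries (ι ⊕ Unit) ℝ) : pderiv ℝ (Sum.inr ()) (tint u) = u := by
  ext m
  rw [coeff_pderiv, coeff_tint_add]
  field_simp

theorem timeVar_dvd_tint (u : MvPowerSeries (ι ⊕ Unit) ℝ) : timeVar ∣ tint u := by
  simpa using timeVar_pow_dvd_tint (k := 0) (u := u) (by simp)

theorem timeVar_pow_dvd_pderiv {k : ℕ} {u : MvPowerSeries (ι ⊕ Unit) ℝ} (i : ι)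
    (h : timeVar ^ k ∣ u) : timeVar ^ k ∣ pderiv ℝ (Sum.inl i) u := by
  rw [X_pow_dvd_iff] at h ⊢
  intro m hm
  rw [coeff_pderiv, h _ (by simpa using hm), zero_mul]

/-- On monomials containing `t`, time differentiation only multiplies the coefficient by a nonzero
exponent. This is the induction step of the uniqueness arguments below. -/
theorem timeVar_pow_succ_dvd {k : ℕ} {u : MvPowerSeries (ι ⊕ Unit) ℝ} (h0 : timeVar ∣ u)
    (h : timeVar ^ k ∣ pderiv ℝ (Sum.inr ()) u) : timeVar ^ (k + 1) ∣ u := by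
  rw [X_pow_dvd_iff] at h ⊢
  rw [X_dvd_iff] at h0
  intro m hm
  by_cases hz : m (Sum.inr ()) = 0
  · exact h0 m hz
  · have h1 := h (m - timeExp) (by rw [Finsupp.tsub_apply, Finsupp.single_eq_same]; omega)
    have hle : timeExp ≤ m := by rw [Finsupp.single_le_iff]; omega
    rw [coeff_pderiv, tsub_add_cancel_of_le hle] at h1
    exact (mul_eq_zero.1 h1).resolve_right (by positivity)

theorem eq_zero_of_timeVar_pow_dvd {u : MvPowerSeries (ι ⊕ Unit) ℝ}
    (h : ∀ k, timeVar ^ k ∣ u) : u = 0 := by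
  ext m
  exact X_pow_dvd_iff.1 (h (m (Sum.inr ()) + 1)) m (by omega)

variable {B : Type*}

/-- `Φ` respects congruence modulo powers of the time variable. -/
def IsAdic (Φ : (B → MvPowerSeries (ι ⊕ Unit) ℝ) → MvPowerSeries (ι ⊕ Unit) ℝ) : Prop :=
  ∀ k u v, (∀ b, timeVar ^ k ∣ u b - v b) → timeVar ^ k ∣ Φ u - Φ v

/-- `Φ` is adic and bounded on balls, uniformly in `ε ≤ 1`. -/
structure IsTame (r : ℝ≥0)
    (Φ : (B → MvPowerSeries (ι ⊕ Unit) ℝ) → MvPowerSeries (ι ⊕ Unit) ℝ) : Prop where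
  bdd : ∀ R : ℝ≥0, ∃ C : ℝ≥0, ∀ ε ≤ (1 : ℝ≥0), ∀ u, (∀ b, wnorm r ε (u b) ≤ R) →
    wnorm r ε (Φ u) ≤ C
  adic : IsAdic Φ

/-- `Φ` loses at most one space derivative, so that its time integral is small for small `ε`. -/
structure IsQuasilinear (r : ℝ≥0)
    (Φ : (B → MvPowerSeries (ι ⊕ Unit) ℝ) → MvPowerSeries (ι ⊕ Unit) ℝ) : Prop where
  bdd : ∀ R : ℝ≥0, ∃ C : ℝ≥0, ∀ ε ≤ (1 : ℝ≥0), ∀ u, (∀ b, wnorm r ε (u b) ≤ R) →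
    ∀ a, wnorm r ε (tint (a * Φ u)) ≤ ε * C * wnorm r ε a
  adic : IsAdic Φ

/-- A tame map whose space derivatives are quasilinear. -/
structure IsTameOne (r : ℝ≥0)
    (Φ : (B → MvPowerSeries (ι ⊕ Unit) ℝ) → MvPowerSeries (ι ⊕ Unit) ℝ) : Prop where
  tame : IsTame r Φ
  deriv : ∀ i : ι, IsQuasilinear r (fun u => pderiv ℝ (Sum.inl i) (Φ u))

variable {r : ℝ≥0} {Φ Ψ : (B → MvPowerSeries (ι ⊕ Unit) ℝ) → MvPowerSeries (ι ⊕ Unit) ℝ}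

theorem IsAdic.add (h : IsAdic Φ) (h' : IsAdic Ψ) : IsAdic (fun u => Φ u + Ψ u) := by
  intro k u v huv
  rw [add_sub_add_comm]
  exact dvd_add (h k u v huv) (h' k u v huv)

theorem IsAdic.mul (h : IsAdic Φ) (h' : IsAdic Ψ) : IsAdic (fun u => Φ u * Ψ u) := by
  intro k u v huv
  rw [show Φ u * Ψ u - Φ v * Ψ v = Φ u * (Ψ u - Ψ v) + (Φ u - Φ v) * Ψ v by ring]
  exact dvd_add (Dvd.dvd.mul_left (h' k u v huv) _) (Dvd.dvd.mul_right (h k u v huv) _)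

theorem IsAdic.pderiv (h : IsAdic Φ) (i : ι) :
    IsAdic (fun u => pderiv ℝ (Sum.inl i) (Φ u)) := by
  intro k u v huv
  rw [← map_sub]
  exact timeVar_pow_dvd_pderiv i (h k u v huv)

theorem IsTame.add (h : IsTame r Φ) (h' : IsTame r Ψ) : IsTame r (fun u => Φ u + Ψ u) := by
  refine ⟨fun R => ?_, h.adic.add h'.adic⟩
  obtain ⟨C, hC⟩ := h.bdd R
  obtain ⟨C', hC'⟩ := h'.bdd R
  refine ⟨C + C', fun ε hε u hu => (wnorm_add_le _ _ _ _).trans ?_⟩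
  push_cast
  exact add_le_add (hC ε hε u hu) (hC' ε hε u hu)

theorem IsTame.mul (h : IsTame r Φ) (h' : IsTame r Ψ) : IsTame r (fun u => Φ u * Ψ u) := by
  refine ⟨fun R => ?_, h.adic.mul h'.adic⟩
  obtain ⟨C, hC⟩ := h.bdd R
  obtain ⟨C', hC'⟩ := h'.bdd R
  refine ⟨C * C', fun ε hε u hu => (wnorm_mul_le _ _ _ _).trans ?_⟩
  push_cast
  exact mul_le_mul' (hC ε hε u hu) (hC' ε hε u hu)

theorem IsQuasilinear.add (h : IsQuasilinear r Φ) (h' : IsQuasilinear r Ψ) :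
    IsQuasilinear r (fun u => Φ u + Ψ u) := by
  refine ⟨fun R => ?_, h.adic.add h'.adic⟩
  obtain ⟨C, hC⟩ := h.bdd R
  obtain ⟨C', hC'⟩ := h'.bdd R
  refine ⟨C + C', fun ε hε u hu a => ?_⟩
  rw [mul_add, tint_add]
  refine (wnorm_add_le _ _ _ _).trans ((add_le_add (hC ε hε u hu a) (hC' ε hε u hu a)).trans_eq ?_)
  push_cast
  ring

/-- The factor `Φ u` is absorbed into the multiplier `a`. For this reason the bound in
`IsQuasilinear` is required for every `a`. -/
theorem IsTame.mul_quasilinear (h : IsTame r Φ) (h' : IsQuasilinear r Ψ) :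
    IsQuasilinear r (fun u => Φ u * Ψ u) := by
  refine ⟨fun R => ?_, h.adic.mul h'.adic⟩
  obtain ⟨C, hC⟩ := h.bdd R
  obtain ⟨C', hC'⟩ := h'.bdd R
  refine ⟨C' * C, fun ε hε u hu a => ?_⟩
  rw [← mul_assoc]
  refine (hC' ε hε u hu _).trans ?_
  calc _ ≤ (ε : ℝ≥0∞) * C' * (wnorm r ε a * C) := by
        gcongr
        exact (wnorm_mul_le _ _ _ _).trans (mul_le_mul' le_rfl (hC ε hε u hu))
    _ = _ := by push_cast; ring

theorem IsTame.quasilinear (h : IsTame r Φ) : IsQuasilinear r Φ := by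
  refine ⟨fun R => ?_, h.adic⟩
  obtain ⟨C, hC⟩ := h.bdd R
  refine ⟨r * C, fun ε hε u hu a => ?_⟩
  refine (wnorm_tint_le _ _ _).trans ?_
  calc _ ≤ (ε : ℝ≥0∞) * r * (wnorm r ε a * C) := by
        gcongr
        exact (wnorm_mul_le _ _ _ _).trans (mul_le_mul' le_rfl (hC ε hε u hu))
    _ = _ := by push_cast; ring

theorem IsTameOne.quasilinear (h : IsTameOne r Φ) : IsQuasilinear r Φ := h.tame.quasilinear

theorem IsTame.const {c : MvPowerSeries (ι ⊕ Unit) ℝ} (hc : wnorm r 1 c < ⊤) :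
    IsTame r (fun _ : B → MvPowerSeries (ι ⊕ Unit) ℝ => c) := by
  refine ⟨fun R => ⟨(wnorm r 1 c).toNNReal, fun ε hε u _ => ?_⟩, fun k u v _ => by simp⟩
  rw [ENNReal.coe_toNNReal hc.ne]
  exact wnorm_mono r hε c

theorem IsTameOne.const {c : MvPowerSeries (ι ⊕ Unit) ℝ} (hc : wnorm r 1 c < ⊤)
    (hc' : ∀ i : ι, wnorm r 1 (MvPowerSeries.pderiv ℝ (Sum.inl i) c) < ⊤) :
    IsTameOne r (fun _ : B → MvPowerSeries (ι ⊕ Unit) ℝ => c) :=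
  ⟨IsTame.const hc, fun i => (IsTame.const (hc' i)).quasilinear⟩

/-- An unknown may be differentiated once in space: this is `wnorm_tint_mul_pderiv_le`. -/
theorem IsTameOne.proj (b : B) :
    IsTameOne r (fun u : B → MvPowerSeries (ι ⊕ Unit) ℝ => u b) := by
  have had : IsAdic (fun u : B → MvPowerSeries (ι ⊕ Unit) ℝ => u b) := fun k u v h => h b
  refine ⟨⟨fun R => ⟨R, fun ε _ u hu => hu b⟩, had⟩, fun i => ⟨fun R => ⟨R, ?_⟩, had.pderiv i⟩⟩
  intro ε _ u hu a
  refine (wnorm_tint_mul_pderiv_le _ _ _ _ _).trans ?_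
  rw [mul_right_comm]
  gcongr
  exact hu b

theorem IsTameOne.add (h : IsTameOne r Φ) (h' : IsTameOne r Ψ) :
    IsTameOne r (fun u => Φ u + Ψ u) := by
  refine ⟨h.tame.add h'.tame, fun i => ?_⟩
  simp only [map_add]
  exact (h.deriv i).add (h'.deriv i)

/-- The Leibniz rule differentiates one factor at a time, so a product of unknowns loses no more
than one derivative. -/
theorem IsTameOne.mul (h : IsTameOne r Φ) (h' : IsTameOne r Ψ) :
    IsTameOne r (fun u => Φ u * Ψ u) := by
  refine ⟨h.tame.mul h'.tame, fun i => ?_⟩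
  simp only [Derivation.leibniz, smul_eq_mul]
  exact (h.tame.mul_quasilinear (h'.deriv i)).add (h'.tame.mul_quasilinear (h.deriv i))

theorem wnorm_algebraMap_lt_top (c : ℝ) :
    wnorm r 1 (c • (1 : MvPowerSeries (ι ⊕ Unit) ℝ)) < ⊤ := by
  rw [wnorm_smul, wnorm_one, mul_one]
  exact enorm_lt_top

theorem IsTame.smul (c : ℝ) (h : IsTame r Φ) : IsTame r (fun u => c • Φ u) := by
  simpa using (IsTame.const (wnorm_algebraMap_lt_top c)).mul h

theorem IsQuasilinear.smul (c : ℝ) (h : IsQuasilinear r Φ) :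
    IsQuasilinear r (fun u => c • Φ u) := by
  simpa using (IsTame.const (wnorm_algebraMap_lt_top c)).mul_quasilinear h

theorem IsTameOne.smul (c : ℝ) (h : IsTameOne r Φ) : IsTameOne r (fun u => c • Φ u) := by
  refine ⟨h.tame.smul c, fun i => ?_⟩
  simp only [Derivation.map_smul]
  exact (h.deriv i).smul c

theorem IsTameOne.neg (h : IsTameOne r Φ) : IsTameOne r (fun u => -Φ u) := by
  simpa using h.smul (-1)

theorem IsQuasilinear.neg (h : IsQuasilinear r Φ) : IsQuasilinear r (fun u => -Φ u) := by
  simpa using h.smul (-1)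

theorem IsTameOne.sub (h : IsTameOne r Φ) (h' : IsTameOne r Ψ) :
    IsTameOne r (fun u => Φ u - Ψ u) := by
  simpa only [sub_eq_add_neg] using h.add h'.neg

theorem IsQuasilinear.sub (h : IsQuasilinear r Φ) (h' : IsQuasilinear r Ψ) :
    IsQuasilinear r (fun u => Φ u - Ψ u) := by
  simpa only [sub_eq_add_neg] using h.add h'.neg

theorem IsTameOne.zero : IsTameOne r (fun _ : B → MvPowerSeries (ι ⊕ Unit) ℝ => 0) :=
  IsTameOne.const (by simp [wnorm_zero]) (fun i => by simp [wnorm_zero])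

theorem IsTameOne.sum {A : Type*} (s : Finset A)
    {Θ : A → (B → MvPowerSeries (ι ⊕ Unit) ℝ) → MvPowerSeries (ι ⊕ Unit) ℝ}
    (h : ∀ a, IsTameOne r (Θ a)) : IsTameOne r (fun u => ∑ a ∈ s, Θ a u) := by
  classical
  induction s using Finset.induction_on with
  | empty => simpa using IsTameOne.zero
  | insert a s ha ih => simpa only [Finset.sum_insert ha] using (h a).add ih

theorem IsQuasilinear.sum {A : Type*} (s : Finset A)
    {Θ : A → (B → MvPowerSeries (ι ⊕ Unit) ℝ) → MvPowerSeries (ι ⊕ Unit) ℝ}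
    (h : ∀ a, IsQuasilinear r (Θ a)) : IsQuasilinear r (fun u => ∑ a ∈ s, Θ a u) := by
  classical
  induction s using Finset.induction_on with
  | empty => simpa using IsTameOne.zero.quasilinear
  | insert a s ha ih => simpa only [Finset.sum_insert ha] using (h a).add ih

/-- The Cauchy–Kovalevskaya theorem for quasilinear systems, for formal power series with finite
weighted norm. -/
theorem formal_cauchy_kovalevskaya [Fintype B] (u₀ : B → MvPowerSeries (ι ⊕ Unit) ℝ)
    (hu₀ : ∀ b, wnorm r 1 (u₀ b) < ⊤)
    (Θ : B → (B → MvPowerSeries (ι ⊕ Unit) ℝ) → MvPowerSeries (ι ⊕ Unit) ℝ)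
    (hΘ : ∀ b, IsQuasilinear r (Θ b)) :
    ∃ ε : ℝ≥0, 0 < ε ∧ ∃ u : B → MvPowerSeries (ι ⊕ Unit) ℝ,
      (∀ b, wnorm r ε (u b) < ⊤) ∧ ∀ b, u b = u₀ b + tint (Θ b u) := by
  -- The ball leaves room of size `1` around the data. Below, `ε` is chosen so small that the
  -- integral term has norm at most `1`.
  set R : ℝ≥0 := (∑ b, (wnorm r 1 (u₀ b)).toNNReal) + 1 with hR
  choose C hC using fun b => (hΘ b).bdd R
  set ε : ℝ≥0 := (1 + ∑ b, C b)⁻¹ with hε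
  have hε0 : 0 < ε := by positivity
  have hε1 : ε ≤ 1 := inv_le_one_of_one_le₀ (by simp)
  have hεC : ∀ b, ε * C b ≤ 1 := by
    intro b
    rw [hε, inv_mul_le_iff₀ (by positivity), mul_one]
    exact (Finset.single_le_sum (fun _ _ => zero_le) (Finset.mem_univ b)).trans (by simp)
  let step : (B → MvPowerSeries (ι ⊕ Unit) ℝ) → (B → MvPowerSeries (ι ⊕ Unit) ℝ) :=
    fun u b => u₀ b + tint (Θ b u)
  let v : ℕ → B → MvPowerSeries (ι ⊕ Unit) ℝ := fun m => step^[m] u₀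
  have hv : ∀ m, v (m + 1) = step (v m) := fun m => Function.iterate_succ_apply' _ _ _
  have hb0 : ∀ b, wnorm r ε (u₀ b) + 1 ≤ R := by
    intro b
    rw [hR]
    push_cast
    gcongr
    refine (wnorm_mono r hε1 _).trans ?_
    rw [← ENNReal.coe_toNNReal (hu₀ b).ne, ← ENNReal.ofNNReal_finsetSum]
    norm_cast
    exact Finset.single_le_sum (f := fun b => (wnorm r 1 (u₀ b)).toNNReal)
      (fun _ _ => zero_le) (Finset.mem_univ b)
  -- The iterates stay in the ball; the quasilinear bound is used with multiplier `1`.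
  have hvR : ∀ m b, wnorm r ε (v m b) ≤ R := by
    intro m
    induction m with
    | zero => exact fun b => le_trans le_self_add (hb0 b)
    | succ m ih =>
      intro b
      rw [hv]
      refine ((wnorm_add_le _ _ _ _).trans ?_).trans (hb0 b)
      gcongr
      have := hC b ε hε1 (v m) ih 1
      rw [one_mul, wnorm_one, mul_one] at this
      exact this.trans (by exact_mod_cast hεC b)
  -- No contraction estimate in the norm is needed: each step improves agreement by one power of
  -- `t`.
  have hstep : ∀ k u w, (∀ b, timeVar ^ k ∣ u b - w b) →
      ∀ b, timeVar ^ (k + 1) ∣ step u b - step w b := by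
    intro k u w h b
    have h1 := timeVar_pow_dvd_tint ((hΘ b).adic k u w h)
    have h2 : step u b - step w b = tint (Θ b u - Θ b w) := by
      rw [sub_eq_add_neg (Θ b u), ← neg_one_smul ℝ (Θ b w), tint_add, tint_smul, neg_one_smul]
      simp only [step]
      ring
    rwa [h2]
  have hcau : ∀ m b, timeVar ^ m ∣ v (m + 1) b - v m b := by
    intro m
    induction m with
    | zero => intro b; simp
    | succ m ih =>
      intro b
      rw [hv, hv]
      have := hstep m _ _ ih b
      rwa [hv] at this
  have hcau' : ∀ m M, m ≤ M → ∀ b, timeVar ^ m ∣ v M b - v m b := by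
    intro m M hM
    induction M, hM using Nat.le_induction with
    | base => intro b; simp
    | succ M hM ih =>
      intro b
      have := dvd_add ((pow_dvd_pow timeVar hM).trans (hcau M b)) (ih b)
      rwa [sub_add_sub_cancel] at this
  -- The coefficient at `m` no longer changes after as many steps as its exponent of `t` plus one,
  -- so the limit is taken coefficientwise.
  let u : B → MvPowerSeries (ι ⊕ Unit) ℝ :=
    fun b m => coeff m (v (m (Sum.inr ()) + 1) b)
  have huc : ∀ b m M, m (Sum.inr ()) < M → coeff m (u b) = coeff m (v M b) := by
    intro b m M hM
    have h1 := X_pow_dvd_iff.1 (hcau' (m (Sum.inr ()) + 1) M hM b) m (by omega)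
    rw [map_sub, sub_eq_zero] at h1
    exact h1.symm
  have huv : ∀ M b, timeVar ^ M ∣ u b - v M b := by
    intro M b
    rw [X_pow_dvd_iff]
    intro m hm
    rw [map_sub, huc b m M hm, sub_self]
  refine ⟨ε, hε0, u, fun b => ?_, fun b => ?_⟩
  · refine lt_of_le_of_lt ?_ (ENNReal.coe_lt_top (r := R))
    unfold wnorm
    rw [ENNReal.tsum_eq_iSup_sum]
    refine iSup_le fun s => ?_
    -- A finite partial sum of the norm of the limit is a partial sum of the norm of one iterate,
    -- which is at most `R`.
    obtain ⟨M, hM⟩ : ∃ M, ∀ m ∈ s, m (Sum.inr ()) < M := by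
      refine ⟨s.sup (fun m => m (Sum.inr ())) + 1, fun m hm => Nat.lt_succ_of_le ?_⟩
      exact Finset.le_sup (f := fun m : ι ⊕ Unit →₀ ℕ => m (Sum.inr ())) hm
    calc _ = ∑ m ∈ s, ‖coeff m (v M b)‖ₑ * (weight r ε m : ℝ≥0∞) :=
          Finset.sum_congr rfl fun m hm => by rw [huc b m M (hM m hm)]
      _ ≤ wnorm r ε (v M b) := ENNReal.sum_le_tsum s
      _ ≤ R := hvR M b
  -- The fixed point equation holds modulo every power of `t`.
  · refine sub_eq_zero.1 (eq_zero_of_timeVar_pow_dvd fun k => ?_)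
    have h1 := hstep k u (v k) (huv k) b
    have h2 := huv (k + 1) b
    rw [hv] at h2
    have h3 := dvd_sub h2 h1
    rw [sub_sub_sub_cancel_right] at h3
    exact (pow_dvd_pow _ (Nat.le_succ k)).trans h3

end FormalCauchyKovalevskaya

/-! ### Convergent power series and the functions they represent. -/

section ConvergentSeries

open MvPowerSeries Finset Topology Filter
open scoped NNReal ENNReal

variable {σ : Type*} [Fintype σ]

/-- The value of the monomial with exponents `m` at `z`. -/
def mono (m : σ →₀ ℕ) (z : σ → ℝ) : ℝ := ∏ i, z i ^ m i

theorem mono_add (m m' : σ →₀ ℕ) (z : σ → ℝ) : mono (m + m') z = mono m z * mono m' z := by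
  simp [mono, pow_add, Finset.prod_mul_distrib]

theorem mono_single (i : σ) (z : σ → ℝ) : mono (Finsupp.single i 1) z = z i := by
  classical
  unfold mono
  rw [Finset.prod_eq_single i] <;> simp +contextual [eq_comm]

theorem mono_zero (z : σ → ℝ) : mono (0 : σ →₀ ℕ) z = 1 := by simp [mono]

theorem mono_apply_zero {m : σ →₀ ℕ} {z : σ → ℝ} {i : σ} (hz : z i = 0) (hm : m i ≠ 0) :
    mono m z = 0 :=
  Finset.prod_eq_zero (Finset.mem_univ i) (by rw [hz, zero_pow hm])

theorem norm_mono_le (m : σ →₀ ℕ) {z : σ → ℝ} {s : ℝ} (hz : ‖z‖ ≤ s) :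
    ‖mono m z‖ ≤ s ^ m.degree := by
  unfold mono
  rw [norm_prod, Finsupp.degree_eq_sum, ← Finset.prod_pow_eq_pow_sum]
  refine Finset.prod_le_prod (fun _ _ => norm_nonneg _) fun i _ => ?_
  rw [norm_pow]
  exact pow_le_pow_left₀ (norm_nonneg _) ((norm_le_pi_norm z i).trans hz) _

/-- The `ℓ¹` norm on the polydisc of radius `s`. -/
def pnorm (s : ℝ≥0) (u : MvPowerSeries σ ℝ) : ℝ≥0∞ :=
  ∑' m, ‖coeff m u‖ₑ * (s : ℝ≥0∞) ^ m.degree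

theorem pnorm_mono {s s' : ℝ≥0} (h : s ≤ s') (u : MvPowerSeries σ ℝ) : pnorm s u ≤ pnorm s' u := by
  unfold pnorm
  gcongr

theorem summable_of_pnorm {s : ℝ≥0} {u : MvPowerSeries σ ℝ} (h : pnorm s u < ⊤) :
    Summable fun m => ‖coeff m u‖ * (s : ℝ) ^ m.degree := by
  have := ENNReal.summable_toReal h.ne
  refine this.congr fun m => ?_
  simp

theorem summable_mono {s : ℝ≥0} {u : MvPowerSeries σ ℝ} (h : pnorm s u < ⊤) {z : σ → ℝ}
    (hz : ‖z‖ ≤ s) : Summable fun m => ‖coeff m u * mono m z‖ := by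
  refine (summable_of_pnorm h).of_nonneg_of_le (fun _ => norm_nonneg _) fun m => ?_
  rw [norm_mul]
  gcongr
  exact norm_mono_le m hz

theorem pnorm_add_le (s : ℝ≥0) (u v : MvPowerSeries σ ℝ) :
    pnorm s (u + v) ≤ pnorm s u + pnorm s v := by
  unfold pnorm
  rw [← ENNReal.tsum_add]
  refine ENNReal.tsum_le_tsum fun p => ?_
  rw [← add_mul, map_add]
  gcongr
  exact enorm_add_le _ _

theorem pnorm_mul_le (s : ℝ≥0) (u v : MvPowerSeries σ ℝ) :
    pnorm s (u * v) ≤ pnorm s u * pnorm s v := by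
  classical
  unfold pnorm
  rw [← ENNReal.tsum_mul_right]
  simp_rw [← ENNReal.tsum_mul_left]
  rw [← ENNReal.tsum_prod (f := fun p q => ‖coeff p u‖ₑ * (s : ℝ≥0∞) ^ p.degree *
    (‖coeff q v‖ₑ * (s : ℝ≥0∞) ^ q.degree)),
    ← Finset.HasAntidiagonal.sigmaAntidiagonalEquivProd.tsum_eq, ENNReal.tsum_sigma']
  refine ENNReal.tsum_le_tsum fun m => ?_
  rw [tsum_fintype, coeff_mul]
  calc ‖∑ x ∈ antidiagonal m, coeff x.1 u * coeff x.2 v‖ₑ * (s : ℝ≥0∞) ^ m.degree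
      ≤ (∑ x ∈ antidiagonal m, ‖coeff x.1 u * coeff x.2 v‖ₑ) * (s : ℝ≥0∞) ^ m.degree := by
        gcongr; exact enorm_sum_le _ _
    _ = ∑ x ∈ antidiagonal m, ‖coeff x.1 u‖ₑ * (s : ℝ≥0∞) ^ x.1.degree *
          (‖coeff x.2 v‖ₑ * (s : ℝ≥0∞) ^ x.2.degree) := by
        rw [Finset.sum_mul]
        refine Finset.sum_congr rfl fun x hx => ?_
        rw [enorm_mul, ← HasAntidiagonal.mem_antidiagonal.1 hx, map_add, pow_add]
        ring
    _ = _ := by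
        rw [← Finset.sum_coe_sort]; rfl
    _ ≤ _ := le_rfl

/-- Halving the radius pays for the exponent, as `q_i + 1 ≤ 2^|q|`. -/
theorem pnorm_pderiv_le (s : ℝ≥0) (hs : 0 < s) (i : σ) (u : MvPowerSeries σ ℝ) :
    pnorm (s / 2) (pderiv ℝ i u) ≤ (s : ℝ≥0∞)⁻¹ * pnorm s u := by
  classical
  have hinj : Function.Injective
      (fun m : σ →₀ ℕ => m + Finsupp.single i 1) := add_left_injective _
  have h2 : ∑' q, ‖coeff (q + Finsupp.single i 1) u‖ₑ *
      (s : ℝ≥0∞) ^ (q + Finsupp.single i 1).degree ≤ pnorm s u :=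
    ENNReal.tsum_comp_le_tsum_of_injective hinj _
  refine le_trans ?_ (mul_le_mul_right h2 _)
  unfold pnorm
  rw [← ENNReal.tsum_mul_left]
  refine ENNReal.tsum_le_tsum fun q => ?_
  have e : (q + Finsupp.single i 1).degree = q.degree + 1 := by simp
  rw [coeff_pderiv, enorm_mul, e]
  have h3 : ‖((q i : ℝ) + 1)‖ₑ = ((q i + 1 : ℝ≥0) : ℝ≥0∞) := by
    rw [← ofReal_norm, Real.norm_of_nonneg (by positivity), ENNReal.ofReal,
      Real.toNNReal_add (by positivity) (by positivity)]
    simp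
  rw [h3]
  have h4 : (q i + 1 : ℝ≥0) * (s / 2) ^ q.degree ≤ s⁻¹ * s ^ (q.degree + 1) := by
    have h5 : (q i + 1 : ℝ≥0) ≤ 2 ^ q.degree := by
      have : q i + 1 ≤ 2 ^ q.degree :=
        (Nat.succ_le_succ (Finsupp.le_degree i q)).trans Nat.lt_two_pow_self
      exact_mod_cast this
    rw [pow_succ, mul_comm (s ^ _), inv_mul_cancel_left₀ hs.ne', div_pow]
    calc _ ≤ 2 ^ q.degree * (s ^ q.degree / 2 ^ q.degree) := by gcongr
      _ = s ^ q.degree := by field_simp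
  have h6 : ((q i + 1 : ℝ≥0) : ℝ≥0∞) * ((s / 2 : ℝ≥0) : ℝ≥0∞) ^ q.degree ≤
      (s : ℝ≥0∞)⁻¹ * (s : ℝ≥0∞) ^ (q.degree + 1) := by
    rw [← ENNReal.coe_inv hs.ne']
    exact_mod_cast h4
  calc _ = ‖coeff (q + Finsupp.single i 1) u‖ₑ *
        (((q i + 1 : ℝ≥0) : ℝ≥0∞) * ((s / 2 : ℝ≥0) : ℝ≥0∞) ^ q.degree) := by ring
    _ ≤ ‖coeff (q + Finsupp.single i 1) u‖ₑ * ((s : ℝ≥0∞)⁻¹ * (s : ℝ≥0∞) ^ (q.degree + 1)) := by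
        gcongr
    _ = _ := by ring

/-- The binomial denominator is at least `1`. Convergent data therefore have finite weighted norm at
`ε = 1`. -/
theorem wnorm_one_le_pnorm {ι : Type*} [Fintype ι] (r : ℝ≥0) (u : MvPowerSeries (ι ⊕ Unit) ℝ) :
    wnorm r 1 u ≤ pnorm r u := by
  unfold wnorm pnorm weight
  refine ENNReal.tsum_le_tsum fun m => ?_
  gcongr
  rw [← ENNReal.coe_pow, ENNReal.coe_le_coe, one_pow, mul_one]
  exact div_le_self zero_le (by exact_mod_cast degree_pos_choose m)

/-- Binomial coefficients are at most `2^|m|`, and `ε^|m| ≤ ε^k` for the exponent `k` of `t`. This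
turns a formal solution of finite weighted norm into a convergent one. -/
theorem pnorm_le_wnorm {ι : Type*} [Fintype ι] (r ε : ℝ≥0) (hε : ε ≤ 1)
    (u : MvPowerSeries (ι ⊕ Unit) ℝ) : pnorm (r * ε / 2) u ≤ wnorm r ε u := by
  unfold wnorm pnorm weight
  refine ENNReal.tsum_le_tsum fun m => ?_
  gcongr
  rw [← ENNReal.coe_pow, ENNReal.coe_le_coe, div_pow, mul_pow]
  have h1 : (m.degree.choose (m (Sum.inr ())) : ℝ≥0) ≤ 2 ^ m.degree := by
    exact_mod_cast Nat.choose_le_two_pow _ _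
  have h2 := degree_pos_choose m
  have h3 : ε ^ m.degree ≤ ε ^ m (Sum.inr ()) :=
    pow_le_pow_of_le_one zero_le hε (Finsupp.le_degree _ _)
  gcongr

/-- `u` converges near `0` and its sum is `f` there. -/
def Represents (u : MvPowerSeries σ ℝ) (f : (σ → ℝ) → ℝ) : Prop :=
  (∃ s : ℝ≥0, 0 < s ∧ pnorm s u < ⊤) ∧ ∀ᶠ z in 𝓝 0, f z = ∑' m, coeff m u * mono m z

theorem eventually_norm_le {s : ℝ≥0} (hs : 0 < s) : ∀ᶠ z : σ → ℝ in 𝓝 0, ‖z‖ ≤ s := by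
  filter_upwards [Metric.closedBall_mem_nhds (0 : σ → ℝ) (show (0 : ℝ) < s from hs)] with z hz
  simpa using hz

variable {u v : MvPowerSeries σ ℝ} {f g : (σ → ℝ) → ℝ}

theorem Represents.congr (h : Represents u f) (hfg : f =ᶠ[𝓝 0] g) : Represents u g :=
  ⟨h.1, by filter_upwards [h.2, hfg] with z h1 h2; rw [← h2, h1]⟩

theorem Represents.add (h : Represents u f) (h' : Represents v g) :
    Represents (u + v) (fun z => f z + g z) := by
  obtain ⟨⟨s, hs, hsu⟩, hf⟩ := h
  obtain ⟨⟨s', hs', hsv⟩, hg⟩ := h'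
  have hm : 0 < min s s' := lt_min hs hs'
  have hsu := (pnorm_mono (min_le_left s s') u).trans_lt hsu
  have hsv := (pnorm_mono (min_le_right s s') v).trans_lt hsv
  refine ⟨⟨min s s', hm, (pnorm_add_le _ _ _).trans_lt (ENNReal.add_lt_top.2 ⟨hsu, hsv⟩)⟩, ?_⟩
  filter_upwards [hf, hg, eventually_norm_le hm] with z h1 h2 h3
  rw [h1, h2, ← (summable_mono hsu h3).of_norm.tsum_add (summable_mono hsv h3).of_norm]
  simp only [map_add, add_mul]

theorem summable_mono_mul {s : ℝ≥0} (hu : pnorm s u < ⊤) (hv : pnorm s v < ⊤) {z : σ → ℝ}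
    (hz : ‖z‖ ≤ s) : Summable fun x : (σ →₀ ℕ) × (σ →₀ ℕ) =>
      coeff x.1 u * mono x.1 z * (coeff x.2 v * mono x.2 z) :=
  summable_mul_of_summable_norm (f := fun m => coeff m u * mono m z)
    (g := fun m => coeff m v * mono m z) (summable_mono hu hz) (summable_mono hv hz)

theorem coeff_mul_mono [DecidableEq σ] (m : σ →₀ ℕ) (z : σ → ℝ) :
    coeff m (u * v) * mono m z =
      ∑ kl ∈ antidiagonal m, coeff kl.1 u * mono kl.1 z * (coeff kl.2 v * mono kl.2 z) := by
  rw [coeff_mul, Finset.sum_mul]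
  refine Finset.sum_congr rfl fun x hx => ?_
  rw [← HasAntidiagonal.mem_antidiagonal.1 hx, mono_add]
  ring

theorem tsum_coeff_mul_mono [DecidableEq σ] {s : ℝ≥0} (hu : pnorm s u < ⊤) (hv : pnorm s v < ⊤)
    {z : σ → ℝ} (hz : ‖z‖ ≤ s) : ∑' m, coeff m (u * v) * mono m z =
      (∑' m, coeff m u * mono m z) * ∑' m, coeff m v * mono m z := by
  have key := Summable.tsum_mul_tsum_eq_tsum_sum_antidiagonal
    (f := fun m => coeff m u * mono m z) (g := fun m => coeff m v * mono m z)
    (summable_mono hu hz).of_norm (summable_mono hv hz).of_norm (summable_mono_mul hu hv hz)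
  rw [key]
  exact tsum_congr fun m => coeff_mul_mono m z

theorem Represents.mul (h : Represents u f) (h' : Represents v g) :
    Represents (u * v) (fun z => f z * g z) := by
  classical
  obtain ⟨⟨s, hs, hsu⟩, hf⟩ := h
  obtain ⟨⟨s', hs', hsv⟩, hg⟩ := h'
  have hm : 0 < min s s' := lt_min hs hs'
  have hsu := (pnorm_mono (min_le_left s s') u).trans_lt hsu
  have hsv := (pnorm_mono (min_le_right s s') v).trans_lt hsv
  refine ⟨⟨min s s', hm, (pnorm_mul_le _ _ _).trans_lt (ENNReal.mul_lt_top hsu hsv)⟩, ?_⟩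
  filter_upwards [hf, hg, eventually_norm_le hm] with z h1 h2 h3
  rw [h1, h2, tsum_coeff_mul_mono hsu hsv h3]

theorem Represents.const (c : ℝ) : Represents (C c : MvPowerSeries σ ℝ) (fun _ => c) := by
  classical
  refine ⟨⟨1, one_pos, ?_⟩, .of_forall fun z => ?_⟩
  · unfold pnorm
    rw [tsum_eq_single 0]
    · simp
    · intro m hm
      simp [coeff_C, hm]
  · rw [tsum_eq_single 0]
    · simp [mono_zero]
    · intro m hm
      simp [coeff_C, hm]

theorem Represents.smul (c : ℝ) (h : Represents u f) : Represents (c • u) (fun z => c * f z) := by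
  rw [smul_eq_C_mul]
  exact (Represents.const c).mul h

theorem Represents.neg (h : Represents u f) : Represents (-u) (fun z => -f z) := by
  simpa using h.smul (-1)

theorem Represents.sub (h : Represents u f) (h' : Represents v g) :
    Represents (u - v) (fun z => f z - g z) := by
  simpa only [sub_eq_add_neg] using h.add h'.neg

theorem Represents.zero : Represents (0 : MvPowerSeries σ ℝ) (fun _ => 0) := by
  simpa using Represents.const (σ := σ) 0

theorem Represents.sum {A : Type*} (S : Finset A) {U : A → MvPowerSeries σ ℝ}
    {F : A → (σ → ℝ) → ℝ} (h : ∀ a, Represents (U a) (F a)) :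
    Represents (∑ a ∈ S, U a) (fun z => ∑ a ∈ S, F a z) := by
  classical
  induction S using Finset.induction_on with
  | empty => simpa using Represents.zero
  | insert a S ha ih => simpa only [Finset.sum_insert ha] using (h a).add ih

theorem Represents.apply_zero (h : Represents u f) : f 0 = constantCoeff u := by
  rw [h.2.self_of_nhds, tsum_eq_single 0]
  · simp [mono_zero]
  · intro m hm
    obtain ⟨i, hi⟩ := Finsupp.ne_iff.1 hm
    rw [mono_apply_zero (z := 0) (i := i) rfl hi, mul_zero]

theorem hasFDerivAt_mono (m : σ →₀ ℕ) (z : σ → ℝ) :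
    HasFDerivAt (mono m) (∑ i, ((m i : ℝ) * mono (m - Finsupp.single i 1) z) •
      (ContinuousLinearMap.proj i : (σ → ℝ) →L[ℝ] ℝ)) z := by
  classical
  have h : HasFDerivAt (fun z : σ → ℝ => ∏ i, z i ^ m i)
      (∑ i, (∏ j ∈ Finset.univ.erase i, z j ^ m j) • ((m i : ℝ) * z i ^ (m i - 1)) •
        (ContinuousLinearMap.proj i : (σ → ℝ) →L[ℝ] ℝ)) z := by
    refine HasFDerivAt.finsetProd (u := Finset.univ) (fun i _ => ?_)
    simpa using ((ContinuousLinearMap.proj i : (σ → ℝ) →L[ℝ] ℝ).hasFDerivAt (x := z)).pow (m i)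
  refine HasFDerivAt.congr_fderiv (f := mono m) h (Finset.sum_congr rfl fun i _ => ?_)
  rw [smul_smul]
  congr 1
  unfold mono
  rw [← Finset.mul_prod_erase _ _ (Finset.mem_univ i), mul_comm, mul_assoc]
  congr 1
  simp only [Finsupp.tsub_apply, Finsupp.single_eq_same]
  congr 1
  refine Finset.prod_congr rfl fun j hj => ?_
  rw [Finsupp.single_eq_of_ne (Finset.ne_of_mem_erase hj), tsub_zero]

/-- Termwise differentiation. On the ball of radius `s / 2` the derivative of the monomial of degree
`k + 1` is at most `(k + 1) (s / 2)^k ≤ s^k`. The summability of the derivatives is recorded as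
well, so that they can be evaluated term by term. -/
theorem Represents.hasFDerivAt {s : ℝ≥0} (hs : 0 < s) (hsu : pnorm s u < ⊤) {z : σ → ℝ}
    (hz : ‖z‖ < s / 2) :
    HasFDerivAt (fun z => ∑' m, coeff m u * mono m z) (∑' m, coeff m u •
      ∑ i, ((m i : ℝ) * mono (m - Finsupp.single i 1) z) •
        (ContinuousLinearMap.proj i : (σ → ℝ) →L[ℝ] ℝ)) z ∧
    Summable fun m => coeff m u • ∑ i, ((m i : ℝ) * mono (m - Finsupp.single i 1) z) •
        (ContinuousLinearMap.proj i : (σ → ℝ) →L[ℝ] ℝ) := by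
  classical
  have hs0 : (0 : ℝ) < s := hs
  have hsum := (summable_of_pnorm hsu).mul_right (s : ℝ)⁻¹
  have hbd : ∀ m (y : σ → ℝ), y ∈ Metric.ball (0 : σ → ℝ) (s / 2) →
      ‖coeff m u • ∑ i, ((m i : ℝ) * mono (m - Finsupp.single i 1) y) •
        (ContinuousLinearMap.proj i : (σ → ℝ) →L[ℝ] ℝ)‖ ≤
        ‖coeff m u‖ * (s : ℝ) ^ m.degree * (s : ℝ)⁻¹ := by
    intro m y hy
    rw [mem_ball_zero_iff] at hy
    rw [norm_smul, mul_assoc]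
    gcongr
    refine (norm_sum_le _ _).trans ?_
    have h1 : ∀ i, ‖((m i : ℝ) * mono (m - Finsupp.single i 1) y) •
        (ContinuousLinearMap.proj i : (σ → ℝ) →L[ℝ] ℝ)‖ ≤ m i * ((s : ℝ) / 2) ^ (m.degree - 1) := by
      intro i
      rw [norm_smul, norm_mul, Real.norm_of_nonneg (by positivity : (0 : ℝ) ≤ m i)]
      have h2 : ‖(ContinuousLinearMap.proj i : (σ → ℝ) →L[ℝ] ℝ)‖ ≤ 1 :=
        ContinuousLinearMap.opNorm_le_bound _ zero_le_one fun w => by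
          simpa using norm_le_pi_norm w i
      by_cases hi : m i = 0
      · simp [hi]
      · have h3 : (m - Finsupp.single i 1).degree = m.degree - 1 := by
          have : m - Finsupp.single i 1 + Finsupp.single i 1 = m :=
            tsub_add_cancel_of_le (by rw [Finsupp.single_le_iff]; omega)
          have := congrArg Finsupp.degree this
          rw [map_add, Finsupp.degree_single] at this
          omega
        calc _ ≤ (m i : ℝ) * ((s : ℝ) / 2) ^ (m.degree - 1) * 1 := by
              gcongr
              rw [← h3]
              exact norm_mono_le _ hy.le
          _ = _ := mul_one _
    refine (Finset.sum_le_sum fun i _ => h1 i).trans ?_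
    rw [← Finset.sum_mul, ← Nat.cast_sum, ← Finsupp.degree_eq_sum]
    rcases Nat.eq_zero_or_pos m.degree with h0 | h0
    · rw [h0]; simp
    · obtain ⟨k, hk⟩ := Nat.exists_eq_succ_of_ne_zero h0.ne'
      rw [hk, Nat.succ_sub_one, pow_succ, mul_assoc, mul_inv_cancel₀ hs0.ne', mul_one, div_pow]
      have : ((k.succ : ℕ) : ℝ) ≤ 2 ^ k := by exact_mod_cast Nat.lt_two_pow_self (n := k)
      calc _ ≤ (2 : ℝ) ^ k * ((s : ℝ) ^ k / 2 ^ k) := by gcongr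
        _ = _ := by field_simp
  have hz' : z ∈ Metric.ball (0 : σ → ℝ) (s / 2) := by simpa using hz
  refine ⟨hasFDerivAt_tsum_of_isPreconnected hsum Metric.isOpen_ball
    (convex_ball _ _).isPreconnected (fun m y _ => (hasFDerivAt_mono m y).const_smul (coeff m u))
    hbd (x₀ := 0) (by simpa using hs) ?_ hz', ?_⟩
  · exact (summable_mono hsu (z := 0) (by simp)).of_norm
  · exact hsum.of_norm_bounded (fun m => hbd m z hz')

theorem Represents.pderiv [DecidableEq σ] (h : Represents u f) (i : σ) :
    Represents (pderiv ℝ i u) (fun z => fderiv ℝ f z (Pi.single i 1)) := by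
  obtain ⟨⟨s, hs, hsu⟩, hf⟩ := h
  refine ⟨⟨s / 2, by positivity, (pnorm_pderiv_le s hs i u).trans_lt
    (ENNReal.mul_lt_top (by simpa using hs) hsu)⟩, ?_⟩
  have hev : ∀ᶠ z : σ → ℝ in 𝓝 0, ‖z‖ < s / 2 := by
    filter_upwards [Metric.ball_mem_nhds (0 : σ → ℝ) (show (0 : ℝ) < s / 2 by positivity)] with z hz
    simpa using hz
  filter_upwards [hf.eventually_nhds, hev] with z h1 h2
  obtain ⟨h3, h4⟩ := Represents.hasFDerivAt hs hsu h2
  have h5 : HasFDerivAt f _ z := h3.congr_of_eventuallyEq h1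
  rw [h5.fderiv]
  have h6 := h4.hasSum.mapL (ContinuousLinearMap.apply ℝ ℝ (Pi.single i 1 : σ → ℝ))
  rw [ContinuousLinearMap.apply_apply] at h6
  rw [← h6.tsum_eq]
  have hinj : Function.Injective
      (fun m : σ →₀ ℕ => m + Finsupp.single i 1) := add_left_injective _
  rw [← hinj.tsum_eq]
  · refine tsum_congr fun m => ?_
    simp only [ContinuousLinearMap.apply_apply, _root_.smul_apply,
      _root_.sum_apply, ContinuousLinearMap.proj_apply, smul_eq_mul]
    rw [Finset.sum_eq_single i]
    · rw [coeff_pderiv]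
      simp
      ring
    · intro j _ hj
      simp [Pi.single_eq_of_ne hj]
    · simp
  · intro m hm
    by_cases h0 : m i = 0
    · refine absurd hm ?_
      rw [Function.notMem_support]
      simp only [ContinuousLinearMap.apply_apply, _root_.smul_apply,
        _root_.sum_apply, ContinuousLinearMap.proj_apply, smul_eq_mul]
      rw [Finset.sum_eq_single i]
      · simp [h0]
      · intro j _ hj
        simp [Pi.single_eq_of_ne hj]
      · simp
    · exact ⟨m - Finsupp.single i 1, tsub_add_cancel_of_le (by
        rw [Finsupp.single_le_iff]; omega)⟩

/-- Induction on the degree: a derivative in a direction `i` with `p i`, which is tangent to the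
subspace where `f` vanishes, vanishes there too. With `p` always true this is the uniqueness of the
series; with `p` the space directions it gives divisibility by `t` for functions vanishing on the
slice. -/
theorem Represents.coeff_eq_zero (p : σ → Prop)
    (h : Represents u f) (hf : ∀ᶠ z in 𝓝 0, (∀ i, ¬ p i → z i = 0) → f z = 0) :
    ∀ m : σ →₀ ℕ, (∀ i, ¬ p i → m i = 0) → coeff m u = 0 := by
  classical
  -- Series and function are generalized because the induction replaces them by their derivatives.
  suffices H : ∀ (k : ℕ) (m : σ →₀ ℕ) (u : MvPowerSeries σ ℝ) (f : (σ → ℝ) → ℝ), m.degree = k →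
      Represents u f → (∀ᶠ z in 𝓝 0, (∀ i, ¬ p i → z i = 0) → f z = 0) →
      (∀ i, ¬ p i → m i = 0) → coeff m u = 0 from
    fun m hm => H _ m u f rfl h hf hm
  intro k
  induction k with
  | zero =>
    intro m u f hm h hf _
    rw [Finsupp.degree_eq_zero_iff] at hm
    rw [hm, coeff_zero_eq_constantCoeff_apply, ← h.apply_zero]
    exact hf.self_of_nhds (fun _ _ => rfl)
  | succ k ih =>
    intro m u f hm h hf hp
    have hne : m ≠ 0 := by rintro rfl; simp at hm
    obtain ⟨i, hi⟩ := Finsupp.ne_iff.1 hne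
    rw [Finsupp.zero_apply] at hi
    have hpi : p i := by by_contra hc; exact hi (hp i hc)
    have hle : m - Finsupp.single i 1 + Finsupp.single i 1 = m :=
      tsub_add_cancel_of_le (by rw [Finsupp.single_le_iff]; omega)
    have hdeg : (m - Finsupp.single i 1).degree = k := by
      have := congrArg Finsupp.degree hle
      rw [map_add, Finsupp.degree_single] at this
      omega
    have hd := ih (m - Finsupp.single i 1) _ _ hdeg (h.pderiv i) ?_ ?_
    · rw [coeff_pderiv, hle] at hd
      exact (mul_eq_zero.1 hd).resolve_right (by positivity)
    · obtain ⟨⟨s, hs, hsu⟩, hfs⟩ := h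
      have hev : ∀ᶠ z : σ → ℝ in 𝓝 0, ‖z‖ < s / 2 := by
        filter_upwards [Metric.ball_mem_nhds (0 : σ → ℝ)
          (show (0 : ℝ) < s / 2 by positivity)] with z hz
        simpa using hz
      filter_upwards [hf.eventually_nhds, hfs.eventually_nhds, hev] with z h1 h2 h3 hz
      have hdf : DifferentiableAt ℝ f z :=
        ((Represents.hasFDerivAt hs hsu h3).1.congr_of_eventuallyEq h2).differentiableAt
      have hline : HasLineDerivAt ℝ f (fderiv ℝ f z (Pi.single i 1)) z (Pi.single i 1) :=
        hdf.hasFDerivAt.hasLineDerivAt _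
      have hcont : Tendsto (fun t : ℝ => z + t • (Pi.single i 1 : σ → ℝ)) (𝓝 0) (𝓝 z) := by
        have : Continuous (fun t : ℝ => z + t • (Pi.single i 1 : σ → ℝ)) := by fun_prop
        simpa using this.tendsto 0
      have hzero : (fun t : ℝ => f (z + t • (Pi.single i 1 : σ → ℝ))) =ᶠ[𝓝 0] fun _ => 0 := by
        filter_upwards [hcont.eventually h1] with t ht
        refine ht fun j hj => ?_
        have hji : j ≠ i := by rintro rfl; exact hj hpi
        simp [hz j hj, Pi.single_eq_of_ne hji]
      exact (HasDerivAt.congr_of_eventuallyEq hline hzero.symm).unique (hasDerivAt_const _ _)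
    · intro j hj
      simp [hp j hj]

theorem Represents.unique (h : Represents u f) (h' : Represents v f) : u = v := by
  rw [← sub_eq_zero]
  ext m
  exact (h.sub h').coeff_eq_zero (fun _ => True) (.of_forall fun z _ => sub_self _) m (by simp)

end ConvergentSeries

/-! ### Analytic functions are those represented by convergent power series. -/

section AnalyticSeries

open MvPowerSeries Finset Topology Filter
open scoped NNReal ENNReal

variable {σ : Type*} [Fintype σ]

/-- With `d` the degree, this passes from a sum over multiindices to a sum over homogeneous parts.
-/
theorem hasSum_fiberwise {A X : Type*} [AddCommMonoid X] [TopologicalSpace X] [ContinuousAdd X]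
    [RegularSpace X] {F : A → X} {a : X} (h : HasSum F a) (d : A → ℕ) (S : ℕ → Finset A)
    (hS : ∀ n m, m ∈ S n ↔ d m = n) : HasSum (fun n => ∑ m ∈ S n, F m) a := by
  refine HasSum.sigma ((Equiv.sigmaFiberEquiv d).hasSum_iff.2 h) fun n => ?_
  have h1 := (S n).hasSum F
  let e : {m // d m = n} ≃ {m // m ∈ S n} := Equiv.subtypeEquivRight fun m => (hS n m).symm
  exact e.hasSum_iff.2 h1

/-- The multiindices of total degree `n`. -/
def degreeFinset [DecidableEq σ] (n : ℕ) : Finset (σ →₀ ℕ) := finsuppAntidiag univ n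

theorem mem_degreeFinset [DecidableEq σ] (n : ℕ) (m : σ →₀ ℕ) :
    m ∈ degreeFinset n ↔ m.degree = n := by
  simp [degreeFinset, mem_finsuppAntidiag, Finsupp.degree_eq_sum]

/-- The multilinear map `(z₁, …, z_n) ↦ ∏ z_j (s j)`. -/
def monoMultilinear {n : ℕ} (s : Fin n → σ) :
    ContinuousMultilinearMap ℝ (fun _ : Fin n => (σ → ℝ)) ℝ :=
  (ContinuousMultilinearMap.mkPiAlgebra ℝ (Fin n) ℝ).compContinuousLinearMap
    (fun j => ContinuousLinearMap.proj (s j))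

theorem monoMultilinear_apply {n : ℕ} (s : Fin n → σ) (z : Fin n → σ → ℝ) :
    monoMultilinear s z = ∏ j, z j (s j) := by
  simp [monoMultilinear]

theorem norm_monoMultilinear_le {n : ℕ} (s : Fin n → σ) : ‖monoMultilinear s‖ ≤ 1 := by
  refine ContinuousMultilinearMap.opNorm_le_bound zero_le_one fun z => ?_
  rw [monoMultilinear_apply, norm_prod, one_mul]
  exact Finset.prod_le_prod (fun _ _ => norm_nonneg _) fun j _ => norm_le_pi_norm (z j) (s j)

/-- The multiindex counting the values of `s`. -/
def countIndex {n : ℕ} (s : Fin n → σ) : σ →₀ ℕ := ∑ j, Finsupp.single (s j) 1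

theorem degree_countIndex {n : ℕ} (s : Fin n → σ) : (countIndex s).degree = n := by
  simp [countIndex]

theorem mono_countIndex {n : ℕ} (s : Fin n → σ) (z : σ → ℝ) :
    mono (countIndex s) z = ∏ j, z (s j) := by
  unfold countIndex
  induction n with
  | zero => simp [mono_zero]
  | succ n ih =>
    rw [Fin.sum_univ_succ, mono_add, mono_single, Fin.prod_univ_succ, ih (fun j => s j.succ)]

theorem exists_countIndex (m : σ →₀ ℕ) : ∃ s : Fin m.degree → σ, countIndex s = m := by
  classical
  suffices H : ∀ n (m : σ →₀ ℕ), m.degree = n → ∃ s : Fin n → σ, countIndex s = m from H _ m rfl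
  intro n
  induction n with
  | zero =>
    intro m hm
    rw [Finsupp.degree_eq_zero_iff] at hm
    exact ⟨Fin.elim0, by simp [countIndex, hm]⟩
  | succ n ih =>
    intro m hm
    have hne : m ≠ 0 := by rintro rfl; simp at hm
    obtain ⟨i, hi⟩ := Finsupp.ne_iff.1 hne
    rw [Finsupp.zero_apply] at hi
    have hle : m - Finsupp.single i 1 + Finsupp.single i 1 = m :=
      tsub_add_cancel_of_le (by rw [Finsupp.single_le_iff]; omega)
    have hdeg : (m - Finsupp.single i 1).degree = n := by
      have := congrArg Finsupp.degree hle
      rw [map_add, Finsupp.degree_single] at this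
      omega
    obtain ⟨s, hs⟩ := ih _ hdeg
    refine ⟨Fin.cons i s, ?_⟩
    unfold countIndex at hs ⊢
    rw [Fin.sum_univ_succ]
    simp only [Fin.cons_zero, Fin.cons_succ]
    rw [hs, add_comm, hle]

theorem Represents.analyticAt {u : MvPowerSeries σ ℝ} {f : (σ → ℝ) → ℝ} (h : Represents u f) :
    AnalyticAt ℝ f 0 := by
  classical
  obtain ⟨⟨s, hs, hsu⟩, hf⟩ := h
  -- Only diagonal values matter, so a monomial may be realized by any word with the right letter
  -- counts, without symmetrization. For the wrong degree the form is a dummy `0`.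
  have hex : ∀ (n : ℕ) (m : σ →₀ ℕ),
      ∃ L : ContinuousMultilinearMap ℝ (fun _ : Fin n => (σ → ℝ)) ℝ,
      ‖L‖ ≤ 1 ∧ (m.degree = n → ∀ z : σ → ℝ, L (fun _ => z) = mono m z) := by
    intro n m
    by_cases hd : m.degree = n
    · subst hd
      obtain ⟨t, ht⟩ := exists_countIndex m
      refine ⟨monoMultilinear t, norm_monoMultilinear_le t, fun _ z => ?_⟩
      rw [monoMultilinear_apply]
      conv_rhs => rw [← ht]
      rw [mono_countIndex]
    · exact ⟨0, by simp, fun h => absurd h hd⟩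
  choose L hL1 hL2 using hex
  let p : FormalMultilinearSeries ℝ (σ → ℝ) ℝ :=
    fun n => ∑ m ∈ degreeFinset n, coeff m u • L n m
  have hp : HasFPowerSeriesOnBall (fun z => ∑' m, coeff m u * mono m z) p 0 s := by
    refine ⟨?_, by simpa using hs, fun {z} hz => ?_⟩
    · refine p.le_radius_of_summable_norm ?_
      refine Summable.of_nonneg_of_le (fun n => by positivity) (fun n => ?_)
        (hasSum_fiberwise (summable_of_pnorm hsu).hasSum Finsupp.degree degreeFinset
          mem_degreeFinset).summable
      rw [Finset.sum_congr rfl (fun m hm => by rw [(mem_degreeFinset n m).1 hm]),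
        ← Finset.sum_mul]
      gcongr
      refine (norm_sum_le _ _).trans (Finset.sum_le_sum fun m _ => ?_)
      rw [norm_smul]
      exact mul_le_of_le_one_right (norm_nonneg _) (hL1 n m)
    · have hz' : ‖z‖ ≤ s := by
        rw [Metric.mem_eball, edist_zero_right] at hz
        have : ‖z‖₊ < s := by exact_mod_cast hz
        exact this.le
      have h1 := hasSum_fiberwise (summable_mono hsu hz').of_norm.hasSum Finsupp.degree degreeFinset
          mem_degreeFinset
      rw [zero_add]
      convert h1 using 2 with n
      simp only [p, _root_.sum_apply, _root_.smul_apply, smul_eq_mul]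
      exact Finset.sum_congr rfl fun m hm => by rw [hL2 n m ((mem_degreeFinset n m).1 hm) z]
  exact (hp.analyticAt).congr (hf.mono fun z hz => hz.symm)

theorem exists_represents {f : (σ → ℝ) → ℝ} (hf : AnalyticAt ℝ f 0) : ∃ u, Represents u f := by
  classical
  obtain ⟨p, R, hp⟩ := hf
  -- Expanding `p n` on the standard basis gives one term for each word `s`; the coefficient at `m`
  -- collects the words with letter counts `m`.
  let cf : ∀ n : ℕ, (σ →₀ ℕ) → ℝ := fun n m =>
    ∑ s : Fin n → σ with countIndex s = m, p n (fun j => Pi.single (s j) 1)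
  let u : MvPowerSeries σ ℝ := fun m => cf m.degree m
  have hu : ∀ n, ∀ m ∈ degreeFinset n, coeff m u = cf n m := by
    intro n m hm
    rw [mem_degreeFinset] at hm
    subst hm
    rfl
  have hpn : ∀ n (z : σ → ℝ), p n (fun _ => z) = ∑ m ∈ degreeFinset n, coeff m u * mono m z := by
    intro n z
    have h1 : (fun _ : Fin n => z) = fun _ => ∑ i, z i • (Pi.single i 1 : σ → ℝ) := by
      funext _
      exact (pi_eq_sum_univ' z)
    rw [h1, ContinuousMultilinearMap.map_sum]
    simp_rw [ContinuousMultilinearMap.map_smul_univ]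
    have h2 : ∑ m ∈ degreeFinset n, coeff m u * mono m z = ∑ m ∈ degreeFinset n,
        ∑ s : Fin n → σ with countIndex s = m, p n (fun j => Pi.single (s j) 1) * mono m z :=
      Finset.sum_congr rfl (fun m hm => by rw [hu n m hm, Finset.sum_mul])
    rw [h2]
    rw [← Finset.sum_fiberwise_of_maps_to (s := Finset.univ) (t := degreeFinset n)
      (g := fun s : Fin n → σ => countIndex s)
      (fun s _ => (mem_degreeFinset n _).2 (degree_countIndex s))]
    refine Finset.sum_congr rfl fun m _ => Finset.sum_congr rfl fun s hs => ?_
    rw [← (Finset.mem_filter.1 hs).2, mono_countIndex, smul_eq_mul, mul_comm]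
  obtain ⟨ρ, hρ0, hρR⟩ : ∃ ρ : ℝ≥0, 0 < ρ ∧ (ρ : ℝ≥0∞) < R := by
    obtain ⟨ρ, h1, h2⟩ := ENNReal.lt_iff_exists_nnreal_btwn.1 hp.r_pos
    exact ⟨ρ, by exact_mod_cast h1, h2⟩
  have hρsum := p.summable_norm_mul_pow (hρR.trans_le hp.r_le)
  -- There are `(card σ)^n` words of length `n`, so the radius is divided by a bound for `card σ`.
  -- The `+ 1` keeps `N` positive when `σ` is empty.
  set N : ℝ≥0 := Fintype.card σ + 1 with hN
  set s : ℝ≥0 := ρ / N with hs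
  have hs0 : 0 < s := by positivity
  have hsρ : s ≤ ρ := div_le_self zero_le (by simp [hN])
  have hps : pnorm s u < ⊤ := by
    have h1 := (hasSum_fiberwise (ENNReal.summable (f := fun m : σ →₀ ℕ =>
      ‖coeff m u‖ₑ * (s : ℝ≥0∞) ^ m.degree)).hasSum Finsupp.degree degreeFinset
          mem_degreeFinset).tsum_eq
    unfold pnorm
    rw [← h1]
    have h2 : ∀ n, ∑ m ∈ degreeFinset n, ‖coeff m u‖ₑ * (s : ℝ≥0∞) ^ m.degree ≤
        ENNReal.ofReal (‖p n‖ * (ρ : ℝ) ^ n) := by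
      intro n
      have h3 : ∑ m ∈ degreeFinset n, ‖coeff m u‖ ≤ (Fintype.card σ : ℝ) ^ n * ‖p n‖ := by
        calc ∑ m ∈ degreeFinset n, ‖coeff m u‖
            ≤ ∑ m ∈ degreeFinset n, ∑ s : Fin n → σ with countIndex s = m,
                ‖p n (fun j => Pi.single (s j) 1)‖ := by
              refine Finset.sum_le_sum fun m hm => ?_
              rw [hu n m hm]
              exact norm_sum_le _ _
          _ = ∑ s : Fin n → σ, ‖p n (fun j => Pi.single (s j) 1)‖ :=
              Finset.sum_fiberwise_of_maps_to
                (fun s _ => (mem_degreeFinset n _).2 (degree_countIndex s)) _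
          _ ≤ ∑ s : Fin n → σ, ‖p n‖ := by
              refine Finset.sum_le_sum fun t _ => ?_
              refine ((p n).le_opNorm _).trans (mul_le_of_le_one_right (norm_nonneg _) ?_)
              refine Finset.prod_le_one (fun _ _ => norm_nonneg _) fun j _ => ?_
              simp [Pi.norm_single]
          _ = _ := by simp
      calc ∑ m ∈ degreeFinset n, ‖coeff m u‖ₑ * (s : ℝ≥0∞) ^ m.degree
          = ENNReal.ofReal ((∑ m ∈ degreeFinset n, ‖coeff m u‖) * (s : ℝ) ^ n) := by
            rw [Finset.sum_mul, ENNReal.ofReal_sum_of_nonneg (fun _ _ => by positivity)]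
            refine Finset.sum_congr rfl fun m hm => ?_
            rw [(mem_degreeFinset n m).1 hm, ENNReal.ofReal_mul (norm_nonneg _), ofReal_norm,
              ENNReal.ofReal_pow (NNReal.coe_nonneg s), ENNReal.ofReal_coe_nnreal]
        _ ≤ _ := by
            refine ENNReal.ofReal_le_ofReal ?_
            calc (∑ m ∈ degreeFinset n, ‖coeff m u‖) * (s : ℝ) ^ n
                ≤ ((N : ℝ) ^ n * ‖p n‖) * (s : ℝ) ^ n := by
                  gcongr
                  refine h3.trans ?_
                  gcongr
                  simp [hN]
              _ = ‖p n‖ * (ρ : ℝ) ^ n := by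
                  have hN0 : (N : ℝ) ≠ 0 := by simp [hN]; positivity
                  rw [hs, NNReal.coe_div, div_pow]
                  field_simp
    refine (ENNReal.tsum_le_tsum h2).trans_lt ?_
    rw [← ENNReal.ofReal_tsum_of_nonneg (fun n => by positivity) hρsum]
    exact ENNReal.ofReal_lt_top
  refine ⟨u, ⟨s, hs0, hps⟩, ?_⟩
  filter_upwards [eventually_norm_le hs0] with z hz
  have hzR : z ∈ Metric.eball (0 : σ → ℝ) R := by
    rw [Metric.mem_eball, edist_zero_right]
    refine lt_of_le_of_lt ?_ hρR
    have : ‖z‖₊ ≤ ρ := (show ‖z‖₊ ≤ s from hz).trans hsρ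
    exact_mod_cast this
  have h1 := hp.hasSum hzR
  have h2 := hasSum_fiberwise (summable_mono hps hz).of_norm.hasSum Finsupp.degree degreeFinset
          mem_degreeFinset
  rw [zero_add] at h1
  simp_rw [hpn] at h1
  exact h1.unique h2

end AnalyticSeries

/-! ### Partial derivatives, Christoffel symbols and the symmetry of the Ricci tensor. -/

section MetricBasics

open Topology Filter

variable {ι F : Type*} [Fintype ι] [DecidableEq ι] [NormedAddCommGroup F] [NormedSpace ℝ F]
variable {b : ι → F} {f f' : F → ℝ} {x : F} {i j k : ι}

theorem analyticAt_pd (h : AnalyticAt ℝ f x) : AnalyticAt ℝ (pd b i f) x :=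
  ((ContinuousLinearMap.apply ℝ ℝ (b i)).analyticAt _).comp h.fderiv

theorem pd_add (h : AnalyticAt ℝ f x) (h' : AnalyticAt ℝ f' x) :
    pd b i (fun z => f z + f' z) x = pd b i f x + pd b i f' x := by
  simp [pd, fderiv_fun_add h.differentiableAt h'.differentiableAt]

theorem pd_sub (h : AnalyticAt ℝ f x) (h' : AnalyticAt ℝ f' x) :
    pd b i (fun z => f z - f' z) x = pd b i f x - pd b i f' x := by
  simp [pd, fderiv_fun_sub h.differentiableAt h'.differentiableAt]

theorem pd_neg : pd b i (fun z => -f z) x = -pd b i f x := by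
  simp [pd, fderiv_fun_neg]

theorem pd_mul (h : AnalyticAt ℝ f x) (h' : AnalyticAt ℝ f' x) :
    pd b i (fun z => f z * f' z) x = pd b i f x * f' x + f x * pd b i f' x := by
  simp [pd, fderiv_fun_mul h.differentiableAt h'.differentiableAt]
  ring

theorem pd_const_mul (c : ℝ) (h : AnalyticAt ℝ f x) :
    pd b i (fun z => c * f z) x = c * pd b i f x := by
  simp [pd, fderiv_const_mul h.differentiableAt]

theorem pd_const (c : ℝ) : pd b i (fun _ => c) x = 0 := by simp [pd]

theorem pd_sum {A : Type*} {s : Finset A} {g : A → F → ℝ} (h : ∀ a, AnalyticAt ℝ (g a) x) :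
    pd b i (fun z => ∑ a ∈ s, g a z) x = ∑ a ∈ s, pd b i (g a) x := by
  simp [pd, fderiv_fun_sum (fun a _ => (h a).differentiableAt)]

theorem pd_congr (h : f =ᶠ[𝓝 x] f') : pd b i f x = pd b i f' x := by
  simp [pd, h.fderiv_eq]

theorem eventuallyEq_pd (h : f =ᶠ[𝓝 x] f') : pd b i f =ᶠ[𝓝 x] pd b i f' :=
  h.eventually_nhds.mono fun _ hz => pd_congr hz

theorem pd_comm (h : AnalyticAt ℝ f x) : pd b i (pd b j f) x = pd b j (pd b i f) x := by
  have hs : IsSymmSndFDerivAt ℝ f x :=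
    h.contDiffAt.isSymmSndFDerivAt (n := ω) (by simp)
  have hd : ∀ v w, fderiv ℝ (fun z => fderiv ℝ f z v) x w = fderiv ℝ (fderiv ℝ f) x w v := by
    intro v w
    rw [fderiv_clm_apply h.fderiv.differentiableAt (differentiableAt_const v)]
    simp
  unfold pd
  rw [hd, hd]
  exact hs _ _

theorem analyticAt_sum {A : Type*} {s : Finset A} {g : A → F → ℝ}
    (h : ∀ a, AnalyticAt ℝ (g a) x) : AnalyticAt ℝ (fun z => ∑ a ∈ s, g a z) x :=
  Finset.analyticAt_fun_sum _ fun a _ => h a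

theorem analyticAt_det {g : F → Matrix ι ι ℝ} (h : ∀ i j, AnalyticAt ℝ (fun z => g z i j) x) :
    AnalyticAt ℝ (fun z => (g z).det) x := by
  simp only [Matrix.det_apply]
  refine analyticAt_sum fun σ => ?_
  have : AnalyticAt ℝ (fun z => ∏ i, g z (σ i) i) x :=
    Finset.analyticAt_fun_prod _ fun i _ => h _ _
  simp only [Units.smul_def, zsmul_eq_mul]
  exact analyticAt_const.mul this

theorem analyticAt_inv_entry {g : F → Matrix ι ι ℝ}
    (h : ∀ i j, AnalyticAt ℝ (fun z => g z i j) x) (hdet : (g x).det ≠ 0) (i j : ι) :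
    AnalyticAt ℝ (fun z => (g z)⁻¹ i j) x := by
  simp only [Matrix.inv_def, Matrix.smul_apply, smul_eq_mul, Ring.inverse_eq_inv']
  refine ((analyticAt_det h).inv hdet).mul ?_
  simp only [Matrix.adjugate_apply]
  refine analyticAt_det fun a c => ?_
  simp only [Matrix.updateRow_apply]
  split_ifs
  · exact analyticAt_const
  · exact h a c

/-- The matrix function `g` gives the components of a nondegenerate analytic metric near `x`. -/
structure IsMetricAt (g : F → Matrix ι ι ℝ) (x : F) : Prop where
  analytic : ∀ i j, AnalyticAt ℝ (fun z => g z i j) x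
  symm : ∀ᶠ z in 𝓝 x, ∀ i j, g z i j = g z j i
  det_ne : (g x).det ≠ 0

variable {g : F → Matrix ι ι ℝ}

theorem IsMetricAt.eventually (hg : IsMetricAt g x) : ∀ᶠ z in 𝓝 x, IsMetricAt g z := by
  have h1 : ∀ᶠ z in 𝓝 x, ∀ i j, AnalyticAt ℝ (fun z => g z i j) z :=
    eventually_all.2 fun i => eventually_all.2 fun j => (hg.analytic i j).eventually_analyticAt
  have h2 : ∀ᶠ z in 𝓝 x, (g z).det ≠ 0 :=
    (analyticAt_det hg.analytic).continuousAt.eventually_ne hg.det_ne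
  filter_upwards [h1, h2, hg.symm.eventually_nhds] with z a c d
  exact ⟨a, d, c⟩

theorem IsMetricAt.congr {g' : F → Matrix ι ι ℝ} (hg : IsMetricAt g x) (h : g =ᶠ[𝓝 x] g') :
    IsMetricAt g' x := by
  refine ⟨fun i j => (hg.analytic i j).congr (h.mono fun z hz => by simp only [hz]), ?_, ?_⟩
  · filter_upwards [hg.symm, h] with z a c
    rwa [← c]
  · rw [← h.self_of_nhds]
    exact hg.det_ne

theorem IsMetricAt.isUnit (hg : IsMetricAt g x) : IsUnit (g x).det := isUnit_iff_ne_zero.2 hg.det_ne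

theorem IsMetricAt.isSymm (hg : IsMetricAt g x) : (g x).IsSymm :=
  Matrix.IsSymm.ext fun i j => (hg.symm.self_of_nhds j i)

theorem IsMetricAt.inv_symm (hg : IsMetricAt g x) (i j : ι) : (g x)⁻¹ i j = (g x)⁻¹ j i := by
  have h : ((g x)⁻¹).transpose = (g x)⁻¹ := by
    rw [Matrix.transpose_nonsing_inv, hg.isSymm.eq]
  exact congrFun (congrFun h j) i

theorem IsMetricAt.inv_analytic (hg : IsMetricAt g x) (i j : ι) :
    AnalyticAt ℝ (fun z => (g z)⁻¹ i j) x := analyticAt_inv_entry hg.analytic hg.det_ne i j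

theorem IsMetricAt.sum_inv_mul (hg : IsMetricAt g x) (i j : ι) :
    ∑ m, (g x)⁻¹ i m * g x m j = if i = j then 1 else 0 := by
  rw [← Matrix.mul_apply, Matrix.nonsing_inv_mul _ hg.isUnit, Matrix.one_apply]

theorem IsMetricAt.sum_mul_inv (hg : IsMetricAt g x) (i j : ι) :
    ∑ m, g x i m * (g x)⁻¹ m j = if i = j then 1 else 0 := by
  rw [← Matrix.mul_apply, Matrix.mul_nonsing_inv _ hg.isUnit, Matrix.one_apply]

theorem IsMetricAt.pd_symm (hg : IsMetricAt g x) (k i j : ι) :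
    pd b k (fun z => g z i j) x = pd b k (fun z => g z j i) x :=
  pd_congr (hg.symm.mono fun _ h => h i j)

/-- Differentiate `g⁻¹ g = 1` and multiply by `g⁻¹` from the right. -/
theorem IsMetricAt.pd_inv (hg : IsMetricAt g x) (k i j : ι) :
    pd b k (fun z => (g z)⁻¹ i j) x =
      -∑ a, ∑ c, (g x)⁻¹ i a * pd b k (fun z => g z a c) x * (g x)⁻¹ c j := by
  have h1 : ∀ m, ∑ a, (pd b k (fun z => (g z)⁻¹ i a) x * g x a m
      + (g x)⁻¹ i a * pd b k (fun z => g z a m) x) = 0 := by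
    intro m
    have h2 : (fun z => ∑ a, (g z)⁻¹ i a * g z a m) =ᶠ[𝓝 x] fun _ => if i = m then 1 else 0 :=
      hg.eventually.mono fun z hz => hz.sum_inv_mul i m
    have h3 := pd_congr (b := b) (i := k) h2
    rw [pd_const, pd_sum (fun a => (hg.inv_analytic i a).fun_mul (hg.analytic a m))] at h3
    rw [← h3]
    exact Finset.sum_congr rfl fun a _ => (pd_mul (hg.inv_analytic i a) (hg.analytic a m)).symm
  have h4 : ∑ m, (∑ a, (pd b k (fun z => (g z)⁻¹ i a) x * g x a m
      + (g x)⁻¹ i a * pd b k (fun z => g z a m) x)) * (g x)⁻¹ m j = 0 :=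
    Finset.sum_eq_zero fun m _ => by rw [h1, zero_mul]
  simp only [Finset.sum_mul, add_mul, Finset.sum_add_distrib] at h4
  have h5 : ∑ m, ∑ a, pd b k (fun z => (g z)⁻¹ i a) x * g x a m * (g x)⁻¹ m j =
      pd b k (fun z => (g z)⁻¹ i j) x := by
    rw [Finset.sum_comm]
    simp only [mul_assoc, ← Finset.mul_sum, hg.sum_mul_inv]
    simp
  rw [h5, Finset.sum_comm] at h4
  exact eq_neg_of_add_eq_zero_left h4

theorem IsMetricAt.christoffel_symm (hg : IsMetricAt g x) (l i j : ι) :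
    christoffel b g l i j x = christoffel b g l j i x := by
  unfold christoffel
  congr 1
  refine Finset.sum_congr rfl fun m _ => ?_
  rw [hg.pd_symm m i j]
  ring

theorem IsMetricAt.christoffel_analytic (hg : IsMetricAt g x) (l i j : ι) :
    AnalyticAt ℝ (christoffel b g l i j) x := by
  unfold christoffel
  refine analyticAt_const.mul (analyticAt_sum fun m => (hg.inv_analytic l m).mul ?_)
  exact ((analyticAt_pd (hg.analytic _ _)).add (analyticAt_pd (hg.analytic _ _))).sub
    (analyticAt_pd (hg.analytic _ _))

theorem IsMetricAt.ricci_analytic (hg : IsMetricAt g x) (i j : ι) :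
    AnalyticAt ℝ (ricci b g i j) x := by
  unfold ricci
  have h := fun l i j => hg.christoffel_analytic (b := b) l i j
  refine (analyticAt_sum fun l => (analyticAt_pd (h _ _ _)).sub (analyticAt_pd (h _ _ _))).add
    (analyticAt_sum fun l => analyticAt_sum fun m => ((h _ _ _).mul (h _ _ _)).sub
      ((h _ _ _).mul (h _ _ _)))

theorem IsMetricAt.sum_mul_christoffel (hg : IsMetricAt g x) (m i j : ι) :
    ∑ l, g x m l * christoffel b g l i j x = 1 / 2 *
      (pd b i (fun z => g z j m) x + pd b j (fun z => g z i m) x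
        - pd b m (fun z => g z i j) x) := by
  unfold christoffel
  simp only [Finset.mul_sum]
  rw [Finset.sum_comm]
  rw [Finset.sum_congr rfl (fun a _ => by
    rw [Finset.sum_congr rfl (fun l _ => show _ = (g x m l * (g x)⁻¹ l a) * (1 / 2 *
      (pd b i (fun z => g z j a) x + pd b j (fun z => g z i a) x
        - pd b a (fun z => g z i j) x)) by ring), ← Finset.sum_mul, hg.sum_mul_inv])]
  simp

theorem IsMetricAt.metric_compat (hg : IsMetricAt g x) (k i j : ι) :
    pd b k (fun z => g z i j) x =
      ∑ l, (christoffel b g l k i x * g x l j + christoffel b g l k j x * g x i l) := by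
  have h1 := hg.sum_mul_christoffel (b := b) j k i
  have h2 := hg.sum_mul_christoffel (b := b) i k j
  rw [Finset.sum_add_distrib]
  have e1 : ∑ l, christoffel b g l k i x * g x l j = ∑ l, g x j l * christoffel b g l k i x :=
    Finset.sum_congr rfl fun l _ => by rw [hg.symm.self_of_nhds l j, mul_comm]
  have e2 : ∑ l, christoffel b g l k j x * g x i l = ∑ l, g x i l * christoffel b g l k j x :=
    Finset.sum_congr rfl fun l _ => by rw [mul_comm]
  rw [e1, e2, h1, h2, hg.pd_symm k j i, hg.pd_symm i k j, hg.pd_symm j k i]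
  ring

/-- The other two terms cancel by the symmetry of `g⁻¹`. The result is `∂_i` of `½ log |det g|`,
hence a gradient, as the symmetry of the Ricci tensor requires. -/
theorem IsMetricAt.sum_christoffel_trace (hg : IsMetricAt g x) (i : ι) :
    ∑ l, christoffel b g l i l x =
      1 / 2 * ∑ l, ∑ m, (g x)⁻¹ l m * pd b i (fun z => g z l m) x := by
  unfold christoffel
  rw [← Finset.mul_sum]
  congr 1
  have h : ∑ l, ∑ m, (g x)⁻¹ l m * pd b l (fun z => g z i m) x =
      ∑ l, ∑ m, (g x)⁻¹ l m * pd b m (fun z => g z i l) x := by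
    rw [Finset.sum_comm]
    exact Finset.sum_congr rfl fun l _ => Finset.sum_congr rfl fun m _ => by
      rw [hg.inv_symm]
  simp only [mul_sub, mul_add, Finset.sum_sub_distrib, Finset.sum_add_distrib]
  rw [h]
  ring

theorem IsMetricAt.pd_christoffel_trace (hg : IsMetricAt g x) (i j : ι) :
    ∑ l, pd b i (christoffel b g l j l) x = 1 / 2 * ((∑ l, ∑ m, (g x)⁻¹ l m *
      pd b i (pd b j (fun z => g z l m)) x) - ∑ l, ∑ m, (∑ a, ∑ c, (g x)⁻¹ l a *
        pd b i (fun z => g z a c) x * (g x)⁻¹ c m) * pd b j (fun z => g z l m) x) := by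
  rw [← pd_sum (fun l => hg.christoffel_analytic l j l)]
  rw [pd_congr (hg.eventually.mono fun z hz => hz.sum_christoffel_trace j)]
  have ha : ∀ l m, AnalyticAt ℝ (fun z => (g z)⁻¹ l m * pd b j (fun z => g z l m) z) x :=
    fun l m => (hg.inv_analytic l m).mul (analyticAt_pd (hg.analytic l m))
  rw [pd_const_mul _ (analyticAt_sum fun l => analyticAt_sum fun m => ha l m),
    pd_sum (fun l => analyticAt_sum fun m => ha l m)]
  congr 1
  rw [← Finset.sum_sub_distrib]
  refine Finset.sum_congr rfl fun l _ => ?_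
  rw [pd_sum (fun m => ha l m), ← Finset.sum_sub_distrib]
  refine Finset.sum_congr rfl fun m _ => ?_
  rw [pd_mul (hg.inv_analytic l m) (analyticAt_pd (hg.analytic l m)), hg.pd_inv]
  ring

/-- Only `∂_i Γ^l_{jl}` is not visibly symmetric in `i`, `j`. By `pd_christoffel_trace` it consists
of a second derivative of `g` and a product of two first derivatives, both symmetric after
contraction. -/
theorem IsMetricAt.ricci_symm (hg : IsMetricAt g x) (i j : ι) :
    ricci b g i j x = ricci b g j i x := by
  unfold ricci
  have hs : ∀ l i j, christoffel b g l i j =ᶠ[𝓝 x] christoffel b g l j i := fun l i j =>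
    hg.eventually.mono fun z hz => hz.christoffel_symm l i j
  simp only [Finset.sum_sub_distrib]
  have h1 : ∑ l, pd b l (christoffel b g l i j) x = ∑ l, pd b l (christoffel b g l j i) x :=
    Finset.sum_congr rfl fun l _ => pd_congr (hs l i j)
  have h3 : ∑ l, ∑ m, christoffel b g l i j x * christoffel b g m l m x =
      ∑ l, ∑ m, christoffel b g l j i x * christoffel b g m l m x := by
    simp only [hg.christoffel_symm _ i j]
  have h4 : ∑ l, ∑ m, christoffel b g l i m x * christoffel b g m j l x =
      ∑ l, ∑ m, christoffel b g l j m x * christoffel b g m i l x := by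
    rw [Finset.sum_comm]
    exact Finset.sum_congr rfl fun l _ => Finset.sum_congr rfl fun m _ => mul_comm _ _
  have h2 : ∑ l, pd b i (christoffel b g l j l) x = ∑ l, pd b j (christoffel b g l i l) x := by
    rw [hg.pd_christoffel_trace, hg.pd_christoffel_trace]
    congr 1
    congr 1
    · exact Finset.sum_congr rfl fun l _ => Finset.sum_congr rfl fun m _ => by
        rw [pd_comm (hg.analytic l m)]
    · simp only [Finset.sum_mul]
      have e : ∀ l m a c, (g x)⁻¹ l a * pd b i (fun z => g z a c) x * (g x)⁻¹ c m *
          pd b j (fun z => g z l m) x = (g x)⁻¹ a l * pd b j (fun z => g z l m) x *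
          (g x)⁻¹ m c * pd b i (fun z => g z a c) x := by
        intro l m a c
        rw [hg.inv_symm l a, hg.inv_symm c m]
        ring
      simp only [e]
      calc _ = ∑ l, ∑ a, ∑ c, ∑ m, (g x)⁻¹ a l * pd b j (fun z => g z l m) x *
          (g x)⁻¹ m c * pd b i (fun z => g z a c) x := by
            refine Finset.sum_congr rfl fun l _ => ?_
            rw [Finset.sum_comm]
            exact Finset.sum_congr rfl fun a _ => Finset.sum_comm
        _ = ∑ a, ∑ c, ∑ l, ∑ m, (g x)⁻¹ a l * pd b j (fun z => g z l m) x *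
          (g x)⁻¹ m c * pd b i (fun z => g z a c) x := by
            rw [Finset.sum_comm]
            exact Finset.sum_congr rfl fun a _ => Finset.sum_comm
  rw [h1, h2, h3, h4]

end MetricBasics

/-! ### Power series at a point of `ℝⁿ × ℝ` and order of contact in time. -/

section Coordinates

open MvPowerSeries Topology Filter

variable {n : ℕ}

/-- The coordinates of `ℝⁿ × ℝ` as a linear equivalence. -/
def coordEquiv : (EuclideanSpace ℝ (Fin n) × ℝ) ≃L[ℝ] (Fin n ⊕ Unit → ℝ) :=
  LinearEquiv.toContinuousLinearEquiv
    { toFun := fun q => Sum.elim (fun i => q.1 i) (fun _ => q.2)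
      invFun := fun z => (WithLp.toLp 2 fun i => z (Sum.inl i), z (Sum.inr ()))
      map_add' := fun p q => by ext (i | i) <;> simp
      map_smul' := fun c q => by ext (i | i) <;> simp
      left_inv := fun q => by ext <;> simp
      right_inv := fun z => by ext (i | i) <;> simp }

theorem coordEquiv_symm_apply (z : Fin n ⊕ Unit → ℝ) :
    coordEquiv.symm z = (WithLp.toLp 2 fun i => z (Sum.inl i), z (Sum.inr ())) := rfl

theorem coordEquiv_apply (q : EuclideanSpace ℝ (Fin n) × ℝ) :
    coordEquiv q = Sum.elim (fun i => q.1 i) (fun _ => q.2) := rfl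

theorem coordEquiv_symm_single (i : Fin n ⊕ Unit) :
    coordEquiv.symm (Pi.single i 1) = spacetimeDir i := by
  rw [ContinuousLinearEquiv.symm_apply_eq]
  rcases i with i | i
  · ext (j | j) <;>
    simp [coordEquiv_apply, spacetimeDir, sliceDir, spaceDir, Pi.single_apply]
  · ext (j | j) <;> simp [coordEquiv_apply, spacetimeDir]

/-- The power series `u` at `q₀` represents the function `f`. -/
def RepAt (q₀ : EuclideanSpace ℝ (Fin n) × ℝ) (u : MvPowerSeries (Fin n ⊕ Unit) ℝ)
    (f : EuclideanSpace ℝ (Fin n) × ℝ → ℝ) : Prop :=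
  Represents u fun z => f (q₀ + coordEquiv.symm z)

variable {q₀ : EuclideanSpace ℝ (Fin n) × ℝ} {u v : MvPowerSeries (Fin n ⊕ Unit) ℝ}
  {f g : EuclideanSpace ℝ (Fin n) × ℝ → ℝ}

theorem tendsto_coord (q₀ : EuclideanSpace ℝ (Fin n) × ℝ) :
    Tendsto (fun z : Fin n ⊕ Unit → ℝ => q₀ + coordEquiv.symm z) (𝓝 0) (𝓝 q₀) := by
  have : Continuous (fun z : Fin n ⊕ Unit → ℝ => q₀ + coordEquiv.symm z) := by fun_prop
  simpa using this.tendsto 0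

theorem tendsto_coord_symm (q₀ : EuclideanSpace ℝ (Fin n) × ℝ) :
    Tendsto (fun q : EuclideanSpace ℝ (Fin n) × ℝ => coordEquiv (q - q₀)) (𝓝 q₀) (𝓝 0) := by
  have : Continuous (fun q : EuclideanSpace ℝ (Fin n) × ℝ => coordEquiv (q - q₀)) := by fun_prop
  simpa using this.tendsto q₀

theorem RepAt.congr (h : RepAt q₀ u f) (hfg : f =ᶠ[𝓝 q₀] g) : RepAt q₀ u g :=
  Represents.congr h ((tendsto_coord q₀).eventually hfg)

theorem RepAt.add (h : RepAt q₀ u f) (h' : RepAt q₀ v g) : RepAt q₀ (u + v) (f + g) :=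
  Represents.add h h'

theorem RepAt.sub (h : RepAt q₀ u f) (h' : RepAt q₀ v g) : RepAt q₀ (u - v) (f - g) :=
  Represents.sub h h'

theorem RepAt.mul (h : RepAt q₀ u f) (h' : RepAt q₀ v g) : RepAt q₀ (u * v) (f * g) :=
  Represents.mul h h'

theorem RepAt.smul (c : ℝ) (h : RepAt q₀ u f) : RepAt q₀ (c • u) (c • f) :=
  Represents.smul c h

theorem RepAt.one : RepAt q₀ (1 : MvPowerSeries (Fin n ⊕ Unit) ℝ) 1 := by
  rw [← map_one (C (σ := Fin n ⊕ Unit) (R := ℝ))]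
  exact Represents.const 1

theorem RepAt.zero : RepAt q₀ (0 : MvPowerSeries (Fin n ⊕ Unit) ℝ) 0 := Represents.zero

theorem RepAt.sum {A : Type*} {S : Finset A} {U : A → MvPowerSeries (Fin n ⊕ Unit) ℝ}
    {F : A → EuclideanSpace ℝ (Fin n) × ℝ → ℝ} (h : ∀ a, RepAt q₀ (U a) (F a)) :
    RepAt q₀ (∑ a ∈ S, U a) (∑ a ∈ S, F a) := by
  have := Represents.sum S h
  unfold RepAt
  simpa only [Finset.sum_apply] using this

theorem RepAt.pd (h : RepAt q₀ u f) (i : Fin n ⊕ Unit) :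
    RepAt q₀ (pderiv ℝ i u) (pd spacetimeDir i f) := by
  refine Represents.congr (Represents.pderiv h i) (.of_forall fun z => ?_)
  have h1 := ContinuousLinearEquiv.comp_right_fderiv (f := fun w => f (q₀ + w)) (x := z)
    (coordEquiv (n := n)).symm
  change fderiv ℝ ((fun w => f (q₀ + w)) ∘ coordEquiv.symm) z (Pi.single i 1) = _
  rw [h1, fderiv_comp_add_left]
  simp [EinsteinCauchy.pd, coordEquiv_symm_single]

theorem RepAt.unique (h : RepAt q₀ u f) (h' : RepAt q₀ v f) : u = v := Represents.unique h h'

theorem RepAt.eventuallyEq (h : RepAt q₀ u f) (h' : RepAt q₀ u g) : f =ᶠ[𝓝 q₀] g := by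
  have h1 : ∀ᶠ z in 𝓝 (0 : Fin n ⊕ Unit → ℝ),
      f (q₀ + coordEquiv.symm z) = g (q₀ + coordEquiv.symm z) := by
    filter_upwards [h.2, h'.2] with z a c
    rw [a, c]
  filter_upwards [(tendsto_coord_symm q₀).eventually h1] with q hq
  simpa using hq

theorem RepAt.analyticAt (h : RepAt q₀ u f) : AnalyticAt ℝ f q₀ := by
  have h1 := Represents.analyticAt h
  have h2 : AnalyticAt ℝ (fun q : EuclideanSpace ℝ (Fin n) × ℝ => coordEquiv (q - q₀)) q₀ :=
    (coordEquiv.toContinuousLinearMap.analyticAt _).comp (analyticAt_id.sub analyticAt_const)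
  have h3 := AnalyticAt.comp_of_eq h1 h2 (by simp)
  refine h3.congr (.of_forall fun q => ?_)
  simp

theorem exists_repAt (h : AnalyticAt ℝ f q₀) : ∃ u, RepAt q₀ u f := by
  refine exists_represents ?_
  have h2 : AnalyticAt ℝ (fun z : Fin n ⊕ Unit → ℝ => q₀ + coordEquiv.symm z) 0 :=
    analyticAt_const.add (coordEquiv.symm.toContinuousLinearMap.analyticAt _)
  exact AnalyticAt.comp_of_eq h h2 (by simp)

theorem exists_function_repAt (q₀ : EuclideanSpace ℝ (Fin n) × ℝ)
    {u : MvPowerSeries (Fin n ⊕ Unit) ℝ} {s : NNReal} (hs : 0 < s)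
    (hu : pnorm s u < ⊤) : ∃ f, RepAt q₀ u f :=
  ⟨fun q => ∑' m, coeff m u * mono m (coordEquiv (q - q₀)), ⟨s, hs, hu⟩,
    .of_forall fun z => by simp⟩

theorem RepAt.eq_on_slice {y₀ : EuclideanSpace ℝ (Fin n)} (h : RepAt (y₀, 0) u f)
    (h' : RepAt (y₀, 0) v g) (huv : timeVar ∣ u - v) : ∀ᶠ y in 𝓝 y₀, f (y, 0) = g (y, 0) := by
  have h1 := (RepAt.sub h h').2
  rw [X_dvd_iff] at huv
  have h2 : ∀ᶠ q in 𝓝 ((y₀, 0) : EuclideanSpace ℝ (Fin n) × ℝ), (f - g) q =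
      ∑' m, coeff m (u - v) * mono m (coordEquiv (q - (y₀, 0))) := by
    filter_upwards [(tendsto_coord_symm (y₀, 0)).eventually h1] with q hq
    simpa using hq
  have h3 : Tendsto (fun y : EuclideanSpace ℝ (Fin n) => (y, (0 : ℝ))) (𝓝 y₀) (𝓝 (y₀, 0)) :=
    (Continuous.prodMk_left 0).tendsto y₀
  filter_upwards [h3.eventually h2] with y hy
  rw [← sub_eq_zero]
  refine hy.trans ?_
  rw [← tsum_zero]
  refine tsum_congr fun m => ?_
  by_cases hm : m (Sum.inr ()) = 0
  · rw [huv m hm, zero_mul]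
  · rw [mono_apply_zero (i := Sum.inr ()) _ hm, mul_zero]
    simp [coordEquiv_apply]

/-- This is `Represents.coeff_eq_zero` applied to the space directions. -/
theorem RepAt.timeVar_dvd {y₀ : EuclideanSpace ℝ (Fin n)} (h : RepAt (y₀, 0) u f)
    (h' : RepAt (y₀, 0) v g) (hfg : ∀ᶠ y in 𝓝 y₀, f (y, 0) = g (y, 0)) : timeVar ∣ u - v := by
  rw [X_dvd_iff]
  intro m hm
  refine Represents.coeff_eq_zero (fun i => i ≠ Sum.inr ()) (RepAt.sub h h') ?_ m ?_
  · have h1 : Tendsto (fun z : Fin n ⊕ Unit → ℝ => ((y₀, (0 : ℝ)) + coordEquiv.symm z).1)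
        (𝓝 0) (𝓝 y₀) := (continuous_fst.tendsto _).comp (tendsto_coord (y₀, 0))
    filter_upwards [h1.eventually hfg] with z hz hz0
    have h2 : (y₀, (0 : ℝ)) + coordEquiv.symm z =
        (((y₀, (0 : ℝ)) + coordEquiv.symm z).1, 0) := by
      ext1
      · rfl
      · simp [coordEquiv_symm_apply, hz0 (Sum.inr ()) (by simp)]
    rw [h2, Pi.sub_apply, hz, sub_self]
  · intro i hi
    rw [not_not] at hi
    rw [hi, hm]

/-- `f` and `g` are analytic at `q₀` and agree there to order `k` in time. -/
def ContactAt (k : ℕ) (q₀ : EuclideanSpace ℝ (Fin n) × ℝ)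
    (f g : EuclideanSpace ℝ (Fin n) × ℝ → ℝ) : Prop :=
  ∃ u v, RepAt q₀ u f ∧ RepAt q₀ v g ∧ timeVar ^ k ∣ u - v

variable {k : ℕ} {f' g' : EuclideanSpace ℝ (Fin n) × ℝ → ℝ}

theorem ContactAt.refl (h : AnalyticAt ℝ f q₀) : ContactAt k q₀ f f := by
  obtain ⟨u, hu⟩ := exists_repAt h
  exact ⟨u, u, hu, hu, by simp⟩

theorem ContactAt.congr (h : ContactAt k q₀ f g) (hf : f =ᶠ[𝓝 q₀] f') (hg : g =ᶠ[𝓝 q₀] g') :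
    ContactAt k q₀ f' g' := by
  obtain ⟨u, v, hu, hv, huv⟩ := h
  exact ⟨u, v, hu.congr hf, hv.congr hg, huv⟩

theorem ContactAt.add (h : ContactAt k q₀ f g) (h' : ContactAt k q₀ f' g') :
    ContactAt k q₀ (fun z => f z + f' z) (fun z => g z + g' z) := by
  obtain ⟨u, v, hu, hv, huv⟩ := h
  obtain ⟨u', v', hu', hv', huv'⟩ := h'
  refine ⟨u + u', v + v', hu.add hu', hv.add hv', ?_⟩
  rw [add_sub_add_comm]
  exact dvd_add huv huv'

theorem ContactAt.mul (h : ContactAt k q₀ f g) (h' : ContactAt k q₀ f' g') :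
    ContactAt k q₀ (fun z => f z * f' z) (fun z => g z * g' z) := by
  obtain ⟨u, v, hu, hv, huv⟩ := h
  obtain ⟨u', v', hu', hv', huv'⟩ := h'
  refine ⟨u * u', v * v', hu.mul hu', hv.mul hv', ?_⟩
  rw [show u * u' - v * v' = u * (u' - v') + (u - v) * v' by ring]
  exact dvd_add (Dvd.dvd.mul_left huv' _) (Dvd.dvd.mul_right huv _)

theorem ContactAt.const_mul (c : ℝ) (h : ContactAt k q₀ f g) :
    ContactAt k q₀ (fun z => c * f z) (fun z => c * g z) :=
  (ContactAt.refl analyticAt_const).mul h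

theorem ContactAt.neg (h : ContactAt k q₀ f g) :
    ContactAt k q₀ (fun z => -f z) (fun z => -g z) := by
  simpa using h.const_mul (-1)

theorem ContactAt.sub (h : ContactAt k q₀ f g) (h' : ContactAt k q₀ f' g') :
    ContactAt k q₀ (fun z => f z - f' z) (fun z => g z - g' z) := by
  simpa only [sub_eq_add_neg] using h.add h'.neg

theorem ContactAt.sum {A : Type*} {S : Finset A} {G H : A → EuclideanSpace ℝ (Fin n) × ℝ → ℝ}
    (h : ∀ a, ContactAt k q₀ (G a) (H a)) :
    ContactAt k q₀ (fun z => ∑ a ∈ S, G a z) (fun z => ∑ a ∈ S, H a z) := by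
  classical
  induction S using Finset.induction_on with
  | empty => simpa using ContactAt.refl analyticAt_const
  | insert a S ha ih => simpa only [Finset.sum_insert ha] using (h a).add ih

theorem ContactAt.pd (h : ContactAt k q₀ f g) (i : Fin n) :
    ContactAt k q₀ (pd sliceDir i f) (pd sliceDir i g) := by
  obtain ⟨u, v, hu, hv, huv⟩ := h
  refine ⟨_, _, hu.pd (Sum.inl i), hv.pd (Sum.inl i), ?_⟩
  rw [← map_sub]
  exact timeVar_pow_dvd_pderiv i huv

/-- Agreement on the slice and contact of the time derivatives integrate to one more order of
contact. -/
theorem ContactAt.succ {y₀ : EuclideanSpace ℝ (Fin n)} (h0 : ∀ᶠ y in 𝓝 y₀, f (y, 0) = g (y, 0))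
    (hf : AnalyticAt ℝ f (y₀, 0)) (hg : AnalyticAt ℝ g (y₀, 0))
    (h : ContactAt k (y₀, 0) (EinsteinCauchy.pd spacetimeDir (Sum.inr ()) f)
      (EinsteinCauchy.pd spacetimeDir (Sum.inr ()) g)) : ContactAt (k + 1) (y₀, 0) f g := by
  obtain ⟨u', v', hu', hv', huv'⟩ := h
  obtain ⟨u, hu⟩ := exists_repAt hf
  obtain ⟨v, hv⟩ := exists_repAt hg
  refine ⟨u, v, hu, hv, timeVar_pow_succ_dvd (hu.timeVar_dvd hv h0) ?_⟩
  rwa [map_sub, (hu.pd _).unique hu', (hv.pd _).unique hv']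

theorem ContactAt.zero (hf : AnalyticAt ℝ f q₀) (hg : AnalyticAt ℝ g q₀) : ContactAt 0 q₀ f g := by
  obtain ⟨u, hu⟩ := exists_repAt hf
  obtain ⟨v, hv⟩ := exists_repAt hg
  exact ⟨u, v, hu, hv, by simp⟩

theorem eventuallyEq_of_contactAt (h : ∀ k, ContactAt k q₀ f g) : f =ᶠ[𝓝 q₀] g := by
  obtain ⟨u, v, hu, hv, -⟩ := h 0
  have : u = v := by
    rw [← sub_eq_zero]
    refine eq_zero_of_timeVar_pow_dvd fun k => ?_
    -- The representing series are unique, so the pair of series does not depend on `k`.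
    obtain ⟨u', v', hu', hv', huv'⟩ := h k
    rwa [hu.unique hu', hv.unique hv']
  subst this
  exact hu.eventuallyEq hv

end Coordinates

/-! ### The evolution equations with the shift terms as Lie derivatives. -/

section EvolutionInCoordinates

open Topology Filter

variable {n : ℕ}

/-- The evolution equations at a point, in coordinates. -/
def EvolutionAt (Nc : EuclideanSpace ℝ (Fin n) × ℝ → ℝ)
    (βc : EuclideanSpace ℝ (Fin n) × ℝ → Fin n → ℝ)
    (ρc gc Kc : EuclideanSpace ℝ (Fin n) × ℝ → Matrix (Fin n) (Fin n) ℝ)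
    (q : EuclideanSpace ℝ (Fin n) × ℝ) : Prop :=
  ∀ i j : Fin n,
    let βlow : EuclideanSpace ℝ (Fin n) × ℝ → Fin n → ℝ := fun z => (gc z).mulVec (βc z)
    pd spacetimeDir (Sum.inr ()) (fun z => gc z i j) q =
        -2 * Nc q * Kc q i j
          + covDerivCovector sliceDir gc βlow i j q + covDerivCovector sliceDir gc βlow j i q ∧
    pd spacetimeDir (Sum.inr ()) (fun z => Kc z i j) q =
        Nc q * (ricci sliceDir gc i j q - 2 * (Kc q * (gc q)⁻¹ * Kc q) i j
            + Kc q i j * tr gc Kc q)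
          - covDerivCovector sliceDir gc (fun z k => pd sliceDir k Nc z) i j q
          + ∑ h, (βc q h * covDerivTensor sliceDir gc Kc h i j q
            + Kc q i h * covDerivVector sliceDir gc βc j h q
            + Kc q h j * covDerivVector sliceDir gc βc i h q)
          - Nc q * ρc q i j

/-- The right-hand side of the evolution equation of the metric, without Christoffel symbols. -/
def metricRate (N : EuclideanSpace ℝ (Fin n) × ℝ → ℝ)
    (β : EuclideanSpace ℝ (Fin n) × ℝ → Fin n → ℝ)
    (g K : EuclideanSpace ℝ (Fin n) × ℝ → Matrix (Fin n) (Fin n) ℝ) (i j : Fin n)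
    (q : EuclideanSpace ℝ (Fin n) × ℝ) : ℝ :=
  -2 * (N q * K q i j) + ∑ h, (β q h * pd sliceDir h (fun z => g z i j) q
    + (pd sliceDir j (fun z => β z h) q * g q i h + pd sliceDir i (fun z => β z h) q * g q h j))

/-- The right-hand side of the evolution equation of the extrinsic curvature. -/
def curvatureRate (N : EuclideanSpace ℝ (Fin n) × ℝ → ℝ)
    (β : EuclideanSpace ℝ (Fin n) × ℝ → Fin n → ℝ)
    (ρ g K : EuclideanSpace ℝ (Fin n) × ℝ → Matrix (Fin n) (Fin n) ℝ) (i j : Fin n)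
    (q : EuclideanSpace ℝ (Fin n) × ℝ) : ℝ :=
  N q * (ricci sliceDir g i j q - 2 * (∑ a, ∑ c, K q i a * (g q)⁻¹ a c * K q c j)
      + K q i j * ∑ a, ∑ c, (g q)⁻¹ a c * K q a c)
    - (pd sliceDir i (pd sliceDir j N) q - ∑ l, christoffel sliceDir g l i j q * pd sliceDir l N q)
    + ∑ h, (β q h * pd sliceDir h (fun z => K z i j) q
      + (K q i h * pd sliceDir j (fun z => β z h) q + K q h j * pd sliceDir i (fun z => β z h) q))
    - N q * ρ q i j

variable {N : EuclideanSpace ℝ (Fin n) × ℝ → ℝ} {β : EuclideanSpace ℝ (Fin n) × ℝ → Fin n → ℝ}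
  {ρ g K : EuclideanSpace ℝ (Fin n) × ℝ → Matrix (Fin n) (Fin n) ℝ}
  {q : EuclideanSpace ℝ (Fin n) × ℝ}

/-- Both sides are the Lie derivative of `g` along `β`, from which the Christoffel symbols drop out.
-/
theorem covDerivCovector_shift (hg : IsMetricAt g q) (hβ : ∀ h, AnalyticAt ℝ (fun z => β z h) q)
    (i j : Fin n) :
    covDerivCovector sliceDir g (fun z => (g z).mulVec (β z)) i j q
      + covDerivCovector sliceDir g (fun z => (g z).mulVec (β z)) j i q =
    ∑ h, (β q h * pd sliceDir h (fun z => g z i j) q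
    + (pd sliceDir j (fun z => β z h) q * g q i h + pd sliceDir i (fun z => β z h) q * g q h j)) := by
  have h1 : ∀ i j, pd sliceDir i (fun z => (g z).mulVec (β z) j) q =
      ∑ h, (pd sliceDir i (fun z => g z j h) q * β q h
        + g q j h * pd sliceDir i (fun z => β z h) q) := by
    intro i j
    simp only [Matrix.mulVec, dotProduct]
    rw [pd_sum (fun h => (hg.analytic j h).fun_mul (hβ h))]
    exact Finset.sum_congr rfl fun h _ => pd_mul (hg.analytic j h) (hβ h)
  have h2 : ∀ i j, ∑ l, christoffel sliceDir g l i j q * (g q).mulVec (β q) l =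
      ∑ h, β q h * (1 / 2 * (pd sliceDir i (fun z => g z j h) q + pd sliceDir j (fun z => g z i h) q
        - pd sliceDir h (fun z => g z i j) q)) := by
    intro i j
    simp only [Matrix.mulVec, dotProduct, Finset.mul_sum]
    rw [Finset.sum_comm]
    refine Finset.sum_congr rfl fun h _ => ?_
    rw [← hg.sum_mul_christoffel, Finset.mul_sum]
    refine Finset.sum_congr rfl fun l _ => ?_
    rw [hg.symm.self_of_nhds h l]
    ring
  unfold covDerivCovector
  rw [h1, h1, h2, h2, ← Finset.sum_sub_distrib, ← Finset.sum_sub_distrib, ← Finset.sum_add_distrib]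
  refine Finset.sum_congr rfl fun h _ => ?_
  rw [hg.pd_symm h j i, hg.symm.self_of_nhds j h]
  ring

/-- Both sides are the Lie derivative of `K` along `β`; since the connection has no torsion,
covariant derivatives may be replaced by partial ones. -/
theorem covDeriv_lie (hg : IsMetricAt g q) (i j : Fin n) :
    ∑ h, (β q h * covDerivTensor sliceDir g K h i j q
            + K q i h * covDerivVector sliceDir g β j h q
            + K q h j * covDerivVector sliceDir g β i h q) =
    ∑ h, (β q h * pd sliceDir h (fun z => K z i j) q
      + (K q i h * pd sliceDir j (fun z => β z h) q
        + K q h j * pd sliceDir i (fun z => β z h) q)) := by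
  unfold covDerivTensor covDerivVector
  simp only [mul_sub, mul_add, Finset.sum_add_distrib, Finset.sum_sub_distrib, Finset.mul_sum]
  have h1 : ∑ h, ∑ m, β q h * (christoffel sliceDir g m h i q * K q m j) =
      ∑ h, ∑ l, K q h j * (christoffel sliceDir g h i l q * β q l) := by
    rw [Finset.sum_comm]
    refine Finset.sum_congr rfl fun m _ => Finset.sum_congr rfl fun h _ => ?_
    rw [hg.christoffel_symm m h i]
    ring
  have h2 : ∑ h, ∑ m, β q h * (christoffel sliceDir g m h j q * K q i m) =
      ∑ h, ∑ l, K q i h * (christoffel sliceDir g h j l q * β q l) := by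
    rw [Finset.sum_comm]
    refine Finset.sum_congr rfl fun m _ => Finset.sum_congr rfl fun h _ => ?_
    rw [hg.christoffel_symm m h j]
    ring
  rw [h1, h2]
  ring

theorem evolutionAt_iff (hg : IsMetricAt g q) (hβ : ∀ h, AnalyticAt ℝ (fun z => β z h) q) :
    EvolutionAt N β ρ g K q ↔ ∀ i j,
      pd spacetimeDir (Sum.inr ()) (fun z => g z i j) q = metricRate N β g K i j q ∧
      pd spacetimeDir (Sum.inr ()) (fun z => K z i j) q = curvatureRate N β ρ g K i j q := by
  unfold EvolutionAt metricRate curvatureRate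
  refine forall_congr' fun i => forall_congr' fun j => ?_
  have h1 := covDerivCovector_shift hg hβ i j
  have h2 := covDeriv_lie (β := β) (K := K) hg i j
  have h3 : (K q * (g q)⁻¹ * K q) i j = ∑ a, ∑ c, K q i a * (g q)⁻¹ a c * K q c j := by
    simp only [Matrix.mul_apply, Finset.sum_mul]
    exact Finset.sum_comm
  dsimp only
  rw [add_assoc (-2 * N q * K q i j), h1, h2, h3, mul_assoc (-2 : ℝ)]
  rfl

end EvolutionInCoordinates

/-! ### The right-hand sides over an arbitrary algebra, to be used for series and for functions
alike. -/

section Jets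

variable {n : ℕ} {R : Type*} [CommRing R] [Algebra ℝ R]

/-- Christoffel symbols from the inverse metric and the derivatives of the metric. -/
def jetChr (γ : Fin n → Fin n → R) (d : Fin n → Fin n → Fin n → R) (l i j : Fin n) : R :=
  (1 / 2 : ℝ) • ∑ m, γ l m * (d i j m + d j i m - d m i j)

/-- The Ricci tensor from the Christoffel symbols. -/
def jetRicci (D : Fin n → R → R) (Γ : Fin n → Fin n → Fin n → R) (i j : Fin n) : R :=
  ∑ l, (D l (Γ l i j) - D i (Γ l j l)) + ∑ l, ∑ m, (Γ l i j * Γ m l m - Γ l i m * Γ m j l)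

/-- The rate of change of the metric. -/
def jetRate (N : R) (β : Fin n → R) (Dβ : Fin n → Fin n → R) (g K : Fin n → Fin n → R)
    (d : Fin n → Fin n → Fin n → R) (i j : Fin n) : R :=
  (-2 : ℝ) • (N * K i j) + ∑ h, (β h * d h i j + (Dβ j h * g i h + Dβ i h * g h j))

/-- The rate of change of the extrinsic curvature. -/
def jetCurv (D : Fin n → R → R) (N : R) (DN : Fin n → R) (β : Fin n → R) (Dβ : Fin n → Fin n → R)
    (ρ γ K : Fin n → Fin n → R) (Γ : Fin n → Fin n → Fin n → R) (i j : Fin n) : R :=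
  N * (jetRicci D Γ i j - (2 : ℝ) • (∑ a, ∑ c, K i a * γ a c * K c j)
      + K i j * ∑ a, ∑ c, γ a c * K a c)
    - (D i (DN j) - ∑ l, Γ l i j * DN l)
    + ∑ h, (β h * D h (K i j) + (K i h * Dβ j h + K h j * Dβ i h))
    - N * ρ i j

end Jets

/-! ### The first order system and its formal solution. -/

section FormalEvolution

open MvPowerSeries Topology Filter
open scoped NNReal ENNReal

variable {n : ℕ}

/-- The unknowns of the first order evolution system: the metric, its inverse, the extrinsic
curvature and the derivatives of the metric. -/
abbrev Unknown (n : ℕ) := (Fin n × Fin n) ⊕ (Fin n × Fin n) ⊕ (Fin n × Fin n) ⊕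
  (Fin n × Fin n × Fin n)

/-- `c` and its space derivatives have finite norm. -/
def IsTameConst {ι : Type*} [Fintype ι] (r : ℝ≥0) (c : MvPowerSeries (ι ⊕ Unit) ℝ) : Prop :=
  wnorm r 1 c < ⊤ ∧ ∀ i : ι, wnorm r 1 (pderiv ℝ (Sum.inl i) c) < ⊤

theorem RepAt.pnorm_lt_top {q₀ : EuclideanSpace ℝ (Fin n) × ℝ}
    {u : MvPowerSeries (Fin n ⊕ Unit) ℝ} {f} (h : RepAt q₀ u f) :
    ∃ s : ℝ≥0, 0 < s ∧ pnorm s u < ⊤ := h.1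

/-- Stated for all small `r`, so that the finitely many coefficients of the system can share one
radius. -/
theorem RepAt.eventually_isTameConst {q₀ : EuclideanSpace ℝ (Fin n) × ℝ}
    {u : MvPowerSeries (Fin n ⊕ Unit) ℝ} {f} (h : RepAt q₀ u f) :
    ∀ᶠ r in 𝓝[>] (0 : ℝ≥0), IsTameConst r u := by
  have key : ∀ {v : MvPowerSeries (Fin n ⊕ Unit) ℝ} {f'}, RepAt q₀ v f' →
      ∀ᶠ r in 𝓝[>] (0 : ℝ≥0), wnorm r 1 v < ⊤ := by
    intro v f' hv
    obtain ⟨s, hs, hsv⟩ := hv.pnorm_lt_top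
    filter_upwards [Ioo_mem_nhdsGT hs] with r hr
    exact (wnorm_one_le_pnorm r v).trans_lt ((pnorm_mono hr.2.le v).trans_lt hsv)
  exact (key h).and (eventually_all.2 fun i => key (h.pd (Sum.inl i)))

theorem IsTameConst.isTameOne {ι B : Type*} [Fintype ι] {r : ℝ≥0}
    {c : MvPowerSeries (ι ⊕ Unit) ℝ} (h : IsTameConst r c) :
    IsTameOne r (fun _ : B → MvPowerSeries (ι ⊕ Unit) ℝ => c) := IsTameOne.const h.1 h.2

/-- The formal space derivatives. -/
abbrev spaceDeriv (i : Fin n) (u : MvPowerSeries (Fin n ⊕ Unit) ℝ) :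
    MvPowerSeries (Fin n ⊕ Unit) ℝ := pderiv ℝ (Sum.inl i) u

section Tame

variable {B : Type*} {r : ℝ≥0}

/-- Maps from families of series to series. -/
local notation "𝓜" => (B → MvPowerSeries (Fin n ⊕ Unit) ℝ) → MvPowerSeries (Fin n ⊕ Unit) ℝ

theorem isTameOne_jetChr {γ : Fin n → Fin n → 𝓜} {d : Fin n → Fin n → Fin n → 𝓜}
    (hγ : ∀ i j, IsTameOne r (γ i j)) (hd : ∀ k i j, IsTameOne r (d k i j)) (l i j : Fin n) :
    IsTameOne r (fun u => jetChr (fun i j => γ i j u) (fun k i j => d k i j u) l i j) := by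
  unfold jetChr
  exact (IsTameOne.sum _ fun m => (hγ _ _).mul (((hd _ _ _).add (hd _ _ _)).sub (hd _ _ _))).smul _

/-- The Ricci tensor differentiates `Γ` once, and `Γ` is polynomial in the unknowns `γ` and `d`; in
these variables only one derivative is lost. -/
theorem isQuasilinear_jetRicci {Γ : Fin n → Fin n → Fin n → 𝓜}
    (hΓ : ∀ k i j, IsTameOne r (Γ k i j)) (i j : Fin n) :
    IsQuasilinear r (fun u => jetRicci spaceDeriv (fun k i j => Γ k i j u) i j) := by
  unfold jetRicci
  exact (IsQuasilinear.sum _ fun l => ((hΓ _ _ _).deriv _).sub ((hΓ _ _ _).deriv _)).add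
    (IsTameOne.sum _ fun l => IsTameOne.sum _ fun m =>
      ((hΓ _ _ _).mul (hΓ _ _ _)).sub ((hΓ _ _ _).mul (hΓ _ _ _))).quasilinear

theorem isTameOne_jetRate {N : 𝓜} {β : Fin n → 𝓜} {Dβ g K : Fin n → Fin n → 𝓜}
    {d : Fin n → Fin n → Fin n → 𝓜} (hN : IsTameOne r N) (hβ : ∀ i, IsTameOne r (β i))
    (hDβ : ∀ i j, IsTameOne r (Dβ i j)) (hg : ∀ i j, IsTameOne r (g i j))
    (hK : ∀ i j, IsTameOne r (K i j)) (hd : ∀ k i j, IsTameOne r (d k i j)) (i j : Fin n) :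
    IsTameOne r (fun u => jetRate (N u) (fun i => β i u) (fun i j => Dβ i j u) (fun i j => g i j u)
      (fun i j => K i j u) (fun k i j => d k i j u) i j) := by
  unfold jetRate
  exact ((hN.mul (hK _ _)).smul _).add (IsTameOne.sum _ fun h => ((hβ _).mul (hd _ _ _)).add
    (((hDβ _ _).mul (hg _ _)).add ((hDβ _ _).mul (hg _ _))))

theorem isQuasilinear_jetCurv {N : 𝓜} {DN β : Fin n → 𝓜} {Dβ ρ γ K : Fin n → Fin n → 𝓜}
    {Γ : Fin n → Fin n → Fin n → 𝓜} (hN : IsTameOne r N) (hDN : ∀ i, IsTameOne r (DN i))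
    (hβ : ∀ i, IsTameOne r (β i)) (hDβ : ∀ i j, IsTameOne r (Dβ i j))
    (hρ : ∀ i j, IsTameOne r (ρ i j)) (hγ : ∀ i j, IsTameOne r (γ i j))
    (hK : ∀ i j, IsTameOne r (K i j)) (hΓ : ∀ k i j, IsTameOne r (Γ k i j)) (i j : Fin n) :
    IsQuasilinear r (fun u => jetCurv spaceDeriv (N u) (fun i => DN i u) (fun i => β i u)
      (fun i j => Dβ i j u) (fun i j => ρ i j u) (fun i j => γ i j u) (fun i j => K i j u)
      (fun k i j => Γ k i j u) i j) := by
  unfold jetCurv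
  refine (((hN.tame.mul_quasilinear (((isQuasilinear_jetRicci hΓ i j).sub
    ((IsTameOne.sum _ fun a => IsTameOne.sum _ fun c =>
      ((hK _ _).mul (hγ _ _)).mul (hK _ _)).smul _).quasilinear).add
    ((hK _ _).mul (IsTameOne.sum _ fun a => IsTameOne.sum _ fun c =>
      (hγ _ _).mul (hK _ _))).quasilinear)).sub
    (((hDN j).deriv i).sub (IsTameOne.sum _ fun l => (hΓ _ _ _).mul (hDN _)).quasilinear)).add
    (IsQuasilinear.sum _ fun h => ((hβ h).tame.mul_quasilinear ((hK _ _).deriv h)).add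
      (((hK _ _).mul (hDβ _ _)).add ((hK _ _).mul (hDβ _ _))).quasilinear)).sub
    (hN.mul (hρ _ _)).quasilinear

end Tame

/-- Formal solutions of the first order evolution system. -/
theorem exists_formal_evolution {r : ℝ≥0} (hr : 0 < r) {N : MvPowerSeries (Fin n ⊕ Unit) ℝ}
    {β : Fin n → MvPowerSeries (Fin n ⊕ Unit) ℝ}
    {ρ g₀ γ₀ K₀ : Fin n → Fin n → MvPowerSeries (Fin n ⊕ Unit) ℝ}
    (hN : IsTameConst r N) (hDN : ∀ i, IsTameConst r (spaceDeriv i N))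
    (hβ : ∀ i, IsTameConst r (β i)) (hDβ : ∀ i j, IsTameConst r (spaceDeriv i (β j)))
    (hρ : ∀ i j, IsTameConst r (ρ i j)) (hg₀ : ∀ i j, IsTameConst r (g₀ i j))
    (hγ₀ : ∀ i j, IsTameConst r (γ₀ i j)) (hK₀ : ∀ i j, IsTameConst r (K₀ i j))
    (htg : ∀ i j, pderiv ℝ (Sum.inr ()) (g₀ i j) = 0)
    (htγ : ∀ i j, pderiv ℝ (Sum.inr ()) (γ₀ i j) = 0)
    (htK : ∀ i j, pderiv ℝ (Sum.inr ()) (K₀ i j) = 0) :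
    ∃ (g γ K : Fin n → Fin n → MvPowerSeries (Fin n ⊕ Unit) ℝ)
      (d : Fin n → Fin n → Fin n → MvPowerSeries (Fin n ⊕ Unit) ℝ) (s : ℝ≥0), 0 < s ∧
      (∀ i j, pnorm s (g i j) < ⊤ ∧ pnorm s (γ i j) < ⊤ ∧ pnorm s (K i j) < ⊤) ∧
      (∀ i j, timeVar ∣ g i j - g₀ i j ∧ timeVar ∣ γ i j - γ₀ i j ∧ timeVar ∣ K i j - K₀ i j) ∧
      (∀ k i j, timeVar ∣ d k i j - spaceDeriv k (g₀ i j)) ∧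
      (∀ i j, pderiv ℝ (Sum.inr ()) (g i j) =
        jetRate N β (fun i j => spaceDeriv i (β j)) g K d i j) ∧
      (∀ i j, pderiv ℝ (Sum.inr ()) (γ i j) =
        -∑ a, ∑ c, γ i a * jetRate N β (fun i j => spaceDeriv i (β j)) g K d a c * γ c j) ∧
      (∀ k i j, pderiv ℝ (Sum.inr ()) (d k i j) =
        spaceDeriv k (jetRate N β (fun i j => spaceDeriv i (β j)) g K d i j)) ∧
      (∀ i j, pderiv ℝ (Sum.inr ()) (K i j) = (1 / 2 : ℝ) •
        (jetCurv spaceDeriv N (fun i => spaceDeriv i N) β (fun i j => spaceDeriv i (β j)) ρ γ K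
          (jetChr γ d) i j +
        jetCurv spaceDeriv N (fun i => spaceDeriv i N) β (fun i j => spaceDeriv i (β j)) ρ γ K
          (jetChr γ d) j i)) := by
  let R := MvPowerSeries (Fin n ⊕ Unit) ℝ
  let pg : (Unknown n → R) → Fin n → Fin n → R := fun u i j => u (.inl (i, j))
  let pγ : (Unknown n → R) → Fin n → Fin n → R := fun u i j => u (.inr (.inl (i, j)))
  let pK : (Unknown n → R) → Fin n → Fin n → R := fun u i j => u (.inr (.inr (.inl (i, j))))
  let pdd : (Unknown n → R) → Fin n → Fin n → Fin n → R :=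
    fun u k i j => u (.inr (.inr (.inr (k, i, j))))
  let S : (Unknown n → R) → Fin n → Fin n → R := fun u =>
    jetRate N β (fun i j => spaceDeriv i (β j)) (pg u) (pK u) (pdd u)
  let Q : (Unknown n → R) → Fin n → Fin n → R := fun u =>
    jetCurv spaceDeriv N (fun i => spaceDeriv i N) β (fun i j => spaceDeriv i (β j)) ρ (pγ u)
      (pK u) (jetChr (pγ u) (pdd u))
  let u₀ : Unknown n → R := Sum.elim (fun p => g₀ p.1 p.2) (Sum.elim (fun p => γ₀ p.1 p.2)
    (Sum.elim (fun p => K₀ p.1 p.2) (fun p => spaceDeriv p.1 (g₀ p.2.1 p.2.2))))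
  -- The equations for the auxiliary unknowns are `∂_t γ = -γ (∂_t g) γ` and `∂_t d_k = ∂_k (∂_t
  -- g)`, with `∂_t g` replaced by its rate. The rate of `K` is symmetrized, so that `K` comes out
  -- symmetric before `g` is known to be symmetric and `γ` to be its inverse.
  let Θ : Unknown n → (Unknown n → R) → R := Sum.elim (fun p u => S u p.1 p.2)
    (Sum.elim (fun p u => -∑ a, ∑ c, pγ u p.1 a * S u a c * pγ u c p.2)
    (Sum.elim (fun p u => (1 / 2 : ℝ) • (Q u p.1 p.2 + Q u p.2 p.1))
      (fun p u => spaceDeriv p.1 (S u p.2.1 p.2.2))))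
  have hS : ∀ i j, IsTameOne r (fun u => S u i j) := fun i j =>
    isTameOne_jetRate (N := fun _ => N) (β := fun i _ => β i)
      (Dβ := fun i j _ => spaceDeriv i (β j)) (g := fun i j u => pg u i j)
      (K := fun i j u => pK u i j) (d := fun k i j u => pdd u k i j)
      hN.isTameOne (fun i => (hβ i).isTameOne) (fun i j => (hDβ i j).isTameOne)
      (fun i j => IsTameOne.proj _) (fun i j => IsTameOne.proj _) (fun k i j => IsTameOne.proj _) i j
  have hQ : ∀ i j, IsQuasilinear r (fun u => Q u i j) := fun i j =>
    isQuasilinear_jetCurv (N := fun _ => N) (DN := fun i _ => spaceDeriv i N) (β := fun i _ => β i)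
      (Dβ := fun i j _ => spaceDeriv i (β j)) (ρ := fun i j _ => ρ i j) (γ := fun i j u => pγ u i j)
      (K := fun i j u => pK u i j) (Γ := fun l i j u => jetChr (pγ u) (pdd u) l i j)
      hN.isTameOne (fun i => (hDN i).isTameOne) (fun i => (hβ i).isTameOne)
      (fun i j => (hDβ i j).isTameOne) (fun i j => (hρ i j).isTameOne)
      (fun i j => IsTameOne.proj _) (fun i j => IsTameOne.proj _)
      (fun l i j => isTameOne_jetChr (γ := fun i j u => pγ u i j) (d := fun k i j u => pdd u k i j)
        (fun i j => IsTameOne.proj _) (fun k i j => IsTameOne.proj _) l i j) i j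
  have hΘ : ∀ b, IsQuasilinear r (Θ b) := by
    rintro (p | p | p | p)
    · exact (hS _ _).quasilinear
    · exact (IsTameOne.sum _ fun a => IsTameOne.sum _ fun c =>
        ((IsTameOne.proj _).mul (hS _ _)).mul (IsTameOne.proj _)).neg.quasilinear
    · exact ((hQ _ _).add (hQ _ _)).smul _
    · exact (hS _ _).deriv _
  have hu₀ : ∀ b, wnorm r 1 (u₀ b) < ⊤ := by
    rintro (p | p | p | p)
    · exact (hg₀ _ _).1
    · exact (hγ₀ _ _).1
    · exact (hK₀ _ _).1
    · exact (hg₀ _ _).2 _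
  -- The data do not depend on `t`, so differentiating the fixed point equation in time returns
  -- exactly `Θ`.
  have htu₀ : ∀ b, pderiv ℝ (Sum.inr ()) (u₀ b) = 0 := by
    rintro (p | p | p | p)
    · exact htg _ _
    · exact htγ _ _
    · exact htK _ _
    · change pderiv ℝ (Sum.inr ()) (pderiv ℝ (Sum.inl p.1) (g₀ p.2.1 p.2.2)) = 0
      have h := htg p.2.1 p.2.2
      ext m
      have h2 := congrArg (coeff (m + Finsupp.single (Sum.inl p.1) 1)) h
      rw [coeff_pderiv, map_zero] at h2
      rw [coeff_pderiv, coeff_pderiv, map_zero, add_right_comm]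
      have h3 := (mul_eq_zero.1 h2).resolve_right (by positivity)
      rw [h3, zero_mul, zero_mul]
  obtain ⟨ε, hε, u, hfin, hu⟩ := formal_cauchy_kovalevskaya u₀ hu₀ Θ hΘ
  have hdiv : ∀ b, timeVar ∣ u b - u₀ b := fun b => by
    rw [hu b, add_sub_cancel_left]
    exact timeVar_dvd_tint _
  have hder : ∀ b, pderiv ℝ (Sum.inr ()) (u b) = Θ b u := fun b => by
    conv_lhs => rw [hu b, map_add, htu₀, pderiv_tint, zero_add]
  -- The comparison with `pnorm` needs `ε ≤ 1`, whence the minimum.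
  have hpn : ∀ b, pnorm (r * min ε 1 / 2) (u b) < ⊤ := fun b =>
    (pnorm_le_wnorm r (min ε 1) (min_le_right _ _) _).trans_lt
      ((wnorm_mono r (min_le_left _ _) _).trans_lt (hfin b))
  exact ⟨pg u, pγ u, pK u, pdd u, r * min ε 1 / 2, by positivity,
    fun i j => ⟨hpn _, hpn _, hpn _⟩, fun i j => ⟨hdiv _, hdiv _, hdiv _⟩, fun k i j => hdiv _,
    fun i j => hder _, fun i j => hder _, fun k i j => hder _, fun i j => hder _⟩

end FormalEvolution

/-! ### Propagation of relations from the initial slice. -/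

section FormalConsequences

open MvPowerSeries

variable {n : ℕ}

/-- A formal Gronwall argument: quantities that vanish at `t = 0`, and whose time derivatives are as
small in powers of `t` as they are themselves, vanish. A linear homogeneous system without time
derivatives on its right-hand side satisfies the second condition. -/
theorem eq_zero_of_timeVar_steps {A : Type*} {w : A → MvPowerSeries (Fin n ⊕ Unit) ℝ}
    (h0 : ∀ a, timeVar ∣ w a)
    (h : ∀ k, (∀ a, timeVar ^ k ∣ w a) → ∀ a, timeVar ^ k ∣ pderiv ℝ (Sum.inr ()) (w a)) (a : A) :
    w a = 0 := by
  have h1 : ∀ k, ∀ a, timeVar ^ k ∣ w a := by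
    intro k
    induction k with
    | zero => intro a; simp
    | succ k ih => exact fun a => timeVar_pow_succ_dvd (h0 a) (h k ih a)
  exact eq_zero_of_timeVar_pow_dvd fun k => h1 k a

theorem pderiv_comm' (i j : Fin n ⊕ Unit) (u : MvPowerSeries (Fin n ⊕ Unit) ℝ) :
    pderiv ℝ i (pderiv ℝ j u) = pderiv ℝ j (pderiv ℝ i u) := by
  classical
  ext m
  rw [coeff_pderiv, coeff_pderiv, coeff_pderiv, coeff_pderiv, add_right_comm]
  simp only [Finsupp.add_apply]
  by_cases h : i = j
  · subst h; ring
  · rw [Finsupp.single_eq_of_ne h, Finsupp.single_eq_of_ne (Ne.symm h)]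
    push_cast
    ring

end FormalConsequences

/-! ### Local existence for the evolution equations in coordinates. -/

section LocalExistence

open MvPowerSeries Topology Filter
open scoped NNReal ENNReal

variable {n : ℕ} {q₀ : EuclideanSpace ℝ (Fin n) × ℝ}

/-- The expressions are built from algebraic operations and space derivatives, each of which
respects `RepAt`; the proofs of this and the following statements mirror the expressions. -/
theorem RepAt.jetChr {γ : Fin n → Fin n → MvPowerSeries (Fin n ⊕ Unit) ℝ}
    {d : Fin n → Fin n → Fin n → MvPowerSeries (Fin n ⊕ Unit) ℝ}
    {γ' : Fin n → Fin n → EuclideanSpace ℝ (Fin n) × ℝ → ℝ}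
    {d' : Fin n → Fin n → Fin n → EuclideanSpace ℝ (Fin n) × ℝ → ℝ}
    (hγ : ∀ i j, RepAt q₀ (γ i j) (γ' i j)) (hd : ∀ k i j, RepAt q₀ (d k i j) (d' k i j))
    (l i j : Fin n) :
    RepAt q₀ (EinsteinCauchy.jetChr γ d l i j) (EinsteinCauchy.jetChr γ' d' l i j) :=
  (RepAt.sum fun _ => (hγ _ _).mul (((hd _ _ _).add (hd _ _ _)).sub (hd _ _ _))).smul _

theorem RepAt.jetRate {N : MvPowerSeries (Fin n ⊕ Unit) ℝ}
    {β : Fin n → MvPowerSeries (Fin n ⊕ Unit) ℝ}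
    {g K Dβ : Fin n → Fin n → MvPowerSeries (Fin n ⊕ Unit) ℝ}
    {d : Fin n → Fin n → Fin n → MvPowerSeries (Fin n ⊕ Unit) ℝ}
    {N' : EuclideanSpace ℝ (Fin n) × ℝ → ℝ} {β' : Fin n → EuclideanSpace ℝ (Fin n) × ℝ → ℝ}
    {g' K' Dβ' : Fin n → Fin n → EuclideanSpace ℝ (Fin n) × ℝ → ℝ}
    {d' : Fin n → Fin n → Fin n → EuclideanSpace ℝ (Fin n) × ℝ → ℝ}
    (hN : RepAt q₀ N N') (hβ : ∀ i, RepAt q₀ (β i) (β' i))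
    (hDβ : ∀ i j, RepAt q₀ (Dβ i j) (Dβ' i j)) (hg : ∀ i j, RepAt q₀ (g i j) (g' i j))
    (hK : ∀ i j, RepAt q₀ (K i j) (K' i j)) (hd : ∀ k i j, RepAt q₀ (d k i j) (d' k i j))
    (i j : Fin n) :
    RepAt q₀ (EinsteinCauchy.jetRate N β Dβ g K d i j)
      (EinsteinCauchy.jetRate N' β' Dβ' g' K' d' i j) :=
  ((hN.mul (hK _ _)).smul _).add (RepAt.sum fun _ => ((hβ _).mul (hd _ _ _)).add
    (((hDβ _ _).mul (hg _ _)).add ((hDβ _ _).mul (hg _ _))))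

theorem RepAt.jetRicci {Γ : Fin n → Fin n → Fin n → MvPowerSeries (Fin n ⊕ Unit) ℝ}
    {Γ' : Fin n → Fin n → Fin n → EuclideanSpace ℝ (Fin n) × ℝ → ℝ}
    (hΓ : ∀ k i j, RepAt q₀ (Γ k i j) (Γ' k i j)) (i j : Fin n) :
    RepAt q₀ (EinsteinCauchy.jetRicci spaceDeriv Γ i j)
      (EinsteinCauchy.jetRicci (EinsteinCauchy.pd sliceDir) Γ' i j) :=
  (RepAt.sum fun l => ((hΓ _ _ _).pd (Sum.inl l)).sub ((hΓ _ _ _).pd (Sum.inl i))).add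
    (RepAt.sum fun _ => RepAt.sum fun _ =>
      ((hΓ _ _ _).mul (hΓ _ _ _)).sub ((hΓ _ _ _).mul (hΓ _ _ _)))

theorem RepAt.jetCurv {N : MvPowerSeries (Fin n ⊕ Unit) ℝ}
    {DN β : Fin n → MvPowerSeries (Fin n ⊕ Unit) ℝ}
    {Dβ ρ γ K : Fin n → Fin n → MvPowerSeries (Fin n ⊕ Unit) ℝ}
    {Γ : Fin n → Fin n → Fin n → MvPowerSeries (Fin n ⊕ Unit) ℝ}
    {N' : EuclideanSpace ℝ (Fin n) × ℝ → ℝ} {DN' β' : Fin n → EuclideanSpace ℝ (Fin n) × ℝ → ℝ}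
    {Dβ' ρ' γ' K' : Fin n → Fin n → EuclideanSpace ℝ (Fin n) × ℝ → ℝ}
    {Γ' : Fin n → Fin n → Fin n → EuclideanSpace ℝ (Fin n) × ℝ → ℝ}
    (hN : RepAt q₀ N N') (hDN : ∀ i, RepAt q₀ (DN i) (DN' i)) (hβ : ∀ i, RepAt q₀ (β i) (β' i))
    (hDβ : ∀ i j, RepAt q₀ (Dβ i j) (Dβ' i j)) (hρ : ∀ i j, RepAt q₀ (ρ i j) (ρ' i j))
    (hγ : ∀ i j, RepAt q₀ (γ i j) (γ' i j)) (hK : ∀ i j, RepAt q₀ (K i j) (K' i j))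
    (hΓ : ∀ k i j, RepAt q₀ (Γ k i j) (Γ' k i j)) (i j : Fin n) :
    RepAt q₀ (EinsteinCauchy.jetCurv spaceDeriv N DN β Dβ ρ γ K Γ i j)
      (EinsteinCauchy.jetCurv (EinsteinCauchy.pd sliceDir) N' DN' β' Dβ' ρ' γ' K' Γ' i j) :=
  (((hN.mul (((RepAt.jetRicci hΓ i j).sub ((RepAt.sum fun _ => RepAt.sum fun _ =>
      ((hK _ _).mul (hγ _ _)).mul (hK _ _)).smul _)).add
    ((hK _ _).mul (RepAt.sum fun _ => RepAt.sum fun _ => (hγ _ _).mul (hK _ _))))).sub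
    (((hDN j).pd (Sum.inl i)).sub (RepAt.sum fun _ => (hΓ _ _ _).mul (hDN _)))).add
    (RepAt.sum fun h => ((hβ h).mul ((hK _ _).pd (Sum.inl h))).add
      (((hK _ _).mul (hDβ _ _)).add ((hK _ _).mul (hDβ _ _))))).sub
    (hN.mul (hρ _ _))

theorem jetChr_eq_christoffel {g : EuclideanSpace ℝ (Fin n) × ℝ → Matrix (Fin n) (Fin n) ℝ}
    (l i j : Fin n) :
    jetChr (fun i j q => (g q)⁻¹ i j) (fun k i j => pd sliceDir k (fun z => g z i j)) l i j =
      christoffel sliceDir g l i j := by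
  funext q
  simp [jetChr, christoffel]

/-- Once `g` and `K` are known to be symmetric, this undoes the symmetrization made in
`exists_formal_evolution`. -/
theorem curvatureRate_symm {N : EuclideanSpace ℝ (Fin n) × ℝ → ℝ}
    {β : EuclideanSpace ℝ (Fin n) × ℝ → Fin n → ℝ}
    {ρ g K : EuclideanSpace ℝ (Fin n) × ℝ → Matrix (Fin n) (Fin n) ℝ}
    {q : EuclideanSpace ℝ (Fin n) × ℝ} (hN : AnalyticAt ℝ N q) (hg : IsMetricAt g q)
    (hK : ∀ᶠ z in 𝓝 q, ∀ i j, K z i j = K z j i) (hρ : ∀ i j, ρ q i j = ρ q j i) (i j : Fin n) :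
    curvatureRate N β ρ g K i j q = curvatureRate N β ρ g K j i q := by
  have hKq := hK.self_of_nhds
  unfold curvatureRate
  rw [hg.ricci_symm i j, hKq i j, pd_comm hN, hρ i j]
  have h1 : ∑ a, ∑ c, K q i a * (g q)⁻¹ a c * K q c j =
      ∑ a, ∑ c, K q j a * (g q)⁻¹ a c * K q c i := by
    rw [Finset.sum_comm]
    refine Finset.sum_congr rfl fun c _ => Finset.sum_congr rfl fun a _ => ?_
    rw [hKq i a, hKq c j, hg.inv_symm a c]
    ring
  have h2 : ∀ h, pd sliceDir h (fun z => K z i j) q = pd sliceDir h (fun z => K z j i) q :=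
    fun h => pd_congr (hK.mono fun z hz => hz i j)
  simp only [h1, h2, hg.christoffel_symm _ i j]
  congr 2
  refine Finset.sum_congr rfl fun h _ => ?_
  rw [hKq i h, hKq h j]
  ring

/-- Local existence for the evolution equations, in coordinates. -/
theorem exists_local_evolution {y₀ : EuclideanSpace ℝ (Fin n)}
    {N : EuclideanSpace ℝ (Fin n) × ℝ → ℝ} {β : EuclideanSpace ℝ (Fin n) × ℝ → Fin n → ℝ}
    {ρ : EuclideanSpace ℝ (Fin n) × ℝ → Matrix (Fin n) (Fin n) ℝ}
    {g₀ K₀ : EuclideanSpace ℝ (Fin n) → Matrix (Fin n) (Fin n) ℝ}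
    (hN : AnalyticAt ℝ N (y₀, 0)) (hβ : ∀ h, AnalyticAt ℝ (fun z => β z h) (y₀, 0))
    (hρ : ∀ i j, AnalyticAt ℝ (fun z => ρ z i j) (y₀, 0))
    (hρs : ∀ᶠ z in 𝓝 (y₀, (0 : ℝ)), ∀ i j, ρ z i j = ρ z j i)
    (hg₀ : IsMetricAt g₀ y₀) (hK₀ : ∀ i j, AnalyticAt ℝ (fun y => K₀ y i j) y₀)
    (hK₀s : ∀ᶠ y in 𝓝 y₀, ∀ i j, K₀ y i j = K₀ y j i) :
    ∃ g K : EuclideanSpace ℝ (Fin n) × ℝ → Matrix (Fin n) (Fin n) ℝ,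
      IsMetricAt g (y₀, 0) ∧ (∀ i j, AnalyticAt ℝ (fun z => K z i j) (y₀, 0)) ∧
      (∀ᶠ z in 𝓝 (y₀, (0 : ℝ)), ∀ i j, K z i j = K z j i) ∧
      (∀ᶠ y in 𝓝 y₀, g (y, 0) = g₀ y ∧ K (y, 0) = K₀ y) ∧
      ∀ᶠ z in 𝓝 (y₀, (0 : ℝ)), EvolutionAt N β ρ g K z := by
  have hfst : AnalyticAt ℝ (Prod.fst : EuclideanSpace ℝ (Fin n) × ℝ → _) (y₀, 0) := analyticAt_fst
  -- The initial data are extended to be constant in time.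
  have hlift : ∀ {f : EuclideanSpace ℝ (Fin n) → ℝ}, AnalyticAt ℝ f y₀ →
      ∃ u, RepAt (y₀, (0 : ℝ)) u (fun z => f z.1) ∧ pderiv ℝ (Sum.inr ()) u = 0 := by
    intro f hf
    have h1 : AnalyticAt ℝ (fun z : EuclideanSpace ℝ (Fin n) × ℝ => f z.1) (y₀, 0) :=
      hf.comp_of_eq hfst rfl
    obtain ⟨u, hu⟩ := exists_repAt h1
    refine ⟨u, hu, (hu.pd (Sum.inr ())).unique (RepAt.zero.congr ?_)⟩
    have h2 : ∀ᶠ z : EuclideanSpace ℝ (Fin n) × ℝ in 𝓝 (y₀, 0), AnalyticAt ℝ f z.1 :=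
      (continuous_fst.tendsto (y₀, (0 : ℝ))).eventually hf.eventually_analyticAt
    filter_upwards [h2] with z hz
    have h3 : HasFDerivAt (fun z : EuclideanSpace ℝ (Fin n) × ℝ => f z.1)
        ((fderiv ℝ f z.1).comp (ContinuousLinearMap.fst ℝ _ ℝ)) z :=
      hz.differentiableAt.hasFDerivAt.comp z hasFDerivAt_fst
    simp [pd, h3.fderiv, spacetimeDir]
  obtain ⟨N', hN'⟩ := exists_repAt hN
  choose β' hβ' using fun h => exists_repAt (hβ h)
  choose ρ' hρ' using fun i j => exists_repAt (hρ i j)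
  choose g' hg' htg using fun i j => hlift (hg₀.analytic i j)
  choose γ' hγ' htγ using fun i j => hlift (hg₀.inv_analytic i j)
  choose K' hK' htK using fun i j => hlift (hK₀ i j)
  have hDβ' := fun i j => (hβ' j).pd (Sum.inl i)
  have hDN' := fun i => hN'.pd (Sum.inl i)
  have hmem : ∀ᶠ r in 𝓝[>] (0 : ℝ≥0), 0 < r ∧ IsTameConst r N' ∧
      (∀ i, IsTameConst r (spaceDeriv i N')) ∧ (∀ i, IsTameConst r (β' i)) ∧
      (∀ i j, IsTameConst r (spaceDeriv i (β' j))) ∧ (∀ i j, IsTameConst r (ρ' i j)) ∧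
      (∀ i j, IsTameConst r (g' i j)) ∧ (∀ i j, IsTameConst r (γ' i j)) ∧
      (∀ i j, IsTameConst r (K' i j)) := by
    refine (show ∀ᶠ r in 𝓝[>] (0 : ℝ≥0), 0 < r from self_mem_nhdsWithin).and ?_
    refine hN'.eventually_isTameConst.and ?_
    refine (eventually_all.2 fun i => (hDN' i).eventually_isTameConst).and ?_
    refine (eventually_all.2 fun i => (hβ' i).eventually_isTameConst).and ?_
    refine (eventually_all.2 fun i => eventually_all.2 fun j =>
      (hDβ' i j).eventually_isTameConst).and ?_
    refine (eventually_all.2 fun i => eventually_all.2 fun j =>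
      (hρ' i j).eventually_isTameConst).and ?_
    refine (eventually_all.2 fun i => eventually_all.2 fun j =>
      (hg' i j).eventually_isTameConst).and ?_
    refine (eventually_all.2 fun i => eventually_all.2 fun j =>
      (hγ' i j).eventually_isTameConst).and ?_
    exact eventually_all.2 fun i => eventually_all.2 fun j => (hK' i j).eventually_isTameConst
  obtain ⟨r, hr, c1, c2, c3, c4, c5, c6, c7, c8⟩ := hmem.exists
  obtain ⟨G, Γ, Q, d, s, hs, hfin, hdiv, hdivd, eG, eΓ, ed, eQ⟩ :=
    exists_formal_evolution hr c1 c2 c3 c4 c5 c6 c7 c8 htg htγ htK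
  -- The two sides agree at `t = 0` and have the same time derivative, since `∂_t` and `∂_k`
  -- commute.
  have hd : ∀ k i j, d k i j = spaceDeriv k (G i j) := by
    intro k i j
    rw [← sub_eq_zero]
    refine eq_zero_of_timeVar_steps (A := Unit) (w := fun _ => d k i j - spaceDeriv k (G i j))
      (fun _ => ?_) (fun m _ _ => ?_) ()
    · rw [← sub_sub_sub_cancel_right _ _ (spaceDeriv k (g' i j))]
      refine dvd_sub (hdivd k i j) ?_
      have h1 := timeVar_pow_dvd_pderiv (k := 1) k (by simpa only [pow_one] using (hdiv i j).1)
      rwa [pow_one, map_sub] at h1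
    · rw [map_sub, ed, pderiv_comm', eG, sub_self]
      exact dvd_zero _
  -- The symmetrized rate makes the antisymmetric part of `Q` constant in time.
  have hQs : ∀ i j, Q i j = Q j i := by
    intro i j
    rw [← sub_eq_zero]
    have h1 : K' i j = K' j i := by
      refine (hK' i j).unique ((hK' j i).congr ?_)
      filter_upwards [(continuous_fst.tendsto (y₀, (0 : ℝ))).eventually hK₀s] with z hz
      exact hz j i
    refine eq_zero_of_timeVar_steps (A := Unit) (w := fun _ => Q i j - Q j i)
      (fun _ => ?_) (fun m _ _ => ?_) ()
    · have := dvd_sub (hdiv i j).2.2 (hdiv j i).2.2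
      rwa [h1, sub_sub_sub_cancel_right] at this
    · rw [map_sub, eQ, eQ, add_comm, sub_self]
      exact dvd_zero _
  -- With `Q` symmetric and `d = ∂G`, the antisymmetric part of `G` satisfies a linear homogeneous
  -- equation, namely its Lie transport along `β`.
  have hGs : ∀ i j, G i j = G j i := by
    intro i j
    rw [← sub_eq_zero]
    refine eq_zero_of_timeVar_steps (A := Fin n × Fin n) (w := fun p => G p.1 p.2 - G p.2 p.1)
      (fun p => ?_) (fun m hm p => ?_) (i, j)
    · have h1 : g' p.1 p.2 = g' p.2 p.1 := by
        refine (hg' _ _).unique ((hg' _ _).congr ?_)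
        filter_upwards [(continuous_fst.tendsto (y₀, (0 : ℝ))).eventually hg₀.symm] with z hz
        exact hz _ _
      have := dvd_sub (hdiv p.1 p.2).1 (hdiv p.2 p.1).1
      rwa [h1, sub_sub_sub_cancel_right] at this
    · rw [map_sub, eG, eG]
      unfold jetRate
      rw [hQs p.2 p.1, add_sub_add_left_eq_sub, ← Finset.sum_sub_distrib]
      refine Finset.dvd_sum fun h _ => ?_
      rw [hd, hd, show ∀ b x y D E p1 p2 p3 p4 : MvPowerSeries (Fin n ⊕ Unit) ℝ,
        b * x + (D * p1 + E * p2) - (b * y + (E * p3 + D * p4)) =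
        b * (x - y) + (D * (p1 - p4) + E * (p2 - p3)) from fun _ _ _ _ _ _ _ _ _ => by ring,
        ← map_sub]
      exact dvd_add (Dvd.dvd.mul_left (timeVar_pow_dvd_pderiv h (hm p)) _)
        (dvd_add (Dvd.dvd.mul_left (hm (p.1, h)) _) (Dvd.dvd.mul_left (hm (h, p.2)) _))
  set S := jetRate N' β' (fun i j => spaceDeriv i (β' j)) G Q d with hS
  -- Here `Γ` is the unknown for the inverse metric. With `S` the rate of `G`, the equations give
  -- `∂_t (ΓG - 1) = -Γ S (ΓG - 1)`, which is linear and homogeneous in `ΓG - 1`.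
  have hinv : ∀ i j, ∑ m, Γ i m * G m j = if i = j then 1 else 0 := by
    intro i j
    rw [← sub_eq_zero]
    refine eq_zero_of_timeVar_steps (A := Fin n × Fin n)
      (w := fun p => ∑ m, Γ p.1 m * G m p.2 - if p.1 = p.2 then 1 else 0)
      (fun p => ?_) (fun k hk p => ?_) (i, j)
    · have h1 : ∑ m, γ' p.1 m * g' m p.2 = if p.1 = p.2 then 1 else 0 := by
        refine (RepAt.sum fun m => (hγ' p.1 m).mul (hg' m p.2)).unique
          (RepAt.congr (f := if p.1 = p.2 then 1 else 0) ?_ ?_)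
        · split_ifs
          · exact RepAt.one
          · exact RepAt.zero
        · filter_upwards [(continuous_fst.tendsto (y₀, (0 : ℝ))).eventually hg₀.eventually] with z hz
          have := hz.sum_inv_mul p.1 p.2
          simp only [Finset.sum_apply, Pi.mul_apply]
          rw [this]
          split_ifs <;> rfl
      rw [← h1, ← Finset.sum_sub_distrib]
      refine Finset.dvd_sum fun m _ => ?_
      rw [show Γ p.1 m * G m p.2 - γ' p.1 m * g' m p.2 =
        Γ p.1 m * (G m p.2 - g' m p.2) + (Γ p.1 m - γ' p.1 m) * g' m p.2 by ring]
      exact dvd_add (Dvd.dvd.mul_left (hdiv _ _).1 _) (Dvd.dvd.mul_right (hdiv _ _).2.1 _)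
    · have h1 : pderiv ℝ (Sum.inr ()) (∑ m, Γ p.1 m * G m p.2 -
          (if p.1 = p.2 then 1 else 0 : MvPowerSeries (Fin n ⊕ Unit) ℝ)) =
          -∑ a, ∑ c, Γ p.1 a * S a c * (∑ m, Γ c m * G m p.2 - if c = p.2 then 1 else 0) := by
        have h2 : pderiv ℝ (Sum.inr ())
            (if p.1 = p.2 then 1 else 0 : MvPowerSeries (Fin n ⊕ Unit) ℝ) = 0 := by
          split_ifs
          · exact pderiv_one
          · exact map_zero _
        have h3 : ∑ m, ∑ a, ∑ c, G m p.2 * (Γ p.1 a * S a c * Γ c m) =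
            ∑ a, ∑ c, Γ p.1 a * S a c * ∑ m, Γ c m * G m p.2 := by
          rw [Finset.sum_comm]
          refine Finset.sum_congr rfl fun a _ => ?_
          rw [Finset.sum_comm]
          refine Finset.sum_congr rfl fun c _ => ?_
          rw [Finset.mul_sum]
          exact Finset.sum_congr rfl fun m _ => by ring
        rw [map_sub, h2, map_sum, sub_zero]
        simp only [Derivation.leibniz, eG, eΓ, smul_eq_mul, mul_sub, Finset.sum_sub_distrib,
          Finset.sum_add_distrib, mul_neg, Finset.mul_sum, Finset.sum_neg_distrib] at h3 ⊢
        rw [h3]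
        simp
        ring
      rw [h1]
      refine dvd_neg.2 (Finset.dvd_sum fun a _ => Finset.dvd_sum fun c _ => ?_)
      exact Dvd.dvd.mul_left (hk (c, p.2)) _
  choose g hg using fun i j => exists_function_repAt (y₀, (0 : ℝ)) hs (hfin i j).1
  choose K hK using fun i j => exists_function_repAt (y₀, (0 : ℝ)) hs (hfin i j).2.2
  choose γ hγ using fun i j => exists_function_repAt (y₀, (0 : ℝ)) hs (hfin i j).2.1
  let gm : EuclideanSpace ℝ (Fin n) × ℝ → Matrix (Fin n) (Fin n) ℝ := fun z i j => g i j z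
  let Km : EuclideanSpace ℝ (Fin n) × ℝ → Matrix (Fin n) (Fin n) ℝ := fun z i j => K i j z
  have hinit : ∀ᶠ y in 𝓝 y₀, gm (y, 0) = g₀ y ∧ Km (y, 0) = K₀ y := by
    have h1 : ∀ᶠ y in 𝓝 y₀, ∀ i j, g i j (y, 0) = g₀ y i j := eventually_all.2 fun i =>
      eventually_all.2 fun j => (hg i j).eq_on_slice (hg' i j) (hdiv i j).1
    have h2 : ∀ᶠ y in 𝓝 y₀, ∀ i j, K i j (y, 0) = K₀ y i j := eventually_all.2 fun i =>
      eventually_all.2 fun j => (hK i j).eq_on_slice (hK' i j) (hdiv i j).2.2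
    filter_upwards [h1, h2] with y a c
    exact ⟨by ext i j; exact a i j, by ext i j; exact c i j⟩
  have hmetric : IsMetricAt gm (y₀, 0) := by
    refine ⟨fun i j => (hg i j).analyticAt, eventually_all.2 fun i => eventually_all.2 fun j => ?_,
      ?_⟩
    · exact (hg i j).eventuallyEq (by rw [hGs]; exact hg j i)
    · rw [hinit.self_of_nhds.1]
      exact hg₀.det_ne
  have hKs : ∀ᶠ z in 𝓝 (y₀, (0 : ℝ)), ∀ i j, Km z i j = Km z j i :=
    eventually_all.2 fun i => eventually_all.2 fun j =>
      (hK i j).eventuallyEq (by rw [hQs]; exact hK j i)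
  have hγinv : ∀ i j, RepAt (y₀, (0 : ℝ)) (Γ i j) (fun q => (gm q)⁻¹ i j) := by
    have h1 : ∀ᶠ z in 𝓝 (y₀, (0 : ℝ)), ∀ i j, ∑ m, γ i m z * g m j z = if i = j then 1 else 0 := by
      refine eventually_all.2 fun i => eventually_all.2 fun j => ?_
      have h2 := RepAt.sum (S := Finset.univ) fun m => (hγ i m).mul (hg m j)
      rw [hinv] at h2
      have h3 : RepAt (y₀, (0 : ℝ)) (if i = j then 1 else 0 : MvPowerSeries (Fin n ⊕ Unit) ℝ)
          (if i = j then 1 else 0) := by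
        split_ifs
        · exact RepAt.one
        · exact RepAt.zero
      filter_upwards [h2.eventuallyEq h3] with z hz
      simp only [Finset.sum_apply, Pi.mul_apply] at hz
      rw [hz]
      split_ifs <;> rfl
    intro i j
    refine (hγ i j).congr ?_
    filter_upwards [h1] with z hz
    have h4 : (Matrix.of fun i j => γ i j z) * gm z = 1 := by
      ext a c
      rw [Matrix.mul_apply, Matrix.one_apply]
      exact hz a c
    rw [Matrix.inv_eq_left_inv h4]
    rfl
  have hdd : ∀ k i j, RepAt (y₀, (0 : ℝ)) (d k i j) (pd sliceDir k (fun z => gm z i j)) := by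
    intro k i j
    rw [hd]
    exact (hg i j).pd (Sum.inl k)
  have hrate : ∀ i j, RepAt (y₀, (0 : ℝ)) (pderiv ℝ (Sum.inr ()) (G i j))
      (metricRate N β gm Km i j) := by
    intro i j
    rw [eG, hS]
    refine (RepAt.jetRate hN' hβ' hDβ' hg hK hdd i j).congr (.of_forall fun z => ?_)
    simp [jetRate, metricRate, gm, Km]
    rfl
  have hcurv : ∀ i j, RepAt (y₀, (0 : ℝ)) (jetCurv spaceDeriv N' (fun i => spaceDeriv i N') β'
      (fun i j => spaceDeriv i (β' j)) ρ' Γ Q (jetChr Γ d) i j) (curvatureRate N β ρ gm Km i j) := by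
    intro i j
    have hchr : ∀ l i j, RepAt (y₀, (0 : ℝ)) (jetChr Γ d l i j) (christoffel sliceDir gm l i j) :=
      fun l i j => by
        rw [← jetChr_eq_christoffel]
        exact RepAt.jetChr hγinv hdd l i j
    refine (RepAt.jetCurv hN' hDN' hβ' hDβ' hρ' hγinv hK hchr i j).congr (.of_forall fun z => ?_)
    simp [jetCurv, curvatureRate, jetRicci, ricci, gm, Km]
    rfl
  refine ⟨gm, Km, hmetric, fun i j => (hK i j).analyticAt, hKs, hinit, ?_⟩
  have e1 : ∀ᶠ z in 𝓝 (y₀, (0 : ℝ)), ∀ i j,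
      pd spacetimeDir (Sum.inr ()) (fun z => gm z i j) z = metricRate N β gm Km i j z :=
    eventually_all.2 fun i => eventually_all.2 fun j =>
      ((hg i j).pd (Sum.inr ())).eventuallyEq (hrate i j)
  have e2 : ∀ᶠ z in 𝓝 (y₀, (0 : ℝ)), ∀ i j,
      pd spacetimeDir (Sum.inr ()) (fun z => Km z i j) z =
        1 / 2 * (curvatureRate N β ρ gm Km i j z + curvatureRate N β ρ gm Km j i z) :=
    eventually_all.2 fun i => eventually_all.2 fun j => by
      have h1 := (hK i j).pd (Sum.inr ())
      rw [eQ] at h1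
      exact h1.eventuallyEq (((hcurv i j).add (hcurv j i)).smul _)
  have e3 : ∀ᶠ z in 𝓝 (y₀, (0 : ℝ)), ∀ h, AnalyticAt ℝ (fun z => β z h) z :=
    eventually_all.2 fun h => (hβ h).eventually_analyticAt
  filter_upwards [e1, e2, e3, hmetric.eventually, hN.eventually_analyticAt, hρs,
    hKs.eventually_nhds] with z a1 a2 a3 a4 a5 a6 a7
  rw [evolutionAt_iff a4 a3]
  refine fun i j => ⟨a1 i j, ?_⟩
  rw [a2, curvatureRate_symm a5 a4 a7 a6 j i]
  ring

end LocalExistence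

/-! ### Local uniqueness for the evolution equations in coordinates. -/

section LocalUniqueness

open Topology Filter

variable {n k : ℕ} {q₀ : EuclideanSpace ℝ (Fin n) × ℝ}
  {N : EuclideanSpace ℝ (Fin n) × ℝ → ℝ} {β : EuclideanSpace ℝ (Fin n) × ℝ → Fin n → ℝ}
  {ρ g g' K K' : EuclideanSpace ℝ (Fin n) × ℝ → Matrix (Fin n) (Fin n) ℝ}

/-- By `g⁻¹ = g⁻¹ (g' - g) g'⁻¹ + g'⁻¹`, where the factor `g' - g` has contact of order `k` with `g
- g = 0`. -/
theorem ContactAt.inv (hg : IsMetricAt g q₀) (hg' : IsMetricAt g' q₀)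
    (h : ∀ i j, ContactAt k q₀ (fun z => g z i j) (fun z => g' z i j)) (i j : Fin n) :
    ContactAt k q₀ (fun z => (g z)⁻¹ i j) (fun z => (g' z)⁻¹ i j) := by
  have h1 : ContactAt k q₀ (fun z => ∑ a, ∑ c, (g z)⁻¹ i a * (g' z a c - g z a c) * (g' z)⁻¹ c j)
      (fun z => ∑ a, ∑ c, (g z)⁻¹ i a * (g z a c - g z a c) * (g' z)⁻¹ c j) :=
    ContactAt.sum fun a => ContactAt.sum fun c =>
      ((ContactAt.refl (hg.inv_analytic i a)).mul
        (ContactAt.sub (by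
          obtain ⟨u, v, hu, hv, huv⟩ := h a c
          exact ⟨v, u, hv, hu, by rw [← neg_sub]; exact dvd_neg.2 huv⟩)
          (ContactAt.refl (hg.analytic a c)))).mul
        (ContactAt.refl (hg'.inv_analytic c j))
  have h2 := h1.add (ContactAt.refl (hg'.inv_analytic i j))
  refine h2.congr ?_ (.of_forall fun z => by simp)
  filter_upwards [hg.eventually, hg'.eventually] with z hz hz'
  have e : (g z)⁻¹ * (g' z - g z) * (g' z)⁻¹ + (g' z)⁻¹ = (g z)⁻¹ := by
    rw [mul_sub, sub_mul, Matrix.nonsing_inv_mul _ hz.isUnit, mul_assoc,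
      Matrix.mul_nonsing_inv _ hz'.isUnit]
    simp
  have e2 := congrFun (congrFun e i) j
  rw [Matrix.add_apply, Matrix.mul_apply] at e2
  simp only [Matrix.mul_apply, Matrix.sub_apply, Finset.sum_mul] at e2
  rw [Finset.sum_comm] at e2
  exact e2

theorem ContactAt.christoffel (hg : IsMetricAt g q₀) (hg' : IsMetricAt g' q₀)
    (h : ∀ i j, ContactAt k q₀ (fun z => g z i j) (fun z => g' z i j)) (l i j : Fin n) :
    ContactAt k q₀ (EinsteinCauchy.christoffel sliceDir g l i j)
      (EinsteinCauchy.christoffel sliceDir g' l i j) :=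
  ContactAt.const_mul _ (ContactAt.sum fun m => (ContactAt.inv hg hg' h l m).mul
    ((((h _ _).pd _).add ((h _ _).pd _)).sub ((h _ _).pd _)))

theorem ContactAt.ricci (hg : IsMetricAt g q₀) (hg' : IsMetricAt g' q₀)
    (h : ∀ i j, ContactAt k q₀ (fun z => g z i j) (fun z => g' z i j)) (i j : Fin n) :
    ContactAt k q₀ (EinsteinCauchy.ricci sliceDir g i j) (EinsteinCauchy.ricci sliceDir g' i j) := by
  have hc := ContactAt.christoffel hg hg' h
  exact (ContactAt.sum fun l => ((hc _ _ _).pd _).sub ((hc _ _ _).pd _)).add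
    (ContactAt.sum fun l => ContactAt.sum fun m =>
      ((hc _ _ _).mul (hc _ _ _)).sub ((hc _ _ _).mul (hc _ _ _)))

theorem ContactAt.metricRate (hN : AnalyticAt ℝ N q₀) (hβ : ∀ h, AnalyticAt ℝ (fun z => β z h) q₀)
    (h : ∀ i j, ContactAt k q₀ (fun z => g z i j) (fun z => g' z i j))
    (hK : ∀ i j, ContactAt k q₀ (fun z => K z i j) (fun z => K' z i j)) (i j : Fin n) :
    ContactAt k q₀ (EinsteinCauchy.metricRate N β g K i j)
      (EinsteinCauchy.metricRate N β g' K' i j) := by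
  have rβ := fun h => ContactAt.refl (k := k) (hβ h)
  exact (ContactAt.const_mul _ ((ContactAt.refl hN).mul (hK _ _))).add
    (ContactAt.sum fun h' => ((rβ _).mul ((h _ _).pd _)).add
      ((((rβ _).pd _).mul (h _ _)).add (((rβ _).pd _).mul (h _ _))))

theorem ContactAt.curvatureRate (hN : AnalyticAt ℝ N q₀)
    (hβ : ∀ h, AnalyticAt ℝ (fun z => β z h) q₀) (hρ : ∀ i j, AnalyticAt ℝ (fun z => ρ z i j) q₀)
    (hg : IsMetricAt g q₀) (hg' : IsMetricAt g' q₀)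
    (h : ∀ i j, ContactAt k q₀ (fun z => g z i j) (fun z => g' z i j))
    (hK : ∀ i j, ContactAt k q₀ (fun z => K z i j) (fun z => K' z i j)) (i j : Fin n) :
    ContactAt k q₀ (EinsteinCauchy.curvatureRate N β ρ g K i j)
      (EinsteinCauchy.curvatureRate N β ρ g' K' i j) := by
  have rβ := fun h => ContactAt.refl (k := k) (hβ h)
  have rN := ContactAt.refl (k := k) hN
  have hi := ContactAt.inv hg hg' h
  exact (((rN.mul (((ContactAt.ricci hg hg' h i j).sub (ContactAt.const_mul _
    (ContactAt.sum fun a => ContactAt.sum fun c => ((hK _ _).mul (hi _ _)).mul (hK _ _)))).add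
    ((hK _ _).mul (ContactAt.sum fun a => ContactAt.sum fun c => (hi _ _).mul (hK _ _))))).sub
    (((rN.pd j).pd i).sub (ContactAt.sum fun l =>
      (ContactAt.christoffel hg hg' h _ _ _).mul (rN.pd l)))).add
    (ContactAt.sum fun h' => ((rβ _).mul ((hK _ _).pd _)).add
      (((hK _ _).mul ((rβ _).pd _)).add ((hK _ _).mul ((rβ _).pd _))))).sub
    (rN.mul (ContactAt.refl (hρ i j)))

/-- Local uniqueness for the evolution equations, in coordinates. -/
theorem evolution_local_unique {y₀ : EuclideanSpace ℝ (Fin n)}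
    (hN : AnalyticAt ℝ N (y₀, 0)) (hβ : ∀ h, AnalyticAt ℝ (fun z => β z h) (y₀, 0))
    (hρ : ∀ i j, AnalyticAt ℝ (fun z => ρ z i j) (y₀, 0))
    (hg : IsMetricAt g (y₀, 0)) (hg' : IsMetricAt g' (y₀, 0))
    (hK : ∀ i j, AnalyticAt ℝ (fun z => K z i j) (y₀, 0))
    (hK' : ∀ i j, AnalyticAt ℝ (fun z => K' z i j) (y₀, 0))
    (h0 : ∀ᶠ y in 𝓝 y₀, g (y, 0) = g' (y, 0) ∧ K (y, 0) = K' (y, 0))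
    (he : ∀ᶠ z in 𝓝 (y₀, (0 : ℝ)), EvolutionAt N β ρ g K z)
    (he' : ∀ᶠ z in 𝓝 (y₀, (0 : ℝ)), EvolutionAt N β ρ g' K' z) :
    ∀ᶠ z in 𝓝 (y₀, (0 : ℝ)), g z = g' z ∧ K z = K' z := by
  have hβe : ∀ᶠ z in 𝓝 (y₀, (0 : ℝ)), ∀ h, AnalyticAt ℝ (fun z => β z h) z :=
    eventually_all.2 fun h => (hβ h).eventually_analyticAt
  have hev : ∀ {g K : EuclideanSpace ℝ (Fin n) × ℝ → Matrix (Fin n) (Fin n) ℝ},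
      IsMetricAt g (y₀, 0) → (∀ᶠ z in 𝓝 (y₀, (0 : ℝ)), EvolutionAt N β ρ g K z) → ∀ i j,
      metricRate N β g K i j =ᶠ[𝓝 (y₀, (0 : ℝ))] pd spacetimeDir (Sum.inr ()) (fun z => g z i j) ∧
      curvatureRate N β ρ g K i j =ᶠ[𝓝 (y₀, (0 : ℝ))]
        pd spacetimeDir (Sum.inr ()) (fun z => K z i j) := by
    intro g K hg he i j
    constructor <;> filter_upwards [hβe, hg.eventually, he] with z a c d
    · exact ((evolutionAt_iff c a).1 d i j).1.symm
    · exact ((evolutionAt_iff c a).1 d i j).2.symm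
  -- The rates contain only space derivatives, which preserve the order of contact. Contact of order
  -- `k` thus passes to the time derivatives, and integration raises it to `k + 1`.
  have key : ∀ k, (∀ i j, ContactAt k (y₀, 0) (fun z => g z i j) (fun z => g' z i j)) ∧
      ∀ i j, ContactAt k (y₀, 0) (fun z => K z i j) (fun z => K' z i j) := by
    intro k
    induction k with
    | zero => exact ⟨fun i j => ContactAt.zero (hg.analytic i j) (hg'.analytic i j),
        fun i j => ContactAt.zero (hK i j) (hK' i j)⟩
    | succ k ih =>
      refine ⟨fun i j => ContactAt.succ (h0.mono fun y hy => by rw [hy.1]) (hg.analytic i j)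
        (hg'.analytic i j) ?_, fun i j => ContactAt.succ (h0.mono fun y hy => by rw [hy.2])
        (hK i j) (hK' i j) ?_⟩
      · exact (ContactAt.metricRate hN hβ ih.1 ih.2 i j).congr (hev hg he i j).1 (hev hg' he' i j).1
      · exact (ContactAt.curvatureRate hN hβ hρ hg hg' ih.1 ih.2 i j).congr (hev hg he i j).2
          (hev hg' he' i j).2
  have e1 : ∀ᶠ z in 𝓝 (y₀, (0 : ℝ)), ∀ i j, g z i j = g' z i j :=
    eventually_all.2 fun i => eventually_all.2 fun j =>
      eventuallyEq_of_contactAt fun k => (key k).1 i j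
  have e2 : ∀ᶠ z in 𝓝 (y₀, (0 : ℝ)), ∀ i j, K z i j = K' z i j :=
    eventually_all.2 fun i => eventually_all.2 fun j =>
      eventuallyEq_of_contactAt fun k => (key k).2 i j
  filter_upwards [e1, e2] with z a c
  exact ⟨by ext i j; exact a i j, by ext i j; exact c i j⟩

end LocalUniqueness

/-! ### Connection and curvature in a frame along a map. -/

section Frames

open Topology Filter

variable {ι κ F F' : Type*} [Fintype ι] [DecidableEq ι] [Fintype κ]
  [NormedAddCommGroup F] [NormedSpace ℝ F] [FiniteDimensional ℝ F]
  [NormedAddCommGroup F'] [NormedSpace ℝ F']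

/-- The coordinate functionals of a basis. -/
def coordCLM (b : Module.Basis ι ℝ F) (i : ι) : F →L[ℝ] ℝ :=
  LinearMap.toContinuousLinearMap (b.coord i)

omit [Fintype ι] in
theorem coordCLM_apply (b : Module.Basis ι ℝ F) (i : ι) (v : F) : coordCLM b i v = b.repr v i := rfl

theorem coordCLM_basis (b : Module.Basis ι ℝ F) (i j : ι) :
    coordCLM b i (b j) = if i = j then 1 else 0 := by
  rw [coordCLM_apply, b.repr_self, Finsupp.single_apply]
  simp only [eq_comm]

/-- The Christoffel symbols as a bilinear map. -/
def gammaMap (b : Module.Basis ι ℝ F) (G : F → Matrix ι ι ℝ) (x : F) : F →L[ℝ] F →L[ℝ] F :=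
  ∑ l, ∑ i, ∑ j, christoffel b G l i j x •
    (coordCLM b i).smulRight ((coordCLM b j).smulRight (b l))

/-- The metric as a bilinear map. -/
def formMap (b : Module.Basis ι ℝ F) (G : F → Matrix ι ι ℝ) (x : F) : F →L[ℝ] F →L[ℝ] ℝ :=
  ∑ i, ∑ j, G x i j • (coordCLM b i).smulRight (coordCLM b j)

variable {b : Module.Basis ι ℝ F} {G : F → Matrix ι ι ℝ} {x : F}

theorem gammaMap_basis (i j : ι) :
    gammaMap b G x (b i) (b j) = ∑ l, christoffel b G l i j x • b l := by
  simp only [gammaMap, _root_.sum_apply, _root_.smul_apply, ContinuousLinearMap.smulRight_apply,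
    coordCLM_basis]
  refine Finset.sum_congr rfl fun l _ => ?_
  rw [Finset.sum_eq_single i (by intro a _ ha; simp [ha]) (by simp),
    Finset.sum_eq_single j (by intro a _ ha; simp [ha]) (by simp)]
  simp

theorem formMap_basis (i j : ι) : formMap b G x (b i) (b j) = G x i j := by
  simp only [formMap, _root_.sum_apply, _root_.smul_apply, ContinuousLinearMap.smulRight_apply,
    coordCLM_basis]
  rw [Finset.sum_eq_single i (by intro a _ ha; simp [ha]) (by simp),
    Finset.sum_eq_single j (by intro a _ ha; simp [ha]) (by simp)]
  simp

/-- Bilinear maps agreeing on a basis agree. -/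
theorem clm_ext_basis {X : Type*} [NormedAddCommGroup X] [NormedSpace ℝ X]
    {A B : F →L[ℝ] F →L[ℝ] X} (h : ∀ i j, A (b i) (b j) = B (b i) (b j)) (v w : F) :
    A v w = B v w := by
  have : A = B := by
    apply ContinuousLinearMap.coe_injective
    refine b.ext fun i => ?_
    apply ContinuousLinearMap.coe_injective
    exact b.ext fun j => h i j
  rw [this]

theorem analyticAt_smul_const {X : Type*} [NormedAddCommGroup X] [NormedSpace ℝ X] {f : F → ℝ}
    (hf : AnalyticAt ℝ f x) (c : X) : AnalyticAt ℝ (fun z => f z • c) x :=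
  hf.smul analyticAt_const

theorem analyticAt_gammaMap (hG : IsMetricAt G x) : AnalyticAt ℝ (gammaMap b G) x := by
  unfold gammaMap
  refine Finset.analyticAt_fun_sum _ fun l _ => Finset.analyticAt_fun_sum _ fun i _ =>
    Finset.analyticAt_fun_sum _ fun j _ => ?_
  exact analyticAt_smul_const (hG.christoffel_analytic l i j) _

theorem analyticAt_formMap (hG : IsMetricAt G x) : AnalyticAt ℝ (formMap b G) x := by
  unfold formMap
  refine Finset.analyticAt_fun_sum _ fun i _ => Finset.analyticAt_fun_sum _ fun j _ => ?_
  exact analyticAt_smul_const (hG.analytic i j) _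

theorem gammaMap_symm (hG : IsMetricAt G x) (v w : F) :
    gammaMap b G x v w = gammaMap b G x w v := by
  have : ∀ v w, gammaMap b G x v w = (gammaMap b G x).flip v w := by
    refine clm_ext_basis (b := b) fun i j => ?_
    rw [ContinuousLinearMap.flip_apply, gammaMap_basis, gammaMap_basis]
    exact Finset.sum_congr rfl fun l _ => by rw [hG.christoffel_symm]
  exact this v w

/-- Metric compatibility, freed from the coordinate basis so that it can be evaluated on frame
vectors. -/
theorem fderiv_formMap (hG : IsMetricAt G x) (u v w : F) :
    fderiv ℝ (formMap b G) x u v w =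
      formMap b G x (gammaMap b G x u v) w + formMap b G x v (gammaMap b G x u w) := by
  have hd := (analyticAt_formMap (b := b) hG).differentiableAt
  have h1 : ∀ u i j, fderiv ℝ (formMap b G) x u (b i) (b j) =
      fderiv ℝ (fun z => G z i j) x u := by
    intro u i j
    have h2 : (fun z => G z i j) = fun z => formMap b G z (b i) (b j) := by
      funext z; rw [formMap_basis]
    rw [h2, fderiv_clm_apply (hd.clm_apply (differentiableAt_const _)) (differentiableAt_const _),
      fderiv_clm_apply hd (differentiableAt_const _)]
    simp
  have hlin : ∀ k v w, fderiv ℝ (formMap b G) x (b k) v w =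
      formMap b G x (gammaMap b G x (b k) v) w + formMap b G x v (gammaMap b G x (b k) w) := by
    intro k
    let A : F →L[ℝ] F →L[ℝ] ℝ := (formMap b G x).comp (gammaMap b G x (b k)) +
      ((formMap b G x).flip.comp (gammaMap b G x (b k))).flip
    have hA : ∀ v w, A v w = formMap b G x (gammaMap b G x (b k) v) w +
        formMap b G x v (gammaMap b G x (b k) w) := fun v w => by simp [A]
    intro v w
    rw [← hA]
    refine clm_ext_basis (b := b) (fun i j => ?_) v w
    rw [h1, hA, gammaMap_basis, gammaMap_basis]
    have := hG.metric_compat (b := b) k i j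
    unfold pd at this
    rw [this]
    simp [formMap_basis, Finset.sum_add_distrib]
  have hsum : u = ∑ k, b.repr u k • b k := (b.sum_repr u).symm
  rw [hsum]
  simp only [map_sum, map_smul, _root_.sum_apply, _root_.smul_apply, hlin, smul_eq_mul, mul_add,
    Finset.sum_add_distrib]

theorem formMap_nondegenerate (hG : IsMetricAt G x) {v : F}
    (h : ∀ w, formMap b G x v w = 0) : v = 0 := by
  have h1 : Matrix.vecMul (fun i => b.repr v i) (G x) = 0 := by
    funext j
    have h2 := h (b j)
    rw [← b.sum_repr v] at h2
    simp only [map_sum, map_smul, _root_.sum_apply, _root_.smul_apply, formMap_basis,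
      smul_eq_mul] at h2
    simpa [Matrix.vecMul, dotProduct] using h2
  have h3 := Matrix.eq_zero_of_vecMul_eq_zero hG.det_ne h1
  apply b.repr.injective
  ext i
  simpa using congrFun h3 i

/-- The curvature of the connection `Γ`. -/
def riemannMap (Γ : F → F →L[ℝ] F →L[ℝ] F) (x u v w : F) : F :=
  fderiv ℝ Γ x u v w - fderiv ℝ Γ x v u w + Γ x u (Γ x v w) - Γ x v (Γ x u w)

/-- The Ricci curvature of the connection `Γ`. -/
def ricciForm (Γ : F → F →L[ℝ] F →L[ℝ] F) (x v w : F) : ℝ :=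
  LinearMap.trace ℝ F
    { toFun := fun u => riemannMap Γ x u v w
      map_add' := fun u u' => by simp [riemannMap]; abel
      map_smul' := fun c u => by simp [riemannMap, smul_sub, smul_add] }

/-- The trace may be taken in any basis; later it is taken in the frame. -/
theorem ricciForm_eq_sum [DecidableEq κ] (Γ : F → F →L[ℝ] F →L[ℝ] F) (x v w : F)
    (B : Module.Basis κ ℝ F) : ricciForm Γ x v w = ∑ a, B.repr (riemannMap Γ x (B a) v w) a := by
  unfold ricciForm
  rw [LinearMap.trace_eq_matrix_trace ℝ B, Matrix.trace]
  refine Finset.sum_congr rfl fun a _ => ?_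
  rw [Matrix.diag_apply, LinearMap.toMatrix_apply]
  rfl

variable {Ψ : F' → F} {e : κ → F' → F'} {W : κ → κ → κ → F' → ℝ} {y : F'}

/-- The image under the derivative of `Ψ` of the vector field `e a`. -/
def pushField (Ψ : F' → F) (e : κ → F' → F') (a : κ) (z : F') : F := fderiv ℝ Ψ z (e a z)

theorem analyticAt_pushField (hΨ : AnalyticAt ℝ Ψ y) (he : ∀ a, AnalyticAt ℝ (e a) y) (a : κ) :
    AnalyticAt ℝ (pushField Ψ e a) y := by
  have := FiniteDimensional.complete ℝ F
  exact ((ContinuousLinearMap.id ℝ (F' →L[ℝ] F)).analyticAt_bilinear _).comp₂ hΨ.fderiv (he a)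

/-- Brackets push forward, because the second derivative of `Ψ` is symmetric. -/
theorem fderiv_pushField_sub (hΨ : AnalyticAt ℝ Ψ y) (he : ∀ a, AnalyticAt ℝ (e a) y) (a c : κ) :
    fderiv ℝ (pushField Ψ e c) y (e a y) - fderiv ℝ (pushField Ψ e a) y (e c y) =
      fderiv ℝ Ψ y (fderiv ℝ (e c) y (e a y) - fderiv ℝ (e a) y (e c y)) := by
  have := FiniteDimensional.complete ℝ F
  have h1 : ∀ a c, fderiv ℝ (pushField Ψ e c) y (e a y) =
      fderiv ℝ Ψ y (fderiv ℝ (e c) y (e a y)) + fderiv ℝ (fderiv ℝ Ψ) y (e a y) (e c y) := by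
    intro a c
    unfold pushField
    rw [fderiv_clm_apply hΨ.fderiv.differentiableAt (he c).differentiableAt]
    simp
  have hs : IsSymmSndFDerivAt ℝ Ψ y := hΨ.contDiffAt.isSymmSndFDerivAt (n := ω) (by simp)
  rw [h1, h1, hs (e a y) (e c y), map_sub]
  abel

/-- The Levi-Civita connection along `Ψ` is determined in a frame by compatibility with the metric
and vanishing torsion. -/
theorem frame_connection (hG : IsMetricAt G (Ψ y)) (hΨ : AnalyticAt ℝ Ψ y)
    (he : ∀ a, AnalyticAt ℝ (e a) y)
    (hspan : ⊤ ≤ Submodule.span ℝ (Set.range fun a => pushField Ψ e a y))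
    (hmet : ∀ a c d, fderiv ℝ (fun z => formMap b G (Ψ z) (pushField Ψ e c z) (pushField Ψ e d z)) y
        (e a y) = ∑ f, (W f a c y * formMap b G (Ψ y) (pushField Ψ e f y) (pushField Ψ e d y) +
          W f a d y * formMap b G (Ψ y) (pushField Ψ e c y) (pushField Ψ e f y)))
    (htor : ∀ a c, fderiv ℝ (e c) y (e a y) - fderiv ℝ (e a) y (e c y) =
      ∑ f, (W f a c y - W f c a y) • e f y) (a c : κ) :
    fderiv ℝ (pushField Ψ e c) y (e a y) +
        gammaMap b G (Ψ y) (pushField Ψ e a y) (pushField Ψ e c y) =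
      ∑ f, W f a c y • pushField Ψ e f y := by
  set E := pushField Ψ e with hE
  -- `X` is the difference between the Levi-Civita connection along `Ψ` and the one with
  -- coefficients `W`. Vanishing torsion makes it symmetric in its two indices (`hXs`), and
  -- compatibility makes it antisymmetric in the last two indices once the value is lowered (`hXa`).
  -- As in Koszul's formula, such a tensor is zero (`hT`).
  let X : κ → κ → F := fun a c => fderiv ℝ (E c) y (e a y) +
    gammaMap b G (Ψ y) (E a y) (E c y) - ∑ f, W f a c y • E f y
  have hXs : ∀ a c, X a c = X c a := by
    intro a c
    have h1 := fderiv_pushField_sub hΨ he a c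
    rw [htor, map_sum] at h1
    simp only [map_smul, sub_smul, map_sub, Finset.sum_sub_distrib] at h1
    simp only [X]
    rw [gammaMap_symm hG (E c y) (E a y)]
    have h2 : fderiv ℝ (E c) y (e a y) - fderiv ℝ (E a) y (e c y) =
      ∑ f, W f a c y • E f y - ∑ f, W f c a y • E f y := h1
    rw [← sub_eq_zero] at h2 ⊢
    rw [← h2]
    abel
  have hsymm : ∀ v w, formMap b G (Ψ y) v w = formMap b G (Ψ y) w v := by
    intro v w
    have : ∀ v w, formMap b G (Ψ y) v w = (formMap b G (Ψ y)).flip v w := by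
      refine clm_ext_basis (b := b) fun i j => ?_
      rw [ContinuousLinearMap.flip_apply, formMap_basis, formMap_basis]
      exact hG.symm.self_of_nhds i j
    exact this v w
  have hXa : ∀ a c d, formMap b G (Ψ y) (X a c) (E d y) + formMap b G (Ψ y) (E c y) (X a d) = 0 := by
    intro a c d
    have hEd := fun a => (analyticAt_pushField hΨ he a).differentiableAt
    have hfd : DifferentiableAt ℝ (fun z => formMap b G (Ψ z)) y :=
      (analyticAt_formMap hG).differentiableAt.comp y hΨ.differentiableAt
    have h1 := hmet a c d
    rw [fderiv_clm_apply (hfd.clm_apply (hEd c)) (hEd d), fderiv_clm_apply hfd (hEd c)] at h1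
    have h2 : fderiv ℝ (fun z => formMap b G (Ψ z)) y (e a y) =
        fderiv ℝ (formMap b G) (Ψ y) (E a y) := by
      have := fderiv_comp y (analyticAt_formMap (b := b) hG).differentiableAt hΨ.differentiableAt
      change fderiv ℝ (formMap b G ∘ Ψ) y (e a y) = _
      rw [this]
      rfl
    simp only [_root_.add_apply, ContinuousLinearMap.comp_apply,
      ContinuousLinearMap.flip_apply] at h1
    rw [h2, fderiv_formMap hG] at h1
    simp only [X, map_sub, map_add, map_sum, map_smul, _root_.add_apply,
      _root_.sub_apply, _root_.sum_apply, _root_.smul_apply, smul_eq_mul]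
    rw [Finset.sum_add_distrib] at h1
    linear_combination h1
  have hT : ∀ a c d, formMap b G (Ψ y) (X a c) (E d y) = 0 := by
    intro a c d
    have k1 := hXa a c d
    have k2 := hXa c d a
    have k3 := hXa d a c
    rw [hsymm (E c y)] at k1
    rw [hsymm (E d y)] at k2
    rw [hsymm (E a y)] at k3
    rw [hXs c a] at k2
    rw [hXs d a, hXs d c] at k3
    linarith
  have hX0 : X a c = 0 := by
    refine formMap_nondegenerate (b := b) hG fun w => ?_
    have hw : w ∈ Submodule.span ℝ (Set.range fun a => E a y) := hspan trivial
    induction hw using Submodule.span_induction with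
    | mem w hw => obtain ⟨d, rfl⟩ := hw; exact hT a c d
    | zero => simp
    | add u v _ _ hu hv => rw [map_add, hu, hv, add_zero]
    | smul r u _ hu => rw [map_smul, hu, smul_zero]
  exact sub_eq_zero.1 hX0

/-- The curvature in a frame along `Ψ`. -/
theorem frame_riemann {Γ : F → F →L[ℝ] F →L[ℝ] F} (hΓ : AnalyticAt ℝ Γ (Ψ y))
    (hΓs : ∀ v w, Γ (Ψ y) v w = Γ (Ψ y) w v) (hΨ : AnalyticAt ℝ Ψ y)
    (he : ∀ a, AnalyticAt ℝ (e a) y) (hW : ∀ a c d, AnalyticAt ℝ (W a c d) y)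
    (hcon : ∀ᶠ z in 𝓝 y, ∀ a c, fderiv ℝ (pushField Ψ e c) z (e a z) +
      Γ (Ψ z) (pushField Ψ e a z) (pushField Ψ e c z) = ∑ f, W f a c z • pushField Ψ e f z)
    (htor : ∀ a c, fderiv ℝ (e c) y (e a y) - fderiv ℝ (e a) y (e c y) =
      ∑ f, (W f a c y - W f c a y) • e f y) (a c d : κ) :
    riemannMap Γ (Ψ y) (pushField Ψ e a y) (pushField Ψ e c y) (pushField Ψ e d y) =
      ∑ f, (fderiv ℝ (W f c d) y (e a y) - fderiv ℝ (W f a d) y (e c y)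
        + ∑ h, (W h c d y * W f a h y - W h a d y * W f c h y)
        - ∑ h, (W h a c y - W h c a y) * W f h d y) • pushField Ψ e f y := by
  have := FiniteDimensional.complete ℝ F
  set E := pushField Ψ e with hE
  have hEa : ∀ a, AnalyticAt ℝ (E a) y := fun a => analyticAt_pushField hΨ he a
  have hEd := fun a => (hEa a).differentiableAt
  have hΓd : DifferentiableAt ℝ (fun z => Γ (Ψ z)) y :=
    hΓ.differentiableAt.comp y hΨ.differentiableAt
  have hcony := hcon.self_of_nhds
  -- The derivative along `e a` of the equation for `∇_{e c} E d`. Antisymmetrizing in `a`, `c`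
  -- removes the second derivative of `E d` and leaves the curvature together with bracket terms.
  have key : ∀ a c, fderiv ℝ (fderiv ℝ (E d)) y (e a y) (e c y) +
      fderiv ℝ (E d) y (fderiv ℝ (e c) y (e a y)) + (fderiv ℝ Γ (Ψ y) (E a y) (E c y) (E d y) +
        Γ (Ψ y) (fderiv ℝ (E c) y (e a y)) (E d y) +
        Γ (Ψ y) (E c y) (fderiv ℝ (E d) y (e a y))) =
      ∑ f, (fderiv ℝ (W f c d) y (e a y) • E f y + W f c d y • fderiv ℝ (E f) y (e a y)) := by
    intro a c
    have h1 : (fun z => fderiv ℝ (E d) z (e c z) + Γ (Ψ z) (E c z) (E d z)) =ᶠ[𝓝 y]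
        fun z => ∑ f, W f c d z • E f z := hcon.mono fun z hz => hz c d
    have h2 := congrArg (fun L : F' →L[ℝ] F => L (e a y)) (h1.fderiv_eq (𝕜 := ℝ))
    have d1 : DifferentiableAt ℝ (fun z => fderiv ℝ (E d) z (e c z)) y :=
      (hEa d).fderiv.differentiableAt.clm_apply (he c).differentiableAt
    have d2 : DifferentiableAt ℝ (fun z => Γ (Ψ z) (E c z)) y := hΓd.clm_apply (hEd c)
    rw [fderiv_fun_add d1 (d2.clm_apply (hEd d)),
      fderiv_fun_sum (fun f _ => (hW f c d).differentiableAt.fun_smul (hEd f)),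
      fderiv_clm_apply (hEa d).fderiv.differentiableAt (he c).differentiableAt,
      fderiv_clm_apply d2 (hEd d), fderiv_clm_apply hΓd (hEd c)] at h2
    have h3 : fderiv ℝ (fun z => Γ (Ψ z)) y (e a y) = fderiv ℝ Γ (Ψ y) (E a y) := by
      have := fderiv_comp y hΓ.differentiableAt hΨ.differentiableAt
      change fderiv ℝ (Γ ∘ Ψ) y (e a y) = _
      rw [this]
      rfl
    simp only [_root_.add_apply, ContinuousLinearMap.comp_apply,
      ContinuousLinearMap.flip_apply, _root_.sum_apply, h3] at h2
    have h4 : ∀ f, fderiv ℝ (fun z => W f c d z • E f z) y (e a y) =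
        fderiv ℝ (W f c d) y (e a y) • E f y + W f c d y • fderiv ℝ (E f) y (e a y) := by
      intro f
      rw [fderiv_fun_smul (hW f c d).differentiableAt (hEd f)]
      simp [add_comm]
    simp only [h4] at h2
    rw [← h2]
    abel
  have hs : IsSymmSndFDerivAt ℝ (E d) y := (hEa d).contDiffAt.isSymmSndFDerivAt (n := ω) (by simp)
  have k1 := key a c
  have k2 := key c a
  rw [hs.eq (e c y) (e a y)] at k2
  have hDE : ∀ a c, fderiv ℝ (E c) y (e a y) =
      ∑ f, W f a c y • E f y - Γ (Ψ y) (E a y) (E c y) := fun a c =>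
    eq_sub_of_add_eq (hcony a c)
  have hbr : fderiv ℝ (E d) y (fderiv ℝ (e c) y (e a y)) - fderiv ℝ (E d) y (fderiv ℝ (e a) y (e c y))
      = ∑ f, (W f a c y - W f c a y) • fderiv ℝ (E d) y (e f y) := by
    rw [← map_sub, htor, map_sum]
    simp only [map_smul]
  have hbrE : Γ (Ψ y) (fderiv ℝ (E c) y (e a y)) (E d y) - Γ (Ψ y) (fderiv ℝ (E a) y (e c y)) (E d y)
      = ∑ f, (W f a c y - W f c a y) • Γ (Ψ y) (E f y) (E d y) := by
    rw [hDE a c, hDE c a, hΓs (E c y) (E a y)]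
    simp only [map_sub, map_sum, map_smul, _root_.sub_apply, _root_.sum_apply,
      _root_.smul_apply, sub_smul, Finset.sum_sub_distrib]
    abel
  have hbrS : ∑ f, (W f a c y - W f c a y) • fderiv ℝ (E d) y (e f y) +
      ∑ f, (W f a c y - W f c a y) • Γ (Ψ y) (E f y) (E d y) =
      ∑ f, (∑ h, (W h a c y - W h c a y) * W f h d y) • E f y := by
    rw [← Finset.sum_add_distrib]
    simp only [← smul_add, hcony, Finset.smul_sum, smul_smul, Finset.sum_smul]
    exact Finset.sum_comm
  have hGs : ∀ a c, Γ (Ψ y) (E c y) (fderiv ℝ (E d) y (e a y)) =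
      ∑ f, W f a d y • Γ (Ψ y) (E c y) (E f y) - Γ (Ψ y) (E c y) (Γ (Ψ y) (E a y) (E d y)) := by
    intro a c
    rw [hDE a d]
    simp only [map_sub, map_sum, map_smul]
  have hR : ∀ a c, ∑ f, (fderiv ℝ (W f c d) y (e a y) • E f y + W f c d y • fderiv ℝ (E f) y (e a y)) =
      ∑ f, fderiv ℝ (W f c d) y (e a y) • E f y + ∑ f, (∑ h, W h c d y * W f a h y) • E f y -
        ∑ f, W f c d y • Γ (Ψ y) (E a y) (E f y) := by
    intro a c
    rw [Finset.sum_add_distrib, add_sub_assoc]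
    congr 1
    simp only [hDE a, smul_sub, Finset.sum_sub_distrib, Finset.smul_sum, smul_smul, Finset.sum_smul]
    congr 1
    exact Finset.sum_comm
  rw [hR, hGs] at k1 k2
  have hfin : ∑ f, (fderiv ℝ (W f c d) y (e a y) - fderiv ℝ (W f a d) y (e c y)
        + ∑ h, (W h c d y * W f a h y - W h a d y * W f c h y)
        - ∑ h, (W h a c y - W h c a y) * W f h d y) • E f y =
      ∑ f, fderiv ℝ (W f c d) y (e a y) • E f y - ∑ f, fderiv ℝ (W f a d) y (e c y) • E f y +
      (∑ f, (∑ h, W h c d y * W f a h y) • E f y - ∑ f, (∑ h, W h a d y * W f c h y) • E f y) -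
      ∑ f, (∑ h, (W h a c y - W h c a y) * W f h d y) • E f y := by
    simp only [sub_smul, add_smul, Finset.sum_sub_distrib, Finset.sum_add_distrib]
  rw [hfin, ← hbrS, ← hbr, ← hbrE]
  unfold riemannMap
  rw [← sub_eq_zero] at k1 k2 ⊢
  -- The claim is the difference of `k1` and `k2`, up to the order of the terms.
  trans (0 : F) - 0
  · nth_rewrite 1 [← k1]
    rw [← k2]
    abel
  · exact sub_zero _

end Frames

/-! ### The Ricci tensor in a frame and under changes of coordinates. -/

section FrameRicci

open Topology Filter

variable {ι F F' : Type*} [Fintype ι] [DecidableEq ι]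
  [NormedAddCommGroup F] [NormedSpace ℝ F] [FiniteDimensional ℝ F]
  [NormedAddCommGroup F'] [NormedSpace ℝ F'] [FiniteDimensional ℝ F']
  {b : Module.Basis ι ℝ F} {b' : Module.Basis ι ℝ F'} {G : F → Matrix ι ι ℝ}
  {Ψ : F' → F} {e : ι → F' → F'} {W : ι → ι → ι → F' → ℝ} {y : F'} {h : F' → Matrix ι ι ℝ}

/-- Vectors with a nondegenerate Gram matrix are linearly independent. -/
theorem linearIndependent_of_gram {A : F →L[ℝ] F →L[ℝ] ℝ} {v : ι → F} {H : Matrix ι ι ℝ}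
    (hdet : H.det ≠ 0) (hH : ∀ c d, H c d = A (v c) (v d)) : LinearIndependent ℝ v := by
  rw [Fintype.linearIndependent_iff]
  intro r hr
  have h1 : Matrix.vecMul r H = 0 := by
    funext d
    have h2 : A (∑ c, r c • v c) (v d) = 0 := by rw [hr]; simp
    simpa [Matrix.vecMul, dotProduct, hH, _root_.sum_apply] using h2
  exact fun i => congrFun (Matrix.eq_zero_of_vecMul_eq_zero hdet h1) i

/-- The data of a frame along `Ψ`: its Gram matrix `h` and its connection coefficients `W`,
compatible with the metric and torsion free. -/
structure IsFrameAlong (b : Module.Basis ι ℝ F) (G : F → Matrix ι ι ℝ) (Ψ : F' → F)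
    (e : ι → F' → F') (h : F' → Matrix ι ι ℝ) (W : ι → ι → ι → F' → ℝ) (z : F') : Prop where
  det_ne : (h z).det ≠ 0
  gram : ∀ c d, h z c d = formMap b G (Ψ z) (pushField Ψ e c z) (pushField Ψ e d z)
  metric : ∀ a c d, fderiv ℝ (fun z => h z c d) z (e a z) =
    ∑ f, (W f a c z * h z f d + W f a d z * h z c f)
  torsion : ∀ a c, fderiv ℝ (e c) z (e a z) - fderiv ℝ (e a) z (e c z) =
    ∑ f, (W f a c z - W f c a z) • e f z

theorem IsFrameAlong.linearIndependent (hf : IsFrameAlong b G Ψ e h W y) :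
    LinearIndependent ℝ fun a => pushField Ψ e a y :=
  linearIndependent_of_gram hf.det_ne hf.gram

theorem IsFrameAlong.span (hf : IsFrameAlong b G Ψ e h W y) :
    ⊤ ≤ Submodule.span ℝ (Set.range fun a => pushField Ψ e a y) :=
  (hf.linearIndependent.span_eq_top_of_card_eq_finrank'
    (Module.finrank_eq_card_basis b).symm).ge

theorem frame_connection_eventually (hG : IsMetricAt G (Ψ y)) (hΨ : AnalyticAt ℝ Ψ y)
    (he : ∀ a, AnalyticAt ℝ (e a) y) (hf : ∀ᶠ z in 𝓝 y, IsFrameAlong b G Ψ e h W z) :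
    ∀ᶠ z in 𝓝 y, ∀ a c, fderiv ℝ (pushField Ψ e c) z (e a z) +
        gammaMap b G (Ψ z) (pushField Ψ e a z) (pushField Ψ e c z) =
      ∑ f, W f a c z • pushField Ψ e f z := by
  have he' : ∀ᶠ z in 𝓝 y, ∀ a, AnalyticAt ℝ (e a) z :=
    eventually_all.2 fun a => (he a).eventually_analyticAt
  filter_upwards [hf.eventually_nhds, hΨ.eventually_analyticAt, he',
    hΨ.continuousAt.eventually hG.eventually] with z hz hΨz hez hGz a c
  have hzz := hz.self_of_nhds
  refine frame_connection hGz hΨz hez hzz.span (fun a c d => ?_) hzz.torsion a c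
  have h1 : (fun z => formMap b G (Ψ z) (pushField Ψ e c z) (pushField Ψ e d z)) =ᶠ[𝓝 z]
      fun z => h z c d := hz.mono fun z hz => (hz.gram c d).symm
  rw [h1.fderiv_eq, hzz.metric]
  simp only [hzz.gram]

/-- The Ricci curvature in a frame with connection coefficients `W`. -/
def frameRicci (e : ι → F' → F') (W : ι → ι → ι → F' → ℝ) (c d : ι) (y : F') : ℝ :=
  ∑ a, (fderiv ℝ (W a c d) y (e a y) - fderiv ℝ (W a a d) y (e c y)
    + ∑ f, (W f c d y * W a a f y - W f a d y * W a c f y)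
    - ∑ f, (W f a c y - W f c a y) * W a f d y)

/-- The trace of `frame_riemann` in the basis formed by the frame. It has two uses: the coordinate
frame with `Ψ` a change of coordinates gives covariance, and `Ψ` the identity with the frame `∂_i`,
`e₀` gives the splitting of the spacetime Ricci tensor. -/
theorem frame_ricci (hG : IsMetricAt G (Ψ y)) (hΨ : AnalyticAt ℝ Ψ y)
    (he : ∀ a, AnalyticAt ℝ (e a) y) (hW : ∀ a c d, AnalyticAt ℝ (W a c d) y)
    (hf : ∀ᶠ z in 𝓝 y, IsFrameAlong b G Ψ e h W z) (c d : ι) :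
    ricciForm (gammaMap b G) (Ψ y) (pushField Ψ e c y) (pushField Ψ e d y) =
      frameRicci e W c d y := by
  have hy := hf.self_of_nhds
  let B : Module.Basis ι ℝ F := Module.Basis.mk hy.linearIndependent hy.span
  have hB : ∀ a, B a = pushField Ψ e a y := fun a => Module.Basis.mk_apply _ _ a
  rw [ricciForm_eq_sum _ _ _ _ B]
  refine Finset.sum_congr rfl fun a _ => ?_
  have h1 := frame_riemann (analyticAt_gammaMap hG) (gammaMap_symm hG) hΨ he hW
    (frame_connection_eventually hG hΨ he hf) hy.torsion a c d
  simp only [← hB] at h1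
  rw [← hB c, ← hB d, h1, B.repr_sum_self]

theorem isFrameAlong_id (hG : IsMetricAt G x) :
    IsFrameAlong b G (fun z => z) (fun a _ => b a) G (christoffel b G) x where
  det_ne := hG.det_ne
  gram c d := by simp [pushField, formMap_basis]
  metric a c d := by
    have := hG.metric_compat (b := b) a c d
    unfold pd at this
    rw [this, Finset.sum_add_distrib]
  torsion a c := by
    simp [hG.christoffel_symm _ a c]

theorem frameRicci_christoffel {b : ι → F} {x : F} (hG : IsMetricAt G x) (i j : ι) :
    frameRicci (fun a _ => b a) (christoffel b G) i j x = ricci b G i j x := by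
  have h0 : ∀ l, (christoffel b G l l j) =ᶠ[𝓝 x] christoffel b G l j l := fun l =>
    hG.eventually.mono fun z hz => hz.christoffel_symm _ _ _
  have h1 : frameRicci (fun a _ => b a) (christoffel b G) i j x =
      ∑ l, (pd b l (christoffel b G l i j) x - pd b i (christoffel b G l j l) x)
      + (∑ l, ∑ m, christoffel b G m i j x * christoffel b G l m l x
        - ∑ l, ∑ m, christoffel b G l i m x * christoffel b G m j l x) := by
    unfold frameRicci
    rw [← Finset.sum_sub_distrib, ← Finset.sum_add_distrib]
    refine Finset.sum_congr rfl fun l _ => ?_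
    rw [(h0 l).fderiv_eq, ← Finset.sum_sub_distrib]
    simp only [hG.christoffel_symm _ l i, sub_self, zero_mul, Finset.sum_const_zero, sub_zero, pd]
    congr 1
    refine Finset.sum_congr rfl fun m _ => ?_
    rw [hG.christoffel_symm m l j, hG.christoffel_symm l l m]
    ring
  rw [h1, Finset.sum_comm (f := fun l m => christoffel b G m i j x * christoffel b G l m l x),
    ← Finset.sum_sub_distrib]
  simp only [ricci, ← Finset.sum_sub_distrib]

/-- The coordinate vectors are a frame along the identity, whose connection coefficients are the
Christoffel symbols. -/
theorem ricci_eq_ricciForm {x : F} (hG : IsMetricAt G x) (i j : ι) :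
    ricci b G i j x = ricciForm (gammaMap b G) x (b i) (b j) := by
  rw [← frameRicci_christoffel hG]
  have h1 := frame_ricci (b := b) (Ψ := fun z : F => z) (e := fun a _ => b a) (y := x) hG
    analyticAt_id (fun _ => analyticAt_const) (fun a c d => hG.christoffel_analytic a c d)
    (hG.eventually.mono fun z hz => isFrameAlong_id hz) i j
  rw [← h1]
  simp [pushField]

theorem ricciForm_add_left (Γ : F → F →L[ℝ] F →L[ℝ] F) (x v v' w : F) :
    ricciForm Γ x (v + v') w = ricciForm Γ x v w + ricciForm Γ x v' w := by
  unfold ricciForm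
  rw [← map_add]
  congr 1
  ext u
  simp [riemannMap]
  abel

theorem ricciForm_smul_left (Γ : F → F →L[ℝ] F →L[ℝ] F) (x : F) (r : ℝ) (v w : F) :
    ricciForm Γ x (r • v) w = r * ricciForm Γ x v w := by
  unfold ricciForm
  rw [← smul_eq_mul, ← map_smul]
  congr 1
  ext u
  simp [riemannMap, smul_sub, smul_add]

theorem ricciForm_add_right (Γ : F → F →L[ℝ] F →L[ℝ] F) (x v w w' : F) :
    ricciForm Γ x v (w + w') = ricciForm Γ x v w + ricciForm Γ x v w' := by
  unfold ricciForm
  rw [← map_add]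
  congr 1
  ext u
  simp [riemannMap]
  abel

theorem ricciForm_smul_right (Γ : F → F →L[ℝ] F →L[ℝ] F) (x : F) (r : ℝ) (v w : F) :
    ricciForm Γ x v (r • w) = r * ricciForm Γ x v w := by
  unfold ricciForm
  rw [← smul_eq_mul, ← map_smul]
  congr 1
  ext u
  simp [riemannMap, smul_sub, smul_add]

/-- The Ricci curvature as a bilinear form. -/
def ricciBilin (Γ : F → F →L[ℝ] F →L[ℝ] F) (x : F) : LinearMap.BilinForm ℝ F :=
  LinearMap.mk₂ ℝ (ricciForm Γ x) (ricciForm_add_left Γ x) (ricciForm_smul_left Γ x)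
    (ricciForm_add_right Γ x) (ricciForm_smul_right Γ x)

theorem ricciForm_expand {x : F} (hG : IsMetricAt G x) (v w : F) :
    ricciForm (gammaMap b G) x v w =
      ∑ i, ∑ j, b.repr v i * b.repr w j * ricci b G i j x := by
  change ricciBilin (gammaMap b G) x v w = _
  have h1 : ∀ i j, ricciBilin (gammaMap b G) x (b i) (b j) = ricci b G i j x := fun i j =>
    (ricci_eq_ricciForm hG i j).symm
  nth_rewrite 1 [← b.sum_repr v, ← b.sum_repr w]
  simp only [map_sum, map_smul, LinearMap.sum_apply,
    LinearMap.smul_apply, h1, smul_eq_mul, mul_assoc]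
  rw [Finset.sum_comm]
  refine Finset.sum_congr rfl fun i _ => ?_
  simp only [Finset.mul_sum]
  refine Finset.sum_congr rfl fun j _ => ?_
  ring

/-! Change of coordinates. -/

variable {G' : F' → Matrix ι ι ℝ}

/-- `G'` is the pullback of `G` under `Ψ`. -/
def IsPullback (b : Module.Basis ι ℝ F) (b' : Module.Basis ι ℝ F') (Ψ : F' → F)
    (h : F → Matrix ι ι ℝ) (h' : F' → Matrix ι ι ℝ) (y : F') : Prop :=
  ∀ᶠ z in 𝓝 y, ∀ i j, h' z i j = formMap b h (Ψ z) (fderiv ℝ Ψ z (b' i)) (fderiv ℝ Ψ z (b' j))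

/-- The coordinate vectors of the source, pushed forward by `Ψ`, have Gram matrix `G'`, and the
Christoffel symbols of `G'` are then their connection coefficients. -/
theorem isFrameAlong_pullback (hG' : IsMetricAt G' y) (hp : IsPullback b b' Ψ G G' y) :
    ∀ᶠ z in 𝓝 y, IsFrameAlong b G Ψ (fun a _ => b' a) G' (christoffel b' G') z := by
  filter_upwards [hG'.eventually, hp] with z hz hpz
  have := isFrameAlong_id (b := b') hz
  exact ⟨hz.det_ne, fun c d => hpz c d, this.metric, this.torsion⟩

/-- The transformation law of the Christoffel symbols: the first term is the inhomogeneous one, with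
the second derivative of `Ψ`. -/
theorem christoffel_pullback (hG : IsMetricAt G (Ψ y)) (hG' : IsMetricAt G' y)
    (hΨ : AnalyticAt ℝ Ψ y) (hp : IsPullback b b' Ψ G G' y) (a c : ι) :
    fderiv ℝ (fun z => fderiv ℝ Ψ z (b' c)) y (b' a) +
        gammaMap b G (Ψ y) (fderiv ℝ Ψ y (b' a)) (fderiv ℝ Ψ y (b' c)) =
      ∑ f, christoffel b' G' f a c y • fderiv ℝ Ψ y (b' f) :=
  (frame_connection_eventually hG hΨ (fun _ => analyticAt_const)
    (isFrameAlong_pullback hG' hp)).self_of_nhds a c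

theorem ricci_pullback (hG : IsMetricAt G (Ψ y)) (hG' : IsMetricAt G' y)
    (hΨ : AnalyticAt ℝ Ψ y) (hp : IsPullback b b' Ψ G G' y) (c d : ι) :
    ricci b' G' c d y =
      ricciForm (gammaMap b G) (Ψ y) (fderiv ℝ Ψ y (b' c)) (fderiv ℝ Ψ y (b' d)) := by
  rw [← frameRicci_christoffel hG']
  exact (frame_ricci hG hΨ (fun _ => analyticAt_const)
    (fun a c d => hG'.christoffel_analytic a c d) (isFrameAlong_pullback hG' hp) c d).symm

/-- The covariant derivative of a bilinear form. -/
def covForm (Γ : F → F →L[ℝ] F →L[ℝ] F) (H : F → F →L[ℝ] F →L[ℝ] ℝ) (x u v w : F) : ℝ :=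
  fderiv ℝ H x u v w - H x (Γ x u v) w - H x v (Γ x u w)

/-- The second derivatives of `Ψ` that arise from differentiating `H'` cancel against those in
`christoffel_pullback`. -/
theorem covDerivTensor_pullback {H : F → Matrix ι ι ℝ} {H' : F' → Matrix ι ι ℝ}
    (hG : IsMetricAt G (Ψ y)) (hG' : IsMetricAt G' y) (hΨ : AnalyticAt ℝ Ψ y)
    (hp : IsPullback b b' Ψ G G' y) (hH : ∀ i j, AnalyticAt ℝ (fun z => H z i j) (Ψ y))
    (hq : IsPullback b b' Ψ H H' y) (a c d : ι) :
    covDerivTensor b' G' H' a c d y = covForm (gammaMap b G) (formMap b H) (Ψ y)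
      (fderiv ℝ Ψ y (b' a)) (fderiv ℝ Ψ y (b' c)) (fderiv ℝ Ψ y (b' d)) := by
  have hHa : AnalyticAt ℝ (formMap b H) (Ψ y) := by
    unfold formMap
    refine Finset.analyticAt_fun_sum _ fun i _ => Finset.analyticAt_fun_sum _ fun j _ => ?_
    exact analyticAt_smul_const (hH i j) _
  have hc := christoffel_pullback hG hG' hΨ hp
  have hEd : ∀ c, DifferentiableAt ℝ (fun z => fderiv ℝ Ψ z (b' c)) y := fun c =>
    (analyticAt_pushField (e := fun c _ => b' c) hΨ (fun _ => analyticAt_const) c).differentiableAt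
  have hfd : DifferentiableAt ℝ (fun z => formMap b H (Ψ z)) y :=
    hHa.differentiableAt.comp y hΨ.differentiableAt
  have h1 : (fun z => H' z c d) =ᶠ[𝓝 y]
      fun z => formMap b H (Ψ z) (fderiv ℝ Ψ z (b' c)) (fderiv ℝ Ψ z (b' d)) :=
    hq.mono fun z hz => hz c d
  have h2 : fderiv ℝ (fun z => formMap b H (Ψ z)) y (b' a) =
      fderiv ℝ (formMap b H) (Ψ y) (fderiv ℝ Ψ y (b' a)) := by
    have := fderiv_comp y hHa.differentiableAt hΨ.differentiableAt
    change fderiv ℝ (formMap b H ∘ Ψ) y (b' a) = _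
    rw [this]
    rfl
  have h3 : pd b' a (fun z => H' z c d) y =
      fderiv ℝ (formMap b H) (Ψ y) (fderiv ℝ Ψ y (b' a)) (fderiv ℝ Ψ y (b' c)) (fderiv ℝ Ψ y (b' d)) +
      formMap b H (Ψ y) (fderiv ℝ (fun z => fderiv ℝ Ψ z (b' c)) y (b' a)) (fderiv ℝ Ψ y (b' d)) +
      formMap b H (Ψ y) (fderiv ℝ Ψ y (b' c)) (fderiv ℝ (fun z => fderiv ℝ Ψ z (b' d)) y (b' a)) := by
    unfold pd
    rw [h1.fderiv_eq, fderiv_clm_apply (hfd.clm_apply (hEd c)) (hEd d),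
      fderiv_clm_apply hfd (hEd c)]
    simp only [_root_.add_apply, ContinuousLinearMap.comp_apply, ContinuousLinearMap.flip_apply]
    rw [h2]
    ring
  have h4 : ∀ a c d, ∑ m, christoffel b' G' m a c y * H' y m d =
      formMap b H (Ψ y) (fderiv ℝ (fun z => fderiv ℝ Ψ z (b' c)) y (b' a) +
        gammaMap b G (Ψ y) (fderiv ℝ Ψ y (b' a)) (fderiv ℝ Ψ y (b' c))) (fderiv ℝ Ψ y (b' d)) := by
    intro a c d
    rw [hc a c]
    simp only [map_sum, map_smul, _root_.sum_apply, _root_.smul_apply, smul_eq_mul,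
      hq.self_of_nhds]
  have h5 : ∀ a c d, ∑ m, christoffel b' G' m a d y * H' y c m =
      formMap b H (Ψ y) (fderiv ℝ Ψ y (b' c)) (fderiv ℝ (fun z => fderiv ℝ Ψ z (b' d)) y (b' a) +
        gammaMap b G (Ψ y) (fderiv ℝ Ψ y (b' a)) (fderiv ℝ Ψ y (b' d))) := by
    intro a c d
    rw [hc a d]
    simp only [map_sum, map_smul, smul_eq_mul,
      hq.self_of_nhds]
  unfold covDerivTensor covForm
  rw [h3, Finset.sum_add_distrib, h4, h5]
  simp only [map_add, _root_.add_apply]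
  ring

theorem isPullback_id (x : F) (h : F → Matrix ι ι ℝ) : IsPullback b b (fun z => z) h h x :=
  Eventually.of_forall fun z i j => by simp [formMap_basis]

theorem covDerivTensor_eq_covForm {x : F} {H : F → Matrix ι ι ℝ}
    (hG : IsMetricAt G x) (hH : ∀ i j, AnalyticAt ℝ (fun z => H z i j) x) (a c d : ι) :
    covDerivTensor b G H a c d x =
      covForm (gammaMap b G) (formMap b H) x (b a) (b c) (b d) := by
  have := covDerivTensor_pullback (b := b) (b' := b) (Ψ := fun z : F => z) hG hG analyticAt_id
    (isPullback_id x G) hH (isPullback_id x H) a c d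
  simpa using this

end FrameRicci

/-! ### The contracted Bianchi identity where the Christoffel symbols vanish. -/

section Bianchi

open Topology Filter

variable {ι F : Type*} [Fintype ι] [DecidableEq ι]
  [NormedAddCommGroup F] [NormedSpace ℝ F] {x : F} {g : F → Matrix ι ι ℝ} {b : ι → F}

theorem pd_inv_eq_christoffel (hg : IsMetricAt g x) (k i j : ι) :
    pd b k (fun z => (g z)⁻¹ i j) x =
      -∑ m, ((g x)⁻¹ m j * christoffel b g i k m x + (g x)⁻¹ i m * christoffel b g j k m x) := by
  rw [hg.pd_inv]
  have h2 : ∀ p q, pd b k (fun z => g z p q) x =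
      ∑ m, christoffel b g m k p x * g x m q + ∑ m, christoffel b g m k q x * g x p m :=
    fun p q => by rw [hg.metric_compat, Finset.sum_add_distrib]
  have e1 : ∑ p, ∑ q, (g x)⁻¹ i p * (∑ m, christoffel b g m k p x * g x m q) * (g x)⁻¹ q j =
      ∑ p, (g x)⁻¹ i p * christoffel b g j k p x := by
    refine Finset.sum_congr rfl fun p _ => ?_
    have : ∀ q, (g x)⁻¹ i p * (∑ m, christoffel b g m k p x * g x m q) * (g x)⁻¹ q j =
        ∑ m, (g x)⁻¹ i p * christoffel b g m k p x * (g x m q * (g x)⁻¹ q j) := by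
      intro q
      rw [Finset.mul_sum, Finset.sum_mul]
      exact Finset.sum_congr rfl fun m _ => by ring
    simp only [this]
    rw [Finset.sum_comm]
    simp only [← Finset.mul_sum, hg.sum_mul_inv]
    simp
  have e2 : ∑ p, ∑ q, (g x)⁻¹ i p * (∑ m, christoffel b g m k q x * g x p m) * (g x)⁻¹ q j =
      ∑ q, (g x)⁻¹ q j * christoffel b g i k q x := by
    rw [Finset.sum_comm]
    refine Finset.sum_congr rfl fun q _ => ?_
    have : ∀ p, (g x)⁻¹ i p * (∑ m, christoffel b g m k q x * g x p m) * (g x)⁻¹ q j =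
        ∑ m, (g x)⁻¹ q j * christoffel b g m k q x * ((g x)⁻¹ i p * g x p m) := by
      intro p
      rw [Finset.mul_sum, Finset.sum_mul]
      exact Finset.sum_congr rfl fun m _ => by ring
    simp only [this]
    rw [Finset.sum_comm]
    simp only [← Finset.mul_sum, hg.sum_inv_mul]
    simp
  simp only [h2, mul_add, add_mul, Finset.sum_add_distrib]
  rw [e1, e2]
  ring

/-- The inverse metric is parallel, so contraction commutes with covariant differentiation. -/
theorem pd_tr {h : F → Matrix ι ι ℝ} (hg : IsMetricAt g x)
    (hh : ∀ i j, AnalyticAt ℝ (fun z => h z i j) x) (k : ι) :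
    pd b k (tr g h) x = ∑ i, ∑ j, (g x)⁻¹ i j * covDerivTensor b g h k i j x := by
  have h1 : pd b k (tr g h) x = ∑ i, ∑ j,
      ((g x)⁻¹ i j * pd b k (fun z => h z i j) x + pd b k (fun z => (g z)⁻¹ i j) x * h x i j) := by
    unfold tr
    rw [pd_sum fun i => analyticAt_sum fun j => (hg.inv_analytic i j).fun_mul (hh i j)]
    refine Finset.sum_congr rfl fun i _ => ?_
    rw [pd_sum fun j => (hg.inv_analytic i j).fun_mul (hh i j)]
    refine Finset.sum_congr rfl fun j _ => ?_
    rw [pd_mul (hg.inv_analytic i j) (hh i j)]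
    ring
  have hd := pd_inv_eq_christoffel (b := b) hg k
  rw [h1]
  unfold covDerivTensor
  simp only [hd, mul_sub, Finset.mul_sum, Finset.sum_add_distrib, Finset.sum_sub_distrib, mul_add,
    neg_mul, add_mul, Finset.sum_mul, Finset.sum_neg_distrib, neg_add]
  have a1 : ∑ i, ∑ j, ∑ m, (g x)⁻¹ m j * christoffel b g i k m x * h x i j =
      ∑ i, ∑ j, ∑ m, (g x)⁻¹ i j * (christoffel b g m k i x * h x m j) := by
    have : ∀ j, ∑ i, ∑ m, (g x)⁻¹ m j * christoffel b g i k m x * h x i j =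
        ∑ i, ∑ m, (g x)⁻¹ i j * (christoffel b g m k i x * h x m j) := by
      intro j
      rw [Finset.sum_comm]
      exact Finset.sum_congr rfl fun _ _ => Finset.sum_congr rfl fun _ _ => by ring
    rw [Finset.sum_comm, Finset.sum_congr rfl fun j _ => this j, Finset.sum_comm]
  have a2 : ∑ i, ∑ j, ∑ m, (g x)⁻¹ i m * christoffel b g j k m x * h x i j =
      ∑ i, ∑ j, ∑ m, (g x)⁻¹ i j * (christoffel b g m k j x * h x i m) := by
    refine Finset.sum_congr rfl fun i _ => ?_
    rw [Finset.sum_comm]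
    exact Finset.sum_congr rfl fun _ _ => Finset.sum_congr rfl fun _ _ => by ring
  rw [a1, a2]
  ring

/-- Of the four terms of the Leibniz rule the hypotheses leave one. It is applied with `u` an entry
of `g⁻¹` and `v` twice a Christoffel symbol with lowered index, at a point where the first
derivatives of `g` vanish. -/
theorem pd_pd_mul {u v : F → ℝ} (hu : AnalyticAt ℝ u x) (hv : AnalyticAt ℝ v x) {i j : ι}
    (hui : pd b i u x = 0) (huj : pd b j u x = 0) (hv0 : v x = 0) :
    pd b i (pd b j fun z => u z * v z) x = u x * pd b i (pd b j v) x := by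
  have h1 : (pd b j fun z => u z * v z) =ᶠ[𝓝 x] fun z => pd b j u z * v z + u z * pd b j v z := by
    filter_upwards [hu.eventually_analyticAt, hv.eventually_analyticAt] with z hz hz'
    rw [pd_mul hz hz']
  rw [pd_congr h1, pd_add ((analyticAt_pd hu).fun_mul hv) (hu.fun_mul (analyticAt_pd hv)),
    pd_mul (analyticAt_pd hu) hv, pd_mul hu (analyticAt_pd hv), hui, huj, hv0]
  ring

theorem pd_eq_zero_of_christoffel (hg : IsMetricAt g x) (h0 : ∀ l i j, christoffel b g l i j x = 0)
    (k i j : ι) : pd b k (fun z => g z i j) x = 0 := by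
  rw [hg.metric_compat]; simp [h0]

theorem pd_inv_eq_zero_of_christoffel (hg : IsMetricAt g x)
    (h0 : ∀ l i j, christoffel b g l i j x = 0) (k i j : ι) :
    pd b k (fun z => (g z)⁻¹ i j) x = 0 := by
  rw [hg.pd_inv]; simp [pd_eq_zero_of_christoffel hg h0]

theorem pd_pd_christoffel (hg : IsMetricAt g x) (h0 : ∀ l i j, christoffel b g l i j x = 0)
    (a l k c d : ι) : pd b a (pd b l (christoffel b g k c d)) x = 1 / 2 * ∑ m, (g x)⁻¹ k m *
      (pd b a (pd b l (pd b c fun z => g z d m)) x + pd b a (pd b l (pd b d fun z => g z c m)) x -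
        pd b a (pd b l (pd b m fun z => g z c d)) x) := by
  have hA : ∀ c d m, AnalyticAt ℝ (pd b c fun z => g z d m) x := fun c d m =>
    analyticAt_pd (hg.analytic d m)
  let S : ι → F → ℝ := fun m z => pd b c (fun z => g z d m) z + pd b d (fun z => g z c m) z -
    pd b m (fun z => g z c d) z
  have hS : ∀ m, AnalyticAt ℝ (S m) x := fun m => ((hA c d m).add (hA d c m)).sub (hA m c d)
  have h1 : (pd b l (christoffel b g k c d)) =ᶠ[𝓝 x]
      fun z => 1 / 2 * ∑ m, pd b l (fun z => (g z)⁻¹ k m * S m z) z := by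
    have hS' : ∀ᶠ z in 𝓝 x, ∀ m, AnalyticAt ℝ (S m) z :=
      eventually_all.2 fun m => (hS m).eventually_analyticAt
    filter_upwards [hg.eventually, hS'] with z hz hSz
    have hm := fun m => (hz.inv_analytic k m).fun_mul (hSz m)
    rw [← pd_sum hm, ← pd_const_mul _ (analyticAt_sum hm)]
    rfl
  have hm := fun m => (hg.inv_analytic k m).fun_mul (hS m)
  rw [pd_congr h1, pd_const_mul _ (analyticAt_sum fun m => analyticAt_pd (hm m)),
    pd_sum fun m => analyticAt_pd (hm m)]
  congr 1
  refine Finset.sum_congr rfl fun m _ => ?_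
  have hS0 : S m x = 0 := by simp [S, pd_eq_zero_of_christoffel hg h0]
  rw [pd_pd_mul (hg.inv_analytic k m) (hS m) (pd_inv_eq_zero_of_christoffel hg h0 _ _ _)
    (pd_inv_eq_zero_of_christoffel hg h0 _ _ _) hS0]
  congr 1
  have h2 : (pd b l (S m)) =ᶠ[𝓝 x] fun z => pd b l (pd b c fun z => g z d m) z +
      pd b l (pd b d fun z => g z c m) z - pd b l (pd b m fun z => g z c d) z := by
    filter_upwards [(hA c d m).eventually_analyticAt, (hA d c m).eventually_analyticAt,
      (hA m c d).eventually_analyticAt] with z h1 h2 h3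
    rw [← pd_add h1 h2, ← pd_sub (h1.fun_add h2) h3]
  have hA2 : ∀ c d m, AnalyticAt ℝ (pd b l (pd b c fun z => g z d m)) x := fun c d m =>
    analyticAt_pd (hA c d m)
  rw [pd_congr h2, pd_sub ((hA2 c d m).fun_add (hA2 d c m)) (hA2 m c d),
    pd_add (hA2 c d m) (hA2 d c m)]

/-- The quadratic terms of the Ricci tensor vanish to second order where the Christoffel symbols
vanish. -/
theorem pd_ricci (hg : IsMetricAt g x) (h0 : ∀ l i j, christoffel b g l i j x = 0)
    (a c d : ι) : pd b a (ricci b g c d) x = ∑ l,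
      (pd b a (pd b l (christoffel b g l c d)) x - pd b a (pd b c (christoffel b g l d l)) x) := by
  have hc := fun l i j => hg.christoffel_analytic (b := b) l i j
  have hp := fun k l i j => analyticAt_pd (b := b) (i := k) (hc l i j)
  have hq := fun l m => ((hc l c d).fun_mul (hc m l m)).fun_sub ((hc l c m).fun_mul (hc m d l))
  have h1 : pd b a (ricci b g c d) x =
      pd b a (fun z => ∑ l, (pd b l (christoffel b g l c d) z - pd b c (christoffel b g l d l) z)) x +
      pd b a (fun z => ∑ l, ∑ m, (christoffel b g l c d z * christoffel b g m l m z
        - christoffel b g l c m z * christoffel b g m d l z)) x := by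
    rw [← pd_add (analyticAt_sum fun l => (hp _ _ _ _).fun_sub (hp _ _ _ _))
      (analyticAt_sum fun l => analyticAt_sum fun m => hq l m)]
    rfl
  rw [h1, pd_sum fun l => (hp _ _ _ _).fun_sub (hp _ _ _ _),
    pd_sum fun l => analyticAt_sum fun m => hq l m]
  have h2 : ∀ l, pd b a (fun z => ∑ m, (christoffel b g l c d z * christoffel b g m l m z
        - christoffel b g l c m z * christoffel b g m d l z)) x = 0 := by
    intro l
    rw [pd_sum fun m => hq l m]
    refine Finset.sum_eq_zero fun m _ => ?_
    rw [pd_sub ((hc l c d).fun_mul (hc m l m)) ((hc l c m).fun_mul (hc m d l)),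
      pd_mul (hc _ _ _) (hc _ _ _), pd_mul (hc _ _ _) (hc _ _ _)]
    simp [h0]
  simp only [h2, Finset.sum_const_zero, add_zero]
  exact Finset.sum_congr rfl fun l _ => pd_sub (hp _ _ _ _) (hp _ _ _ _)

/-- Double contraction with a symmetric matrix. -/
def doubleContract (w : Matrix ι ι ℝ) (f : ι → ι → ι → ι → ℝ) : ℝ :=
  ∑ i, ∑ k, ∑ l, ∑ m, w i k * w l m * f i k l m

theorem doubleContract_swap_left {w : Matrix ι ι ℝ} (hw : ∀ i j, w i j = w j i)
    (f : ι → ι → ι → ι → ℝ) :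
    doubleContract w (fun i k l m => f k i l m) = doubleContract w f := by
  unfold doubleContract
  rw [Finset.sum_comm]
  simp only [hw]

theorem doubleContract_swap_right {w : Matrix ι ι ℝ} (hw : ∀ i j, w i j = w j i)
    (f : ι → ι → ι → ι → ℝ) :
    doubleContract w (fun i k l m => f i k m l) = doubleContract w f := by
  unfold doubleContract
  refine Finset.sum_congr rfl fun i _ => Finset.sum_congr rfl fun k _ => ?_
  rw [Finset.sum_comm]
  refine Finset.sum_congr rfl fun l _ => Finset.sum_congr rfl fun m _ => ?_
  rw [hw m l]

theorem doubleContract_swap_pairs {w : Matrix ι ι ℝ} (f : ι → ι → ι → ι → ℝ) :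
    doubleContract w (fun i k l m => f l m i k) = doubleContract w f := by
  have h1 : ∀ Q : (ι × ι) → (ι × ι) → ℝ, ∑ p, ∑ q, Q p q = ∑ p, ∑ q, Q q p := fun Q =>
    Finset.sum_comm
  simp only [Fintype.sum_prod_type] at h1
  have h2 := h1 fun p q => w p.1 p.2 * w q.1 q.2 * f q.1 q.2 p.1 p.2
  unfold doubleContract
  refine h2.trans ?_
  refine Finset.sum_congr rfl fun i _ => Finset.sum_congr rfl fun k _ =>
    Finset.sum_congr rfl fun l _ => Finset.sum_congr rfl fun m _ => ?_
  rw [mul_comm (w i k)]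

/-- `P a b c d e` stands for `∂_a ∂_b ∂_c g_{de}` at a point where the Christoffel symbols vanish.
Relabelling under the double contraction cancels most terms, and both sides become half of the
contraction of `P i l j k m` minus that of `P j i k l m`. -/
theorem bianchi_algebra {w : Matrix ι ι ℝ} (hw : ∀ i j, w i j = w j i)
    {P : ι → ι → ι → ι → ι → ℝ} (h12 : ∀ a b c d e, P a b c d e = P b a c d e)
    (h23 : ∀ a b c d e, P a b c d e = P a c b d e) (h45 : ∀ a b c d e, P a b c d e = P a b c e d)
    {R : ι → ι → ι → ℝ} (hR : ∀ a c d, R a c d = 1 / 2 * ∑ l, ∑ m, w l m *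
      ((P a l c d m + P a l d c m - P a l m c d) - (P a c d l m + P a c l d m - P a c m d l)))
    (j : ι) :
    ∑ i, ∑ k, w i k * R i k j = 1 / 2 * ∑ i, ∑ k, w i k * R j i k := by
  have e1 : ∑ i, ∑ k, w i k * R i k j = 1 / 2 * doubleContract w fun i k l m =>
      ((P i l k j m + P i l j k m - P i l m k j) - (P i k j l m + P i k l j m - P i k m j l)) := by
    simp only [doubleContract, hR, Finset.mul_sum]
    exact Finset.sum_congr rfl fun _ _ => Finset.sum_congr rfl fun _ _ =>
      Finset.sum_congr rfl fun _ _ => Finset.sum_congr rfl fun _ _ => by ring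
  have e2 : ∑ i, ∑ k, w i k * R j i k = 1 / 2 * doubleContract w fun i k l m =>
      ((P j l i k m + P j l k i m - P j l m i k) - (P j i k l m + P j i l k m - P j i m k l)) := by
    simp only [doubleContract, hR, Finset.mul_sum]
    exact Finset.sum_congr rfl fun _ _ => Finset.sum_congr rfl fun _ _ =>
      Finset.sum_congr rfl fun _ _ => Finset.sum_congr rfl fun _ _ => by ring
  have hadd : ∀ f f', doubleContract w (fun i k l m => f i k l m + f' i k l m) =
      doubleContract w f + doubleContract w f' := fun f f' => by
    simp only [doubleContract, mul_add, Finset.sum_add_distrib]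
  have hsub : ∀ f f', doubleContract w (fun i k l m => f i k l m - f' i k l m) =
      doubleContract w f - doubleContract w f' := fun f f' => by
    simp only [doubleContract, mul_sub, Finset.sum_sub_distrib]
  rw [e1, e2]
  simp only [hadd, hsub]
  have t13 : doubleContract w (fun i k l m => P i l m k j) =
      doubleContract w fun i k l m => P i l k j m := by
    rw [← doubleContract_swap_pairs]
    congr 1; funext i k l m
    rw [h12, h45]
  have t56 : doubleContract w (fun i k l m => P i k m j l) =
      doubleContract w fun i k l m => P i k l j m :=
    doubleContract_swap_right hw fun i k l m => P i k l j m
  have u56 : doubleContract w (fun i k l m => P j i m k l) =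
      doubleContract w fun i k l m => P j i l k m :=
    doubleContract_swap_right hw fun i k l m => P j i l k m
  have u1 : doubleContract w (fun i k l m => P j l i k m) =
      doubleContract w fun i k l m => P i l j k m := by
    congr 1; funext i k l m
    rw [h12, h23, h12, h23]
  have u2 : doubleContract w (fun i k l m => P j l k i m) =
      doubleContract w fun i k l m => P j l i k m :=
    doubleContract_swap_left hw fun i k l m => P j l i k m
  have u3 : doubleContract w (fun i k l m => P j l m i k) =
      doubleContract w fun i k l m => P j i k l m :=
    doubleContract_swap_pairs fun i k l m => P j i k l m
  have u4 : doubleContract w (fun i k l m => P i k j l m) =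
      doubleContract w fun i k l m => P j i k l m := by
    congr 1; funext i k l m
    rw [h23, h12]
  rw [t13, t56, u56, u2, u1, u3, u4]
  ring

theorem bianchi_of_christoffel_eq_zero (hg : IsMetricAt g x)
    (h0 : ∀ l i j, christoffel b g l i j x = 0) (j : ι) :
    ∑ i, ∑ k, (g x)⁻¹ i k * pd b i (ricci b g k j) x =
      1 / 2 * ∑ i, ∑ k, (g x)⁻¹ i k * pd b j (ricci b g i k) x := by
  have hA : ∀ c d m, AnalyticAt ℝ (pd b c fun z => g z d m) x := fun c d m =>
    analyticAt_pd (hg.analytic d m)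
  refine bianchi_algebra hg.inv_symm (P := fun a b' c d e => pd b a (pd b b' (pd b c fun z => g z d e)) x)
    ?_ ?_ ?_ (R := fun a c d => pd b a (ricci b g c d) x) ?_ j
  · intro a c d e f
    exact pd_comm (hA d e f)
  · intro a c d e f
    have h1 : (pd b c (pd b d fun z => g z e f)) =ᶠ[𝓝 x] pd b d (pd b c fun z => g z e f) :=
      (hg.analytic e f).eventually_analyticAt.mono fun z hz => pd_comm hz
    exact pd_congr h1
  · intro a c d e f
    have h1 : (fun z => g z e f) =ᶠ[𝓝 x] fun z => g z f e := hg.symm.mono fun z hz => hz e f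
    exact pd_congr (eventuallyEq_pd (eventuallyEq_pd h1))
  · intro a c d
    rw [pd_ricci hg h0]
    simp only [pd_pd_christoffel hg h0]
    rw [Finset.mul_sum]
    refine Finset.sum_congr rfl fun l _ => ?_
    simp only [Finset.mul_sum, ← Finset.sum_sub_distrib]
    exact Finset.sum_congr rfl fun m _ => by ring

end Bianchi

/-! ### The contracted Bianchi identity at every point. -/

section ContractedBianchi

open Topology Filter

variable {ι F : Type*} [Fintype ι] [DecidableEq ι]
  [NormedAddCommGroup F] [NormedSpace ℝ F] [FiniteDimensional ℝ F] {q : F} {G : F → Matrix ι ι ℝ}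
  {b : Module.Basis ι ℝ F}

/-- Coordinates in which the Christoffel symbols of `G` at `q` vanish. -/
def normalChart (b : Module.Basis ι ℝ F) (G : F → Matrix ι ι ℝ) (q z : F) : F :=
  z - (1 / 2 : ℝ) • gammaMap b G q (z - q) (z - q)

theorem hasFDerivAt_normalChart (hG : IsMetricAt G q) (z : F) :
    HasFDerivAt (normalChart b G q)
      (ContinuousLinearMap.id ℝ F - gammaMap b G q (z - q)) z := by
  have hid : HasFDerivAt (fun z => z - q) (ContinuousLinearMap.id ℝ F) z :=
    (hasFDerivAt_id z).sub_const q
  have h1 : HasFDerivAt (fun z => gammaMap b G q (z - q)) (gammaMap b G q) z := by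
    have := (gammaMap b G q).hasFDerivAt.comp z hid
    rwa [ContinuousLinearMap.comp_id] at this
  have h2 := (hasFDerivAt_id z).sub ((h1.clm_apply hid).const_smul (1 / 2 : ℝ))
  refine h2.congr_fderiv ?_
  ext v
  simp only [_root_.sub_apply, _root_.smul_apply, _root_.add_apply,
    ContinuousLinearMap.comp_apply, ContinuousLinearMap.flip_apply, ContinuousLinearMap.id_apply]
  rw [gammaMap_symm hG v, ← two_smul ℝ, smul_smul]
  norm_num

theorem fderiv_normalChart (hG : IsMetricAt G q) (z : F) :
    fderiv ℝ (normalChart b G q) z = ContinuousLinearMap.id ℝ F - gammaMap b G q (z - q) :=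
  (hasFDerivAt_normalChart hG z).fderiv

theorem analyticAt_normalChart (z : F) : AnalyticAt ℝ (normalChart b G q) z := by
  have hid : AnalyticAt ℝ (fun z => z - q) z := analyticAt_id.sub analyticAt_const
  exact analyticAt_id.sub (analyticAt_const.smul
    (((gammaMap b G q).analyticAt_bilinear _).comp₂ hid hid))

theorem normalChart_self : normalChart b G q q = q := by simp [normalChart]

/-- The metric in the coordinates `normalChart`. -/
def normalMetric (b : Module.Basis ι ℝ F) (G : F → Matrix ι ι ℝ) (q z : F) : Matrix ι ι ℝ :=
  fun i j => formMap b G (normalChart b G q z) (fderiv ℝ (normalChart b G q) z (b i))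
    (fderiv ℝ (normalChart b G q) z (b j))

theorem formMap_symm {x : F} (hG : ∀ i j, G x i j = G x j i) (v w : F) :
    formMap b G x v w = formMap b G x w v := by
  have : ∀ v w, formMap b G x v w = (formMap b G x).flip v w := by
    refine clm_ext_basis (b := b) fun i j => ?_
    rw [ContinuousLinearMap.flip_apply, formMap_basis, formMap_basis, hG]
  exact this v w

theorem normalMetric_self (hG : IsMetricAt G q) : normalMetric b G q q = G q := by
  funext i j
  simp [normalMetric, fderiv_normalChart hG, normalChart_self, formMap_basis]

theorem isPullback_normalMetric :
    IsPullback b b (normalChart b G q) G (normalMetric b G q) q :=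
  Eventually.of_forall fun _ _ _ => rfl

theorem isMetricAt_normalMetric (hG : IsMetricAt G q) : IsMetricAt (normalMetric b G q) q where
  analytic i j := by
    have := FiniteDimensional.complete ℝ F
    have h1 : AnalyticAt ℝ (formMap b G) (normalChart b G q q) := by
      rw [normalChart_self]; exact analyticAt_formMap hG
    have h2 := h1.comp (analyticAt_normalChart (b := b) (G := G) q)
    have h3 := fun i => analyticAt_pushField (e := fun i _ => b i)
      (analyticAt_normalChart (b := b) (G := G) (q := q) q) (fun _ => analyticAt_const) i
    have h4 := ((ContinuousLinearMap.id ℝ (F →L[ℝ] F →L[ℝ] ℝ)).analyticAt_bilinear _).comp₂ h2 (h3 i)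
    exact ((ContinuousLinearMap.id ℝ (F →L[ℝ] ℝ)).analyticAt_bilinear _).comp₂ h4 (h3 j)
  symm := by
    have hc : Tendsto (normalChart b G q) (𝓝 q) (𝓝 q) := by
      have := (analyticAt_normalChart (b := b) (G := G) (q := q) q).continuousAt.tendsto
      rwa [normalChart_self] at this
    filter_upwards [hc.eventually hG.symm] with z hz i j
    exact formMap_symm hz _ _
  det_ne := by rw [normalMetric_self hG]; exact hG.det_ne

/-- At `q` the chart has the identity as derivative and minus the Christoffel symbols as second
derivative, so the two terms of the transformation law cancel. -/
theorem christoffel_normalMetric (hG : IsMetricAt G q) (l i j : ι) :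
    christoffel b (normalMetric b G q) l i j q = 0 := by
  have hG' : IsMetricAt G (normalChart b G q q) := by rw [normalChart_self]; exact hG
  have h1 := christoffel_pullback hG' (isMetricAt_normalMetric hG) (analyticAt_normalChart q)
    isPullback_normalMetric i j
  have h2 : fderiv ℝ (fun z => fderiv ℝ (normalChart b G q) z (b j)) q (b i) =
      -gammaMap b G q (b i) (b j) := by
    have h3 : (fun z => fderiv ℝ (normalChart b G q) z (b j)) =
        fun z => b j - gammaMap b G q (z - q) (b j) := by
      funext z; rw [fderiv_normalChart hG]; rfl
    have hid : HasFDerivAt (fun z => z - q) (ContinuousLinearMap.id ℝ F) q :=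
      (hasFDerivAt_id q).sub_const q
    have h4 : HasFDerivAt (fun z => gammaMap b G q (z - q)) (gammaMap b G q) q := by
      have := (gammaMap b G q).hasFDerivAt.comp q hid
      rwa [ContinuousLinearMap.comp_id] at this
    rw [h3, ((h4.clm_apply (hasFDerivAt_const (b j) q)).const_sub (b j)).fderiv]
    simp
  rw [h2] at h1
  simp only [fderiv_normalChart hG, normalChart_self, sub_self, map_zero, sub_zero,
    ContinuousLinearMap.id_apply, neg_add_cancel] at h1
  exact (Fintype.linearIndependent_iff.1 b.linearIndependent _ h1.symm) l

theorem formMap_ricci {x : F} (hG : IsMetricAt G x) (v w : F) :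
    formMap b (fun z i j => ricci b G i j z) x v w = ricciForm (gammaMap b G) x v w := by
  rw [ricciForm_expand hG]
  simp only [formMap, _root_.sum_apply, _root_.smul_apply, ContinuousLinearMap.smulRight_apply,
    coordCLM_apply, smul_eq_mul]
  exact Finset.sum_congr rfl fun i _ => Finset.sum_congr rfl fun j _ => by ring

/-- The Ricci tensor is covariant under changes of coordinates. -/
theorem isPullback_ricci {F' : Type*} [NormedAddCommGroup F'] [NormedSpace ℝ F']
    [FiniteDimensional ℝ F'] {b' : Module.Basis ι ℝ F'} {Ψ : F' → F} {y : F'}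
    {G' : F' → Matrix ι ι ℝ} (hG : IsMetricAt G (Ψ y)) (hG' : IsMetricAt G' y)
    (hΨ : AnalyticAt ℝ Ψ y) (hp : IsPullback b b' Ψ G G' y) :
    IsPullback b b' Ψ (fun z i j => ricci b G i j z) (fun z i j => ricci b' G' i j z) y := by
  filter_upwards [hΨ.continuousAt.eventually hG.eventually, hG'.eventually,
    hΨ.eventually_analyticAt, hp.eventually_nhds] with z h1 h2 h3 h4 i j
  rw [formMap_ricci h1, ricci_pullback h1 h2 h3 h4]

/-- The contracted Bianchi identity. -/
theorem divergence_ricci (hG : IsMetricAt G q) (j : ι) :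
    divergence b G (fun z i j => ricci b G i j z) j q = 1 / 2 * pd b j (scalarCurvature b G) q := by
  have hR := fun i j => hG.ricci_analytic (b := b) i j
  have hG' : IsMetricAt G (normalChart b G q q) := by rw [normalChart_self]; exact hG
  have hN := isMetricAt_normalMetric (b := b) hG
  have hΨ := analyticAt_normalChart (b := b) (G := G) (q := q) q
  have h0 := christoffel_normalMetric (b := b) hG
  -- At `q` the change of coordinates is the identity to first order and the new Christoffel symbols
  -- vanish; the covariant derivative of the Ricci tensor is there a partial derivative in the new
  -- coordinates.
  have h1 : ∀ a c d, covDerivTensor b G (fun z i j => ricci b G i j z) a c d q =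
      pd b a (ricci b (normalMetric b G q) c d) q := by
    intro a c d
    have h2 := covDerivTensor_pullback hG' hN hΨ isPullback_normalMetric
      (H := fun z i j => ricci b G i j z) (by rw [normalChart_self]; exact hR)
      (isPullback_ricci hG' hN hΨ isPullback_normalMetric) a c d
    rw [covDerivTensor_eq_covForm hG hR]
    simp only [fderiv_normalChart hG, normalChart_self, sub_self, map_zero, sub_zero,
      ContinuousLinearMap.id_apply] at h2
    rw [← h2]
    simp [covDerivTensor, h0]
  have h3 := bianchi_of_christoffel_eq_zero hN h0 j
  rw [normalMetric_self hG] at h3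
  unfold scalarCurvature
  rw [pd_tr hG hR]
  simp only [divergence, h1]
  exact h3

end ContractedBianchi

/-! ### The spacetime metric built from lapse, shift and slice metric. -/

section SpacetimeSplitting

open Topology Filter

variable {n : ℕ}

theorem sum_space_add_time {X : Type*} [AddCommMonoid X] (f : Fin n ⊕ Unit → X) :
    ∑ a, f a = ∑ i, f (Sum.inl i) + f (Sum.inr ()) := by
  rw [Fintype.sum_sum_type]; simp

/-- The coordinate directions as a basis. -/
def spacetimeBasis : Module.Basis (Fin n ⊕ Unit) ℝ (EuclideanSpace ℝ (Fin n) × ℝ) :=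
  (Pi.basisFun ℝ (Fin n ⊕ Unit)).map coordEquiv.symm.toLinearEquiv

theorem coe_spacetimeBasis : ⇑(spacetimeBasis (n := n)) = spacetimeDir := by
  funext i
  rw [spacetimeBasis, Module.Basis.map_apply, Pi.basisFun_apply]
  exact coordEquiv_symm_single i

theorem spacetimeBasis_repr (v : EuclideanSpace ℝ (Fin n) × ℝ) (i : Fin n ⊕ Unit) :
    spacetimeBasis.repr v i = coordEquiv v i := by
  simp [spacetimeBasis]

variable {N : EuclideanSpace ℝ (Fin n) × ℝ → ℝ} {β : EuclideanSpace ℝ (Fin n) × ℝ → Fin n → ℝ}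
  {g K : EuclideanSpace ℝ (Fin n) × ℝ → Matrix (Fin n) (Fin n) ℝ}
  {q : EuclideanSpace ℝ (Fin n) × ℝ}

/-- The components of the metric `-N² dt² + g_{ij} (dx^i + β^i dt) (dx^j + β^j dt)`. -/
def splitMetric (N : EuclideanSpace ℝ (Fin n) × ℝ → ℝ)
    (β : EuclideanSpace ℝ (Fin n) × ℝ → Fin n → ℝ)
    (g : EuclideanSpace ℝ (Fin n) × ℝ → Matrix (Fin n) (Fin n) ℝ)
    (z : EuclideanSpace ℝ (Fin n) × ℝ) : Matrix (Fin n ⊕ Unit) (Fin n ⊕ Unit) ℝ :=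
  fun a c => match a, c with
  | Sum.inl i, Sum.inl j => g z i j
  | Sum.inl i, Sum.inr _ => ∑ h, g z i h * β z h
  | Sum.inr _, Sum.inl j => ∑ h, g z h j * β z h
  | Sum.inr _, Sum.inr _ => ∑ i, ∑ j, g z i j * β z i * β z j - N z ^ 2

/-- The inverse of `splitMetric`. -/
def splitInverse (N : EuclideanSpace ℝ (Fin n) × ℝ → ℝ)
    (β : EuclideanSpace ℝ (Fin n) × ℝ → Fin n → ℝ)
    (g : EuclideanSpace ℝ (Fin n) × ℝ → Matrix (Fin n) (Fin n) ℝ)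
    (z : EuclideanSpace ℝ (Fin n) × ℝ) : Matrix (Fin n ⊕ Unit) (Fin n ⊕ Unit) ℝ :=
  fun a c => match a, c with
  | Sum.inl i, Sum.inl j => (g z)⁻¹ i j - β z i * β z j / N z ^ 2
  | Sum.inl i, Sum.inr _ => β z i / N z ^ 2
  | Sum.inr _, Sum.inl j => β z j / N z ^ 2
  | Sum.inr _, Sum.inr _ => -(1 / N z ^ 2)

/-- Analytic lapse, shift and slice metric at a point. -/
structure IsSplitAt (N : EuclideanSpace ℝ (Fin n) × ℝ → ℝ)
    (β : EuclideanSpace ℝ (Fin n) × ℝ → Fin n → ℝ)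
    (g : EuclideanSpace ℝ (Fin n) × ℝ → Matrix (Fin n) (Fin n) ℝ)
    (q : EuclideanSpace ℝ (Fin n) × ℝ) : Prop where
  lapse : AnalyticAt ℝ N q
  lapse_ne : N q ≠ 0
  shift : ∀ i, AnalyticAt ℝ (fun z => β z i) q
  metric : IsMetricAt g q

theorem IsSplitAt.eventually (hs : IsSplitAt N β g q) : ∀ᶠ z in 𝓝 q, IsSplitAt N β g z := by
  have hβ : ∀ᶠ z in 𝓝 q, ∀ i, AnalyticAt ℝ (fun z => β z i) z :=
    eventually_all.2 fun i => (hs.shift i).eventually_analyticAt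
  filter_upwards [hs.lapse.eventually_analyticAt, hs.lapse.continuousAt.eventually_ne hs.lapse_ne,
    hβ, hs.metric.eventually] with z h1 h2 h3 h4
  exact ⟨h1, h2, h3, h4⟩

theorem splitMetric_mul_splitInverse (hs : IsSplitAt N β g q) :
    splitMetric N β g q * splitInverse N β g q = 1 := by
  have hN := hs.lapse_ne
  have hm := hs.metric.sum_mul_inv
  have hsy := hs.metric.symm.self_of_nhds
  have e1 : ∀ i j, ∑ x, g q i x * (β q x * β q j / N q ^ 2) =
      (∑ x, g q i x * β q x) * (β q j / N q ^ 2) := fun i j => by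
    rw [Finset.sum_mul]; exact Finset.sum_congr rfl fun x _ => by ring
  have e2 : ∀ i, ∑ x, g q i x * (β q x / N q ^ 2) = (∑ x, g q i x * β q x) * (1 / N q ^ 2) :=
    fun i => by rw [Finset.sum_mul]; exact Finset.sum_congr rfl fun x _ => by ring
  have e3 : ∀ c, ∑ x, (∑ h, g q h x * β q h) * (β q x * c) =
      (∑ i, ∑ j, g q i j * β q i * β q j) * c := by
    intro c
    rw [Finset.sum_comm, Finset.sum_mul]
    refine Finset.sum_congr rfl fun x _ => ?_
    rw [Finset.sum_mul, Finset.sum_mul]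
    exact Finset.sum_congr rfl fun y _ => by ring
  have e4 : ∀ j, ∑ x, (∑ h, g q h x * β q h) * (g q)⁻¹ x j = β q j := by
    intro j
    have : ∀ x, (∑ h, g q h x * β q h) * (g q)⁻¹ x j =
        ∑ h, β q h * (g q h x * (g q)⁻¹ x j) := fun x => by
      rw [Finset.sum_mul]; exact Finset.sum_congr rfl fun y _ => by ring
    simp only [this]
    rw [Finset.sum_comm]
    simp only [← Finset.mul_sum, hm]
    simp
  ext (i | i) (j | j)
  · simp only [splitMetric, splitInverse, Matrix.mul_apply, Fintype.sum_sum_type,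
      Finset.univ_unique, Finset.sum_singleton, mul_sub, Finset.sum_sub_distrib, hm, e1,
      Matrix.one_apply, Sum.inl.injEq]
    ring
  · simp only [splitMetric, splitInverse, Matrix.mul_apply, Fintype.sum_sum_type,
      Finset.univ_unique, Finset.sum_singleton, e2, Matrix.one_apply, reduceCtorEq, if_false]
    ring
  · have h3 := e3 (β q j / N q ^ 2)
    simp only [splitMetric, splitInverse, Matrix.mul_apply, Fintype.sum_sum_type,
      Finset.univ_unique, Finset.sum_singleton, mul_sub, Finset.sum_sub_distrib, e4,
      Matrix.one_apply, reduceCtorEq, if_false, mul_div_assoc, h3]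
    field_simp
    ring
  · have h3 := e3 (1 / N q ^ 2)
    simp only [splitMetric, splitInverse, Matrix.mul_apply, Fintype.sum_sum_type,
      Finset.univ_unique, Finset.sum_singleton,
      Matrix.one_apply, if_true]
    simp only [div_eq_mul_one_div (β q _), h3]
    field_simp
    ring

theorem splitMetric_inv (hs : IsSplitAt N β g q) :
    (splitMetric N β g q)⁻¹ = splitInverse N β g q :=
  Matrix.inv_eq_right_inv (splitMetric_mul_splitInverse hs)

theorem isMetricAt_splitMetric (hs : IsSplitAt N β g q) : IsMetricAt (splitMetric N β g) q where
  analytic := by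
    rintro (i | i) (j | j)
    · exact hs.metric.analytic i j
    · exact analyticAt_sum (s := Finset.univ) fun h => (hs.metric.analytic i h).fun_mul (hs.shift h)
    · exact analyticAt_sum (s := Finset.univ) fun h => (hs.metric.analytic h j).fun_mul (hs.shift h)
    · exact (analyticAt_sum fun i => analyticAt_sum fun j =>
        ((hs.metric.analytic i j).fun_mul (hs.shift i)).fun_mul (hs.shift j)).fun_sub
          (hs.lapse.fun_pow 2)
  symm := by
    filter_upwards [hs.metric.symm] with z hz
    rintro (i | i) (j | j)
    · exact hz i j
    · exact Finset.sum_congr (s₁ := Finset.univ) rfl fun h _ => congrArg (· * β z h) (hz i h)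
    · exact Finset.sum_congr (s₁ := Finset.univ) rfl fun h _ => congrArg (· * β z h) (hz h j)
    · rfl
  det_ne := (Matrix.isUnit_det_of_right_inverse (splitMetric_mul_splitInverse hs)).ne_zero

/-- The evolution equation of the metric says that `K_{ij} = -N Γ^t_{ij}`. -/
theorem metricRate_iff (hs : IsSplitAt N β g q) (i j : Fin n) :
    pd spacetimeDir (Sum.inr ()) (fun z => g z i j) q = metricRate N β g K i j q ↔
      K q i j = -N q * christoffel spacetimeDir (splitMetric N β g) (Sum.inr ()) (Sum.inl i)
        (Sum.inl j) q := by
  have hN := hs.lapse_ne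
  have h1 : ∀ i j, pd sliceDir i (fun z => ∑ h, g z j h * β z h) q =
      ∑ h, (g q j h * pd sliceDir i (fun z => β z h) q
        + pd sliceDir i (fun z => g z j h) q * β q h) := by
    intro i j
    rw [pd_sum fun h => (hs.metric.analytic j h).fun_mul (hs.shift h)]
    refine Finset.sum_congr rfl fun h _ => ?_
    rw [pd_mul (hs.metric.analytic j h) (hs.shift h)]
    ring
  have h2 : christoffel spacetimeDir (splitMetric N β g) (Sum.inr ()) (Sum.inl i) (Sum.inl j) q =
      1 / (2 * N q ^ 2) * (pd spacetimeDir (Sum.inr ()) (fun z => g z i j) q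
        - ∑ h, (β q h * pd sliceDir h (fun z => g z i j) q
    + (pd sliceDir j (fun z => β z h) q * g q i h + pd sliceDir i (fun z => β z h) q * g q h j))) := by
    have e1 : christoffel spacetimeDir (splitMetric N β g) (Sum.inr ()) (Sum.inl i) (Sum.inl j) q =
      1 / 2 * ((∑ m, β q m / N q ^ 2 * (pd sliceDir i (fun z => g z j m) q
          + pd sliceDir j (fun z => g z i m) q - pd sliceDir m (fun z => g z i j) q))
        + -(1 / N q ^ 2) * (pd sliceDir i (fun z => ∑ h, g z j h * β z h) q
          + pd sliceDir j (fun z => ∑ h, g z i h * β z h) q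
          - pd spacetimeDir (Sum.inr ()) (fun z => g z i j) q)) := by
      unfold christoffel
      rw [sum_space_add_time, splitMetric_inv hs]
      rfl
    rw [e1, h1, h1]
    have e2 : ∀ m, β q m / N q ^ 2 * (pd sliceDir i (fun z => g z j m) q
          + pd sliceDir j (fun z => g z i m) q - pd sliceDir m (fun z => g z i j) q) =
        1 / N q ^ 2 * (g q j m * pd sliceDir i (fun z => β z m) q
        + pd sliceDir i (fun z => g z j m) q * β q m) +
        1 / N q ^ 2 * (g q i m * pd sliceDir j (fun z => β z m) q
        + pd sliceDir j (fun z => g z i m) q * β q m) - 1 / N q ^ 2 *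
        (β q m * pd sliceDir m (fun z => g z i j) q
    + (pd sliceDir j (fun z => β z m) q * g q i m + pd sliceDir i (fun z => β z m) q * g q m j)) := by
      intro m
      rw [hs.metric.symm.self_of_nhds m j]
      ring
    simp only [e2, Finset.sum_add_distrib, Finset.sum_sub_distrib, ← Finset.mul_sum]
    field_simp
    ring
  rw [h2]
  unfold metricRate
  constructor
  · intro h
    rw [h]
    field_simp
    ring
  · intro h
    rw [h]
    field_simp
    ring

end SpacetimeSplitting

/-! ### The frame adapted to the slices and its connection coefficients. -/

section SplitFrame

open Topology Filter

variable {n : ℕ}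

/-- The frame `∂_i`, `e₀ = ∂_t - β^j ∂_j`. -/
def splitFrame (β : EuclideanSpace ℝ (Fin n) × ℝ → Fin n → ℝ) :
    Fin n ⊕ Unit → EuclideanSpace ℝ (Fin n) × ℝ → EuclideanSpace ℝ (Fin n) × ℝ
  | Sum.inl i => fun _ => spacetimeDir (Sum.inl i)
  | Sum.inr _ => fun z => spacetimeDir (Sum.inr ()) - ∑ k, β z k • spacetimeDir (Sum.inl k)

/-- The derivative along `e₀`. -/
def normalDeriv (β : EuclideanSpace ℝ (Fin n) × ℝ → Fin n → ℝ)
    (f : EuclideanSpace ℝ (Fin n) × ℝ → ℝ) (z : EuclideanSpace ℝ (Fin n) × ℝ) : ℝ :=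
  pd spacetimeDir (Sum.inr ()) f z - ∑ k, β z k * pd sliceDir k f z

/-- The mixed components `K^l_i`. -/
def mixedComp (g K : EuclideanSpace ℝ (Fin n) × ℝ → Matrix (Fin n) (Fin n) ℝ) (l i : Fin n)
    (z : EuclideanSpace ℝ (Fin n) × ℝ) : ℝ := ∑ m, (g z)⁻¹ l m * K z i m

/-- The components of the metric in the frame `splitFrame`. -/
def splitGram (N : EuclideanSpace ℝ (Fin n) × ℝ → ℝ)
    (g : EuclideanSpace ℝ (Fin n) × ℝ → Matrix (Fin n) (Fin n) ℝ)
    (z : EuclideanSpace ℝ (Fin n) × ℝ) : Matrix (Fin n ⊕ Unit) (Fin n ⊕ Unit) ℝ :=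
  fun a c => match a, c with
  | Sum.inl i, Sum.inl j => g z i j
  | Sum.inl _, Sum.inr _ => 0
  | Sum.inr _, Sum.inl _ => 0
  | Sum.inr _, Sum.inr _ => -N z ^ 2

/-- The connection coefficients in the frame `splitFrame`. -/
def splitConn (N : EuclideanSpace ℝ (Fin n) × ℝ → ℝ)
    (β : EuclideanSpace ℝ (Fin n) × ℝ → Fin n → ℝ)
    (g K : EuclideanSpace ℝ (Fin n) × ℝ → Matrix (Fin n) (Fin n) ℝ) :
    Fin n ⊕ Unit → Fin n ⊕ Unit → Fin n ⊕ Unit → EuclideanSpace ℝ (Fin n) × ℝ → ℝ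
  | Sum.inl l, Sum.inl i, Sum.inl j => christoffel sliceDir g l i j
  | Sum.inl l, Sum.inl i, Sum.inr _ => fun z => -(N z * mixedComp g K l i z)
  | Sum.inl l, Sum.inr _, Sum.inl j => fun z =>
      pd sliceDir j (fun z => β z l) z - N z * mixedComp g K l j z
  | Sum.inl l, Sum.inr _, Sum.inr _ => fun z => N z * ∑ m, (g z)⁻¹ l m * pd sliceDir m N z
  | Sum.inr _, Sum.inl i, Sum.inl j => fun z => -(K z i j / N z)
  | Sum.inr _, Sum.inl i, Sum.inr _ => fun z => pd sliceDir i N z / N z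
  | Sum.inr _, Sum.inr _, Sum.inl j => fun z => pd sliceDir j N z / N z
  | Sum.inr _, Sum.inr _, Sum.inr _ => fun z => normalDeriv β N z / N z

variable {N : EuclideanSpace ℝ (Fin n) × ℝ → ℝ} {β : EuclideanSpace ℝ (Fin n) × ℝ → Fin n → ℝ}
  {g K : EuclideanSpace ℝ (Fin n) × ℝ → Matrix (Fin n) (Fin n) ℝ}
  {q : EuclideanSpace ℝ (Fin n) × ℝ}

theorem fderiv_splitFrame_inr (f : EuclideanSpace ℝ (Fin n) × ℝ → ℝ) (z : EuclideanSpace ℝ (Fin n) × ℝ)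
    (u : Unit) : fderiv ℝ f z (splitFrame β (Sum.inr u) z) = normalDeriv β f z := by
  simp only [splitFrame, normalDeriv, map_sub, map_sum, map_smul, smul_eq_mul]
  rfl

theorem analyticAt_normalDeriv {f : EuclideanSpace ℝ (Fin n) × ℝ → ℝ} (hf : AnalyticAt ℝ f q)
    (hβ : ∀ i, AnalyticAt ℝ (fun z => β z i) q) : AnalyticAt ℝ (normalDeriv β f) q :=
  (analyticAt_pd hf).fun_sub (analyticAt_sum fun k => (hβ k).fun_mul (analyticAt_pd hf))

theorem analyticAt_mixedComp (hg : IsMetricAt g q) (hK : ∀ i j, AnalyticAt ℝ (fun z => K z i j) q)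
    (l i : Fin n) : AnalyticAt ℝ (mixedComp g K l i) q :=
  analyticAt_sum fun m => (hg.inv_analytic l m).fun_mul (hK i m)

theorem analyticAt_splitFrame (hβ : ∀ i, AnalyticAt ℝ (fun z => β z i) q) (a : Fin n ⊕ Unit) :
    AnalyticAt ℝ (splitFrame β a) q := by
  rcases a with i | i
  · exact analyticAt_const
  · exact analyticAt_const.fun_sub
      (Finset.analyticAt_fun_sum _ fun k _ => analyticAt_smul_const (hβ k) _)

theorem analyticAt_splitConn (hs : IsSplitAt N β g q)
    (hK : ∀ i j, AnalyticAt ℝ (fun z => K z i j) q) (a c d : Fin n ⊕ Unit) :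
    AnalyticAt ℝ (splitConn N β g K a c d) q := by
  have hm := analyticAt_mixedComp hs.metric hK
  rcases a with l | l <;> rcases c with i | i <;> rcases d with j | j
  · exact hs.metric.christoffel_analytic l i j
  · exact (hs.lapse.fun_mul (hm l i)).fun_neg
  · exact (analyticAt_pd (hs.shift l)).fun_sub (hs.lapse.fun_mul (hm l j))
  · exact hs.lapse.fun_mul (analyticAt_sum fun m =>
      (hs.metric.inv_analytic l m).fun_mul (analyticAt_pd hs.lapse))
  · exact ((hK i j).fun_div hs.lapse hs.lapse_ne).fun_neg
  · exact (analyticAt_pd hs.lapse).fun_div hs.lapse hs.lapse_ne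
  · exact (analyticAt_pd hs.lapse).fun_div hs.lapse hs.lapse_ne
  · exact (analyticAt_normalDeriv hs.lapse hs.shift).fun_div hs.lapse hs.lapse_ne

theorem sum_mixedComp_mul (hg : IsMetricAt g q) (i j : Fin n) :
    ∑ l, mixedComp g K l i q * g q l j = K q i j := by
  have : ∀ l, mixedComp g K l i q * g q l j = ∑ m, K q i m * ((g q)⁻¹ m l * g q l j) := by
    intro l
    rw [mixedComp, Finset.sum_mul]
    refine Finset.sum_congr rfl fun m _ => ?_
    rw [hg.inv_symm l m]
    ring
  simp only [this]
  rw [Finset.sum_comm]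
  simp only [← Finset.mul_sum, hg.sum_inv_mul]
  simp

theorem sum_mul_raised (hg : IsMetricAt g q) (w : Fin n → ℝ) (j : Fin n) :
    ∑ l, g q j l * ∑ m, (g q)⁻¹ l m * w m = w j := by
  simp only [Finset.mul_sum, ← mul_assoc]
  rw [Finset.sum_comm]
  simp only [← Finset.sum_mul, hg.sum_mul_inv]
  simp

theorem det_splitGram (hs : IsSplitAt N β g q) : (splitGram N g q).det ≠ 0 := by
  have h1 : splitGram N g q = Matrix.fromBlocks (g q) 0 0 (Matrix.of fun _ _ => -N q ^ 2) := by
    ext (i | i) (j | j) <;> rfl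
  rw [h1, Matrix.det_fromBlocks_zero₂₁, Matrix.det_unique (n := Unit)]
  exact mul_ne_zero hs.metric.det_ne (neg_ne_zero.2 (pow_ne_zero 2 hs.lapse_ne))

theorem splitGram_eq (hs : IsSplitAt N β g q) (c d : Fin n ⊕ Unit) :
    splitGram N g q c d = formMap spacetimeBasis (splitMetric N β g) q (splitFrame β c q)
      (splitFrame β d q) := by
  have hb : ∀ a c, formMap spacetimeBasis (splitMetric N β g) q (spacetimeDir a) (spacetimeDir c) =
      splitMetric N β g q a c := fun a c => by
    rw [← coe_spacetimeBasis]; exact formMap_basis a c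
  have hsy := hs.metric.symm.self_of_nhds
  rcases c with i | i <;> rcases d with j | j
  · rw [splitFrame, splitFrame, hb]; rfl
  · simp only [splitFrame, map_sub, map_sum, map_smul, hb, splitMetric, splitGram, smul_eq_mul]
    rw [eq_comm, sub_eq_zero]
    exact Finset.sum_congr rfl fun k _ => mul_comm _ _
  · simp only [splitFrame, map_sub, map_sum, map_smul, _root_.sub_apply, _root_.sum_apply,
      _root_.smul_apply, hb, splitMetric, splitGram, smul_eq_mul]
    rw [eq_comm, sub_eq_zero]
    exact Finset.sum_congr rfl fun k _ => mul_comm _ _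
  · simp only [splitFrame, map_sub, map_sum, map_smul, _root_.sub_apply, _root_.sum_apply,
      _root_.smul_apply, hb, splitMetric, splitGram, smul_eq_mul, mul_sub, Finset.mul_sum,
      Finset.sum_sub_distrib]
    have e1 : ∑ k, ∑ h, β q k * (g q k h * β q h) = ∑ i, ∑ j, g q i j * β q i * β q j :=
      Finset.sum_congr rfl fun _ _ => Finset.sum_congr rfl fun _ _ => by ring
    have e2 : ∑ k, ∑ h, β q k * (g q h k * β q h) = ∑ i, ∑ j, g q i j * β q i * β q j :=
      Finset.sum_congr rfl fun k _ => Finset.sum_congr rfl fun h _ => by rw [hsy h k]; ring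
    have e3 : ∑ k, ∑ h, β q k * (β q h * g q h k) = ∑ i, ∑ j, g q i j * β q i * β q j :=
      Finset.sum_congr rfl fun k _ => Finset.sum_congr rfl fun h _ => by rw [hsy h k]; ring
    rw [e1, e2, e3]
    ring

theorem pd_sq (hN : AnalyticAt ℝ N q) (v : EuclideanSpace ℝ (Fin n) × ℝ) :
    fderiv ℝ (fun z => -N z ^ 2) q v = -2 * N q * fderiv ℝ N q v := by
  have h1 : (fun z => -N z ^ 2) = fun z => -(N z * N z) := by funext z; ring
  have h2 := pd_mul (b := fun _ : Unit => v) (i := ()) hN hN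
  have h3 := pd_neg (b := fun _ : Unit => v) (i := ()) (f := fun z => N z * N z) (x := q)
  rw [h1]
  unfold pd at h2 h3
  rw [h3, h2]
  ring

/-- Of the evolution equations only that of the metric enters, in the derivative of `g_{jk}` along
`e₀`; the remaining compatibility relations are identities. In the torsion, the only nonzero
brackets are those of `∂_i` with `e₀`, namely `-∂_i β^k ∂_k`, and they account for the shift terms.
-/
theorem isFrameAlong_splitFrame (hs : IsSplitAt N β g q) (hK : ∀ i j, K q i j = K q j i)
    (hev : ∀ i j, pd spacetimeDir (Sum.inr ()) (fun z => g z i j) q = metricRate N β g K i j q) :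
    IsFrameAlong spacetimeBasis (splitMetric N β g) (fun z => z) (splitFrame β) (splitGram N g)
      (splitConn N β g K) q where
  det_ne := det_splitGram hs
  gram c d := by
    simp only [pushField, fderiv_fun_id, ContinuousLinearMap.id_apply]
    exact splitGram_eq hs c d
  metric a c d := by
    have hN := hs.lapse_ne
    have hsy := hs.metric.symm.self_of_nhds
    have hmix := sum_mixedComp_mul (K := K) hs.metric
    have hmix' : ∀ i j, ∑ l, mixedComp g K l i q * g q j l = K q i j := fun i j => by
      rw [← hmix i j]; exact Finset.sum_congr rfl fun l _ => by rw [hsy]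
    rw [sum_space_add_time]
    rcases a with i | i <;> rcases c with j | j <;> rcases d with k | k
    · simp only [splitConn, splitGram, mul_zero, add_zero]
      exact hs.metric.metric_compat (b := sliceDir) i j k
    · simp only [splitConn, splitGram, mul_zero, add_zero, zero_add, fderiv_const_apply, neg_mul,
        Finset.sum_neg_distrib, mul_assoc]
      simp only [← Finset.mul_sum, hmix']
      simp
      field_simp
      ring
    · simp only [splitConn, splitGram, mul_zero, add_zero, zero_add, fderiv_const_apply, neg_mul,
        Finset.sum_neg_distrib, mul_assoc]
      simp only [← Finset.mul_sum, hmix]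
      simp
      field_simp
      ring
    · simp only [splitConn, splitGram, mul_zero, add_zero, Finset.sum_const_zero, zero_add]
      rw [pd_sq hs.lapse]
      change -2 * N q * pd sliceDir i N q = _
      field_simp
      ring
    · simp only [splitConn, splitGram, mul_zero, add_zero]
      rw [fderiv_splitFrame_inr, normalDeriv, hev, metricRate]
      simp only [sub_mul, Finset.sum_add_distrib, Finset.sum_sub_distrib, mul_assoc,
        ← Finset.mul_sum, hmix, hmix']
      rw [hK k j]
      ring
    · simp only [splitConn, splitGram, mul_zero, add_zero, zero_add, fderiv_const_apply, mul_assoc]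
      have : ∀ l, N q * (∑ m, (g q)⁻¹ l m * pd sliceDir m N q) * g q j l =
        N q * (g q j l * ∑ m, (g q)⁻¹ l m * pd sliceDir m N q) := fun l => by ring
      simp only [← mul_assoc] at this ⊢
      simp only [this, mul_assoc, ← Finset.mul_sum, sum_mul_raised hs.metric]
      simp
      field_simp
      ring
    · simp only [splitConn, splitGram, mul_zero, add_zero, zero_add, fderiv_const_apply]
      have : ∀ l, N q * (∑ m, (g q)⁻¹ l m * pd sliceDir m N q) * g q l k =
        N q * (g q k l * ∑ m, (g q)⁻¹ l m * pd sliceDir m N q) := fun l => by rw [hsy l k]; ring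
      simp only [this, ← Finset.mul_sum, sum_mul_raised hs.metric]
      simp
      field_simp
      ring
    · simp only [splitConn, splitGram, mul_zero, add_zero, Finset.sum_const_zero, zero_add]
      rw [pd_sq hs.lapse, fderiv_splitFrame_inr]
      field_simp
      ring
  torsion a c := by
    have hfr : ∀ (u : Unit) v, fderiv ℝ (splitFrame β (Sum.inr u)) q v =
        -∑ k, fderiv ℝ (fun z => β z k) q v • spacetimeDir (Sum.inl k) := by
      intro u v
      have h1 : ∀ k, HasFDerivAt (fun z => β z k • (spacetimeDir (Sum.inl k) : EuclideanSpace ℝ (Fin n) × ℝ))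
          ((fderiv ℝ (fun z => β z k) q).smulRight (spacetimeDir (Sum.inl k))) q := fun k =>
        (hs.shift k).differentiableAt.hasFDerivAt.smul_const _
      have h2 := ((HasFDerivAt.fun_sum (u := Finset.univ) fun k _ => h1 k).const_sub
        (spacetimeDir (Sum.inr ()))).fderiv
      change fderiv ℝ (fun z => spacetimeDir (Sum.inr ()) - ∑ k, β z k • spacetimeDir (Sum.inl k)) q v = _
      rw [h2]
      simp [_root_.sum_apply]
    have hfl : ∀ i, fderiv ℝ (splitFrame β (Sum.inl i)) q = 0 := fun i => fderiv_const_apply _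
    rw [sum_space_add_time]
    rcases a with i | i <;> rcases c with j | j
    · simp only [hfl, splitConn]
      simp [hs.metric.christoffel_symm _ i j, hK i j]
    · rw [hfl, hfr, _root_.zero_apply, sub_zero, ← Finset.sum_neg_distrib]
      simp only [splitConn, sub_self, zero_smul, add_zero]
      refine Finset.sum_congr rfl fun k _ => ?_
      rw [← neg_smul, sub_sub_eq_add_sub, neg_add_cancel, zero_sub]
      rfl
    · rw [hfl, hfr, _root_.zero_apply, zero_sub, neg_neg]
      simp only [splitConn, sub_self, zero_smul, add_zero]
      refine Finset.sum_congr rfl fun k _ => ?_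
      rw [sub_neg_eq_add, sub_add_cancel]
      rfl
    · simp

end SplitFrame

/-! ### The spacetime Ricci tensor in terms of `g`, `K`, lapse and shift. -/

section SplitRicci

open Topology Filter

variable {n : ℕ} {N : EuclideanSpace ℝ (Fin n) × ℝ → ℝ}
  {β : EuclideanSpace ℝ (Fin n) × ℝ → Fin n → ℝ}
  {g K : EuclideanSpace ℝ (Fin n) × ℝ → Matrix (Fin n) (Fin n) ℝ}
  {q : EuclideanSpace ℝ (Fin n) × ℝ}

/-- An analytic solution of the evolution equation of the metric. -/
structure IsKinematicAt (N : EuclideanSpace ℝ (Fin n) × ℝ → ℝ)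
    (β : EuclideanSpace ℝ (Fin n) × ℝ → Fin n → ℝ)
    (g K : EuclideanSpace ℝ (Fin n) × ℝ → Matrix (Fin n) (Fin n) ℝ)
    (q : EuclideanSpace ℝ (Fin n) × ℝ) : Prop extends IsSplitAt N β g q where
  curvature : ∀ i j, AnalyticAt ℝ (fun z => K z i j) q
  curvature_symm : ∀ᶠ z in 𝓝 q, ∀ i j, K z i j = K z j i
  rate : ∀ᶠ z in 𝓝 q, ∀ i j,
    pd spacetimeDir (Sum.inr ()) (fun z => g z i j) z = metricRate N β g K i j z

theorem IsKinematicAt.eventually (hk : IsKinematicAt N β g K q) :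
    ∀ᶠ z in 𝓝 q, IsKinematicAt N β g K z := by
  have hK : ∀ᶠ z in 𝓝 q, ∀ i j, AnalyticAt ℝ (fun z => K z i j) z :=
    eventually_all.2 fun i => eventually_all.2 fun j => (hk.curvature i j).eventually_analyticAt
  filter_upwards [hk.toIsSplitAt.eventually, hK, hk.curvature_symm.eventually_nhds,
    hk.rate.eventually_nhds] with z h1 h2 h3 h4
  exact ⟨h1, h2, h3, h4⟩

theorem ricciForm_splitFrame (hk : IsKinematicAt N β g K q) (c d : Fin n ⊕ Unit) :
    ricciForm (gammaMap spacetimeBasis (splitMetric N β g)) q (splitFrame β c q)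
      (splitFrame β d q) = frameRicci (splitFrame β) (splitConn N β g K) c d q := by
  have hf : ∀ᶠ z in 𝓝 q, IsFrameAlong spacetimeBasis (splitMetric N β g) (fun z => z)
      (splitFrame β) (splitGram N g) (splitConn N β g K) z := by
    filter_upwards [hk.eventually] with z hz
    exact isFrameAlong_splitFrame hz.toIsSplitAt hz.curvature_symm.self_of_nhds
      hz.rate.self_of_nhds
  have h1 := frame_ricci (Ψ := fun z => z) (isMetricAt_splitMetric hk.toIsSplitAt) analyticAt_id
    (analyticAt_splitFrame hk.shift) (analyticAt_splitConn hk.toIsSplitAt hk.curvature) hf c d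
  simpa [pushField] using h1

variable {f h : EuclideanSpace ℝ (Fin n) × ℝ → ℝ}

theorem pd_div {ι : Type*} [Fintype ι] [DecidableEq ι] {b : ι → EuclideanSpace ℝ (Fin n) × ℝ} (hf : AnalyticAt ℝ f q)
    (hh : AnalyticAt ℝ h q) (h0 : h q ≠ 0) (i : ι) :
    pd b i (fun z => f z / h z) q = (pd b i f q * h q - f q * pd b i h q) / h q ^ 2 := by
  have h1 := pd_mul (b := b) (i := i) (hf.fun_div hh h0) hh
  have h2 : (fun z => f z / h z * h z) =ᶠ[𝓝 q] f := by
    filter_upwards [hh.continuousAt.eventually_ne h0] with z hz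
    exact div_mul_cancel₀ _ hz
  rw [pd_congr h2] at h1
  field_simp at h1 ⊢
  linarith

theorem normalDeriv_eq_pd (β : EuclideanSpace ℝ (Fin n) × ℝ → Fin n → ℝ) :
    normalDeriv β f q = pd (fun _ : Unit => splitFrame β (Sum.inr ()) q) () f q :=
  (fderiv_splitFrame_inr _ _ _).symm

theorem fderiv_splitFrame_inl (f : EuclideanSpace ℝ (Fin n) × ℝ → ℝ)
    (z : EuclideanSpace ℝ (Fin n) × ℝ) (i : Fin n) :
    fderiv ℝ f z (splitFrame β (Sum.inl i) z) = pd sliceDir i f z := rfl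

/-- The commutator `[e₀, ∂_i] = ∂_i β^k ∂_k`. -/
theorem normalDeriv_pd (hf : AnalyticAt ℝ f q) (hβ : ∀ i, AnalyticAt ℝ (fun z => β z i) q)
    (i : Fin n) : normalDeriv β (pd sliceDir i f) q = pd sliceDir i (normalDeriv β f) q +
      ∑ k, pd sliceDir i (fun z => β z k) q * pd sliceDir k f q := by
  have h1 : pd sliceDir i (normalDeriv β f) q = pd sliceDir i (pd spacetimeDir (Sum.inr ()) f) q -
      ∑ k, (pd sliceDir i (fun z => β z k) q * pd sliceDir k f q
        + β q k * pd sliceDir i (pd sliceDir k f) q) := by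
    unfold normalDeriv
    have hk := fun k => (hβ k).fun_mul (analyticAt_pd (b := sliceDir) (i := k) hf)
    rw [pd_sub (analyticAt_pd hf) (analyticAt_sum hk), pd_sum hk]
    congr 1
    refine Finset.sum_congr rfl fun k _ => ?_
    rw [pd_mul (hβ k) (analyticAt_pd hf)]
  have h2 : pd sliceDir i (pd spacetimeDir (Sum.inr ()) f) q =
      pd spacetimeDir (Sum.inr ()) (pd sliceDir i f) q :=
    pd_comm (b := spacetimeDir) (i := Sum.inl i) (j := Sum.inr ()) hf
  rw [h1, h2, normalDeriv, Finset.sum_add_distrib]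
  have h3 : ∀ k, pd sliceDir k (pd sliceDir i f) q = pd sliceDir i (pd sliceDir k f) q :=
    fun k => pd_comm hf
  simp only [h3]
  ring

/-- The space components of the Ricci tensor of the spacetime metric. -/
theorem frameRicci_space (hk : IsKinematicAt N β g K q)
    (ρ : EuclideanSpace ℝ (Fin n) × ℝ → Matrix (Fin n) (Fin n) ℝ) (i j : Fin n) :
    N q * (frameRicci (splitFrame β) (splitConn N β g K) (Sum.inl i) (Sum.inl j) q - ρ q i j) =
      curvatureRate N β ρ g K i j q - pd spacetimeDir (Sum.inr ()) (fun z => K z i j) q := by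
  have hN := hk.lapse_ne
  have hsy := hk.curvature_symm.self_of_nhds
  have hdiv := fun i j => (hk.curvature i j).fun_div hk.lapse hN
  -- The frame sums are split into space and time indices. Terms with space indices only form the
  -- Ricci tensor of the slice, the next sum has an intermediate time index, and the last bracket is
  -- the time term of the outer trace.
  have e1 : frameRicci (splitFrame β) (splitConn N β g K) (Sum.inl i) (Sum.inl j) q =
      frameRicci (fun a _ => sliceDir a) (christoffel sliceDir g) i j q +
      ∑ l, (-(K q i j / N q) * -(N q * mixedComp g K l l q) -
        -(K q l j / N q) * -(N q * mixedComp g K l i q)) +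
      (normalDeriv β (fun z => -(K z i j / N z)) q - pd sliceDir i (fun z => pd sliceDir j N z / N z) q
        + ∑ k, (christoffel sliceDir g k i j q * (pd sliceDir k N q / N q) -
          (pd sliceDir j (fun z => β z k) q - N q * mixedComp g K k j q) * -(K q i k / N q))
        + (-(K q i j / N q) * (normalDeriv β N q / N q)
          - (pd sliceDir j N q / N q) * (pd sliceDir i N q / N q))
        - ∑ k, pd sliceDir i (fun z => β z k) q * -(K q k j / N q)) := by
    unfold frameRicci
    simp only [sum_space_add_time, splitConn, fderiv_splitFrame_inl, fderiv_splitFrame_inr,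
      hsy _ i, sub_self, zero_mul, add_zero, sub_neg_eq_add, sub_add_cancel]
    rw [← Finset.sum_add_distrib]
    congr 1
    · refine Finset.sum_congr rfl fun l _ => ?_
      simp only [pd]
      ring
    · ring
  rw [frameRicci_christoffel hk.metric, pd_div (analyticAt_pd hk.lapse) hk.lapse hN,
    normalDeriv_eq_pd, pd_neg, pd_div (hk.curvature i j) hk.lapse hN, ← normalDeriv_eq_pd,
    ← normalDeriv_eq_pd] at e1
  have s1 : ∑ a, ∑ c, K q i a * (g q)⁻¹ a c * K q c j = ∑ l, K q l j * mixedComp g K l i q := by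
    simp only [mixedComp, Finset.mul_sum]
    rw [Finset.sum_comm]
    refine Finset.sum_congr rfl fun c _ => Finset.sum_congr rfl fun a _ => ?_
    rw [hk.metric.inv_symm a c]
    ring
  have s2 : ∑ k, K q i k * mixedComp g K k j q = ∑ l, K q l j * mixedComp g K l i q := by
    rw [← s1]
    refine Finset.sum_congr rfl fun a _ => ?_
    simp only [mixedComp, Finset.mul_sum]
    refine Finset.sum_congr rfl fun c _ => ?_
    rw [hsy j c]
    ring
  have s3 : ∑ a, ∑ c, (g q)⁻¹ a c * K q a c = ∑ l, mixedComp g K l l q := rfl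
  have t1 : ∑ l, (-(K q i j / N q) * -(N q * mixedComp g K l l q) -
        -(K q l j / N q) * -(N q * mixedComp g K l i q)) =
      K q i j * ∑ l, mixedComp g K l l q - ∑ l, K q l j * mixedComp g K l i q := by
    rw [Finset.mul_sum, ← Finset.sum_sub_distrib]
    refine Finset.sum_congr rfl fun l _ => ?_
    field_simp
  have t2 : ∑ k, (christoffel sliceDir g k i j q * (pd sliceDir k N q / N q) -
          (pd sliceDir j (fun z => β z k) q - N q * mixedComp g K k j q) * -(K q i k / N q)) =
      (∑ k, christoffel sliceDir g k i j q * pd sliceDir k N q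
        + ∑ k, K q i k * pd sliceDir j (fun z => β z k) q) / N q
        - ∑ k, K q i k * mixedComp g K k j q := by
    rw [← Finset.sum_add_distrib, Finset.sum_div, ← Finset.sum_sub_distrib]
    refine Finset.sum_congr rfl fun l _ => ?_
    field_simp
    ring
  have t3 : ∑ k, pd sliceDir i (fun z => β z k) q * -(K q k j / N q) =
      -(∑ k, K q k j * pd sliceDir i (fun z => β z k) q) / N q := by
    rw [← Finset.sum_neg_distrib, Finset.sum_div]
    refine Finset.sum_congr rfl fun l _ => ?_
    field_simp
  rw [t1, t2, t3, s2, normalDeriv] at e1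
  rw [e1, curvatureRate, s1, s3]
  simp only [Finset.sum_add_distrib]
  field_simp
  ring

/-- The momentum density `-∇_l K^l_i + ∂_i K^l_l`. -/
def momentumDensity (g K : EuclideanSpace ℝ (Fin n) × ℝ → Matrix (Fin n) (Fin n) ℝ) (i : Fin n)
    (z : EuclideanSpace ℝ (Fin n) × ℝ) : ℝ :=
  -divergence sliceDir g K i z + pd sliceDir i (tr g K) z

/-- Raising an index commutes with covariant differentiation. In this form the divergence can be
compared with the connection coefficients, which contain the mixed components. -/
theorem divergence_eq_mixedComp (hg : IsMetricAt g q)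
    (hK : ∀ i j, AnalyticAt ℝ (fun z => K z i j) q) (hKs : ∀ᶠ z in 𝓝 q, ∀ i j, K z i j = K z j i)
    (j : Fin n) : divergence sliceDir g K j q = ∑ l, (pd sliceDir l (mixedComp g K l j) q +
      ∑ k, (christoffel sliceDir g l l k q * mixedComp g K k j q -
        christoffel sliceDir g k l j q * mixedComp g K l k q)) := by
  have hsy := hKs.self_of_nhds
  have h1 : ∀ l, pd sliceDir l (mixedComp g K l j) q = ∑ k, ((g q)⁻¹ l k * pd sliceDir l (fun z => K z k j) q
      + (-∑ m, ((g q)⁻¹ m k * christoffel sliceDir g l l m q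
        + (g q)⁻¹ l m * christoffel sliceDir g k l m q)) * K q k j) := by
    intro l
    unfold mixedComp
    rw [pd_sum fun m => (hg.inv_analytic l m).fun_mul (hK j m)]
    refine Finset.sum_congr rfl fun k _ => ?_
    rw [pd_mul (hg.inv_analytic l k) (hK j k), pd_inv_eq_christoffel hg, hsy j k,
      pd_congr (hKs.mono fun z hz => hz j k)]
    ring
  unfold divergence
  refine Finset.sum_congr rfl fun l _ => ?_
  rw [h1]
  unfold covDerivTensor
  simp only [mul_sub, Finset.sum_sub_distrib, Finset.sum_add_distrib, Finset.mul_sum, neg_mul,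
    Finset.sum_neg_distrib, add_mul, Finset.sum_mul, mul_add, neg_add]
  have a1 : ∑ k, ∑ m, (g q)⁻¹ m k * christoffel sliceDir g l l m q * K q k j =
      ∑ k, christoffel sliceDir g l l k q * mixedComp g K k j q := by
    rw [Finset.sum_comm]
    refine Finset.sum_congr rfl fun m _ => ?_
    rw [mixedComp, Finset.mul_sum]
    refine Finset.sum_congr rfl fun k _ => ?_
    rw [hsy j k]
    ring
  have a2 : ∑ k, ∑ m, (g q)⁻¹ l m * christoffel sliceDir g k l m q * K q k j =
      ∑ k, ∑ m, (g q)⁻¹ l k * (christoffel sliceDir g m l k q * K q m j) := by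
    rw [Finset.sum_comm]
    refine Finset.sum_congr rfl fun m _ => Finset.sum_congr rfl fun k _ => ?_
    ring
  have a3 : ∑ k, ∑ m, (g q)⁻¹ l k * (christoffel sliceDir g m l j q * K q k m) =
      ∑ k, christoffel sliceDir g k l j q * mixedComp g K l k q := by
    rw [Finset.sum_comm]
    refine Finset.sum_congr rfl fun m _ => ?_
    rw [mixedComp, Finset.mul_sum]
    refine Finset.sum_congr rfl fun k _ => ?_
    rw [hsy m k]
    ring
  rw [a1, a2, a3]
  ring

/-- The mixed components of the Ricci tensor of the spacetime metric. -/
theorem frameRicci_mixed (hk : IsKinematicAt N β g K q) (i : Fin n) :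
    frameRicci (splitFrame β) (splitConn N β g K) (Sum.inl i) (Sum.inr ()) q =
      N q * momentumDensity g K i q := by
  have hN := hk.lapse_ne
  have hsy := hk.curvature_symm.self_of_nhds
  have hm := analyticAt_mixedComp hk.metric hk.curvature
  have hc := hk.metric.christoffel_symm (b := sliceDir)
  have e1 : frameRicci (splitFrame β) (splitConn N β g K) (Sum.inl i) (Sum.inr ()) q =
      ∑ l, (pd sliceDir l (fun z => -(N z * mixedComp g K l i z)) q
        - pd sliceDir i (fun z => -(N z * mixedComp g K l l z)) q
        + ∑ k, (-(N q * mixedComp g K k i q) * christoffel sliceDir g l l k q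
          - -(N q * mixedComp g K k l q) * christoffel sliceDir g l i k q)
        + (pd sliceDir i N q / N q * -(N q * mixedComp g K l l q) -
          pd sliceDir l N q / N q * -(N q * mixedComp g K l i q))) +
      (normalDeriv β (fun z => pd sliceDir i N z / N z) q
        - pd sliceDir i (fun z => normalDeriv β N z / N z) q
        + ∑ k, (-(N q * mixedComp g K k i q) * (pd sliceDir k N q / N q)
          - N q * (∑ m, (g q)⁻¹ k m * pd sliceDir m N q) * -(K q i k / N q))
        - ∑ k, pd sliceDir i (fun z => β z k) q * (pd sliceDir k N q / N q)) := by
    unfold frameRicci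
    simp only [sum_space_add_time, splitConn, fderiv_splitFrame_inl, fderiv_splitFrame_inr,
      hsy _ i, hc _ _ i, sub_self, zero_mul, add_zero, sub_neg_eq_add, sub_add_cancel]
    congr 1
    · refine Finset.sum_congr rfl fun l _ => ?_
      simp
      ring
    · ring
  have h1 : ∀ l i j, pd sliceDir j (fun z => -(N z * mixedComp g K l i z)) q =
      -(N q * pd sliceDir j (mixedComp g K l i) q + pd sliceDir j N q * mixedComp g K l i q) := by
    intro l i j
    rw [pd_neg, pd_mul hk.lapse (hm l i)]
    ring
  have h2 : ∑ k, (-(N q * mixedComp g K k i q) * (pd sliceDir k N q / N q)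
          - N q * (∑ m, (g q)⁻¹ k m * pd sliceDir m N q) * -(K q i k / N q)) = 0 := by
    have a1 : ∑ k, mixedComp g K k i q * pd sliceDir k N q =
        ∑ k, (∑ m, (g q)⁻¹ k m * pd sliceDir m N q) * K q i k := by
      simp only [mixedComp, Finset.sum_mul]
      rw [Finset.sum_comm]
      refine Finset.sum_congr rfl fun m _ => Finset.sum_congr rfl fun k _ => ?_
      rw [hk.metric.inv_symm k m]
      ring
    have a2 : ∀ k, -(N q * mixedComp g K k i q) * (pd sliceDir k N q / N q)
          - N q * (∑ m, (g q)⁻¹ k m * pd sliceDir m N q) * -(K q i k / N q) =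
        (∑ m, (g q)⁻¹ k m * pd sliceDir m N q) * K q i k - mixedComp g K k i q * pd sliceDir k N q := by
      intro k
      field_simp
      ring
    simp only [a2, Finset.sum_sub_distrib, a1, sub_self]
  -- This is the commutator `[e₀, ∂_i]` applied to `log N`; all second derivatives of the lapse
  -- cancel.
  have h3 : normalDeriv β (fun z => pd sliceDir i N z / N z) q
        - pd sliceDir i (fun z => normalDeriv β N z / N z) q
        - ∑ k, pd sliceDir i (fun z => β z k) q * (pd sliceDir k N q / N q) = 0 := by
    rw [normalDeriv_eq_pd, pd_div (analyticAt_pd hk.lapse) hk.lapse hN, ← normalDeriv_eq_pd,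
      ← normalDeriv_eq_pd, pd_div (analyticAt_normalDeriv hk.lapse hk.shift) hk.lapse hN,
      normalDeriv_pd hk.lapse hk.shift]
    simp only [← mul_div_assoc, ← Finset.sum_div]
    field_simp
    ring
  have h4 : pd sliceDir i (tr g K) q = ∑ l, pd sliceDir i (mixedComp g K l l) q := by
    rw [← pd_sum fun l => hm l l]
    rfl
  rw [h2, add_zero, h3, add_zero] at e1
  have a4 : ∑ l, ∑ k, christoffel sliceDir g l i k q * mixedComp g K k l q =
      ∑ l, ∑ k, christoffel sliceDir g k l i q * mixedComp g K l k q := by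
    rw [Finset.sum_comm]
    exact Finset.sum_congr rfl fun k _ => Finset.sum_congr rfl fun l _ => by rw [hc l i k]
  have a5 : ∀ l, pd sliceDir l (fun z => -(N z * mixedComp g K l i z)) q
        - pd sliceDir i (fun z => -(N z * mixedComp g K l l z)) q
        + ∑ k, (-(N q * mixedComp g K k i q) * christoffel sliceDir g l l k q
          - -(N q * mixedComp g K k l q) * christoffel sliceDir g l i k q)
        + (pd sliceDir i N q / N q * -(N q * mixedComp g K l l q) -
          pd sliceDir l N q / N q * -(N q * mixedComp g K l i q)) =
      N q * (pd sliceDir i (mixedComp g K l l) q - pd sliceDir l (mixedComp g K l i) q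
        - ∑ k, christoffel sliceDir g l l k q * mixedComp g K k i q
        + ∑ k, christoffel sliceDir g l i k q * mixedComp g K k l q) := by
    intro l
    have a3 : ∑ k, (-(N q * mixedComp g K k i q) * christoffel sliceDir g l l k q
          - -(N q * mixedComp g K k l q) * christoffel sliceDir g l i k q) =
        -(N q * ∑ k, christoffel sliceDir g l l k q * mixedComp g K k i q) +
          N q * ∑ k, christoffel sliceDir g l i k q * mixedComp g K k l q := by
      rw [Finset.mul_sum, Finset.mul_sum, ← Finset.sum_neg_distrib, ← Finset.sum_add_distrib]
      exact Finset.sum_congr rfl fun k _ => by ring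
    rw [h1, h1, a3]
    field_simp
    ring
  rw [e1, momentumDensity, divergence_eq_mixedComp hk.metric hk.curvature hk.curvature_symm, h4]
  rw [Finset.sum_congr rfl fun l _ => a5 l, ← Finset.mul_sum]
  simp only [Finset.sum_add_distrib, Finset.sum_sub_distrib, a4]
  ring

/-- From `pd_inv` along `e₀` and the evolution equation of the metric. -/
theorem normalDeriv_inv (hk : IsKinematicAt N β g K q) (l m : Fin n) :
    normalDeriv β (fun z => (g z)⁻¹ l m) q =
      2 * N q * ∑ a, ∑ c, (g q)⁻¹ l a * K q a c * (g q)⁻¹ c m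
        - ∑ c, pd sliceDir c (fun z => β z l) q * (g q)⁻¹ c m
        - ∑ a, (g q)⁻¹ l a * pd sliceDir a (fun z => β z m) q := by
  have h1 : ∀ a c, normalDeriv β (fun z => g z a c) q = -2 * (N q * K q a c) +
      (∑ h, pd sliceDir c (fun z => β z h) q * g q a h
        + ∑ h, pd sliceDir a (fun z => β z h) q * g q h c) := by
    intro a c
    rw [normalDeriv, hk.rate.self_of_nhds, metricRate]
    simp only [Finset.sum_add_distrib]
    ring
  have h0 : ∀ f, pd (fun _ : Fin n => splitFrame β (Sum.inr ()) q) l f q = normalDeriv β f q :=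
    fun f => fderiv_splitFrame_inr _ _ _
  rw [← h0, hk.metric.pd_inv]
  simp only [h0, h1]
  have e1 : ∑ a, ∑ c, (g q)⁻¹ l a * (∑ h, pd sliceDir c (fun z => β z h) q * g q a h) * (g q)⁻¹ c m
      = ∑ c, pd sliceDir c (fun z => β z l) q * (g q)⁻¹ c m := by
    rw [Finset.sum_comm]
    refine Finset.sum_congr rfl fun c _ => ?_
    rw [← Finset.sum_mul]
    congr 1
    simp only [Finset.mul_sum]
    rw [Finset.sum_comm]
    have : ∀ h, ∑ a, (g q)⁻¹ l a * (pd sliceDir c (fun z => β z h) q * g q a h) =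
        pd sliceDir c (fun z => β z h) q * ∑ a, (g q)⁻¹ l a * g q a h := fun h => by
      rw [Finset.mul_sum]; exact Finset.sum_congr rfl fun a _ => by ring
    simp only [this, hk.metric.sum_inv_mul]
    simp
  have e2 : ∑ a, ∑ c, (g q)⁻¹ l a * (∑ h, pd sliceDir a (fun z => β z h) q * g q h c) * (g q)⁻¹ c m
      = ∑ a, (g q)⁻¹ l a * pd sliceDir a (fun z => β z m) q := by
    refine Finset.sum_congr rfl fun a _ => ?_
    simp only [mul_assoc, ← Finset.mul_sum]
    congr 1
    simp only [Finset.sum_mul, mul_assoc]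
    rw [Finset.sum_comm]
    simp only [← Finset.mul_sum, hk.metric.sum_mul_inv]
    simp
  simp only [mul_add, add_mul, Finset.sum_add_distrib, e1, e2]
  have e3 : ∑ a, ∑ c, (g q)⁻¹ l a * (-2 * (N q * K q a c)) * (g q)⁻¹ c m =
      -(2 * N q * ∑ a, ∑ c, (g q)⁻¹ l a * K q a c * (g q)⁻¹ c m) := by
    simp only [Finset.mul_sum, ← Finset.sum_neg_distrib]
    exact Finset.sum_congr rfl fun a _ => Finset.sum_congr rfl fun c _ => by ring
  rw [e3]
  ring

/-- Exchanges the derivative of the trace of `K`, which occurs in `R_00`, for the trace of the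
derivative of `K`, which occurs in `g^{ij} R_{ij}`, so that the two can cancel. -/
theorem normalDeriv_meanCurvature (hk : IsKinematicAt N β g K q) :
    normalDeriv β (fun z => ∑ l, mixedComp g K l l z) q =
      ∑ i, ∑ j, (g q)⁻¹ i j * normalDeriv β (fun z => K z i j) q
      + 2 * N q * ∑ l, ∑ k, mixedComp g K l k q * mixedComp g K k l q
      - 2 * ∑ l, ∑ k, mixedComp g K l k q * pd sliceDir l (fun z => β z k) q := by
  have hsy := hk.curvature_symm.self_of_nhds
  have hgs := hk.metric.inv_symm
  have h1 : normalDeriv β (fun z => ∑ l, mixedComp g K l l z) q =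
      ∑ i, ∑ j, ((g q)⁻¹ i j * normalDeriv β (fun z => K z i j) q +
        normalDeriv β (fun z => (g z)⁻¹ i j) q * K q i j) := by
    unfold mixedComp
    simp only [normalDeriv_eq_pd]
    have hm := fun i j => (hk.metric.inv_analytic i j).fun_mul (hk.curvature i j)
    rw [pd_sum fun i => analyticAt_sum fun j => hm i j]
    refine Finset.sum_congr rfl fun i _ => ?_
    rw [pd_sum fun j => hm i j]
    exact Finset.sum_congr rfl fun j _ =>
      (pd_mul (hk.metric.inv_analytic i j) (hk.curvature i j)).trans (add_comm _ _)
  rw [h1]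
  simp only [Finset.sum_add_distrib, normalDeriv_inv hk, sub_mul, Finset.sum_sub_distrib]
  have e1 : ∑ i, ∑ j, (2 * N q * ∑ a, ∑ c, (g q)⁻¹ i a * K q a c * (g q)⁻¹ c j) * K q i j =
      2 * N q * ∑ l, ∑ k, mixedComp g K l k q * mixedComp g K k l q := by
    have a1 : ∀ c i, ∑ j, (g q)⁻¹ c j * K q i j = mixedComp g K c i q := fun c i => rfl
    have a2 : ∀ i c, ∑ a, (g q)⁻¹ i a * K q a c = mixedComp g K i c q := fun i c =>
      Finset.sum_congr rfl fun a _ => by rw [hsy a c]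
    have a3 : ∀ i, ∑ j, (∑ a, ∑ c, (g q)⁻¹ i a * K q a c * (g q)⁻¹ c j) * K q i j =
        ∑ k, mixedComp g K i k q * mixedComp g K k i q := by
      intro i
      have a4 : ∀ j, (∑ a, ∑ c, (g q)⁻¹ i a * K q a c * (g q)⁻¹ c j) * K q i j =
          ∑ c, mixedComp g K i c q * ((g q)⁻¹ c j * K q i j) := by
        intro j
        rw [Finset.sum_comm, Finset.sum_mul]
        refine Finset.sum_congr rfl fun c _ => ?_
        rw [← Finset.sum_mul, a2]
        ring
      simp only [a4]
      rw [Finset.sum_comm]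
      simp only [← Finset.mul_sum, a1]
    simp only [mul_assoc (2 * N q), ← Finset.mul_sum, a3]
  have e2 : ∑ i, ∑ j, (∑ c, pd sliceDir c (fun z => β z i) q * (g q)⁻¹ c j) * K q i j =
      ∑ l, ∑ k, mixedComp g K l k q * pd sliceDir l (fun z => β z k) q := by
    rw [Finset.sum_comm' (t' := Finset.univ) (s' := fun _ => Finset.univ) (by simp)]
    have : ∀ i, ∑ j, (∑ c, pd sliceDir c (fun z => β z i) q * (g q)⁻¹ c j) * K q i j =
        ∑ c, mixedComp g K c i q * pd sliceDir c (fun z => β z i) q := by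
      intro i
      simp only [Finset.sum_mul, mixedComp]
      rw [Finset.sum_comm]
      exact Finset.sum_congr rfl fun c _ => Finset.sum_congr rfl fun j _ => by ring
    rw [Finset.sum_comm, Finset.sum_congr rfl fun i _ => this i, Finset.sum_comm]
  have e3 : ∑ i, ∑ j, (∑ a, (g q)⁻¹ i a * pd sliceDir a (fun z => β z j) q) * K q i j =
      ∑ l, ∑ k, mixedComp g K l k q * pd sliceDir l (fun z => β z k) q := by
    rw [Finset.sum_comm]
    have : ∀ j, ∑ i, (∑ a, (g q)⁻¹ i a * pd sliceDir a (fun z => β z j) q) * K q i j =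
        ∑ c, mixedComp g K c j q * pd sliceDir c (fun z => β z j) q := by
      intro j
      simp only [Finset.sum_mul, mixedComp]
      rw [Finset.sum_comm]
      refine Finset.sum_congr rfl fun c _ => Finset.sum_congr rfl fun i _ => ?_
      rw [hgs i c, hsy i j]
      ring
    rw [Finset.sum_congr rfl fun i _ => this i, Finset.sum_comm]
  rw [e1, e2, e3]
  ring

/-- The Raychaudhuri equation for the normals of the slices. The terms with derivatives of the shift
cancel after summation over both indices. -/
theorem frameRicci_time (hk : IsKinematicAt N β g K q) :
    frameRicci (splitFrame β) (splitConn N β g K) (Sum.inr ()) (Sum.inr ()) q =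
      N q * (∑ i, ∑ j, (g q)⁻¹ i j * (pd sliceDir i (pd sliceDir j N) q -
        ∑ l, christoffel sliceDir g l i j q * pd sliceDir l N q))
      + N q * normalDeriv β (fun z => ∑ l, mixedComp g K l l z) q
      - N q ^ 2 * ∑ l, ∑ k, mixedComp g K l k q * mixedComp g K k l q := by
  have hN := hk.lapse_ne
  have hm := analyticAt_mixedComp hk.metric hk.curvature
  set V : Fin n → EuclideanSpace ℝ (Fin n) × ℝ → ℝ :=
    fun l z => ∑ m, (g z)⁻¹ l m * pd sliceDir m N z with hV
  have hVa : ∀ l, AnalyticAt ℝ (V l) q := fun l => analyticAt_sum fun m =>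
    (hk.metric.inv_analytic l m).fun_mul (analyticAt_pd hk.lapse)
  have e1 : frameRicci (splitFrame β) (splitConn N β g K) (Sum.inr ()) (Sum.inr ()) q =
      ∑ l, (pd sliceDir l (fun z => N z * V l z) q
        - normalDeriv β (fun z => -(N z * mixedComp g K l l z)) q
        + ∑ k, (N q * V k q * christoffel sliceDir g l l k q
          - -(N q * mixedComp g K k l q) *
            (pd sliceDir k (fun z => β z l) q - N q * mixedComp g K l k q))
        + (normalDeriv β N q / N q * -(N q * mixedComp g K l l q) -
          pd sliceDir l N q / N q * (N q * V l q))
        - ∑ k, (-(N q * mixedComp g K k l q) - (pd sliceDir l (fun z => β z k) q -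
          N q * mixedComp g K k l q)) * -(N q * mixedComp g K l k q)) := by
    unfold frameRicci
    simp only [sum_space_add_time, splitConn, fderiv_splitFrame_inl, fderiv_splitFrame_inr,
      sub_self, zero_mul, add_zero, Finset.sum_const_zero, hV]
    refine Finset.sum_congr rfl fun l _ => ?_
    ring
  have h1 : ∀ l, pd sliceDir l (V l) q = ∑ m, ((g q)⁻¹ l m * pd sliceDir l (pd sliceDir m N) q
      + (-∑ k, ((g q)⁻¹ k m * christoffel sliceDir g l l k q
        + (g q)⁻¹ l k * christoffel sliceDir g m l k q)) * pd sliceDir m N q) := by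
    intro l
    simp only [hV]
    rw [pd_sum fun m => (hk.metric.inv_analytic l m).fun_mul (analyticAt_pd hk.lapse)]
    refine Finset.sum_congr rfl fun m _ => ?_
    rw [pd_mul (hk.metric.inv_analytic l m) (analyticAt_pd hk.lapse),
      pd_inv_eq_christoffel hk.metric]
    exact add_comm _ _
  have h2 : ∑ l, (pd sliceDir l (V l) q + ∑ k, V k q * christoffel sliceDir g l l k q) =
      ∑ i, ∑ j, (g q)⁻¹ i j * (pd sliceDir i (pd sliceDir j N) q -
        ∑ l, christoffel sliceDir g l i j q * pd sliceDir l N q) := by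
    refine Finset.sum_congr rfl fun l _ => ?_
    rw [h1]
    simp only [mul_sub, Finset.sum_sub_distrib, Finset.sum_add_distrib, Finset.mul_sum, neg_mul,
      Finset.sum_neg_distrib, add_mul, Finset.sum_mul, neg_add, hV]
    have a1 : ∑ m, ∑ k, (g q)⁻¹ k m * christoffel sliceDir g l l k q * pd sliceDir m N q =
        ∑ k, ∑ m, (g q)⁻¹ k m * pd sliceDir m N q * christoffel sliceDir g l l k q := by
      rw [Finset.sum_comm]
      exact Finset.sum_congr rfl fun _ _ => Finset.sum_congr rfl fun _ _ => by ring
    have a2 : ∑ m, ∑ k, (g q)⁻¹ l k * christoffel sliceDir g m l k q * pd sliceDir m N q =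
        ∑ k, ∑ m, (g q)⁻¹ l k * (christoffel sliceDir g m l k q * pd sliceDir m N q) := by
      rw [Finset.sum_comm]
      exact Finset.sum_congr rfl fun _ _ => Finset.sum_congr rfl fun _ _ => by ring
    rw [a1, a2]
    ring
  have h3 : normalDeriv β (fun z => ∑ l, mixedComp g K l l z) q =
      ∑ l, normalDeriv β (mixedComp g K l l) q := by
    simp only [normalDeriv_eq_pd]
    exact pd_sum fun l => hm l l
  have h4 : ∑ l, ∑ k, mixedComp g K k l q * pd sliceDir k (fun z => β z l) q =
      ∑ l, ∑ k, mixedComp g K l k q * pd sliceDir l (fun z => β z k) q := Finset.sum_comm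
  have h5 : ∀ l, (pd sliceDir l (fun z => N z * V l z) q
        - normalDeriv β (fun z => -(N z * mixedComp g K l l z)) q
        + ∑ k, (N q * V k q * christoffel sliceDir g l l k q
          - -(N q * mixedComp g K k l q) *
            (pd sliceDir k (fun z => β z l) q - N q * mixedComp g K l k q))
        + (normalDeriv β N q / N q * -(N q * mixedComp g K l l q) -
          pd sliceDir l N q / N q * (N q * V l q))
        - ∑ k, (-(N q * mixedComp g K k l q) - (pd sliceDir l (fun z => β z k) q -
          N q * mixedComp g K k l q)) * -(N q * mixedComp g K l k q)) =
      N q * (pd sliceDir l (V l) q + ∑ k, V k q * christoffel sliceDir g l l k q)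
      + N q * normalDeriv β (mixedComp g K l l) q
      - N q ^ 2 * ∑ k, mixedComp g K l k q * mixedComp g K k l q
      + N q * (∑ k, mixedComp g K k l q * pd sliceDir k (fun z => β z l) q
        - ∑ k, mixedComp g K l k q * pd sliceDir l (fun z => β z k) q) := by
    intro l
    have a1 : ∑ k, (N q * V k q * christoffel sliceDir g l l k q
          - -(N q * mixedComp g K k l q) *
            (pd sliceDir k (fun z => β z l) q - N q * mixedComp g K l k q)) =
        N q * ∑ k, V k q * christoffel sliceDir g l l k q
        + N q * ∑ k, mixedComp g K k l q * pd sliceDir k (fun z => β z l) q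
        - N q ^ 2 * ∑ k, mixedComp g K l k q * mixedComp g K k l q := by
      simp only [Finset.mul_sum, ← Finset.sum_add_distrib, ← Finset.sum_sub_distrib]
      exact Finset.sum_congr rfl fun k _ => by ring
    have a2 : ∑ k, (-(N q * mixedComp g K k l q) - (pd sliceDir l (fun z => β z k) q -
          N q * mixedComp g K k l q)) * -(N q * mixedComp g K l k q) =
        N q * ∑ k, mixedComp g K l k q * pd sliceDir l (fun z => β z k) q := by
      rw [Finset.mul_sum]
      exact Finset.sum_congr rfl fun k _ => by ring
    rw [a1, a2, pd_mul hk.lapse (hVa l), normalDeriv_eq_pd, pd_neg,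
      pd_mul hk.lapse (hm l l), ← normalDeriv_eq_pd, ← normalDeriv_eq_pd]
    field_simp
    ring
  rw [e1, Finset.sum_congr rfl fun l _ => h5 l, Finset.sum_add_distrib, Finset.sum_sub_distrib,
    Finset.sum_add_distrib, ← Finset.mul_sum, ← Finset.mul_sum, ← Finset.mul_sum, ← Finset.mul_sum,
    Finset.sum_sub_distrib, h4, h2, h3]
  ring

/-- The Hamiltonian density `R - K^i_j K^j_i + (K^h_h)²`. -/
def hamiltonianDensity (g K : EuclideanSpace ℝ (Fin n) × ℝ → Matrix (Fin n) (Fin n) ℝ)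
    (z : EuclideanSpace ℝ (Fin n) × ℝ) : ℝ :=
  scalarCurvature sliceDir g z - ∑ l, ∑ k, mixedComp g K l k z * mixedComp g K k l z
    + (∑ l, mixedComp g K l l z) ^ 2

/-- The combination is twice the `00` component of the Einstein tensor. In it the second derivatives
of the lapse and the derivatives of `K` along `e₀` cancel, which leaves the Gauss equation. -/
theorem frameRicci_hamiltonian (hk : IsKinematicAt N β g K q) :
    frameRicci (splitFrame β) (splitConn N β g K) (Sum.inr ()) (Sum.inr ()) q +
      N q ^ 2 * ∑ i, ∑ j, (g q)⁻¹ i j *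
        frameRicci (splitFrame β) (splitConn N β g K) (Sum.inl i) (Sum.inl j) q =
      N q ^ 2 * hamiltonianDensity g K q := by
  have hsy := hk.curvature_symm.self_of_nhds
  have hgs := hk.metric.inv_symm
  have h1 : ∀ i j, N q ^ 2 * ((g q)⁻¹ i j *
      frameRicci (splitFrame β) (splitConn N β g K) (Sum.inl i) (Sum.inl j) q) =
      N q ^ 2 * ((g q)⁻¹ i j * ricci sliceDir g i j q)
      - N q ^ 2 * 2 * ((g q)⁻¹ i j * ∑ a, ∑ c, K q i a * (g q)⁻¹ a c * K q c j)
      + N q ^ 2 * ((g q)⁻¹ i j * K q i j) * ∑ l, mixedComp g K l l q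
      - N q * ((g q)⁻¹ i j * (pd sliceDir i (pd sliceDir j N) q -
        ∑ l, christoffel sliceDir g l i j q * pd sliceDir l N q))
      - N q * ((g q)⁻¹ i j * normalDeriv β (fun z => K z i j) q)
      + N q * ((g q)⁻¹ i j * ∑ h, K q i h * pd sliceDir j (fun z => β z h) q)
      + N q * ((g q)⁻¹ i j * ∑ h, K q h j * pd sliceDir i (fun z => β z h) q) := by
    intro i j
    -- With zero sources this is a purely geometric identity.
    have h2 := frameRicci_space hk (fun _ _ _ => 0) i j
    unfold curvatureRate at h2
    rw [sub_zero] at h2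
    have s3 : ∑ a, ∑ c, (g q)⁻¹ a c * K q a c = ∑ l, mixedComp g K l l q := rfl
    simp only [Finset.sum_add_distrib, mul_zero, sub_zero, s3] at h2
    rw [normalDeriv]
    linear_combination N q * (g q)⁻¹ i j * h2
  have h3 : ∑ i, ∑ j, ((g q)⁻¹ i j * ∑ a, ∑ c, K q i a * (g q)⁻¹ a c * K q c j) =
      ∑ l, ∑ k, mixedComp g K l k q * mixedComp g K k l q := by
    rw [Finset.sum_comm]
    refine Finset.sum_congr rfl fun j _ => ?_
    have : ∀ i, (g q)⁻¹ i j * ∑ a, ∑ c, K q i a * (g q)⁻¹ a c * K q c j =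
        ∑ a, (g q)⁻¹ j i * K q a i * mixedComp g K a j q := by
      intro i
      rw [Finset.mul_sum]
      refine Finset.sum_congr rfl fun a _ => ?_
      rw [mixedComp, Finset.mul_sum, Finset.mul_sum, hgs j i, hsy a i]
      refine Finset.sum_congr rfl fun c _ => ?_
      rw [hsy c j]
      ring
    simp only [this]
    rw [Finset.sum_comm]
    exact Finset.sum_congr rfl fun a _ => by rw [← Finset.sum_mul]; rfl
  have h4 : ∑ i, ∑ j, ((g q)⁻¹ i j * ∑ h, K q i h * pd sliceDir j (fun z => β z h) q) =
      ∑ l, ∑ k, mixedComp g K l k q * pd sliceDir l (fun z => β z k) q := by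
    rw [Finset.sum_comm]
    refine Finset.sum_congr rfl fun j _ => ?_
    simp only [Finset.mul_sum, mixedComp, Finset.sum_mul]
    rw [Finset.sum_comm]
    refine Finset.sum_congr rfl fun h _ => Finset.sum_congr rfl fun i _ => ?_
    rw [hgs i j, hsy i h]
    ring
  have h5 : ∑ i, ∑ j, ((g q)⁻¹ i j * ∑ h, K q h j * pd sliceDir i (fun z => β z h) q) =
      ∑ l, ∑ k, mixedComp g K l k q * pd sliceDir l (fun z => β z k) q := by
    refine Finset.sum_congr rfl fun i _ => ?_
    simp only [Finset.mul_sum, mixedComp, Finset.sum_mul]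
    rw [Finset.sum_comm]
    refine Finset.sum_congr rfl fun h _ => Finset.sum_congr rfl fun j _ => ?_
    ring
  have h6 : ∑ i, ∑ j, (g q)⁻¹ i j * K q i j = ∑ l, mixedComp g K l l q := rfl
  have h7 : ∑ i, ∑ j, (g q)⁻¹ i j * ricci sliceDir g i j q = scalarCurvature sliceDir g q := rfl
  have h8 : N q ^ 2 * ∑ i, ∑ j, (g q)⁻¹ i j *
        frameRicci (splitFrame β) (splitConn N β g K) (Sum.inl i) (Sum.inl j) q =
      N q ^ 2 * scalarCurvature sliceDir g q
      - N q ^ 2 * 2 * ∑ l, ∑ k, mixedComp g K l k q * mixedComp g K k l q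
      + N q ^ 2 * (∑ l, mixedComp g K l l q) * ∑ l, mixedComp g K l l q
      - N q * ∑ i, ∑ j, (g q)⁻¹ i j * (pd sliceDir i (pd sliceDir j N) q -
        ∑ l, christoffel sliceDir g l i j q * pd sliceDir l N q)
      - N q * ∑ i, ∑ j, (g q)⁻¹ i j * normalDeriv β (fun z => K z i j) q
      + N q * ∑ l, ∑ k, mixedComp g K l k q * pd sliceDir l (fun z => β z k) q
      + N q * ∑ l, ∑ k, mixedComp g K l k q * pd sliceDir l (fun z => β z k) q := by
    nth_rewrite 1 [← h4]
    nth_rewrite 1 [← h5]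
    rw [← h3, ← h7]
    nth_rewrite 1 [← h6]
    rw [Finset.mul_sum]
    simp only [Finset.mul_sum (a := N q ^ 2)]
    rw [Finset.sum_congr rfl fun i _ => Finset.sum_congr rfl fun j _ => h1 i j]
    simp only [Finset.sum_add_distrib, Finset.sum_sub_distrib, ← Finset.mul_sum, ← Finset.sum_mul]
  rw [h8, frameRicci_time hk, normalDeriv_meanCurvature hk, hamiltonianDensity]
  ring

end SplitRicci

/-! ### The divergence identity for the difference between the Ricci tensor and conserved sources.
-/

section Divergence

open Topology Filter

variable {ι F : Type*} [Fintype ι] [DecidableEq ι]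
  [NormedAddCommGroup F] [NormedSpace ℝ F] {x : F} {g : F → Matrix ι ι ℝ} {b : ι → F}

/-- The metric is parallel, so the divergence of `f g` is the gradient of `f`. -/
theorem divergence_sub_smul_metric {h : F → Matrix ι ι ℝ} {f : F → ℝ} (hg : IsMetricAt g x)
    (hh : ∀ i j, AnalyticAt ℝ (fun z => h z i j) x) (hf : AnalyticAt ℝ f x) (j : ι) :
    divergence b g (fun z => h z - f z • g z) j x = divergence b g h j x - pd b j f x := by
  have h1 : ∀ i k, covDerivTensor b g (fun z => h z - f z • g z) i k j x =
      covDerivTensor b g h i k j x - pd b i f x * g x k j := by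
    intro i k
    have h2 : pd b i (fun z => (h z - f z • g z) k j) x = pd b i (fun z => h z k j) x -
        (pd b i f x * g x k j + f x * pd b i (fun z => g z k j) x) := by
      rw [← pd_mul hf (hg.analytic k j), ← pd_sub (hh k j) (hf.fun_mul (hg.analytic k j))]
      rfl
    unfold covDerivTensor
    rw [h2, hg.metric_compat (b := b) i k j]
    simp only [Matrix.sub_apply, Matrix.smul_apply, smul_eq_mul, mul_sub, Finset.mul_sum, mul_add,
      Finset.sum_add_distrib, Finset.sum_sub_distrib]
    have e1 : ∑ m, christoffel b g m i k x * (f x * g x m j) =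
        ∑ m, f x * (christoffel b g m i k x * g x m j) :=
      Finset.sum_congr rfl fun m _ => by ring
    have e2 : ∑ m, christoffel b g m i j x * (f x * g x k m) =
        ∑ m, f x * (christoffel b g m i j x * g x k m) :=
      Finset.sum_congr rfl fun m _ => by ring
    rw [e1, e2]
    ring
  unfold divergence
  simp only [h1, mul_sub, Finset.sum_sub_distrib]
  congr 1
  have h3 : ∀ i, ∑ k, (g x)⁻¹ i k * (pd b i f x * g x k j) =
      pd b i f x * ∑ k, (g x)⁻¹ i k * g x k j := fun i => by
    rw [Finset.mul_sum]; exact Finset.sum_congr rfl fun k _ => by ring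
  simp only [h3, hg.sum_inv_mul]
  simp

theorem divergence_sub {h h' : F → Matrix ι ι ℝ}
    (hh : ∀ i j, AnalyticAt ℝ (fun z => h z i j) x)
    (hh' : ∀ i j, AnalyticAt ℝ (fun z => h' z i j) x) (j : ι) :
    divergence b g (fun z => h z - h' z) j x = divergence b g h j x - divergence b g h' j x := by
  unfold divergence
  simp only [← Finset.sum_sub_distrib, ← mul_sub]
  refine Finset.sum_congr rfl fun i _ => Finset.sum_congr rfl fun k _ => ?_
  unfold covDerivTensor
  have h2 : pd b i (fun z => (h z - h' z) k j) x = pd b i (fun z => h z k j) x -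
      pd b i (fun z => h' z k j) x := by
    rw [← pd_sub (hh k j) (hh' k j)]
    rfl
  rw [h2]
  simp only [Matrix.sub_apply, mul_sub, Finset.sum_sub_distrib, Finset.sum_add_distrib]
  ring

theorem analyticAt_tr {h : F → Matrix ι ι ℝ} (hg : IsMetricAt g x)
    (hh : ∀ i j, AnalyticAt ℝ (fun z => h z i j) x) : AnalyticAt ℝ (tr g h) x :=
  analyticAt_sum fun i => analyticAt_sum fun j => (hg.inv_analytic i j).fun_mul (hh i j)

/-- The Ricci tensor as a matrix. -/
def ricciMatrix (b : ι → F) (g : F → Matrix ι ι ℝ) (z : F) : Matrix ι ι ℝ :=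
  fun i j => ricci b g i j z

/-- For conserved sources `ρ`, the difference `Ricci - ρ` satisfies the contracted Bianchi
identity. -/
theorem divergence_ricci_sub [FiniteDimensional ℝ F] {b : Module.Basis ι ℝ F}
    {ρ : F → Matrix ι ι ℝ} (hg : IsMetricAt g x) (hρ : ∀ i j, AnalyticAt ℝ (fun z => ρ z i j) x)
    {j : ι} (hc : divergence b g (fun z => ρ z - (1 / 2 * tr g ρ z) • g z) j x = 0) :
    divergence b g (fun z => ricciMatrix b g z - ρ z) j x =
      1 / 2 * pd b j (tr g fun z => ricciMatrix b g z - ρ z) x := by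
  have hR := fun i j => hg.ricci_analytic (b := b) i j
  have ht := analyticAt_tr hg hρ
  rw [divergence_sub_smul_metric hg hρ (analyticAt_const.fun_mul ht),
    pd_const_mul _ ht] at hc
  have h1 : (tr g fun z => ricciMatrix b g z - ρ z) =
      fun z => scalarCurvature b g z - tr g ρ z := by
    funext z
    simp only [tr, scalarCurvature, Matrix.sub_apply, mul_sub, Finset.sum_sub_distrib]
    rfl
  have h2 : divergence b g (ricciMatrix b g) j x = 1 / 2 * pd b j (scalarCurvature b g) x :=
    divergence_ricci hg j
  have h3 : AnalyticAt ℝ (scalarCurvature b g) x := analyticAt_tr hg hR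
  rw [h1, pd_sub h3 ht, divergence_sub (h := ricciMatrix b g) hR hρ, h2]
  linarith

end Divergence

/-! ### Vanishing to finite order in time. -/

section Vanishing

open Topology Filter

variable {n k : ℕ} {f h : EuclideanSpace ℝ (Fin n) × ℝ → ℝ} {q : EuclideanSpace ℝ (Fin n) × ℝ}

/-- `f` is analytic and vanishes to order `k` in time. -/
def VanishesAt (k : ℕ) (q : EuclideanSpace ℝ (Fin n) × ℝ) (f : EuclideanSpace ℝ (Fin n) × ℝ → ℝ) :
    Prop := ContactAt k q f fun _ => 0

theorem VanishesAt.congr (hf : VanishesAt k q f) (e : f =ᶠ[𝓝 q] h) : VanishesAt k q h :=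
  ContactAt.congr hf e EventuallyEq.rfl

theorem VanishesAt.add (hf : VanishesAt k q f) (hh : VanishesAt k q h) :
    VanishesAt k q fun z => f z + h z := by
  simpa [VanishesAt] using ContactAt.add hf hh

theorem VanishesAt.sub (hf : VanishesAt k q f) (hh : VanishesAt k q h) :
    VanishesAt k q fun z => f z - h z := by
  simpa [VanishesAt] using ContactAt.sub hf hh

theorem VanishesAt.mul_left (hf : VanishesAt k q f) (hh : AnalyticAt ℝ h q) :
    VanishesAt k q fun z => h z * f z := by
  simpa [VanishesAt] using (ContactAt.refl hh).mul hf

theorem VanishesAt.sum {A : Type*} {S : Finset A} {G : A → EuclideanSpace ℝ (Fin n) × ℝ → ℝ}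
    (h : ∀ a, VanishesAt k q (G a)) : VanishesAt k q fun z => ∑ a ∈ S, G a z := by
  simpa [VanishesAt] using ContactAt.sum (S := S) h

theorem VanishesAt.pd (hf : VanishesAt k q f) (i : Fin n) : VanishesAt k q (pd sliceDir i f) := by
  refine ContactAt.congr (ContactAt.pd hf i) EventuallyEq.rfl (Eventually.of_forall fun z => ?_)
  exact pd_const 0

theorem VanishesAt.of_eventuallyEq (e : f =ᶠ[𝓝 q] fun _ => 0) : VanishesAt k q f :=
  ContactAt.congr (ContactAt.refl analyticAt_const) e.symm EventuallyEq.rfl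

end Vanishing

/-! ### Propagation of the constraints. -/

section Propagation

open Topology Filter

variable {n : ℕ} {G D : EuclideanSpace ℝ (Fin n) × ℝ → Matrix (Fin n ⊕ Unit) (Fin n ⊕ Unit) ℝ}
  {q : EuclideanSpace ℝ (Fin n) × ℝ}

/-- A tensor satisfying the contracted Bianchi identity and without space components vanishes
if it vanishes initially. -/
theorem eventually_zero_of_bianchi {y₀ : EuclideanSpace ℝ (Fin n)} (hG : IsMetricAt G (y₀, 0))
    (htt : (G (y₀, 0))⁻¹ (Sum.inr ()) (Sum.inr ()) ≠ 0)
    (hD : ∀ a c, AnalyticAt ℝ (fun z => D z a c) (y₀, 0))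
    (hDs : ∀ᶠ z in 𝓝 (y₀, (0 : ℝ)), ∀ a c, D z a c = D z c a)
    (hsp : ∀ᶠ z in 𝓝 (y₀, (0 : ℝ)), ∀ i j, D z (Sum.inl i) (Sum.inl j) = 0)
    (hdiv : ∀ᶠ z in 𝓝 (y₀, (0 : ℝ)), ∀ j,
      divergence spacetimeDir G D j z = 1 / 2 * pd spacetimeDir j (tr G D) z)
    (h0 : ∀ᶠ y in 𝓝 y₀, ∀ a c, D (y, 0) a c = 0) :
    ∀ᶠ z in 𝓝 (y₀, (0 : ℝ)), ∀ a c, D z a c = 0 := by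
  set t : Fin n ⊕ Unit := Sum.inr () with ht
  have hw := fun a c => hG.inv_analytic a c
  have hc := fun l i j => hG.christoffel_analytic (b := spacetimeDir) l i j
  have hinv : AnalyticAt ℝ (fun z => ((G z)⁻¹ t t)⁻¹) (y₀, 0) := (hw t t).inv htt
  have hne : ∀ᶠ z in 𝓝 (y₀, (0 : ℝ)), (G z)⁻¹ t t ≠ 0 :=
    (hw t t).continuousAt.eventually_ne htt
  have hDe : ∀ᶠ z in 𝓝 (y₀, (0 : ℝ)), ∀ a c, AnalyticAt ℝ (fun z => D z a c) z :=
    eventually_all.2 fun a => eventually_all.2 fun c => (hD a c).eventually_analyticAt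
  -- the terms without time derivatives of `D`
  let P : Fin n ⊕ Unit → EuclideanSpace ℝ (Fin n) × ℝ → ℝ := fun j z =>
    ∑ i, ∑ c, (G z)⁻¹ (Sum.inl i) c * pd sliceDir i (fun z => D z c j) z
      - ∑ a, ∑ c, ∑ m, ((G z)⁻¹ a c * christoffel spacetimeDir G m a c z * D z m j
        + (G z)⁻¹ a c * christoffel spacetimeDir G m a j z * D z c m)
  have hdivP : ∀ j z, divergence spacetimeDir G D j z = P j z +
      ∑ c, (G z)⁻¹ t c * pd spacetimeDir t (fun z => D z c j) z := by
    intro j z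
    have h1 : divergence spacetimeDir G D j z =
        ∑ a, ∑ c, (G z)⁻¹ a c * pd spacetimeDir a (fun z => D z c j) z -
        ∑ a, ∑ c, ∑ m, ((G z)⁻¹ a c * christoffel spacetimeDir G m a c z * D z m j
        + (G z)⁻¹ a c * christoffel spacetimeDir G m a j z * D z c m) := by
      unfold divergence covDerivTensor
      simp only [mul_sub, Finset.sum_sub_distrib, Finset.mul_sum, mul_add, ← mul_assoc]
    rw [h1, sum_space_add_time]
    simp only [P]
    have h2 : ∀ (i : Fin n) f, pd spacetimeDir (Sum.inl i) f z = pd sliceDir i f z :=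
      fun i f => rfl
    simp only [h2]
    ring
  -- Since the space components vanish and `G^{tt} ≠ 0`, the divergence equations determine the time
  -- derivatives of the other components from `D` and its space derivatives.
  have hstep : ∀ k, (∀ a c, VanishesAt k (y₀, 0) fun z => D z a c) →
      ∀ a c, VanishesAt k (y₀, 0) (pd spacetimeDir t fun z => D z a c) := by
    intro k hk
    have hP : ∀ j, VanishesAt k (y₀, 0) (P j) := fun j =>
      (VanishesAt.sum fun i => VanishesAt.sum fun c => ((hk c j).pd i).mul_left (hw _ c)).sub
        (VanishesAt.sum fun a => VanishesAt.sum fun c => VanishesAt.sum fun m =>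
          ((hk m j).mul_left ((hw a c).fun_mul (hc m a c))).add
            ((hk c m).mul_left ((hw a c).fun_mul (hc m a j))))
    have htr : VanishesAt k (y₀, 0) (tr G D) :=
      VanishesAt.sum fun a => VanishesAt.sum fun c => (hk a c).mul_left (hw a c)
    have hsp0 : ∀ᶠ z in 𝓝 (y₀, (0 : ℝ)), ∀ i j,
        pd spacetimeDir t (fun z => D z (Sum.inl i) (Sum.inl j)) z = 0 := by
      filter_upwards [hsp.eventually_nhds] with z hz i j
      have h1 : (fun z => D z (Sum.inl i) (Sum.inl j)) =ᶠ[𝓝 z] fun _ => 0 :=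
        hz.mono fun w hw => hw i j
      rw [pd_congr h1, pd_const]
    have hss : ∀ i j, VanishesAt k (y₀, 0)
        (pd spacetimeDir t fun z => D z (Sum.inl i) (Sum.inl j)) := fun i j =>
      VanishesAt.of_eventuallyEq (hsp0.mono fun z hz => hz i j)
    -- In the equation with space index `j` the only time derivative left is `G^{tt} ∂_t D_{tj}`.
    have hts : ∀ j, VanishesAt k (y₀, 0) (pd spacetimeDir t fun z => D z t (Sum.inl j)) := by
      intro j
      have h1 : VanishesAt k (y₀, 0) fun z => ((G z)⁻¹ t t)⁻¹ *
          (1 / 2 * pd sliceDir j (tr G D) z - P (Sum.inl j) z) :=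
        ((VanishesAt.mul_left (htr.pd j) analyticAt_const).sub (hP (Sum.inl j))).mul_left hinv
      refine h1.congr ?_
      filter_upwards [hdiv, hne, hsp0] with z h1 h2 h3
      have h4 := h1 (Sum.inl j)
      rw [hdivP, sum_space_add_time] at h4
      simp only [h3, mul_zero, Finset.sum_const_zero, zero_add] at h4
      have h5 : pd sliceDir j (tr G D) z = pd spacetimeDir (Sum.inl j) (tr G D) z := rfl
      rw [h5, ← h4, add_sub_cancel_left, inv_mul_cancel_left₀ h2]
    have hsym : ∀ a c, (pd spacetimeDir t fun z => D z a c) =ᶠ[𝓝 (y₀, (0 : ℝ))]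
        pd spacetimeDir t fun z => D z c a := fun a c =>
      eventuallyEq_pd (hDs.mono fun z hz => hz a c)
    have hst : ∀ j, VanishesAt k (y₀, 0) (pd spacetimeDir t fun z => D z (Sum.inl j) t) :=
      fun j => (hts j).congr (hsym _ _)
    -- In the equation with time index, `½ ∂_t tr D` also contains time derivatives of `D`. Its
    -- terms `G^{ti} ∂_t D_{it}` cancel those of the divergence, and half of `G^{tt} ∂_t D_{tt}`
    -- survives, whence the factor `2` before `P t`.
    have htt' : VanishesAt k (y₀, 0) (pd spacetimeDir t fun z => D z t t) := by
      have h1 : VanishesAt k (y₀, 0) fun z => ((G z)⁻¹ t t)⁻¹ *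
          ((∑ a, ∑ c, pd spacetimeDir t (fun z => (G z)⁻¹ a c) z * D z a c) - 2 * P t z) :=
        ((VanishesAt.sum fun a => VanishesAt.sum fun c =>
          (hk a c).mul_left (analyticAt_pd (hw a c))).sub
            (VanishesAt.mul_left (hP t) analyticAt_const)).mul_left hinv
      refine h1.congr ?_
      filter_upwards [hdiv, hne, hsp0, hG.eventually, hDe,
        eventually_all.2 fun a => eventually_all.2 fun c => hsym a c] with z h1 h2 h3 h4 h5 h6
      have h7 := h1 t
      have h8 : pd spacetimeDir t (tr G D) z =
          ∑ a, ∑ c, pd spacetimeDir t (fun z => (G z)⁻¹ a c) z * D z a c +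
          ∑ a, ∑ c, (G z)⁻¹ a c * pd spacetimeDir t (fun z => D z a c) z := by
        unfold tr
        have hm := fun a c => (h4.inv_analytic a c).fun_mul (h5 a c)
        rw [pd_sum fun a => analyticAt_sum fun c => hm a c, ← Finset.sum_add_distrib]
        refine Finset.sum_congr rfl fun a _ => ?_
        rw [pd_sum fun c => hm a c, ← Finset.sum_add_distrib]
        exact Finset.sum_congr rfl fun c _ => pd_mul (h4.inv_analytic a c) (h5 a c)
      have h9 : ∑ a, ∑ c, (G z)⁻¹ a c * pd spacetimeDir t (fun z => D z a c) z =
          2 * (∑ i, (G z)⁻¹ t (Sum.inl i) * pd spacetimeDir t (fun z => D z (Sum.inl i) t) z)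
          + (G z)⁻¹ t t * pd spacetimeDir t (fun z => D z t t) z := by
        simp only [sum_space_add_time, h3, mul_zero, Finset.sum_const_zero, zero_add, ← ht]
        have e1 : ∀ i, (G z)⁻¹ t (Sum.inl i) * pd spacetimeDir t (fun z => D z t (Sum.inl i)) z =
            (G z)⁻¹ t (Sum.inl i) * pd spacetimeDir t (fun z => D z (Sum.inl i) t) z := fun i => by
          rw [h6 t (Sum.inl i)]
        have e2 : ∀ i, (G z)⁻¹ (Sum.inl i) t * pd spacetimeDir t (fun z => D z (Sum.inl i) t) z =
            (G z)⁻¹ t (Sum.inl i) * pd spacetimeDir t (fun z => D z (Sum.inl i) t) z := fun i => by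
          rw [h4.inv_symm (Sum.inl i) t]
        simp only [e1, e2]
        ring
      rw [hdivP, h8, h9, sum_space_add_time] at h7
      rw [inv_mul_eq_iff_eq_mul₀ h2]
      linarith
    rintro (i | i) (j | j)
    · exact hss i j
    · exact hst i
    · exact hts j
    · exact htt'
  have hall : ∀ k a c, VanishesAt k (y₀, 0) fun z => D z a c := by
    intro k
    induction k with
    | zero => exact fun a c => ContactAt.zero (hD a c) analyticAt_const
    | succ k ih =>
      intro a c
      refine ContactAt.succ (h0.mono fun y hy => hy a c) (hD a c) analyticAt_const ?_
      refine ContactAt.congr (hstep k ih a c) EventuallyEq.rfl (Eventually.of_forall fun z => ?_)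
      exact (pd_const 0).symm
  exact eventually_all.2 fun a => eventually_all.2 fun c =>
    eventuallyEq_of_contactAt fun k => hall k a c

end Propagation

/-! ### The Einstein equations near the initial slice, in coordinates. -/

section EinsteinNearSlice

open Topology Filter

variable {n : ℕ} {N : EuclideanSpace ℝ (Fin n) × ℝ → ℝ}
  {β : EuclideanSpace ℝ (Fin n) × ℝ → Fin n → ℝ}
  {g K : EuclideanSpace ℝ (Fin n) × ℝ → Matrix (Fin n) (Fin n) ℝ}
  {ρ H : EuclideanSpace ℝ (Fin n) × ℝ → Matrix (Fin n ⊕ Unit) (Fin n ⊕ Unit) ℝ}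
  {q : EuclideanSpace ℝ (Fin n) × ℝ}

/-- The components of a tensor in the frame `∂_i`, `e₀`. -/
def frameComp (β : EuclideanSpace ℝ (Fin n) × ℝ → Fin n → ℝ)
    (H : EuclideanSpace ℝ (Fin n) × ℝ → Matrix (Fin n ⊕ Unit) (Fin n ⊕ Unit) ℝ)
    (q : EuclideanSpace ℝ (Fin n) × ℝ) : Matrix (Fin n ⊕ Unit) (Fin n ⊕ Unit) ℝ :=
  fun a c => formMap spacetimeBasis H q (splitFrame β a q) (splitFrame β c q)

theorem formMap_spacetimeDir (a c : Fin n ⊕ Unit) :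
    formMap spacetimeBasis H q (spacetimeDir a) (spacetimeDir c) = H q a c := by
  rw [← coe_spacetimeBasis]; exact formMap_basis a c

theorem frameComp_space (i j : Fin n) :
    frameComp β H q (Sum.inl i) (Sum.inl j) = H q (Sum.inl i) (Sum.inl j) :=
  formMap_spacetimeDir _ _

theorem frameComp_mixed (i : Fin n) : frameComp β H q (Sum.inl i) (Sum.inr ()) =
    H q (Sum.inl i) (Sum.inr ()) - ∑ k, β q k * H q (Sum.inl i) (Sum.inl k) := by
  simp only [frameComp, splitFrame, map_sub, map_sum, map_smul, formMap_spacetimeDir, smul_eq_mul]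

theorem frameComp_time : frameComp β H q (Sum.inr ()) (Sum.inr ()) =
    H q (Sum.inr ()) (Sum.inr ()) - ∑ k, β q k * H q (Sum.inl k) (Sum.inr ())
      - ∑ k, β q k * (H q (Sum.inr ()) (Sum.inl k) - ∑ l, β q l * H q (Sum.inl l) (Sum.inl k)) := by
  simp only [frameComp, splitFrame, map_sub, map_sum, map_smul, formMap_spacetimeDir, smul_eq_mul,
    _root_.sub_apply, _root_.sum_apply, _root_.smul_apply]

theorem frameComp_ricci (hk : IsKinematicAt N β g K q) (a c : Fin n ⊕ Unit) :
    frameComp β (ricciMatrix spacetimeDir (splitMetric N β g)) q a c =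
      frameRicci (splitFrame β) (splitConn N β g K) a c q := by
  rw [← ricciForm_splitFrame hk, ← formMap_ricci (isMetricAt_splitMetric hk.toIsSplitAt),
    coe_spacetimeBasis]
  rfl

/-- The components of a symmetric tensor vanish if its components in the frame do. -/
theorem eq_of_frameComp {H' : EuclideanSpace ℝ (Fin n) × ℝ → Matrix (Fin n ⊕ Unit) (Fin n ⊕ Unit) ℝ}
    (hs : ∀ a c, H q a c = H q c a) (hs' : ∀ a c, H' q a c = H' q c a)
    (h1 : ∀ i j, H q (Sum.inl i) (Sum.inl j) = H' q (Sum.inl i) (Sum.inl j))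
    (h2 : ∀ i, frameComp β H q (Sum.inl i) (Sum.inr ()) = frameComp β H' q (Sum.inl i) (Sum.inr ()))
    (h3 : frameComp β H q (Sum.inr ()) (Sum.inr ()) = frameComp β H' q (Sum.inr ()) (Sum.inr ()))
    (a c : Fin n ⊕ Unit) : H q a c = H' q a c := by
  have h4 : ∀ i, H q (Sum.inl i) (Sum.inr ()) = H' q (Sum.inl i) (Sum.inr ()) := by
    intro i
    have := h2 i
    rw [frameComp_mixed, frameComp_mixed] at this
    simpa only [h1, sub_left_inj] using this
  have h5 : ∀ i, H q (Sum.inr ()) (Sum.inl i) = H' q (Sum.inr ()) (Sum.inl i) := fun i => by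
    rw [hs, h4, hs']
  rw [frameComp_time, frameComp_time] at h3
  simp only [h1, h4, h5, sub_left_inj] at h3
  rcases a with i | i <;> rcases c with j | j
  · exact h1 i j
  · exact h4 i
  · exact h5 j
  · exact h3

/-- The evolution equations as equations for the spacetime metric. -/
theorem curvatureRate_iff (hk : IsKinematicAt N β g K q)
    (r : EuclideanSpace ℝ (Fin n) × ℝ → Matrix (Fin n) (Fin n) ℝ) (i j : Fin n) :
    pd spacetimeDir (Sum.inr ()) (fun z => K z i j) q = curvatureRate N β r g K i j q ↔
      ricci spacetimeDir (splitMetric N β g) (Sum.inl i) (Sum.inl j) q = r q i j := by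
  have h1 := frameRicci_space hk r i j
  rw [← frameComp_ricci hk, frameComp_space] at h1
  change N q * (ricci spacetimeDir (splitMetric N β g) (Sum.inl i) (Sum.inl j) q - r q i j) = _ at h1
  constructor
  · intro h
    rw [h, sub_self] at h1
    exact sub_eq_zero.1 ((mul_eq_zero.1 h1).resolve_left hk.lapse_ne)
  · intro h
    rw [h, sub_self, mul_zero] at h1
    linarith

/-- The Einstein equations hold near the initial slice. -/
theorem einstein_near_slice {y₀ : EuclideanSpace ℝ (Fin n)} (hk : IsKinematicAt N β g K (y₀, 0))
    (hρ : ∀ a c, AnalyticAt ℝ (fun z => ρ z a c) (y₀, 0))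
    (hρs : ∀ᶠ z in 𝓝 (y₀, (0 : ℝ)), ∀ a c, ρ z a c = ρ z c a)
    (hev : ∀ᶠ z in 𝓝 (y₀, (0 : ℝ)), ∀ i j,
      ricci spacetimeDir (splitMetric N β g) (Sum.inl i) (Sum.inl j) z =
        ρ z (Sum.inl i) (Sum.inl j))
    (hcons : ∀ᶠ z in 𝓝 (y₀, (0 : ℝ)), ∀ j, divergence spacetimeDir (splitMetric N β g)
      (fun z => ρ z - (1 / 2 * tr (splitMetric N β g) ρ z) • splitMetric N β g z) j z = 0)
    (hmom : ∀ᶠ y in 𝓝 y₀, ∀ i,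
      frameComp β ρ (y, 0) (Sum.inl i) (Sum.inr ()) = N (y, 0) * momentumDensity g K i (y, 0))
    (hham : ∀ᶠ y in 𝓝 y₀, frameComp β ρ (y, 0) (Sum.inr ()) (Sum.inr ()) + N (y, 0) ^ 2 *
      ∑ i, ∑ j, (g (y, 0))⁻¹ i j * ρ (y, 0) (Sum.inl i) (Sum.inl j) =
        N (y, 0) ^ 2 * hamiltonianDensity g K (y, 0)) :
    ∀ᶠ z in 𝓝 (y₀, (0 : ℝ)), ∀ a c,
      ricci spacetimeDir (splitMetric N β g) a c z = ρ z a c := by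
  have hG := isMetricAt_splitMetric hk.toIsSplitAt
  have hslice : Tendsto (fun y : EuclideanSpace ℝ (Fin n) => (y, (0 : ℝ))) (𝓝 y₀) (𝓝 (y₀, 0)) :=
    (Continuous.prodMk_left (0 : ℝ)).tendsto y₀
  have hR := fun a c => hG.ricci_analytic (b := spacetimeDir) a c
  have hRs : ∀ᶠ z in 𝓝 (y₀, (0 : ℝ)), ∀ a c, ricciMatrix spacetimeDir (splitMetric N β g) z a c =
      ricciMatrix spacetimeDir (splitMetric N β g) z c a :=
    hG.eventually.mono fun z hz a c => hz.ricci_symm a c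
  have hρe : ∀ᶠ z in 𝓝 (y₀, (0 : ℝ)), ∀ a c, AnalyticAt ℝ (fun z => ρ z a c) z :=
    eventually_all.2 fun a => eventually_all.2 fun c => (hρ a c).eventually_analyticAt
  have key := eventually_zero_of_bianchi hG
    (D := fun z => ricciMatrix spacetimeDir (splitMetric N β g) z - ρ z) ?_
    (fun a c => (hR a c).fun_sub (hρ a c)) ?_ ?_ ?_ ?_
  · exact key.mono fun z hz a c => sub_eq_zero.1 (hz a c)
  · rw [splitMetric_inv hk.toIsSplitAt]
    exact neg_ne_zero.2 (one_div_ne_zero (pow_ne_zero 2 hk.lapse_ne))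
  · filter_upwards [hRs, hρs] with z h1 h2 a c
    rw [Matrix.sub_apply, Matrix.sub_apply, h1, h2]
  · exact hev.mono fun z hz i j => sub_eq_zero.2 (hz i j)
  · filter_upwards [hcons, hG.eventually, hρe] with z h1 h2 h3 j
    rw [← coe_spacetimeBasis]
    refine divergence_ricci_sub h2 h3 ?_
    rw [coe_spacetimeBasis]
    exact h1 j
  -- On the slice, the evolution equations give the space components, the momentum constraint gives
  -- the mixed frame components, and, with the space components known, the Hamiltonian constraint
  -- gives the remaining one.
  · filter_upwards [hmom, hham, hslice.eventually hRs, hslice.eventually hρs,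
      hslice.eventually hev, hslice.eventually hk.eventually] with y h1 h2 h3 h4 h5 h6 a c
    refine sub_eq_zero.2 (eq_of_frameComp (β := β) h3 h4 h5 (fun i => ?_) ?_ a c)
    · rw [h1, frameComp_ricci h6, frameRicci_mixed h6]
    · have h7 := frameRicci_hamiltonian h6
      have h8 : ∀ i j, frameRicci (splitFrame β) (splitConn N β g K) (Sum.inl i) (Sum.inl j) (y, 0) =
          ρ (y, 0) (Sum.inl i) (Sum.inl j) := fun i j => by
        rw [← frameComp_ricci h6, frameComp_space]; exact h5 i j
      simp only [h8] at h7
      rw [frameComp_ricci h6]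
      linarith

end EinsteinNearSlice

/-! ### Charts, coordinate changes and components of tensors on `M × ℝ`. -/

section Charts

open Topology Filter

variable {n : ℕ} {M : Type*} [TopologicalSpace M] [ChartedSpace (EuclideanSpace ℝ (Fin n)) M]
  {e e' : OpenPartialHomeomorph M (EuclideanSpace ℝ (Fin n))} {y : EuclideanSpace ℝ (Fin n)}

/-- The differential of the inverse of the chart `e`, acting on coordinate vectors. -/
def symmDeriv (e : OpenPartialHomeomorph M (EuclideanSpace ℝ (Fin n)))
    (y : EuclideanSpace ℝ (Fin n)) : EuclideanSpace ℝ (Fin n) →L[ℝ] EuclideanSpace ℝ (Fin n) :=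
  mfderiv (𝓡 n) (𝓡 n) e.symm y

/-- The differential of the chart `e` at the point with coordinates `y`. -/
def chartDeriv (e : OpenPartialHomeomorph M (EuclideanSpace ℝ (Fin n)))
    (y : EuclideanSpace ℝ (Fin n)) : EuclideanSpace ℝ (Fin n) →L[ℝ] EuclideanSpace ℝ (Fin n) :=
  mfderiv (𝓡 n) (𝓡 n) e (e.symm y)

/-- The coordinate change from `e'` to `e`. -/
def transition (e e' : OpenPartialHomeomorph M (EuclideanSpace ℝ (Fin n)))
    (y : EuclideanSpace ℝ (Fin n)) : EuclideanSpace ℝ (Fin n) := e (e'.symm y)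

theorem spaceDir_sum (v : EuclideanSpace ℝ (Fin n)) : ∑ i, v i • spaceDir i = v := by
  ext j
  simp [spaceDir, Pi.single_apply]

variable [IsManifold (𝓡 n) ω M]

theorem mdifferentiableAt_chart (he : e ∈ IsManifold.maximalAtlas (𝓡 n) ω M) {x : M}
    (hx : x ∈ e.source) : MDifferentiableAt (𝓡 n) (𝓡 n) e x :=
  (contMDiffAt_of_mem_maximalAtlas he hx).mdifferentiableAt (by simp)

theorem mdifferentiableAt_chart_symm (he : e ∈ IsManifold.maximalAtlas (𝓡 n) ω M)
    (hy : y ∈ e.target) : MDifferentiableAt (𝓡 n) (𝓡 n) e.symm y :=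
  (contMDiffAt_symm_of_mem_maximalAtlas he hy).mdifferentiableAt (by simp)

theorem analyticAt_transition (he : e ∈ IsManifold.maximalAtlas (𝓡 n) ω M)
    (he' : e' ∈ IsManifold.maximalAtlas (𝓡 n) ω M) (hy : y ∈ e'.target)
    (hy' : e'.symm y ∈ e.source) : AnalyticAt ℝ (transition e e') y := by
  have h1 : ContMDiffAt (𝓡 n) (𝓡 n) ω (e ∘ e'.symm) y :=
    (contMDiffAt_of_mem_maximalAtlas he hy').comp y (contMDiffAt_symm_of_mem_maximalAtlas he' hy)
  have h2 : ContDiffAt ℝ ω (e ∘ e'.symm) y := h1.contDiffAt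
  exact h2.analyticAt

theorem chartDeriv_symmDeriv (he : e ∈ IsManifold.maximalAtlas (𝓡 n) ω M) (hy : y ∈ e.target)
    (v : EuclideanSpace ℝ (Fin n)) : chartDeriv e y (symmDeriv e y v) = v := by
  have h1 := mfderiv_comp y (mdifferentiableAt_chart he (e.map_target hy))
    (mdifferentiableAt_chart_symm he hy)
  have h2 : (e ∘ e.symm) =ᶠ[𝓝 y] id := by
    filter_upwards [e.open_target.mem_nhds hy] with z hz using e.right_inv hz
  rw [h2.mfderiv_eq, mfderiv_id] at h1
  exact (congrArg (fun A : EuclideanSpace ℝ (Fin n) →L[ℝ] EuclideanSpace ℝ (Fin n) => A v) h1).symm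

/-- In finite dimension a one-sided inverse is two-sided. -/
theorem symmDeriv_chartDeriv (he : e ∈ IsManifold.maximalAtlas (𝓡 n) ω M) (hy : y ∈ e.target)
    (v : EuclideanSpace ℝ (Fin n)) : symmDeriv e y (chartDeriv e y v) = v := by
  have h1 : (chartDeriv e y).toLinearMap ∘ₗ (symmDeriv e y).toLinearMap = LinearMap.id :=
    LinearMap.ext fun v => chartDeriv_symmDeriv he hy v
  rw [LinearMap.comp_eq_id_comm] at h1
  exact LinearMap.congr_fun h1 v

theorem symmDeriv_transition (he : e ∈ IsManifold.maximalAtlas (𝓡 n) ω M)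
    (he' : e' ∈ IsManifold.maximalAtlas (𝓡 n) ω M) (hy : y ∈ e'.target)
    (hy' : e'.symm y ∈ e.source) (v : EuclideanSpace ℝ (Fin n)) :
    symmDeriv e' y v = symmDeriv e (transition e e' y) (fderiv ℝ (transition e e') y v) := by
  have h2 : e'.symm =ᶠ[𝓝 y] e.symm ∘ transition e e' := by
    filter_upwards [e'.symm.continuousAt hy |>.eventually (e.open_source.mem_nhds hy')] with z hz
    exact (e.left_inv hz).symm
  have h3 : MDifferentiableAt (𝓡 n) (𝓡 n) (transition e e') y :=
    (analyticAt_transition he he' hy hy').differentiableAt.mdifferentiableAt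
  have h1 := mfderiv_comp y (mdifferentiableAt_chart_symm he (e.map_source hy')) h3
  have h4 := h2.mfderiv_eq (I := 𝓡 n) (I' := 𝓡 n)
  rw [h1, mfderiv_eq_fderiv] at h4
  exact congrArg (fun A : EuclideanSpace ℝ (Fin n) →L[ℝ] EuclideanSpace ℝ (Fin n) => A v) h4

/-- The vector on `M × ℝ` with coordinates `v` in the chart `e`. -/
def chartPush (e : OpenPartialHomeomorph M (EuclideanSpace ℝ (Fin n)))
    (y : EuclideanSpace ℝ (Fin n)) :
    EuclideanSpace ℝ (Fin n) × ℝ →ₗ[ℝ] EuclideanSpace ℝ (Fin n) × ℝ :=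
  (symmDeriv e y).toLinearMap.prodMap LinearMap.id

theorem chartPush_spacetimeDir (a : Fin n ⊕ Unit) :
    chartPush e y (spacetimeDir a) = spacetimeVec e y a := by
  rcases a with i | i
  · rfl
  · refine Prod.ext ?_ rfl
    exact map_zero (symmDeriv e y)

/-- A bilinear form on `M × ℝ`, evaluated through its components. -/
theorem form_chartPush (h : (p : M × ℝ) → LinearMap.BilinForm ℝ (TangentSpace (𝓡 n) p.1 × ℝ))
    (q v w : EuclideanSpace ℝ (Fin n) × ℝ) :
    h (e.symm q.1, q.2) (chartPush e q.1 v) (chartPush e q.1 w) =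
      formMap spacetimeBasis (spacetimeComp e h) q v w := by
  let H : LinearMap.BilinForm ℝ (EuclideanSpace ℝ (Fin n) × ℝ) := h (e.symm q.1, q.2)
  let B : LinearMap.BilinForm ℝ (EuclideanSpace ℝ (Fin n) × ℝ) :=
    LinearMap.mk₂ ℝ (fun v w => formMap spacetimeBasis (spacetimeComp e h) q v w)
      (by simp) (by simp) (by simp) (by simp)
  have h1 : H.comp (chartPush e q.1) (chartPush e q.1) = B := by
    refine LinearMap.BilinForm.ext_basis spacetimeBasis fun a c => ?_
    change H (chartPush e q.1 _) (chartPush e q.1 _) =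
      formMap spacetimeBasis (spacetimeComp e h) q _ _
    rw [formMap_basis, coe_spacetimeBasis, chartPush_spacetimeDir, chartPush_spacetimeDir]
    rfl
  exact LinearMap.congr_fun (LinearMap.congr_fun h1 v) w

/-- The coordinate change on `M × ℝ`. -/
def spacetimeTransition (e e' : OpenPartialHomeomorph M (EuclideanSpace ℝ (Fin n)))
    (q : EuclideanSpace ℝ (Fin n) × ℝ) : EuclideanSpace ℝ (Fin n) × ℝ :=
  (transition e e' q.1, q.2)

variable {q : EuclideanSpace ℝ (Fin n) × ℝ}

theorem analyticAt_spacetimeTransition (he : e ∈ IsManifold.maximalAtlas (𝓡 n) ω M)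
    (he' : e' ∈ IsManifold.maximalAtlas (𝓡 n) ω M) (hy : q.1 ∈ e'.target)
    (hy' : e'.symm q.1 ∈ e.source) : AnalyticAt ℝ (spacetimeTransition e e') q :=
  ((analyticAt_transition he he' hy hy').comp_of_eq analyticAt_fst rfl).prod analyticAt_snd

theorem fderiv_spacetimeTransition (he : e ∈ IsManifold.maximalAtlas (𝓡 n) ω M)
    (he' : e' ∈ IsManifold.maximalAtlas (𝓡 n) ω M) (hy : q.1 ∈ e'.target)
    (hy' : e'.symm q.1 ∈ e.source) (v : EuclideanSpace ℝ (Fin n) × ℝ) :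
    fderiv ℝ (spacetimeTransition e e') q v = (fderiv ℝ (transition e e') q.1 v.1, v.2) := by
  have h1 : HasFDerivAt (transition e e') (fderiv ℝ (transition e e') q.1) q.1 :=
    (analyticAt_transition he he' hy hy').differentiableAt.hasFDerivAt
  have h2 : HasFDerivAt (spacetimeTransition e e')
      (((fderiv ℝ (transition e e') q.1).comp (ContinuousLinearMap.fst ℝ _ ℝ)).prod
        (ContinuousLinearMap.snd ℝ _ ℝ)) q := (h1.comp q hasFDerivAt_fst).prodMk hasFDerivAt_snd
  rw [h2.fderiv]
  rfl

theorem chartPush_transition (he : e ∈ IsManifold.maximalAtlas (𝓡 n) ω M)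
    (he' : e' ∈ IsManifold.maximalAtlas (𝓡 n) ω M) (hy : q.1 ∈ e'.target)
    (hy' : e'.symm q.1 ∈ e.source) (v : EuclideanSpace ℝ (Fin n) × ℝ) :
    chartPush e' q.1 v = chartPush e (spacetimeTransition e e' q).1
      (fderiv ℝ (spacetimeTransition e e') q v) := by
  rw [fderiv_spacetimeTransition he he' hy hy']
  exact Prod.ext (symmDeriv_transition he he' hy hy' v.1) rfl

theorem spacetimeComp_transition (he : e ∈ IsManifold.maximalAtlas (𝓡 n) ω M)
    (he' : e' ∈ IsManifold.maximalAtlas (𝓡 n) ω M) (hy : q.1 ∈ e'.target)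
    (hy' : e'.symm q.1 ∈ e.source)
    (h : (p : M × ℝ) → LinearMap.BilinForm ℝ (TangentSpace (𝓡 n) p.1 × ℝ)) (a c : Fin n ⊕ Unit) :
    spacetimeComp e' h q a c = formMap spacetimeBasis (spacetimeComp e h)
      (spacetimeTransition e e' q) (fderiv ℝ (spacetimeTransition e e') q (spacetimeBasis a))
      (fderiv ℝ (spacetimeTransition e e') q (spacetimeBasis c)) := by
  rw [← form_chartPush, ← chartPush_transition he he' hy hy', ← chartPush_transition he he' hy hy',
    coe_spacetimeBasis, chartPush_spacetimeDir, chartPush_spacetimeDir]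
  have h1 : e.symm (spacetimeTransition e e' q).1 = e'.symm q.1 := e.left_inv hy'
  -- The type of `h` depends on the base point. As all tangent spaces are the same model space, the
  -- vectors can be kept fixed while one point is substituted for the other.
  have h2 : ∀ x x' : M, x = x' → ∀ v w : EuclideanSpace ℝ (Fin n) × ℝ,
      h (x, q.2) v w = h (x', q.2) v w := by rintro x _ rfl v w; rfl
  exact h2 _ _ h1.symm _ _

theorem eventually_overlap (hy : q.1 ∈ e'.target) (hy' : e'.symm q.1 ∈ e.source) :
    ∀ᶠ z in 𝓝 q, z.1 ∈ e'.target ∧ e'.symm z.1 ∈ e.source := by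
  have h1 : ∀ᶠ y in 𝓝 q.1, y ∈ e'.target ∧ e'.symm y ∈ e.source :=
    (e'.open_target.mem_nhds hy |> fun h => show ∀ᶠ y in 𝓝 q.1, y ∈ e'.target from h).and
      (e'.symm.continuousAt hy |>.eventually (e.open_source.mem_nhds hy'))
  exact (continuous_fst.tendsto q).eventually h1

theorem isPullback_transition (he : e ∈ IsManifold.maximalAtlas (𝓡 n) ω M)
    (he' : e' ∈ IsManifold.maximalAtlas (𝓡 n) ω M) (hy : q.1 ∈ e'.target)
    (hy' : e'.symm q.1 ∈ e.source)
    (h : (p : M × ℝ) → LinearMap.BilinForm ℝ (TangentSpace (𝓡 n) p.1 × ℝ)) :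
    IsPullback spacetimeBasis spacetimeBasis (spacetimeTransition e e') (spacetimeComp e h)
      (spacetimeComp e' h) q := by
  filter_upwards [eventually_overlap hy hy'] with z hz a c
  exact spacetimeComp_transition he he' hz.1 hz.2 h a c

theorem isOpen_chartDomain (e : OpenPartialHomeomorph M (EuclideanSpace ℝ (Fin n)))
    {V : Set (M × ℝ)} (hV : IsOpen V) : IsOpen (chartDomain e V) := by
  have h1 : ContinuousOn (fun q : EuclideanSpace ℝ (Fin n) × ℝ => (e.symm q.1, q.2))
      (e.target ×ˢ Set.univ) :=
    (e.continuousOn_symm.comp continuousOn_fst fun q hq => hq.1).prodMk continuousOn_snd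
  convert h1.isOpen_inter_preimage (e.open_target.prod isOpen_univ) hV using 1
  ext q
  simp [chartDomain]

theorem mem_chartDomain {V : Set (M × ℝ)} {p : M × ℝ} (hp : p ∈ V) (he : p.1 ∈ e.source) :
    (e p.1, p.2) ∈ chartDomain e V :=
  ⟨e.map_source he, by rw [e.left_inv he]; exact hp⟩

/-- The components of an analytic tensor field are analytic in all charts. -/
theorem analyticAt_spacetimeComp_transition (he : e ∈ IsManifold.maximalAtlas (𝓡 n) ω M)
    (he' : e' ∈ IsManifold.maximalAtlas (𝓡 n) ω M) (hy : q.1 ∈ e'.target)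
    (hy' : e'.symm q.1 ∈ e.source)
    {h : (p : M × ℝ) → LinearMap.BilinForm ℝ (TangentSpace (𝓡 n) p.1 × ℝ)}
    (hh : ∀ a c, AnalyticAt ℝ (fun z => spacetimeComp e h z a c) (spacetimeTransition e e' q))
    (a c : Fin n ⊕ Unit) : AnalyticAt ℝ (fun z => spacetimeComp e' h z a c) q := by
  have hΨ := analyticAt_spacetimeTransition he he' hy hy'
  have hd : ∀ a, AnalyticAt ℝ (fun z => fderiv ℝ (spacetimeTransition e e') z (spacetimeBasis a)) q :=
    fun a => analyticAt_pushField (e := fun c _ => spacetimeBasis c) hΨ (fun _ => analyticAt_const) a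
  have hf : AnalyticAt ℝ (formMap spacetimeBasis (spacetimeComp e h)) (spacetimeTransition e e' q) := by
    unfold formMap
    refine Finset.analyticAt_fun_sum _ fun i _ => Finset.analyticAt_fun_sum _ fun j _ => ?_
    exact analyticAt_smul_const (hh i j) _
  have h1 := ((ContinuousLinearMap.id ℝ _).analyticAt_bilinear _).comp₂
    (AnalyticAt.comp_of_eq hf hΨ rfl) (hd a)
  have h2 := ((ContinuousLinearMap.id ℝ (EuclideanSpace ℝ (Fin n) × ℝ →L[ℝ] ℝ)).analyticAt_bilinear
    _).comp₂ h1 (hd c)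
  refine h2.congr ?_
  filter_upwards [isPullback_transition he he' hy hy' h] with z hz
  exact (hz a c).symm

end Charts

/-! ### The evolution equations in terms of the spacetime metric. -/

section EvolutionCharacterization

open Topology Filter

variable {n : ℕ} {N : EuclideanSpace ℝ (Fin n) × ℝ → ℝ}
  {β : EuclideanSpace ℝ (Fin n) × ℝ → Fin n → ℝ}
  {r g K : EuclideanSpace ℝ (Fin n) × ℝ → Matrix (Fin n) (Fin n) ℝ}
  {q : EuclideanSpace ℝ (Fin n) × ℝ}

theorem IsSplitAt.isKinematicAt (hs : IsSplitAt N β g q)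
    (hK : ∀ i j, AnalyticAt ℝ (fun z => K z i j) q)
    (hKs : ∀ᶠ z in 𝓝 q, ∀ i j, K z i j = K z j i)
    (h : ∀ᶠ z in 𝓝 q, ∀ i j, K z i j = -N z * christoffel spacetimeDir (splitMetric N β g)
      (Sum.inr ()) (Sum.inl i) (Sum.inl j) z) : IsKinematicAt N β g K q where
  toIsSplitAt := hs
  curvature := hK
  curvature_symm := hKs
  rate := by
    filter_upwards [hs.eventually, h] with z h1 h2 i j
    exact (metricRate_iff h1 i j).2 (h2 i j)

theorem IsSplitAt.isKinematicAt_of_evolution (hs : IsSplitAt N β g q)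
    (hK : ∀ i j, AnalyticAt ℝ (fun z => K z i j) q)
    (hKs : ∀ᶠ z in 𝓝 q, ∀ i j, K z i j = K z j i)
    (h : ∀ᶠ z in 𝓝 q, EvolutionAt N β r g K z) : IsKinematicAt N β g K q where
  toIsSplitAt := hs
  curvature := hK
  curvature_symm := hKs
  rate := by
    filter_upwards [hs.eventually, h] with z h1 h2 i j
    exact ((evolutionAt_iff h1.metric h1.shift).1 h2 i j).1

/-- The evolution equations, in terms of the spacetime metric: `K_{ij} = -N Γ^t_{ij}` and the
space components of the Einstein equations hold. -/
theorem eventually_evolutionAt_iff (hs : IsSplitAt N β g q)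
    (hK : ∀ i j, AnalyticAt ℝ (fun z => K z i j) q)
    (hKs : ∀ᶠ z in 𝓝 q, ∀ i j, K z i j = K z j i) :
    (∀ᶠ z in 𝓝 q, EvolutionAt N β r g K z) ↔ ∀ᶠ z in 𝓝 q, ∀ i j,
      K z i j = -N z * christoffel spacetimeDir (splitMetric N β g)
        (Sum.inr ()) (Sum.inl i) (Sum.inl j) z ∧
      ricci spacetimeDir (splitMetric N β g) (Sum.inl i) (Sum.inl j) z = r z i j := by
  -- The second relation translates the equation of `K` only where the equation of the metric holds
  -- in a neighbourhood. The equivalence is therefore one of germs, and each direction first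
  -- establishes `IsKinematicAt`.
  constructor
  · intro h
    filter_upwards [(hs.isKinematicAt_of_evolution hK hKs h).eventually, h] with z h1 h2 i j
    have h3 := (evolutionAt_iff h1.metric h1.shift).1 h2 i j
    exact ⟨(metricRate_iff h1.toIsSplitAt i j).1 h3.1, (curvatureRate_iff h1 r i j).1 h3.2⟩
  · intro h
    have hk := hs.isKinematicAt hK hKs (h.mono fun z hz i j => (hz i j).1)
    filter_upwards [hk.eventually, h] with z h1 h2
    exact (evolutionAt_iff h1.metric h1.shift).2 fun i j =>
      ⟨(metricRate_iff h1.toIsSplitAt i j).2 (h2 i j).1, (curvatureRate_iff h1 r i j).2 (h2 i j).2⟩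

/-- The value of a bilinear form on vectors tangent to the slices. -/
theorem formMap_space {H : EuclideanSpace ℝ (Fin n) × ℝ → Matrix (Fin n ⊕ Unit) (Fin n ⊕ Unit) ℝ}
    {v w : EuclideanSpace ℝ (Fin n) × ℝ} (hv : v.2 = 0) (hw : w.2 = 0) :
    formMap spacetimeBasis H q v w = ∑ i, ∑ j, H q (Sum.inl i) (Sum.inl j) * (v.1 i * w.1 j) := by
  simp [formMap, _root_.sum_apply, coordCLM_apply, spacetimeBasis_repr,
    coordEquiv_apply, hv, hw, ContinuousLinearMap.smulRight_apply]

/-- The Christoffel symbols `Γ^t_{αβ}`, as a matrix. -/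
def timeChristoffel (G : EuclideanSpace ℝ (Fin n) × ℝ → Matrix (Fin n ⊕ Unit) (Fin n ⊕ Unit) ℝ)
    (z : EuclideanSpace ℝ (Fin n) × ℝ) : Matrix (Fin n ⊕ Unit) (Fin n ⊕ Unit) ℝ :=
  fun a c => christoffel spacetimeDir G (Sum.inr ()) a c z

/-- Isolates the time component of the transformation law of the Christoffel symbols, the only one
that the relation `K_{ij} = -N Γ^t_{ij}` needs. -/
theorem gammaMap_snd {G : EuclideanSpace ℝ (Fin n) × ℝ → Matrix (Fin n ⊕ Unit) (Fin n ⊕ Unit) ℝ}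
    (v w : EuclideanSpace ℝ (Fin n) × ℝ) : (gammaMap spacetimeBasis G q v w).2 =
      formMap spacetimeBasis (timeChristoffel G) q v w := by
  let B : EuclideanSpace ℝ (Fin n) × ℝ →L[ℝ] EuclideanSpace ℝ (Fin n) × ℝ →L[ℝ] ℝ :=
    ((ContinuousLinearMap.compL ℝ _ _ _ (ContinuousLinearMap.snd ℝ (EuclideanSpace ℝ (Fin n)) ℝ))).comp
      (gammaMap spacetimeBasis G q)
  have h1 : ∀ v w, B v w = formMap spacetimeBasis (timeChristoffel G) q v w := by
    refine clm_ext_basis (b := spacetimeBasis) fun a c => ?_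
    rw [formMap_basis]
    change (gammaMap spacetimeBasis G q _ _).2 = _
    rw [gammaMap_basis, Prod.snd_sum, sum_space_add_time]
    simp [coe_spacetimeBasis, spacetimeDir, sliceDir, timeChristoffel]
  exact h1 v w

end EvolutionCharacterization

/-! ### Tensors tangent to the slices, treated as tensors on `M × ℝ`. -/

section SliceTensors

open Topology Filter

variable {n : ℕ} {M : Type*} [TopologicalSpace M] [ChartedSpace (EuclideanSpace ℝ (Fin n)) M]
  [IsManifold (𝓡 n) ω M]
  {e e' : OpenPartialHomeomorph M (EuclideanSpace ℝ (Fin n))} {y : EuclideanSpace ℝ (Fin n)}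
  {q : EuclideanSpace ℝ (Fin n) × ℝ}
  {N : M × ℝ → ℝ} {β : (p : M × ℝ) → TangentSpace (𝓡 n) p.1}
  {g K : (p : M × ℝ) → LinearMap.BilinForm ℝ (TangentSpace (𝓡 n) p.1)}
  {ρ : (p : M × ℝ) → LinearMap.BilinForm ℝ (TangentSpace (𝓡 n) p.1 × ℝ)}

/-- The pull-back to `M × ℝ` of a time-dependent tensor field on `M`. -/
def spaceLift (h : (p : M × ℝ) → LinearMap.BilinForm ℝ (TangentSpace (𝓡 n) p.1)) (p : M × ℝ) :
    LinearMap.BilinForm ℝ (TangentSpace (𝓡 n) p.1 × ℝ) :=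
  LinearMap.BilinForm.comp (h p) (LinearMap.fst ℝ _ ℝ) (LinearMap.fst ℝ _ ℝ)

theorem spacetimeComp_spaceLift
    (h : (p : M × ℝ) → LinearMap.BilinForm ℝ (TangentSpace (𝓡 n) p.1)) (i j : Fin n) :
    spacetimeComp e (spaceLift h) q (Sum.inl i) (Sum.inl j) = spaceComp e h q i j := rfl

theorem fderiv_spacetimeTransition_inl (he : e ∈ IsManifold.maximalAtlas (𝓡 n) ω M)
    (he' : e' ∈ IsManifold.maximalAtlas (𝓡 n) ω M) (hy : q.1 ∈ e'.target)
    (hy' : e'.symm q.1 ∈ e.source) (i : Fin n) :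
    (fderiv ℝ (spacetimeTransition e e') q (spacetimeBasis (Sum.inl i))).2 = 0 := by
  rw [fderiv_spacetimeTransition he he' hy hy', coe_spacetimeBasis]
  rfl

theorem spaceComp_transition (he : e ∈ IsManifold.maximalAtlas (𝓡 n) ω M)
    (he' : e' ∈ IsManifold.maximalAtlas (𝓡 n) ω M) (hy : q.1 ∈ e'.target)
    (hy' : e'.symm q.1 ∈ e.source)
    (h : (p : M × ℝ) → LinearMap.BilinForm ℝ (TangentSpace (𝓡 n) p.1)) (i j : Fin n) :
    spaceComp e' h q i j = ∑ k, ∑ l, spaceComp e h (spacetimeTransition e e' q) k l *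
      ((fderiv ℝ (spacetimeTransition e e') q (spacetimeBasis (Sum.inl i))).1 k *
        (fderiv ℝ (spacetimeTransition e e') q (spacetimeBasis (Sum.inl j))).1 l) := by
  rw [← spacetimeComp_spaceLift, spacetimeComp_transition he he' hy hy',
    formMap_space (fderiv_spacetimeTransition_inl he he' hy hy' i)
      (fderiv_spacetimeTransition_inl he he' hy hy' j)]
  rfl

theorem analyticAt_spaceComp_transition (he : e ∈ IsManifold.maximalAtlas (𝓡 n) ω M)
    (he' : e' ∈ IsManifold.maximalAtlas (𝓡 n) ω M) (hy : q.1 ∈ e'.target)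
    (hy' : e'.symm q.1 ∈ e.source)
    {h : (p : M × ℝ) → LinearMap.BilinForm ℝ (TangentSpace (𝓡 n) p.1)}
    (hh : ∀ i j, AnalyticAt ℝ (fun z => spaceComp e h z i j) (spacetimeTransition e e' q))
    (i j : Fin n) : AnalyticAt ℝ (fun z => spaceComp e' h z i j) q := by
  refine analyticAt_spacetimeComp_transition he he' hy hy' (h := spaceLift h) ?_
    (Sum.inl i) (Sum.inl j)
  have h0 : ∀ a : Fin n ⊕ Unit, ∀ z : EuclideanSpace ℝ (Fin n) × ℝ,
      spacetimeComp e (spaceLift h) z a (Sum.inr ()) = 0 := by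
    intro a z; exact map_zero (h (e.symm z.1, z.2) (spacetimeVec e z.1 a).1)
  have h1 : ∀ a : Fin n ⊕ Unit, ∀ z : EuclideanSpace ℝ (Fin n) × ℝ,
      spacetimeComp e (spaceLift h) z (Sum.inr ()) a = 0 := by
    intro a z
    exact LinearMap.congr_fun (map_zero (h (e.symm z.1, z.2))) (spacetimeVec e z.1 a).1
  rintro (i | i) (j | j)
  · exact hh i j
  · simp only [h0]; exact analyticAt_const
  · simp only [h1]; exact analyticAt_const
  · simp only [h1]; exact analyticAt_const

theorem vecComp_sum (he : e ∈ IsManifold.maximalAtlas (𝓡 n) ω M) (hy : q.1 ∈ e.target) :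
    (β (e.symm q.1, q.2) : EuclideanSpace ℝ (Fin n)) =
      ∑ k, vecComp e β q k • (coordVec e q.1 k : EuclideanSpace ℝ (Fin n)) := by
  let w : EuclideanSpace ℝ (Fin n) := chartDeriv e q.1 (β (e.symm q.1, q.2))
  have h1 : symmDeriv e q.1 w = ∑ k, w k • symmDeriv e q.1 (spaceDir k) := by
    conv_lhs => rw [← spaceDir_sum w]
    rw [map_sum]
    simp
  exact (symmDeriv_chartDeriv he hy _).symm.trans h1

theorem bilin_sum_smul {ι T : Type*} [Fintype ι] [AddCommGroup T] [Module ℝ T]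
    (H : LinearMap.BilinForm ℝ T) (v w : ι → ℝ) (c : ι → T) :
    H (∑ i, v i • c i) (∑ j, w j • c j) = ∑ i, ∑ j, v i * w j * H (c i) (c j) := by
  simp only [map_sum, LinearMap.sum_apply, map_smul, LinearMap.smul_apply, smul_eq_mul,
    Finset.mul_sum]
  rw [Finset.sum_comm]
  exact Finset.sum_congr rfl fun i _ => Finset.sum_congr rfl fun j _ => by ring

theorem spacetimeComp_spacetimeMetric (he : e ∈ IsManifold.maximalAtlas (𝓡 n) ω M)
    (hy : q.1 ∈ e.target) : spacetimeComp e (spacetimeMetric N β g) q =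
      splitMetric (scalarComp e N) (vecComp e β) (spaceComp e g) q := by
  let p : M × ℝ := (e.symm q.1, q.2)
  let H : LinearMap.BilinForm ℝ (EuclideanSpace ℝ (Fin n)) := g p
  let b : EuclideanSpace ℝ (Fin n) := β p
  let c : Fin n → EuclideanSpace ℝ (Fin n) := coordVec e q.1
  have hG : ∀ v w : EuclideanSpace ℝ (Fin n) × ℝ, spacetimeMetric N β g p v w =
      H (v.1 + v.2 • b) (w.1 + w.2 • b) - N p ^ 2 * (v.2 * w.2) := fun v w => rfl
  have hb : b = ∑ k, vecComp e β q k • c k := vecComp_sum he hy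
  have hH : ∀ i j, H (c i) (c j) = spaceComp e g q i j := fun i j => rfl
  funext a d
  change spacetimeMetric N β g p (spacetimeVec e q.1 a) (spacetimeVec e q.1 d) = _
  refine (hG _ _).trans ?_
  rcases a with i | i <;> rcases d with j | j
  · change H (c i + (0 : ℝ) • b) (c j + (0 : ℝ) • b) - N p ^ 2 * (0 * 0) = spaceComp e g q i j
    rw [zero_smul, add_zero, add_zero, hH]; ring
  · change H (c i + (0 : ℝ) • b) (0 + (1 : ℝ) • b) - N p ^ 2 * (0 * 1) =
      ∑ h, spaceComp e g q i h * vecComp e β q h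
    rw [zero_smul, add_zero, zero_add, one_smul, hb, map_sum]
    simp only [map_smul, hH, smul_eq_mul]
    rw [zero_mul, mul_zero, sub_zero]
    exact Finset.sum_congr rfl fun k _ => mul_comm _ _
  · change H (0 + (1 : ℝ) • b) (c j + (0 : ℝ) • b) - N p ^ 2 * (1 * 0) =
      ∑ h, spaceComp e g q h j * vecComp e β q h
    rw [zero_smul, add_zero, zero_add, one_smul, hb, map_sum, LinearMap.sum_apply]
    simp only [map_smul, LinearMap.smul_apply, hH, smul_eq_mul]
    rw [mul_zero, mul_zero, sub_zero]
    exact Finset.sum_congr rfl fun k _ => mul_comm _ _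
  · change H (0 + (1 : ℝ) • b) (0 + (1 : ℝ) • b) - N p ^ 2 * (1 * 1) =
      ∑ i, ∑ j, spaceComp e g q i j * vecComp e β q i * vecComp e β q j - scalarComp e N q ^ 2
    rw [zero_add, one_smul, hb, bilin_sum_smul, mul_one, mul_one]
    refine congrArg (· - N p ^ 2) ?_
    refine Finset.sum_congr rfl fun i _ => Finset.sum_congr rfl fun j _ => ?_
    rw [hH]
    ring

theorem det_ne_zero_of_isInnerForm (he : e ∈ IsManifold.maximalAtlas (𝓡 n) ω M) (hy : y ∈ e.target)
    {h : LinearMap.BilinForm ℝ (EuclideanSpace ℝ (Fin n))} (hh : IsInnerForm h) :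
    (Matrix.of fun i j =>
      h (symmDeriv e y (spaceDir i)) (symmDeriv e y (spaceDir j))).det ≠ 0 := by
  intro h0
  obtain ⟨v, hv, hv0⟩ := Matrix.exists_mulVec_eq_zero_iff.2 h0
  let w : EuclideanSpace ℝ (Fin n) := ∑ j, v j • spaceDir j
  have hw : w ≠ 0 := by
    intro hw
    apply hv
    funext i
    have := congrArg (fun u : EuclideanSpace ℝ (Fin n) => u i) hw
    simpa [w, spaceDir, Pi.single_apply] using this
  have hs : symmDeriv e y w = ∑ j, v j • symmDeriv e y (spaceDir j) := by
    rw [map_sum]; simp only [map_smul]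
  have hs0 : symmDeriv e y w ≠ 0 := by
    intro h1
    apply hw
    rw [← chartDeriv_symmDeriv he hy w, h1, map_zero]
  have h2 := hh.2 _ hs0
  have h3 : h (symmDeriv e y w) (symmDeriv e y w) = ∑ i, v i *
      (Matrix.of fun i j =>
        h (symmDeriv e y (spaceDir i)) (symmDeriv e y (spaceDir j))).mulVec v i := by
    rw [hs, bilin_sum_smul]
    refine Finset.sum_congr rfl fun i _ => ?_
    rw [Matrix.mulVec, dotProduct, Finset.mul_sum]
    exact Finset.sum_congr rfl fun j _ => by rw [Matrix.of_apply]; ring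
  rw [hv0] at h3
  simp at h3
  exact h2.ne' h3

variable {V : Set (M × ℝ)}

theorem isMetricAt_spaceComp (he : e ∈ IsManifold.maximalAtlas (𝓡 n) ω M) (hV : IsOpen V)
    (hg : ∀ p ∈ V, IsInnerForm (g p))
    (ha : ∀ i j, AnalyticAt ℝ (fun z => spaceComp e g z i j) q) (hq : q ∈ chartDomain e V) :
    IsMetricAt (spaceComp e g) q where
  analytic := ha
  symm := by
    filter_upwards [(isOpen_chartDomain e hV).mem_nhds hq] with z hz i j
    exact (hg _ hz.2).1 _ _
  det_ne := det_ne_zero_of_isInnerForm he hq.1 (hg _ hq.2)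

end SliceTensors

/-! ### Independence of the chart. -/

section ChartChange

open Topology Filter

variable {n : ℕ} {M : Type*} [TopologicalSpace M] [ChartedSpace (EuclideanSpace ℝ (Fin n)) M]
  [IsManifold (𝓡 n) ω M]
  {e e' : OpenPartialHomeomorph M (EuclideanSpace ℝ (Fin n))} {y : EuclideanSpace ℝ (Fin n)}
  {q : EuclideanSpace ℝ (Fin n) × ℝ}
  {N : M × ℝ → ℝ} {β : (p : M × ℝ) → TangentSpace (𝓡 n) p.1}
  {g K : (p : M × ℝ) → LinearMap.BilinForm ℝ (TangentSpace (𝓡 n) p.1)}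
  {ρ : (p : M × ℝ) → LinearMap.BilinForm ℝ (TangentSpace (𝓡 n) p.1 × ℝ)}

theorem formMap_congr {ι F : Type*} [Fintype ι] [DecidableEq ι] [NormedAddCommGroup F]
    [NormedSpace ℝ F] [FiniteDimensional ℝ F] {b : Module.Basis ι ℝ F} {G G' : F → Matrix ι ι ℝ}
    {x : F} (h : G x = G' x) : formMap b G x = formMap b G' x := by
  simp only [formMap, h]

theorem isPullback_splitMetric (he : e ∈ IsManifold.maximalAtlas (𝓡 n) ω M)
    (he' : e' ∈ IsManifold.maximalAtlas (𝓡 n) ω M) (hy : q.1 ∈ e'.target)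
    (hy' : e'.symm q.1 ∈ e.source) :
    IsPullback spacetimeBasis spacetimeBasis (spacetimeTransition e e')
      (splitMetric (scalarComp e N) (vecComp e β) (spaceComp e g))
      (splitMetric (scalarComp e' N) (vecComp e' β) (spaceComp e' g)) q := by
  filter_upwards [eventually_overlap hy hy'] with z hz a c
  rw [← spacetimeComp_spacetimeMetric he' hz.1, spacetimeComp_transition he he' hz.1 hz.2,
    formMap_congr (spacetimeComp_spacetimeMetric he (e.map_source hz.2))]

/-- The relation `K_{ij} = -N Γ^t_{ij}` does not depend on the chart. -/
theorem curvature_eq_christoffel_transition (he : e ∈ IsManifold.maximalAtlas (𝓡 n) ω M)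
    (he' : e' ∈ IsManifold.maximalAtlas (𝓡 n) ω M) (hy : q.1 ∈ e'.target)
    (hy' : e'.symm q.1 ∈ e.source)
    (hs : IsSplitAt (scalarComp e N) (vecComp e β) (spaceComp e g) (spacetimeTransition e e' q))
    (hs' : IsSplitAt (scalarComp e' N) (vecComp e' β) (spaceComp e' g) q)
    (h : ∀ i j, spaceComp e K (spacetimeTransition e e' q) i j =
      -scalarComp e N (spacetimeTransition e e' q) * christoffel spacetimeDir
        (splitMetric (scalarComp e N) (vecComp e β) (spaceComp e g)) (Sum.inr ()) (Sum.inl i)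
        (Sum.inl j) (spacetimeTransition e e' q)) (i j : Fin n) :
    spaceComp e' K q i j = -scalarComp e' N q * christoffel spacetimeDir
        (splitMetric (scalarComp e' N) (vecComp e' β) (spaceComp e' g)) (Sum.inr ()) (Sum.inl i)
        (Sum.inl j) q := by
  have hΨ := analyticAt_spacetimeTransition he he' hy hy'
  have h1 := christoffel_pullback (isMetricAt_splitMetric hs) (isMetricAt_splitMetric hs') hΨ
    (isPullback_splitMetric he he' hy hy') (Sum.inl i) (Sum.inl j)
  have h2 := congrArg Prod.snd h1
  have hN : scalarComp e' N q = scalarComp e N (spacetimeTransition e e' q) := by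
    change N (e'.symm q.1, q.2) = N (e.symm (e (e'.symm q.1)), q.2)
    rw [e.left_inv hy']
  -- Coordinate changes act on the space variables alone, so the inhomogeneous term of the
  -- transformation law has no time component, and `Γ^t_{ij}` transforms like a tensor on the
  -- slices.
  have h3 : (fderiv ℝ (fun z => fderiv ℝ (spacetimeTransition e e') z
      (spacetimeBasis (Sum.inl j))) q (spacetimeBasis (Sum.inl i))).2 = 0 := by
    have hd : AnalyticAt ℝ (fun z => fderiv ℝ (spacetimeTransition e e') z
      (spacetimeBasis (Sum.inl j))) q :=
      analyticAt_pushField (e := fun c _ => spacetimeBasis c) hΨ (fun _ => analyticAt_const) _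
    have h4 : HasFDerivAt (fun z => (fderiv ℝ (spacetimeTransition e e') z
      (spacetimeBasis (Sum.inl j))).2) _ q :=
      hasFDerivAt_snd.comp q hd.differentiableAt.hasFDerivAt
    have h5 : (fun z => (fderiv ℝ (spacetimeTransition e e') z
      (spacetimeBasis (Sum.inl j))).2) =ᶠ[𝓝 q] fun _ => 0 := by
      filter_upwards [eventually_overlap hy hy'] with z hz
      exact fderiv_spacetimeTransition_inl he he' hz.1 hz.2 j
    have h6 := h4.unique ((hasFDerivAt_const (0 : ℝ) q).congr_of_eventuallyEq h5)
    exact congrArg (fun A : EuclideanSpace ℝ (Fin n) × ℝ →L[ℝ] ℝ => A (spacetimeBasis (Sum.inl i))) h6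
  have h7 : ∀ a, (fderiv ℝ (spacetimeTransition e e') q (spacetimeBasis a)).2 =
      if a = Sum.inr () then 1 else 0 := by
    intro a
    rw [fderiv_spacetimeTransition he he' hy hy', coe_spacetimeBasis]
    rcases a with k | k
    · simp [spacetimeDir, sliceDir]
    · simp [spacetimeDir]
  rw [Prod.snd_add, h3, zero_add, gammaMap_snd,
    formMap_space (fderiv_spacetimeTransition_inl he he' hy hy' i)
      (fderiv_spacetimeTransition_inl he he' hy hy' j), Prod.snd_sum] at h2
  simp only [Prod.smul_snd, h7, smul_eq_mul, mul_ite, mul_one, mul_zero, Finset.sum_ite_eq',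
    Finset.mem_univ, if_true] at h2
  rw [spaceComp_transition he he' hy hy', hN, ← coe_spacetimeBasis, ← h2, Finset.mul_sum]
  refine Finset.sum_congr rfl fun k _ => ?_
  rw [Finset.mul_sum]
  refine Finset.sum_congr rfl fun l _ => ?_
  rw [h, timeChristoffel]
  ring

theorem isPullback_ricciMatrix {Ψ : EuclideanSpace ℝ (Fin n) × ℝ → EuclideanSpace ℝ (Fin n) × ℝ}
    {G G' : EuclideanSpace ℝ (Fin n) × ℝ → Matrix (Fin n ⊕ Unit) (Fin n ⊕ Unit) ℝ}
    (hG : IsMetricAt G (Ψ q)) (hG' : IsMetricAt G' q)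
    (hΨ : AnalyticAt ℝ Ψ q) (hp : IsPullback spacetimeBasis spacetimeBasis Ψ G G' q) :
    IsPullback spacetimeBasis spacetimeBasis Ψ (ricciMatrix spacetimeDir G)
      (ricciMatrix spacetimeDir G') q := by
  have h1 := isPullback_ricci hG hG' hΨ hp
  simp only [coe_spacetimeBasis] at h1
  exact h1

/-- The space components of the Einstein equations do not depend on the chart. -/
theorem ricci_space_transition (he : e ∈ IsManifold.maximalAtlas (𝓡 n) ω M)
    (he' : e' ∈ IsManifold.maximalAtlas (𝓡 n) ω M) (hy : q.1 ∈ e'.target)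
    (hy' : e'.symm q.1 ∈ e.source)
    (hs : IsSplitAt (scalarComp e N) (vecComp e β) (spaceComp e g) (spacetimeTransition e e' q))
    (hs' : IsSplitAt (scalarComp e' N) (vecComp e' β) (spaceComp e' g) q)
    (h : ∀ i j, ricci spacetimeDir (splitMetric (scalarComp e N) (vecComp e β) (spaceComp e g))
        (Sum.inl i) (Sum.inl j) (spacetimeTransition e e' q) =
      spatialPart e ρ (spacetimeTransition e e' q) i j) (i j : Fin n) :
    ricci spacetimeDir (splitMetric (scalarComp e' N) (vecComp e' β) (spaceComp e' g))
        (Sum.inl i) (Sum.inl j) q = spatialPart e' ρ q i j := by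
  have h1 := (isPullback_ricciMatrix (isMetricAt_splitMetric hs) (isMetricAt_splitMetric hs')
    (analyticAt_spacetimeTransition he he' hy hy')
    (isPullback_splitMetric he he' hy hy')).self_of_nhds (Sum.inl i) (Sum.inl j)
  have h2 := spacetimeComp_transition he he' hy hy' ρ (Sum.inl i) (Sum.inl j)
  rw [formMap_space (fderiv_spacetimeTransition_inl he he' hy hy' i)
      (fderiv_spacetimeTransition_inl he he' hy hy' j)] at h1 h2
  rw [spatialPart, h2]
  refine h1.trans ?_
  refine Finset.sum_congr rfl fun k _ => Finset.sum_congr rfl fun l _ => ?_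
  rw [ricciMatrix, h k l, spatialPart]

theorem ricci_transition (he : e ∈ IsManifold.maximalAtlas (𝓡 n) ω M)
    (he' : e' ∈ IsManifold.maximalAtlas (𝓡 n) ω M) (hy : q.1 ∈ e'.target)
    (hy' : e'.symm q.1 ∈ e.source)
    {G : (p : M × ℝ) → LinearMap.BilinForm ℝ (TangentSpace (𝓡 n) p.1 × ℝ)}
    (hG : IsMetricAt (spacetimeComp e G) (spacetimeTransition e e' q))
    (hG' : IsMetricAt (spacetimeComp e' G) q)
    (h : ∀ a c, ricci spacetimeDir (spacetimeComp e G) a c (spacetimeTransition e e' q) =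
      spacetimeComp e ρ (spacetimeTransition e e' q) a c) (a c : Fin n ⊕ Unit) :
    ricci spacetimeDir (spacetimeComp e' G) a c q = spacetimeComp e' ρ q a c := by
  have h1 := (isPullback_ricciMatrix hG hG' (analyticAt_spacetimeTransition he he' hy hy')
    (isPullback_transition he he' hy hy' G)).self_of_nhds a c
  have h2 := spacetimeComp_transition he he' hy hy' ρ a c
  have h3 : ricciMatrix spacetimeDir (spacetimeComp e G) (spacetimeTransition e e' q) =
      spacetimeComp e ρ (spacetimeTransition e e' q) := by
    funext a c
    exact h a c
  rw [formMap_congr h3] at h1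
  exact h1.trans h2.symm

/-- Both relations in `eventually_evolutionAt_iff` are independent of the chart, so the evolution
equations are, with no need to transform their terms one by one. -/
theorem evolution_transition (he : e ∈ IsManifold.maximalAtlas (𝓡 n) ω M)
    (he' : e' ∈ IsManifold.maximalAtlas (𝓡 n) ω M) (hy : q.1 ∈ e'.target)
    (hy' : e'.symm q.1 ∈ e.source)
    (hs : IsSplitAt (scalarComp e N) (vecComp e β) (spaceComp e g) (spacetimeTransition e e' q))
    (hs' : IsSplitAt (scalarComp e' N) (vecComp e' β) (spaceComp e' g) q)
    (hK : ∀ i j, AnalyticAt ℝ (fun z => spaceComp e K z i j) (spacetimeTransition e e' q))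
    (hKs : ∀ᶠ z in 𝓝 (spacetimeTransition e e' q), ∀ i j, spaceComp e K z i j = spaceComp e K z j i)
    (h : ∀ᶠ z in 𝓝 (spacetimeTransition e e' q), EvolutionAt (scalarComp e N) (vecComp e β)
      (spatialPart e ρ) (spaceComp e g) (spaceComp e K) z) :
    ∀ᶠ z in 𝓝 q, EvolutionAt (scalarComp e' N) (vecComp e' β)
      (spatialPart e' ρ) (spaceComp e' g) (spaceComp e' K) z := by
  have hc := (analyticAt_spacetimeTransition he he' hy hy').continuousAt
  have hK' := analyticAt_spaceComp_transition he he' hy hy' hK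
  have hKs' : ∀ᶠ z in 𝓝 q, ∀ i j, spaceComp e' K z i j = spaceComp e' K z j i := by
    filter_upwards [eventually_overlap hy hy', hc.eventually hKs] with z hz hz' i j
    rw [spaceComp_transition he he' hz.1 hz.2, spaceComp_transition he he' hz.1 hz.2,
      Finset.sum_comm]
    refine Finset.sum_congr rfl fun k _ => Finset.sum_congr rfl fun l _ => ?_
    rw [hz' l k]; ring
  rw [eventually_evolutionAt_iff hs hK hKs] at h
  rw [eventually_evolutionAt_iff hs' hK' hKs']
  filter_upwards [eventually_overlap hy hy', hc.eventually h, hc.eventually hs.eventually,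
    hs'.eventually] with z h1 h2 h3 h4 i j
  exact ⟨curvature_eq_christoffel_transition he he' h1.1 h1.2 h3 h4 (fun i j => (h2 i j).1) i j,
    ricci_space_transition he he' h1.1 h1.2 h3 h4 (fun i j => (h2 i j).2) i j⟩

end ChartChange

/-! ### Dependence on germs only. -/

section Locality

open Topology Filter

variable {ι F : Type*} [Fintype ι] [DecidableEq ι] [NormedAddCommGroup F] [NormedSpace ℝ F]
  {b : ι → F} {g g' h h' : F → Matrix ι ι ℝ} {x : F}

theorem christoffel_congr (hg : g =ᶠ[𝓝 x] g') (l i j : ι) :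
    christoffel b g l i j x = christoffel b g' l i j x := by
  have h1 : ∀ k i j, pd b k (fun z => g z i j) x = pd b k (fun z => g' z i j) x := fun k i j =>
    pd_congr (hg.mono fun z hz => by simp only [hz])
  simp only [christoffel, h1, hg.self_of_nhds]

theorem eventuallyEq_christoffel (hg : g =ᶠ[𝓝 x] g') (l i j : ι) :
    christoffel b g l i j =ᶠ[𝓝 x] christoffel b g' l i j := by
  filter_upwards [hg.eventuallyEq_nhds] with z hz using christoffel_congr hz l i j

theorem ricci_congr (hg : g =ᶠ[𝓝 x] g') (i j : ι) : ricci b g i j x = ricci b g' i j x := by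
  have h1 : ∀ k l i j, pd b k (christoffel b g l i j) x = pd b k (christoffel b g' l i j) x :=
    fun k l i j => pd_congr (eventuallyEq_christoffel hg l i j)
  simp only [ricci, h1, christoffel_congr hg]

theorem covDerivTensor_congr (hg : g =ᶠ[𝓝 x] g') (hh : h =ᶠ[𝓝 x] h') (l i j : ι) :
    covDerivTensor b g h l i j x = covDerivTensor b g' h' l i j x := by
  have h1 : ∀ k i j, pd b k (fun z => h z i j) x = pd b k (fun z => h' z i j) x := fun k i j =>
    pd_congr (hh.mono fun z hz => by simp only [hz])
  simp only [covDerivTensor, h1, christoffel_congr hg, hh.self_of_nhds]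

theorem divergence_congr (hg : g =ᶠ[𝓝 x] g') (hh : h =ᶠ[𝓝 x] h') (j : ι) :
    divergence b g h j x = divergence b g' h' j x := by
  simp only [divergence, covDerivTensor_congr hg hh, hg.self_of_nhds]

theorem covDerivCovector_congr {w w' : F → ι → ℝ} (hg : g =ᶠ[𝓝 x] g') (hw : w =ᶠ[𝓝 x] w')
    (i j : ι) : covDerivCovector b g w i j x = covDerivCovector b g' w' i j x := by
  have h1 : pd b i (fun z => w z j) x = pd b i (fun z => w' z j) x :=
    pd_congr (hw.mono fun z hz => by simp only [hz])
  simp only [covDerivCovector, h1, christoffel_congr hg, hw.self_of_nhds]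

end Locality

/-! ### Space derivatives on `M × ℝ` and derivatives on a slice. -/

section SliceRestriction

open Topology Filter

variable {n : ℕ} {g h : EuclideanSpace ℝ (Fin n) × ℝ → Matrix (Fin n) (Fin n) ℝ}
  {f : EuclideanSpace ℝ (Fin n) × ℝ → ℝ} {y : EuclideanSpace ℝ (Fin n)} {t : ℝ}

/-- The restriction to the slice at time `t`. -/
def atTime {X : Type*} (t : ℝ) (f : EuclideanSpace ℝ (Fin n) × ℝ → X)
    (y : EuclideanSpace ℝ (Fin n)) : X := f (y, t)

theorem pd_atTime (hf : AnalyticAt ℝ f (y, t)) (i : Fin n) :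
    pd spaceDir i (atTime t f) y = pd sliceDir i f (y, t) := by
  have h1 : HasFDerivAt (atTime t f)
      ((fderiv ℝ f (y, t)).comp ((ContinuousLinearMap.id ℝ _).prod 0)) y :=
    hf.differentiableAt.hasFDerivAt.comp y ((hasFDerivAt_id y).prodMk (hasFDerivAt_const t y))
  unfold pd
  rw [h1.fderiv]
  rfl

theorem eventually_atTime {p : EuclideanSpace ℝ (Fin n) × ℝ → Prop} (hp : ∀ᶠ z in 𝓝 (y, t), p z) :
    ∀ᶠ x in 𝓝 y, p (x, t) := (Continuous.prodMk_left t).tendsto y |>.eventually hp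

theorem christoffel_atTime (hg : IsMetricAt g (y, t)) (l i j : Fin n) :
    christoffel spaceDir (atTime t g) l i j y = christoffel sliceDir g l i j (y, t) := by
  have h1 : ∀ k i j, pd spaceDir k (fun z => atTime t g z i j) y =
      pd sliceDir k (fun z => g z i j) (y, t) := fun k i j => pd_atTime (hg.analytic i j) k
  simp only [christoffel, h1]
  rfl

theorem ricci_atTime (hg : IsMetricAt g (y, t)) (i j : Fin n) :
    ricci spaceDir (atTime t g) i j y = ricci sliceDir g i j (y, t) := by
  have h1 : ∀ k l i j, pd spaceDir k (christoffel spaceDir (atTime t g) l i j) y =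
      pd sliceDir k (christoffel sliceDir g l i j) (y, t) := by
    intro k l i j
    rw [← pd_atTime (hg.christoffel_analytic l i j)]
    exact pd_congr ((eventually_atTime hg.eventually).mono fun x hx => christoffel_atTime hx l i j)
  simp only [ricci, h1, christoffel_atTime hg]

theorem divergence_atTime (hg : IsMetricAt g (y, t))
    (hh : ∀ i j, AnalyticAt ℝ (fun z => h z i j) (y, t)) (j : Fin n) :
    divergence spaceDir (atTime t g) (atTime t h) j y = divergence sliceDir g h j (y, t) := by
  have h1 : ∀ k i j, pd spaceDir k (fun z => atTime t h z i j) y =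
      pd sliceDir k (fun z => h z i j) (y, t) := fun k i j => pd_atTime (hh i j) k
  simp only [divergence, covDerivTensor, h1, christoffel_atTime hg]
  rfl

theorem momentumDensity_eq (hg : IsMetricAt g (y, t))
    (hh : ∀ i j, AnalyticAt ℝ (fun z => h z i j) (y, t)) (i : Fin n) :
    momentumDensity g h i (y, t) = -divergence spaceDir (atTime t g) (atTime t h) i y
      + pd spaceDir i (tr (atTime t g) (atTime t h)) y := by
  rw [divergence_atTime hg hh, momentumDensity, ← pd_atTime (analyticAt_tr hg hh)]
  rfl

theorem hamiltonianDensity_eq (hg : IsMetricAt g (y, t)) (hs : ∀ i j, h (y, t) i j = h (y, t) j i) :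
    hamiltonianDensity g h (y, t) = scalarCurvature spaceDir (atTime t g) y
      - ((atTime t g y)⁻¹ * atTime t h y * ((atTime t g y)⁻¹ * atTime t h y)).trace
      + tr (atTime t g) (atTime t h) y ^ 2 := by
  have h1 : ∀ l i, mixedComp g h l i (y, t) = ((atTime t g y)⁻¹ * atTime t h y) l i := by
    intro l i
    rw [mixedComp, Matrix.mul_apply]
    exact Finset.sum_congr rfl fun m _ => by rw [hs i m]; rfl
  have h2 : ∑ l, mixedComp g h l l (y, t) = tr (atTime t g) (atTime t h) y := rfl
  have h3 : scalarCurvature spaceDir (atTime t g) y = scalarCurvature sliceDir g (y, t) := by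
    simp only [scalarCurvature, tr, ricci_atTime hg]
    rfl
  rw [hamiltonianDensity, h2, h3, Matrix.trace]
  simp only [h1]
  rfl

end SliceRestriction

/-! ### From the constraints to the Einstein equations near `M₀`. -/

section Constraints

open Topology Filter

variable {n : ℕ} {M : Type*} [TopologicalSpace M] [ChartedSpace (EuclideanSpace ℝ (Fin n)) M]
  [IsManifold (𝓡 n) ω M]
  {e e' : OpenPartialHomeomorph M (EuclideanSpace ℝ (Fin n))} {y : EuclideanSpace ℝ (Fin n)}
  {q : EuclideanSpace ℝ (Fin n) × ℝ} {U V : Set (M × ℝ)}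
  {N : M × ℝ → ℝ} {β : (p : M × ℝ) → TangentSpace (𝓡 n) p.1}
  {g K : (p : M × ℝ) → LinearMap.BilinForm ℝ (TangentSpace (𝓡 n) p.1)}
  {ρ : (p : M × ℝ) → LinearMap.BilinForm ℝ (TangentSpace (𝓡 n) p.1 × ℝ)}
  {g₀ K₀ : (x : M) → LinearMap.BilinForm ℝ (TangentSpace (𝓡 n) x)}

theorem eventually_chartDomain (hV : IsOpen V) (hq : q ∈ chartDomain e V) :
    ∀ᶠ z in 𝓝 q, z ∈ chartDomain e V := (isOpen_chartDomain e hV).mem_nhds hq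

theorem IsAnalyticGauge.isSplitAt (hG : IsAnalyticGauge U N β) (hVU : V ⊆ U) (hV : IsOpen V)
    (he : e ∈ IsManifold.maximalAtlas (𝓡 n) ω M) (hg : ∀ p ∈ V, IsInnerForm (g p))
    (ha : ∀ i j, AnalyticAt ℝ (fun z => spaceComp e g z i j) q) (hq : q ∈ chartDomain e V) :
    IsSplitAt (scalarComp e N) (vecComp e β) (spaceComp e g) q where
  lapse := hG.analytic_lapse e he q ⟨hq.1, hVU hq.2⟩
  lapse_ne := (hG.lapse_pos _ (hVU hq.2)).ne'
  shift := fun i => hG.analytic_shift e he i q ⟨hq.1, hVU hq.2⟩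
  metric := isMetricAt_spaceComp he hV hg ha hq

theorem IsAnalyticEvolution.isSplitAt (hs : IsAnalyticEvolution V N β ρ g₀ K₀ g K)
    (hG : IsAnalyticGauge U N β) (hVU : V ⊆ U) (hV : IsOpen V)
    (he : e ∈ IsManifold.maximalAtlas (𝓡 n) ω M) (hq : q ∈ chartDomain e V) :
    IsSplitAt (scalarComp e N) (vecComp e β) (spaceComp e g) q :=
  hG.isSplitAt hVU hV he hs.metric (fun i j => hs.analytic_metric e he i j q hq) hq

theorem IsAnalyticEvolution.eventually_evolutionAt (hs : IsAnalyticEvolution V N β ρ g₀ K₀ g K)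
    (hV : IsOpen V) (he : e ∈ IsManifold.maximalAtlas (𝓡 n) ω M) (hq : q ∈ chartDomain e V) :
    ∀ᶠ z in 𝓝 q, EvolutionAt (scalarComp e N) (vecComp e β) (spatialPart e ρ) (spaceComp e g)
      (spaceComp e K) z :=
  (eventually_chartDomain hV hq).mono fun _ hz => hs.evolution e he _ hz

theorem IsAnalyticEvolution.isKinematicAt (hs : IsAnalyticEvolution V N β ρ g₀ K₀ g K)
    (hG : IsAnalyticGauge U N β) (hVU : V ⊆ U) (hV : IsOpen V)
    (he : e ∈ IsManifold.maximalAtlas (𝓡 n) ω M) (hq : q ∈ chartDomain e V) :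
    IsKinematicAt (scalarComp e N) (vecComp e β) (spaceComp e g) (spaceComp e K) q :=
  (hs.isSplitAt hG hVU hV he hq).isKinematicAt_of_evolution
    (fun i j => hs.analytic_curvature e he i j q hq)
    ((eventually_chartDomain hV hq).mono fun _ hz _ _ => hs.symm _ hz.2 _ _)
    (hs.eventually_evolutionAt hV he hq)

theorem chartPush_splitFrame_time (he : e ∈ IsManifold.maximalAtlas (𝓡 n) ω M)
    (hy : q.1 ∈ e.target) : chartPush e q.1 (splitFrame (vecComp e β) (Sum.inr ()) q) =
      (-β (e.symm q.1, q.2), 1) := by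
  let w : EuclideanSpace ℝ (Fin n) := chartDeriv e q.1 (β (e.symm q.1, q.2))
  have h1 : splitFrame (vecComp e β) (Sum.inr ()) q = (-w, 1) := by
    change spacetimeDir (Sum.inr ()) - ∑ k, w k • spacetimeDir (Sum.inl k) = _
    refine Prod.ext ?_ ?_
    · rw [Prod.fst_sub, Prod.fst_sum]
      refine (zero_sub _).trans (congrArg Neg.neg ?_)
      exact spaceDir_sum w
    · rw [Prod.snd_sub, Prod.snd_sum]
      simp [spacetimeDir, sliceDir]
  rw [h1]
  refine Prod.ext ?_ rfl
  change symmDeriv e q.1 (-w) = _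
  rw [map_neg]
  exact congrArg Neg.neg (symmDeriv_chartDeriv he hy _)

theorem frameComp_spacetimeComp_mixed (he : e ∈ IsManifold.maximalAtlas (𝓡 n) ω M)
    (hy : q.1 ∈ e.target) (i : Fin n) :
    frameComp (vecComp e β) (spacetimeComp e ρ) q (Sum.inl i) (Sum.inr ()) =
      ρ (e.symm q.1, q.2) (coordVec e q.1 i, 0) (-β (e.symm q.1, q.2), 1) := by
  rw [frameComp, ← form_chartPush, chartPush_splitFrame_time he hy, splitFrame,
    chartPush_spacetimeDir]
  rfl

theorem frameComp_spacetimeComp_time (he : e ∈ IsManifold.maximalAtlas (𝓡 n) ω M)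
    (hy : q.1 ∈ e.target) :
    frameComp (vecComp e β) (spacetimeComp e ρ) q (Sum.inr ()) (Sum.inr ()) =
      ρ (e.symm q.1, q.2) (-β (e.symm q.1, q.2), 1) (-β (e.symm q.1, q.2), 1) := by
  rw [frameComp, ← form_chartPush, chartPush_splitFrame_time he hy]

/-- A solution of the evolution equations with conserved sources whose initial data satisfy the
constraints solves the Einstein equations near the initial slice. -/
theorem IsAnalyticEvolution.einstein_near_slice (hs : IsAnalyticEvolution V N β ρ g₀ K₀ g K)
    (hG : IsAnalyticGauge U N β) (hρ : IsAnalyticSymmetric U ρ) (hVU : V ⊆ U)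
    (hV : IsSliceNeighborhood V) (hcons : ConservationLaws V (spacetimeMetric N β g) ρ)
    (hc : Constraints N β ρ g₀ K₀) (he : e ∈ IsManifold.maximalAtlas (𝓡 n) ω M)
    (hy : y ∈ e.target) : ∀ᶠ z in 𝓝 (y, (0 : ℝ)), ∀ a c,
      ricci spacetimeDir (spacetimeComp e (spacetimeMetric N β g)) a c z =
        spacetimeComp e ρ z a c := by
  have hmem : ∀ {x}, x ∈ e.target → (x, (0 : ℝ)) ∈ chartDomain e V :=
    fun hx => ⟨hx, hV.slice_mem _⟩
  have hmet : ∀ z ∈ chartDomain e V, spacetimeComp e (spacetimeMetric N β g) =ᶠ[𝓝 z]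
      splitMetric (scalarComp e N) (vecComp e β) (spaceComp e g) := fun z hz => by
    filter_upwards [eventually_chartDomain hV.isOpen hz] with w hw
    exact spacetimeComp_spacetimeMetric he hw.1
  have hq := hmem hy
  have hdom := eventually_chartDomain hV.isOpen hq
  have hg0 : atTime 0 (spaceComp e g) = dataComp e g₀ := by
    funext x i j
    exact congrArg (fun h : LinearMap.BilinForm ℝ (TangentSpace (𝓡 n) (e.symm x)) =>
      h (coordVec e x i) (coordVec e x j)) (hs.initial_metric (e.symm x))
  have hK0 : atTime 0 (spaceComp e K) = dataComp e K₀ := by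
    funext x i j
    exact congrArg (fun h : LinearMap.BilinForm ℝ (TangentSpace (𝓡 n) (e.symm x)) =>
      h (coordVec e x i) (coordVec e x j)) (hs.initial_curvature (e.symm x))
  have key := EinsteinCauchy.einstein_near_slice (ρ := spacetimeComp e ρ)
    (hs.isKinematicAt hG hVU hV.isOpen he hq)
    (fun a c => hρ.analytic e he a c _ ⟨hq.1, hVU hq.2⟩)
    (hdom.mono fun z hz a c => hρ.symm _ (hVU hz.2) _ _) ?_ ?_ ?_ ?_
  · filter_upwards [key, hdom] with z h1 h2 a c
    rw [ricci_congr (hmet z h2), h1]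
  · filter_upwards [(hs.isKinematicAt hG hVU hV.isOpen he hq).eventually,
      hs.eventually_evolutionAt hV.isOpen he hq] with z h1 h2 i j
    exact (curvatureRate_iff h1 (spatialPart e ρ) i j).1
      ((evolutionAt_iff h1.metric h1.shift).1 h2 i j).2
  · filter_upwards [hdom] with z hz j
    have h1 := hcons e he z hz j
    have h2 : (fun z => spacetimeComp e ρ z - (1 / 2 * tr (spacetimeComp e (spacetimeMetric N β g))
        (spacetimeComp e ρ) z) • spacetimeComp e (spacetimeMetric N β g) z) =ᶠ[𝓝 z]
        fun z => spacetimeComp e ρ z - (1 / 2 * tr (splitMetric (scalarComp e N) (vecComp e β)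
          (spaceComp e g)) (spacetimeComp e ρ) z) •
            splitMetric (scalarComp e N) (vecComp e β) (spaceComp e g) z := by
      filter_upwards [hmet z hz] with w hw
      simp only [tr, hw]
    rw [← divergence_congr (hmet z hz) h2]
    exact h1
  · filter_upwards [e.open_target.mem_nhds hy] with x hx i
    have h1 := (hc e he x hx).1 i
    have hk := hs.isKinematicAt hG hVU hV.isOpen he (hmem hx)
    have hN : N (e.symm x, 0) ≠ 0 := (hG.lapse_pos _ (hVU (hmem hx).2)).ne'
    rw [momentumDensity_eq hk.metric hk.curvature, hg0, hK0,
      frameComp_spacetimeComp_mixed he (q := (x, 0)) hx,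
      hρ.symm _ (hVU (hmem hx).2)]
    have h3 := sub_eq_zero.1 h1
    change _ = N (e.symm x, 0) * momentum e g₀ K₀ i x
    rw [h3, mul_inv_cancel_left₀ hN]
  · filter_upwards [e.open_target.mem_nhds hy] with x hx
    have h1 := (hc e he x hx).2
    have hk := hs.isKinematicAt hG hVU hV.isOpen he (hmem hx)
    have hN : N (e.symm x, 0) ≠ 0 := (hG.lapse_pos _ (hVU (hmem hx).2)).ne'
    rw [hamiltonianDensity_eq hk.metric hk.curvature_symm.self_of_nhds, hg0, hK0,
      frameComp_spacetimeComp_time he (q := (x, 0)) hx]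
    have h4 : ∀ i j, (spaceComp e g (x, 0))⁻¹ i j = (dataComp e g₀ x)⁻¹ i j := by
      intro i j
      rw [← hg0]; rfl
    simp only [h4]
    change _ = N (e.symm x, 0) ^ 2 * hamiltonian e g₀ K₀ x
    -- With `r = ρ_00` and `S` the trace of the space part of `ρ`, the definition of `T` gives `2
    -- T_00 = r + N² S`.
    have h5 : ∀ r S H : ℝ, H + 2 * (-(N (e.symm x, 0) ^ 2)⁻¹ *
        (r - 1 / 2 * (-(N (e.symm x, 0) ^ 2)) * (-(N (e.symm x, 0) ^ 2)⁻¹ * r + S))) = 0 →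
        r + N (e.symm x, 0) ^ 2 * S = N (e.symm x, 0) ^ 2 * H := by
      intro r S H h
      field_simp at h
      linarith
    exact h5 _ _ _ h1

end Constraints

/-! ### Analytic continuation of the Einstein equations over `V`. -/

section Continuation

open Topology Filter

variable {n : ℕ} {M : Type*} [TopologicalSpace M] [ChartedSpace (EuclideanSpace ℝ (Fin n)) M]
  [IsManifold (𝓡 n) ω M]
  {e e' : OpenPartialHomeomorph M (EuclideanSpace ℝ (Fin n))} {p : M × ℝ}
  {q : EuclideanSpace ℝ (Fin n) × ℝ} {U V : Set (M × ℝ)}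
  {N : M × ℝ → ℝ} {β : (p : M × ℝ) → TangentSpace (𝓡 n) p.1}
  {g K : (p : M × ℝ) → LinearMap.BilinForm ℝ (TangentSpace (𝓡 n) p.1)}
  {G ρ : (p : M × ℝ) → LinearMap.BilinForm ℝ (TangentSpace (𝓡 n) p.1 × ℝ)}
  {g₀ K₀ : (x : M) → LinearMap.BilinForm ℝ (TangentSpace (𝓡 n) x)}

/-- The coordinates of a point of `M × ℝ`. -/
def spacetimeCoord (e : OpenPartialHomeomorph M (EuclideanSpace ℝ (Fin n))) (p : M × ℝ) :
    EuclideanSpace ℝ (Fin n) × ℝ := (e p.1, p.2)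

theorem continuousAt_spacetimeCoord (hp : p.1 ∈ e.source) : ContinuousAt (spacetimeCoord e) p :=
  (ContinuousAt.comp (g := e) (f := Prod.fst) (e.continuousAt hp) continuousAt_fst).prodMk
    continuousAt_snd

theorem tendsto_spacetimeCoord_symm (hp : p.1 ∈ e.source) :
    Tendsto (fun q : EuclideanSpace ℝ (Fin n) × ℝ => (e.symm q.1, q.2)) (𝓝 (spacetimeCoord e p))
      (𝓝 p) := by
  have h1 : ContinuousAt (fun q : EuclideanSpace ℝ (Fin n) × ℝ => (e.symm q.1, q.2))
      (spacetimeCoord e p) :=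
    (ContinuousAt.comp (g := e.symm) (f := Prod.fst) (e.continuousAt_symm (e.map_source hp))
      continuousAt_fst).prodMk continuousAt_snd
  have h2 : (e.symm (spacetimeCoord e p).1, (spacetimeCoord e p).2) = p :=
    Prod.ext (e.left_inv hp) rfl
  have h3 := h1.tendsto
  rwa [h2] at h3

theorem eventually_mem_source (hp : p.1 ∈ e.source) : ∀ᶠ p' in 𝓝 p, p'.1 ∈ e.source :=
  (continuous_fst.tendsto p).eventually (e.open_source.mem_nhds hp)

/-- The Einstein equations at a point, in all charts. -/
def EinsteinAt (G ρ : (p : M × ℝ) → LinearMap.BilinForm ℝ (TangentSpace (𝓡 n) p.1 × ℝ))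
    (p : M × ℝ) : Prop :=
  ∀ e ∈ IsManifold.maximalAtlas (𝓡 n) ω M, p.1 ∈ e.source → ∀ a c,
    ricci spacetimeDir (spacetimeComp e G) a c (spacetimeCoord e p) =
      spacetimeComp e ρ (spacetimeCoord e p) a c

/-- The components of `G` are a metric in all charts. -/
def IsMetricOn (V : Set (M × ℝ))
    (G : (p : M × ℝ) → LinearMap.BilinForm ℝ (TangentSpace (𝓡 n) p.1 × ℝ)) : Prop :=
  ∀ e ∈ IsManifold.maximalAtlas (𝓡 n) ω M, ∀ q ∈ chartDomain e V, IsMetricAt (spacetimeComp e G) q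

theorem spacetimeTransition_coord (hp : p.1 ∈ e'.source) :
    spacetimeTransition e e' (spacetimeCoord e' p) = spacetimeCoord e p := by
  change (e (e'.symm (e' p.1)), p.2) = _
  rw [e'.left_inv hp]
  rfl

theorem einsteinAt_of_chart (hG : IsMetricOn V G) (hp : p ∈ V)
    (he : e ∈ IsManifold.maximalAtlas (𝓡 n) ω M) (hpe : p.1 ∈ e.source)
    (h : ∀ a c, ricci spacetimeDir (spacetimeComp e G) a c (spacetimeCoord e p) =
      spacetimeComp e ρ (spacetimeCoord e p) a c) : EinsteinAt G ρ p := by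
  intro e' he' hpe' a c
  have ht := spacetimeTransition_coord (e := e) hpe'
  have hs : e'.symm (spacetimeCoord e' p).1 ∈ e.source := by
    change e'.symm (e' p.1) ∈ _
    rwa [e'.left_inv hpe']
  refine ricci_transition he he' (e'.map_source hpe') hs ?_ (hG e' he' _ (mem_chartDomain hp hpe'))
    ?_ a c
  · rw [ht]; exact hG e he _ (mem_chartDomain hp hpe)
  · rw [ht]; exact h

theorem eventually_einsteinAt_of_chart (hV : IsOpen V) (hG : IsMetricOn V G) (hp : p ∈ V)
    (he : e ∈ IsManifold.maximalAtlas (𝓡 n) ω M) (hpe : p.1 ∈ e.source)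
    (h : ∀ᶠ z in 𝓝 (spacetimeCoord e p), ∀ a c, ricci spacetimeDir (spacetimeComp e G) a c z =
      spacetimeComp e ρ z a c) : ∀ᶠ p' in 𝓝 p, EinsteinAt G ρ p' := by
  filter_upwards [(continuousAt_spacetimeCoord hpe).eventually h, eventually_mem_source hpe,
    hV.mem_nhds hp] with p' h1 h2 h3
  exact einsteinAt_of_chart hG h3 he h2 h1

/-- The Einstein equations for analytic fields continue analytically. -/
theorem eventually_einsteinAt_of_mem_closure (hV : IsOpen V) (hG : IsMetricOn V G)
    (hρ : ∀ e ∈ IsManifold.maximalAtlas (𝓡 n) ω M, ∀ a c,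
      AnalyticOnNhd ℝ (fun q => spacetimeComp e ρ q a c) (chartDomain e V)) (hp : p ∈ V)
    (hcl : p ∈ closure {p | ∀ᶠ p' in 𝓝 p, EinsteinAt G ρ p'}) :
    ∀ᶠ p' in 𝓝 p, EinsteinAt G ρ p' := by
  let e := chartAt (EuclideanSpace ℝ (Fin n)) p.1
  have he : e ∈ IsManifold.maximalAtlas (𝓡 n) ω M := IsManifold.chart_mem_maximalAtlas p.1
  have hpe : p.1 ∈ e.source := mem_chart_source _ p.1
  obtain ⟨r, hr, hball⟩ := Metric.isOpen_iff.1 (isOpen_chartDomain e hV) _ (mem_chartDomain hp hpe)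
  have hB : ∀ᶠ p' in 𝓝 p, spacetimeCoord e p' ∈ Metric.ball (spacetimeCoord e p) r :=
    (continuousAt_spacetimeCoord hpe).eventually (Metric.ball_mem_nhds _ hr)
  -- A point of the set approximating `p` is found inside a coordinate ball around `p`. The ball is
  -- convex, so the identity theorem carries the equations from that point to the whole ball.
  obtain ⟨p', hp', h1, h2⟩ :=
    ((mem_closure_iff_frequently.1 hcl).and_eventually (hB.and (eventually_mem_source hpe))).exists
  have hloc : ∀ᶠ z in 𝓝 (spacetimeCoord e p'), ∀ a c,
      ricci spacetimeDir (spacetimeComp e G) a c z = spacetimeComp e ρ z a c := by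
    filter_upwards [(tendsto_spacetimeCoord_symm h2).eventually hp', Metric.isOpen_ball.mem_nhds h1]
      with z hz hzb
    have h3 := hz e he (e.map_target (hball hzb).1)
    have h4 : spacetimeCoord e (e.symm z.1, z.2) = z := Prod.ext (e.right_inv (hball hzb).1) rfl
    rwa [h4] at h3
  refine eventually_einsteinAt_of_chart hV hG hp he hpe ?_
  filter_upwards [Metric.ball_mem_nhds (spacetimeCoord e p) hr] with z hz a c
  have ha : AnalyticOnNhd ℝ (ricci spacetimeDir (spacetimeComp e G) a c)
      (Metric.ball (spacetimeCoord e p) r) :=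
    fun w hw => (hG e he w (hball hw)).ricci_analytic a c
  exact ha.eqOn_of_preconnected_of_eventuallyEq ((hρ e he a c).mono hball)
    (convex_ball _ _).isPreconnected h1 (hloc.mono fun w hw => hw a c) hz

/-- The set of points near which the equations hold is open, and closed relative to `V`. It contains
`M₀`, and every component of `V` meets `M₀`; this is the use of that condition on `V`. -/
theorem einsteinEquations_of_near_slice (hV : IsSliceNeighborhood V) (hG : IsMetricOn V G)
    (hρ : ∀ e ∈ IsManifold.maximalAtlas (𝓡 n) ω M, ∀ a c,
      AnalyticOnNhd ℝ (fun q => spacetimeComp e ρ q a c) (chartDomain e V))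
    (h : ∀ x : M, ∀ᶠ p' in 𝓝 (x, (0 : ℝ)), EinsteinAt G ρ p') : EinsteinEquations V G ρ := by
  have hall : ∀ p ∈ V, EinsteinAt G ρ p := by
    intro p hp
    obtain ⟨x, hx⟩ := hV.component p hp
    have h1 : connectedComponentIn V p ⊆ {p | ∀ᶠ p' in 𝓝 p, EinsteinAt G ρ p'} := by
      refine isPreconnected_connectedComponentIn.subset_of_closure_inter_subset ?_
        ⟨(x, 0), hx, h x⟩ ?_
      · exact isOpen_iff_mem_nhds.2 fun p hp => eventually_eventually_nhds.2 hp
      · rintro p' ⟨h2, h3⟩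
        exact eventually_einsteinAt_of_mem_closure hV.isOpen hG hρ
          (connectedComponentIn_subset V p h3) h2
    exact (h1 (mem_connectedComponentIn hp)).self_of_nhds
  intro e he q hq i j
  have h1 := hall _ hq.2 e he (e.map_target hq.1) i j
  have h4 : spacetimeCoord e (e.symm q.1, q.2) = q := Prod.ext (e.right_inv hq.1) rfl
  rwa [h4] at h1

theorem IsAnalyticEvolution.isMetricOn (hs : IsAnalyticEvolution V N β ρ g₀ K₀ g K)
    (hG : IsAnalyticGauge U N β) (hVU : V ⊆ U) (hV : IsOpen V) :
    IsMetricOn V (spacetimeMetric N β g) := by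
  intro e he q hq
  refine (isMetricAt_splitMetric (hs.isSplitAt hG hVU hV he hq)).congr ?_
  filter_upwards [eventually_chartDomain hV hq] with w hw
  exact (spacetimeComp_spacetimeMetric he hw.1).symm

theorem IsAnalyticEvolution.einsteinEquations (hs : IsAnalyticEvolution V N β ρ g₀ K₀ g K)
    (hG : IsAnalyticGauge U N β) (hρ : IsAnalyticSymmetric U ρ) (hVU : V ⊆ U)
    (hV : IsSliceNeighborhood V) (hcons : ConservationLaws V (spacetimeMetric N β g) ρ)
    (hc : Constraints N β ρ g₀ K₀) : EinsteinEquations V (spacetimeMetric N β g) ρ := by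
  refine einsteinEquations_of_near_slice hV (hs.isMetricOn hG hVU hV.isOpen)
    (fun e he a c q hq => hρ.analytic e he a c q ⟨hq.1, hVU hq.2⟩) fun x => ?_
  exact eventually_einsteinAt_of_chart hV.isOpen (hs.isMetricOn hG hVU hV.isOpen) (hV.slice_mem x)
    (IsManifold.chart_mem_maximalAtlas x) (mem_chart_source _ x)
    (hs.einstein_near_slice hG hρ hVU hV hcons hc (IsManifold.chart_mem_maximalAtlas x)
      (mem_chart_target _ x))

end Continuation

/-! ### Tensor fields defined by their components in one chart. -/

section LocalForms

open Topology Filter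

variable {n : ℕ}

theorem covDerivVector_congr {ι F : Type*} [Fintype ι] [DecidableEq ι] [NormedAddCommGroup F]
    [NormedSpace ℝ F] {b : ι → F} {g g' : F → Matrix ι ι ℝ} {x : F} (v : F → ι → ℝ)
    (hg : g =ᶠ[𝓝 x] g') (i j : ι) : covDerivVector b g v i j x = covDerivVector b g' v i j x := by
  simp only [covDerivVector, christoffel_congr hg]

theorem evolutionAt_congr {N : EuclideanSpace ℝ (Fin n) × ℝ → ℝ}
    {β : EuclideanSpace ℝ (Fin n) × ℝ → Fin n → ℝ}
    {r g K g' K' : EuclideanSpace ℝ (Fin n) × ℝ → Matrix (Fin n) (Fin n) ℝ}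
    {q : EuclideanSpace ℝ (Fin n) × ℝ} (hg : g =ᶠ[𝓝 q] g') (hK : K =ᶠ[𝓝 q] K')
    (h : EvolutionAt N β r g K q) : EvolutionAt N β r g' K' q := by
  have h1 : ∀ {h h' : EuclideanSpace ℝ (Fin n) × ℝ → Matrix (Fin n) (Fin n) ℝ}, h =ᶠ[𝓝 q] h' →
      ∀ i j, pd spacetimeDir (Sum.inr ()) (fun z => h z i j) q =
        pd spacetimeDir (Sum.inr ()) (fun z => h' z i j) q := fun hh i j =>
    pd_congr (hh.mono fun z hz => by simp only [hz])
  have h2 : ∀ i j, covDerivCovector sliceDir g (fun z => (g z).mulVec (β z)) i j q =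
      covDerivCovector sliceDir g' (fun z => (g' z).mulVec (β z)) i j q := fun i j =>
    covDerivCovector_congr hg (hg.mono fun z hz => by simp only [hz]) i j
  intro i j
  have h3 := h i j
  simp only [h1 hg, h1 hK, h2, ricci_congr hg, covDerivTensor_congr hg hK,
    covDerivVector_congr β hg, tr, hg.self_of_nhds, hK.self_of_nhds,
    covDerivCovector_congr hg (EventuallyEq.refl _ fun z k => pd sliceDir k N z)] at h3
  exact h3

/-- Positive definiteness is an open condition. -/
theorem eventually_posDef {g : EuclideanSpace ℝ (Fin n) × ℝ → Matrix (Fin n) (Fin n) ℝ}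
    {q : EuclideanSpace ℝ (Fin n) × ℝ} (hg : ∀ i j, ContinuousAt (fun z => g z i j) q)
    (h : ∀ v : EuclideanSpace ℝ (Fin n), v ≠ 0 → 0 < ∑ i, ∑ j, g q i j * (v i * v j)) :
    ∀ᶠ z in 𝓝 q, ∀ v : EuclideanSpace ℝ (Fin n), v ≠ 0 →
      0 < ∑ i, ∑ j, g z i j * (v i * v j) := by
  -- Compactness of the unit sphere gives one neighbourhood for all unit vectors; the others follow
  -- by scaling.
  have h1 : ∀ᶠ z in 𝓝 q, ∀ v ∈ Metric.sphere (0 : EuclideanSpace ℝ (Fin n)) 1,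
      0 < ∑ i, ∑ j, g z i j * (v i * v j) := by
    refine (isCompact_sphere _ _).eventually_forall_of_forall_eventually fun v hv => ?_
    have hc : ContinuousAt (fun p : (EuclideanSpace ℝ (Fin n) × ℝ) × EuclideanSpace ℝ (Fin n) =>
        ∑ i, ∑ j, g p.1 i j * (p.2 i * p.2 j)) (q, v) := by
      refine tendsto_finsetSum _ fun i _ => tendsto_finsetSum _ fun j _ => ?_
      have h2 : ContinuousAt (fun p : (EuclideanSpace ℝ (Fin n) × ℝ) × EuclideanSpace ℝ (Fin n) =>
        g p.1 i j) (q, v) := ContinuousAt.comp (g := fun z => g z i j) (f := Prod.fst) (hg i j)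
          continuousAt_fst
      have h3 : Continuous (fun p : (EuclideanSpace ℝ (Fin n) × ℝ) × EuclideanSpace ℝ (Fin n) =>
        p.2 i * p.2 j) := by fun_prop
      exact h2.mul h3.continuousAt
    have hv0 : v ≠ 0 := by
      rintro rfl
      simp at hv
    exact hc.eventually (lt_mem_nhds (h v hv0))
  filter_upwards [h1] with z hz v hv
  have hn : 0 < ‖v‖ := norm_pos_iff.2 hv
  have h4 := hz (‖v‖⁻¹ • v) (by simp [norm_smul, hn.ne'])
  have h5 : ∑ i, ∑ j, g z i j * ((‖v‖⁻¹ • v) i * (‖v‖⁻¹ • v) j) =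
      (‖v‖⁻¹ * ‖v‖⁻¹) * ∑ i, ∑ j, g z i j * (v i * v j) := by
    rw [Finset.mul_sum]
    refine Finset.sum_congr rfl fun i _ => ?_
    rw [Finset.mul_sum]
    refine Finset.sum_congr rfl fun j _ => ?_
    simp only [PiLp.smul_apply, smul_eq_mul]
    ring
  rw [h5] at h4
  exact pos_of_mul_pos_right h4 (by positivity)

variable {M : Type*} [TopologicalSpace M] [ChartedSpace (EuclideanSpace ℝ (Fin n)) M]
  [IsManifold (𝓡 n) ω M]
  {e : OpenPartialHomeomorph M (EuclideanSpace ℝ (Fin n))} {p : M × ℝ}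
  {q : EuclideanSpace ℝ (Fin n) × ℝ}

/-- The bilinear form on vectors with matrix `A`. -/
def matrixForm (A : Matrix (Fin n) (Fin n) ℝ) : LinearMap.BilinForm ℝ (EuclideanSpace ℝ (Fin n)) :=
  LinearMap.mk₂ ℝ (fun v w => ∑ i, ∑ j, A i j * (v i * w j))
    (fun v v' w => by simp only [PiLp.add_apply, add_mul, mul_add, Finset.sum_add_distrib])
    (fun c v w => by
      simp only [PiLp.smul_apply, smul_eq_mul, Finset.mul_sum]
      exact Finset.sum_congr rfl fun i _ => Finset.sum_congr rfl fun j _ => by ring)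
    (fun v w w' => by simp only [PiLp.add_apply, mul_add, Finset.sum_add_distrib])
    (fun c v w => by
      simp only [PiLp.smul_apply, smul_eq_mul, Finset.mul_sum]
      exact Finset.sum_congr rfl fun i _ => Finset.sum_congr rfl fun j _ => by ring)

theorem matrixForm_apply (A : Matrix (Fin n) (Fin n) ℝ) (v w : EuclideanSpace ℝ (Fin n)) :
    matrixForm A v w = ∑ i, ∑ j, A i j * (v i * w j) := rfl

theorem matrixForm_spaceDir (A : Matrix (Fin n) (Fin n) ℝ) (i j : Fin n) :
    matrixForm A (spaceDir i) (spaceDir j) = A i j := by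
  rw [matrixForm_apply, Finset.sum_eq_single i, Finset.sum_eq_single j]
  · simp [spaceDir]
  · intro k _ hk; simp [spaceDir, hk]
  · simp
  · intro k _ hk; simp [spaceDir, hk]
  · simp

/-- The coordinates of a tangent vector at `x`. -/
def tangentCoord (e : OpenPartialHomeomorph M (EuclideanSpace ℝ (Fin n))) (x : M) :
    EuclideanSpace ℝ (Fin n) →L[ℝ] EuclideanSpace ℝ (Fin n) :=
  mfderiv (𝓡 n) (𝓡 n) e x

/-- The time-dependent tensor field on `M` with components `H` in the chart `e`. -/
def formOf (e : OpenPartialHomeomorph M (EuclideanSpace ℝ (Fin n)))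
    (H : EuclideanSpace ℝ (Fin n) × ℝ → Matrix (Fin n) (Fin n) ℝ) (p : M × ℝ) :
    LinearMap.BilinForm ℝ (TangentSpace (𝓡 n) p.1) :=
  (matrixForm (H (spacetimeCoord e p))).comp (tangentCoord e p.1).toLinearMap
    (tangentCoord e p.1).toLinearMap

theorem formOf_apply (H : EuclideanSpace ℝ (Fin n) × ℝ → Matrix (Fin n) (Fin n) ℝ)
    (v w : EuclideanSpace ℝ (Fin n)) : formOf e H p v w =
      matrixForm (H (spacetimeCoord e p)) (tangentCoord e p.1 v) (tangentCoord e p.1 w) := rfl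

theorem spaceComp_formOf (he : e ∈ IsManifold.maximalAtlas (𝓡 n) ω M) (hq : q.1 ∈ e.target)
    (H : EuclideanSpace ℝ (Fin n) × ℝ → Matrix (Fin n) (Fin n) ℝ) :
    spaceComp e (formOf e H) q = H q := by
  funext i j
  have h1 : spacetimeCoord e (e.symm q.1, q.2) = q := Prod.ext (e.right_inv hq) rfl
  have h2 : ∀ i, tangentCoord e (e.symm q.1) (coordVec e q.1 i) = spaceDir i :=
    fun i => chartDeriv_symmDeriv he hq (spaceDir i)
  refine (formOf_apply H _ _).trans ?_
  change matrixForm (H (spacetimeCoord e (e.symm q.1, q.2)))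
    (tangentCoord e (e.symm q.1) (coordVec e q.1 i)) (tangentCoord e (e.symm q.1) (coordVec e q.1 j)) = _
  rw [h1, h2, h2, matrixForm_spaceDir]

theorem tangentCoord_ne_zero (he : e ∈ IsManifold.maximalAtlas (𝓡 n) ω M) {x : M}
    (hx : x ∈ e.source) {v : EuclideanSpace ℝ (Fin n)} (hv : v ≠ 0) : tangentCoord e x v ≠ 0 := by
  obtain ⟨y, hy, rfl⟩ : ∃ y ∈ e.target, e.symm y = x := ⟨e x, e.map_source hx, e.left_inv hx⟩
  intro h
  apply hv
  rw [← symmDeriv_chartDeriv he hy v]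
  change symmDeriv e y (tangentCoord e (e.symm y) v) = 0
  rw [h, map_zero]

/-- Tensors with the same components are equal. -/
theorem form_eq_of_spaceComp_eq (he : e ∈ IsManifold.maximalAtlas (𝓡 n) ω M) (hq : q.1 ∈ e.target)
    {h h' : (p : M × ℝ) → LinearMap.BilinForm ℝ (TangentSpace (𝓡 n) p.1)}
    (heq : spaceComp e h q = spaceComp e h' q) : h (e.symm q.1, q.2) = h' (e.symm q.1, q.2) := by
  let H : LinearMap.BilinForm ℝ (EuclideanSpace ℝ (Fin n)) := h (e.symm q.1, q.2)
  let H' : LinearMap.BilinForm ℝ (EuclideanSpace ℝ (Fin n)) := h' (e.symm q.1, q.2)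
  have h1 : ∀ v : EuclideanSpace ℝ (Fin n), v =
      ∑ k, (chartDeriv e q.1 v) k • symmDeriv e q.1 (spaceDir k) := by
    intro v
    conv_lhs => rw [← symmDeriv_chartDeriv he hq v, ← spaceDir_sum (chartDeriv e q.1 v)]
    rw [map_sum]
    simp
  have h2 : ∀ i j, H (symmDeriv e q.1 (spaceDir i)) (symmDeriv e q.1 (spaceDir j)) =
      H' (symmDeriv e q.1 (spaceDir i)) (symmDeriv e q.1 (spaceDir j)) := fun i j =>
    congrFun (congrFun heq i) j
  have h3 : H = H' := by
    refine LinearMap.ext fun v => LinearMap.ext fun w => ?_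
    rw [h1 v, h1 w, bilin_sum_smul, bilin_sum_smul]
    simp only [h2]
  exact h3

theorem formOf_symm {H : EuclideanSpace ℝ (Fin n) × ℝ → Matrix (Fin n) (Fin n) ℝ}
    (hs : ∀ i j, H (spacetimeCoord e p) i j = H (spacetimeCoord e p) j i)
    (v w : TangentSpace (𝓡 n) p.1) : formOf e H p v w = formOf e H p w v := by
  refine (formOf_apply H v w).trans (Eq.trans ?_ (formOf_apply H w v).symm)
  rw [matrixForm_apply, matrixForm_apply, Finset.sum_comm]
  refine Finset.sum_congr rfl fun i _ => Finset.sum_congr rfl fun j _ => ?_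
  rw [hs j i]
  exact congrArg _ (mul_comm _ _)

theorem formOf_eq_data (he : e ∈ IsManifold.maximalAtlas (𝓡 n) ω M) {x : M} (hx : x ∈ e.source)
    {h : (x : M) → LinearMap.BilinForm ℝ (TangentSpace (𝓡 n) x)} {t : ℝ}
    {H : EuclideanSpace ℝ (Fin n) × ℝ → Matrix (Fin n) (Fin n) ℝ}
    (hH : H (e x, t) = dataComp e h (e x)) : formOf e H (x, t) = h x := by
  have h1 := form_eq_of_spaceComp_eq (h := formOf e H) (h' := fun p => h p.1) (q := (e x, t)) he
    (e.map_source hx) ((spaceComp_formOf he (e.map_source hx) H).trans hH)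
  -- The tensors live over the base point, so `e.symm (e x) = x` is substituted instead of
  -- rewritten.
  have h2 : ∀ {x' : M}, x' = x → formOf e H (x', t) = h x' → formOf e H (x, t) = h x := by
    rintro _ rfl hh; exact hh
  exact h2 (e.left_inv hx) h1

end LocalForms

/-! ### Uniqueness along vertical segments and gluing of local solutions. -/

section Gluing

open Topology Filter

variable {n : ℕ} {M : Type*} [TopologicalSpace M] [ChartedSpace (EuclideanSpace ℝ (Fin n)) M]
  [IsManifold (𝓡 n) ω M]
  {e : OpenPartialHomeomorph M (EuclideanSpace ℝ (Fin n))} {p : M × ℝ}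
  {q : EuclideanSpace ℝ (Fin n) × ℝ} {U O O' : Set (M × ℝ)}
  {N : M × ℝ → ℝ} {β : (p : M × ℝ) → TangentSpace (𝓡 n) p.1}
  {g K g' K' : (p : M × ℝ) → LinearMap.BilinForm ℝ (TangentSpace (𝓡 n) p.1)}
  {ρ : (p : M × ℝ) → LinearMap.BilinForm ℝ (TangentSpace (𝓡 n) p.1 × ℝ)}
  {g₀ K₀ : (x : M) → LinearMap.BilinForm ℝ (TangentSpace (𝓡 n) x)}

/-- An analytic solution of the Cauchy problem for the evolution equations on the set `O`, which
need not contain all of `M₀`. -/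
structure IsEvolutionOn (O : Set (M × ℝ)) (N : M × ℝ → ℝ)
    (β : (p : M × ℝ) → TangentSpace (𝓡 n) p.1)
    (ρ : (p : M × ℝ) → LinearMap.BilinForm ℝ (TangentSpace (𝓡 n) p.1 × ℝ))
    (g₀ K₀ : (x : M) → LinearMap.BilinForm ℝ (TangentSpace (𝓡 n) x))
    (g K : (p : M × ℝ) → LinearMap.BilinForm ℝ (TangentSpace (𝓡 n) p.1)) : Prop where
  metric : ∀ p ∈ O, IsInnerForm (g p)
  symm : ∀ p ∈ O, ∀ v w, K p v w = K p w v
  analytic_metric : ∀ e ∈ IsManifold.maximalAtlas (𝓡 n) ω M, ∀ i j,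
    AnalyticOnNhd ℝ (fun q => spaceComp e g q i j) (chartDomain e O)
  analytic_curvature : ∀ e ∈ IsManifold.maximalAtlas (𝓡 n) ω M, ∀ i j,
    AnalyticOnNhd ℝ (fun q => spaceComp e K q i j) (chartDomain e O)
  initial : ∀ x, (x, (0 : ℝ)) ∈ O → g (x, 0) = g₀ x ∧ K (x, 0) = K₀ x
  evolution : EvolutionEquations O N β ρ g K

/-- `O` contains with each point the vertical segment to `M₀`. -/
def IsVertical (O : Set (M × ℝ)) : Prop := ∀ p ∈ O, ∀ s : ℝ, |s| ≤ |p.2| → (p.1, s) ∈ O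

theorem spaceComp_eq_of_eq {h h' : (p : M × ℝ) → LinearMap.BilinForm ℝ (TangentSpace (𝓡 n) p.1)}
    (hh : h (e.symm q.1, q.2) = h' (e.symm q.1, q.2)) : spaceComp e h q = spaceComp e h' q := by
  funext i j
  exact congrArg (fun H : LinearMap.BilinForm ℝ (TangentSpace (𝓡 n) (e.symm q.1)) =>
    H (coordVec e q.1 i) (coordVec e q.1 j)) hh

theorem IsEvolutionOn.eventually_eq_slice (hs : IsEvolutionOn O N β ρ g₀ K₀ g K)
    (hs' : IsEvolutionOn O' N β ρ g₀ K₀ g' K') (hO : IsOpen O) (hO' : IsOpen O')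
    {y : EuclideanSpace ℝ (Fin n)} (hy : (y, (0 : ℝ)) ∈ chartDomain e O)
    (hy' : (y, (0 : ℝ)) ∈ chartDomain e O') : ∀ᶠ x in 𝓝 y,
      spaceComp e g (x, 0) = spaceComp e g' (x, 0) ∧
        spaceComp e K (x, 0) = spaceComp e K' (x, 0) := by
  filter_upwards [eventually_atTime (eventually_chartDomain hO hy),
    eventually_atTime (eventually_chartDomain hO' hy')] with x hx hx'
  have h1 := hs.initial _ hx.2
  have h2 := hs'.initial _ hx'.2
  exact ⟨spaceComp_eq_of_eq (h1.1.trans h2.1.symm), spaceComp_eq_of_eq (h1.2.trans h2.2.symm)⟩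

/-- Near `(m, 0)` this is local uniqueness. From there the identity theorem in the single variable
`s` reaches `(m, t)`, because the vertical segment lies in both sets. Neither connectedness of `O ∩
O'` nor a separation property of `M` is needed. -/
theorem IsEvolutionOn.eq (hs : IsEvolutionOn O N β ρ g₀ K₀ g K)
    (hs' : IsEvolutionOn O' N β ρ g₀ K₀ g' K') (hO : IsOpen O) (hO' : IsOpen O')
    (hv : IsVertical O) (hv' : IsVertical O') (hOU : O ⊆ U) (hOU' : O' ⊆ U)
    (hG : IsAnalyticGauge U N β) (hρ : IsAnalyticSymmetric U ρ) (hp : p ∈ O) (hp' : p ∈ O') :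
    g p = g' p ∧ K p = K' p := by
  obtain ⟨m, t⟩ := p
  let e := chartAt (EuclideanSpace ℝ (Fin n)) m
  have he : e ∈ IsManifold.maximalAtlas (𝓡 n) ω M := IsManifold.chart_mem_maximalAtlas m
  have hm : m ∈ e.source := mem_chart_source _ m
  have hseg : ∀ s : ℝ, |s| ≤ |t| → (e m, s) ∈ chartDomain e O ∧ (e m, s) ∈ chartDomain e O' :=
    fun s h => ⟨mem_chartDomain (p := (m, s)) (hv _ hp s h) hm,
      mem_chartDomain (p := (m, s)) (hv' _ hp' s h) hm⟩
  have h0 := hseg 0 (by simp)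
  have hsp := hG.isSplitAt hOU hO he hs.metric (fun i j => hs.analytic_metric e he i j _ h0.1) h0.1
  have hsp' := hG.isSplitAt hOU' hO' he hs'.metric (fun i j => hs'.analytic_metric e he i j _ h0.2)
    h0.2
  have hloc := evolution_local_unique hsp.lapse hsp.shift
    (ρ := spatialPart e ρ)
    (fun i j => hρ.analytic e he (Sum.inl i) (Sum.inl j) _ ⟨h0.1.1, hOU h0.1.2⟩)
    hsp.metric hsp'.metric (fun i j => hs.analytic_curvature e he i j _ h0.1)
    (fun i j => hs'.analytic_curvature e he i j _ h0.2)
    (hs.eventually_eq_slice hs' hO hO' h0.1 h0.2)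
    ((eventually_chartDomain hO h0.1).mono fun _ hz => hs.evolution e he _ hz)
    ((eventually_chartDomain hO' h0.2).mono fun _ hz => hs'.evolution e he _ hz)
  have hline : ∀ s : ℝ, AnalyticAt ℝ (fun s : ℝ => (e m, s)) s := fun s =>
    analyticAt_const.prod analyticAt_id
  have hcont : ∀ {f f' : EuclideanSpace ℝ (Fin n) × ℝ → ℝ},
      AnalyticOnNhd ℝ f (chartDomain e O) → AnalyticOnNhd ℝ f' (chartDomain e O') →
      f =ᶠ[𝓝 (e m, 0)] f' → f (e m, t) = f' (e m, t) := by
    intro f f' hf hf' hff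
    have h1 : AnalyticOnNhd ℝ (fun s => f (e m, s)) (Set.Icc (-|t|) |t|) := fun s hs =>
      (hf _ (hseg s (abs_le.2 hs)).1).comp_of_eq (hline s) rfl
    have h2 : AnalyticOnNhd ℝ (fun s => f' (e m, s)) (Set.Icc (-|t|) |t|) := fun s hs =>
      (hf' _ (hseg s (abs_le.2 hs)).2).comp_of_eq (hline s) rfl
    exact h1.eqOn_of_preconnected_of_eventuallyEq h2 isPreconnected_Icc
      (show (0 : ℝ) ∈ _ by simp) ((hline 0).continuousAt.eventually hff)
      (abs_le.1 le_rfl)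
  have ht := (hseg t le_rfl).1
  have h1 : ∀ {h h' : (p : M × ℝ) → LinearMap.BilinForm ℝ (TangentSpace (𝓡 n) p.1)} {x : M},
      x = m → h (x, t) = h' (x, t) → h (m, t) = h' (m, t) := by rintro h h' _ rfl hh; exact hh
  have hg : spaceComp e g (e m, t) = spaceComp e g' (e m, t) := by
    ext i j
    exact hcont (hs.analytic_metric e he i j) (hs'.analytic_metric e he i j)
      (hloc.mono fun z hz => by simp only [hz.1])
  have hK : spaceComp e K (e m, t) = spaceComp e K' (e m, t) := by
    ext i j
    exact hcont (hs.analytic_curvature e he i j) (hs'.analytic_curvature e he i j)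
      (hloc.mono fun z hz => by simp only [hz.2])
  exact ⟨h1 (e.left_inv hm) (form_eq_of_spaceComp_eq he ht.1 hg),
    h1 (e.left_inv hm) (form_eq_of_spaceComp_eq he ht.1 hK)⟩

/-- Fields which agree locally with solutions are solutions. -/
theorem isEvolutionOn_of_local (h : ∀ p ∈ O, ∃ O' g' K', IsOpen O' ∧ p ∈ O' ∧
    IsEvolutionOn O' N β ρ g₀ K₀ g' K' ∧ ∀ p ∈ O', g p = g' p ∧ K p = K' p) :
    IsEvolutionOn O N β ρ g₀ K₀ g K := by
  have hcomp : ∀ {O' : Set (M × ℝ)} {h h' : (p : M × ℝ) → LinearMap.BilinForm ℝ (TangentSpace (𝓡 n) p.1)},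
      IsOpen O' → (∀ p ∈ O', h p = h' p) → ∀ {e q}, q ∈ chartDomain e O' →
      spaceComp e h' =ᶠ[𝓝 q] spaceComp e h := by
    intro O' h h' hO' hh e q hq
    filter_upwards [eventually_chartDomain hO' hq] with z hz
    exact spaceComp_eq_of_eq (hh _ hz.2).symm
  refine ⟨fun p hp => ?_, fun p hp => ?_, fun e he i j q hq => ?_, fun e he i j q hq => ?_,
    fun x hx => ?_, fun e he q hq => ?_⟩
  · obtain ⟨O', g', K', hO', hp', hs, heq⟩ := h p hp
    rw [(heq p hp').1]; exact hs.metric p hp'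
  · obtain ⟨O', g', K', hO', hp', hs, heq⟩ := h p hp
    rw [(heq p hp').2]; exact hs.symm p hp'
  · obtain ⟨O', g', K', hO', hp', hs, heq⟩ := h _ hq.2
    exact (hs.analytic_metric e he i j q ⟨hq.1, hp'⟩).congr
      ((hcomp hO' (fun p hp => (heq p hp).1) ⟨hq.1, hp'⟩).mono fun z hz => by simp only [hz])
  · obtain ⟨O', g', K', hO', hp', hs, heq⟩ := h _ hq.2
    exact (hs.analytic_curvature e he i j q ⟨hq.1, hp'⟩).congr
      ((hcomp hO' (fun p hp => (heq p hp).2) ⟨hq.1, hp'⟩).mono fun z hz => by simp only [hz])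
  · obtain ⟨O', g', K', hO', hp', hs, heq⟩ := h _ hx
    rw [(heq _ hp').1, (heq _ hp').2]; exact hs.initial x hp'
  · obtain ⟨O', g', K', hO', hp', hs, heq⟩ := h _ hq.2
    have h1 : EvolutionAt (scalarComp e N) (vecComp e β) (spatialPart e ρ) (spaceComp e g')
      (spaceComp e K') q := hs.evolution e he q ⟨hq.1, hp'⟩
    exact evolutionAt_congr (hcomp hO' (fun p hp => (heq p hp).1) ⟨hq.1, hp'⟩)
      (hcomp hO' (fun p hp => (heq p hp).2) ⟨hq.1, hp'⟩) h1

/-- Local solutions near the points of `M₀` can be glued. -/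
theorem exists_isAnalyticEvolution (hG : IsAnalyticGauge U N β) (hρ : IsAnalyticSymmetric U ρ)
    (hloc : ∀ x : M, ∃ O ⊆ U, IsOpen O ∧ IsVertical O ∧ (x, (0 : ℝ)) ∈ O ∧
      ∃ g K : (p : M × ℝ) → LinearMap.BilinForm ℝ (TangentSpace (𝓡 n) p.1),
        IsEvolutionOn O N β ρ g₀ K₀ g K) :
    ∃ V ⊆ U, IsSliceNeighborhood V ∧
      ∃ g K : (p : M × ℝ) → LinearMap.BilinForm ℝ (TangentSpace (𝓡 n) p.1),
        IsAnalyticEvolution V N β ρ g₀ K₀ g K := by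
  classical
  choose O hOU hO hv hx g K hs using hloc
  have hV : ∀ p ∈ ⋃ x, O x, ∃ x, p ∈ O x := fun p hp => Set.mem_iUnion.1 hp
  -- At each point any local solution defined there may be chosen, by `IsEvolutionOn.eq`. Outside
  -- the union the value is a dummy `0`.
  let G : (p : M × ℝ) → LinearMap.BilinForm ℝ (TangentSpace (𝓡 n) p.1) := fun p =>
    if h : p ∈ ⋃ x, O x then g (hV p h).choose p else 0
  let L : (p : M × ℝ) → LinearMap.BilinForm ℝ (TangentSpace (𝓡 n) p.1) := fun p =>
    if h : p ∈ ⋃ x, O x then K (hV p h).choose p else 0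
  have heq : ∀ x, ∀ p ∈ O x, G p = g x p ∧ L p = K x p := by
    intro x p hp
    have hpV : p ∈ ⋃ x, O x := Set.mem_iUnion.2 ⟨x, hp⟩
    simp only [G, L, dif_pos hpV]
    exact (hs _).eq (hs x) (hO _) (hO x) (hv _) (hv x) (hOU _) (hOU x) hG hρ
      (hV p hpV).choose_spec hp
  have hE : IsEvolutionOn (⋃ x, O x) N β ρ g₀ K₀ G L := by
    refine isEvolutionOn_of_local fun p hp => ?_
    obtain ⟨x, hpx⟩ := hV p hp
    exact ⟨O x, g x, K x, hO x, hpx, hs x, heq x⟩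
  have hslice : ∀ x : M, (x, (0 : ℝ)) ∈ ⋃ x, O x := fun x => Set.mem_iUnion.2 ⟨x, hx x⟩
  refine ⟨⋃ x, O x, Set.iUnion_subset hOU, ⟨isOpen_iUnion hO, hslice, fun p hp => ?_⟩, G, L,
    ⟨hE.metric, hE.symm, hE.analytic_metric, hE.analytic_curvature,
      fun x => (hE.initial x (hslice x)).1, fun x => (hE.initial x (hslice x)).2, hE.evolution⟩⟩
  obtain ⟨x, hpx⟩ := hV p hp
  refine ⟨p.1, ?_⟩
  -- The vertical segment through `p` stays in the union and joins `p` to `M₀`, so every component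
  -- meets `M₀`.
  have h1 : IsPreconnected ((fun s : ℝ => (p.1, s)) '' Set.Icc (-|p.2|) |p.2|) :=
    isPreconnected_Icc.image _ (by fun_prop)
  refine h1.subset_connectedComponentIn ⟨p.2, abs_le.1 le_rfl, rfl⟩ ?_ ⟨0, by simp, rfl⟩
  rintro _ ⟨s, hs, rfl⟩
  exact Set.mem_iUnion.2 ⟨x, hv x p hpx s (abs_le.2 hs)⟩

end Gluing

/-! ### Local existence near a point of `M₀`. -/

section LocalExistence

open Topology Filter

variable {n : ℕ} {M : Type*} [TopologicalSpace M] [ChartedSpace (EuclideanSpace ℝ (Fin n)) M]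
  [IsManifold (𝓡 n) ω M]
  {e : OpenPartialHomeomorph M (EuclideanSpace ℝ (Fin n))} {p : M × ℝ}
  {q : EuclideanSpace ℝ (Fin n) × ℝ} {U O : Set (M × ℝ)}
  {N : M × ℝ → ℝ} {β : (p : M × ℝ) → TangentSpace (𝓡 n) p.1}
  {g K : (p : M × ℝ) → LinearMap.BilinForm ℝ (TangentSpace (𝓡 n) p.1)}
  {ρ : (p : M × ℝ) → LinearMap.BilinForm ℝ (TangentSpace (𝓡 n) p.1 × ℝ)}
  {g₀ K₀ : (x : M) → LinearMap.BilinForm ℝ (TangentSpace (𝓡 n) x)}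

/-- A solution in the domain of one chart is a solution in all charts. -/
theorem isEvolutionOn_of_chart (hG : IsAnalyticGauge U N β) (hOU : O ⊆ U) (hO : IsOpen O)
    (he : e ∈ IsManifold.maximalAtlas (𝓡 n) ω M) (hOe : ∀ p ∈ O, p.1 ∈ e.source)
    (hm : ∀ p ∈ O, IsInnerForm (g p)) (hsy : ∀ p ∈ O, ∀ v w, K p v w = K p w v)
    (hag : ∀ i j, AnalyticOnNhd ℝ (fun q => spaceComp e g q i j) (chartDomain e O))
    (haK : ∀ i j, AnalyticOnNhd ℝ (fun q => spaceComp e K q i j) (chartDomain e O))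
    (hi : ∀ x, (x, (0 : ℝ)) ∈ O → g (x, 0) = g₀ x ∧ K (x, 0) = K₀ x)
    (hev : ∀ q ∈ chartDomain e O, EvolutionAt (scalarComp e N) (vecComp e β) (spatialPart e ρ)
      (spaceComp e g) (spaceComp e K) q) : IsEvolutionOn O N β ρ g₀ K₀ g K := by
  have hmem : ∀ {e' : OpenPartialHomeomorph M (EuclideanSpace ℝ (Fin n))} {q},
      q ∈ chartDomain e' O → spacetimeTransition e e' q ∈ chartDomain e O := by
    intro e' q hq
    exact mem_chartDomain (p := (e'.symm q.1, q.2)) hq.2 (hOe _ hq.2)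
  have hg' : ∀ e' ∈ IsManifold.maximalAtlas (𝓡 n) ω M, ∀ i j,
      AnalyticOnNhd ℝ (fun q => spaceComp e' g q i j) (chartDomain e' O) := fun e' he' i j q hq =>
    analyticAt_spaceComp_transition he he' hq.1 (hOe _ hq.2) (fun i j => hag i j _ (hmem hq)) i j
  refine ⟨hm, hsy, hg', fun e' he' i j q hq => analyticAt_spaceComp_transition he he' hq.1
    (hOe _ hq.2) (fun i j => haK i j _ (hmem hq)) i j, hi, fun e' he' q hq => ?_⟩
  have hd := eventually_chartDomain hO (hmem hq)
  exact (evolution_transition he he' hq.1 (hOe _ hq.2)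
    (hG.isSplitAt hOU hO he hm (fun i j => hag i j _ (hmem hq)) (hmem hq))
    (hG.isSplitAt hOU hO he' hm (fun i j => hg' e' he' i j _ hq) hq)
    (fun i j => haK i j _ (hmem hq)) (hd.mono fun z hz i j => hsy _ hz.2 _ _)
    (hd.mono hev)).self_of_nhds

theorem isMetricAt_dataComp (hdata : IsAnalyticInitialData g₀ K₀)
    (he : e ∈ IsManifold.maximalAtlas (𝓡 n) ω M) {y : EuclideanSpace ℝ (Fin n)}
    (hy : y ∈ e.target) : IsMetricAt (dataComp e g₀) y where
  analytic := fun i j => hdata.analytic_metric e he i j y hy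
  symm := Eventually.of_forall fun z _ _ => (hdata.metric (e.symm z)).1 _ _
  det_ne := det_ne_zero_of_isInnerForm he hy (hdata.metric (e.symm y))

theorem isInnerForm_formOf (he : e ∈ IsManifold.maximalAtlas (𝓡 n) ω M) (hp : p.1 ∈ e.source)
    {H : EuclideanSpace ℝ (Fin n) × ℝ → Matrix (Fin n) (Fin n) ℝ}
    (hs : ∀ i j, H (spacetimeCoord e p) i j = H (spacetimeCoord e p) j i)
    (hpos : ∀ v : EuclideanSpace ℝ (Fin n), v ≠ 0 →
      0 < ∑ i, ∑ j, H (spacetimeCoord e p) i j * (v i * v j)) : IsInnerForm (formOf e H p) :=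
  ⟨formOf_symm hs, fun _ hv => hpos _ (tangentCoord_ne_zero he hp hv)⟩

theorem dataComp_pos (hdata : IsAnalyticInitialData g₀ K₀)
    (he : e ∈ IsManifold.maximalAtlas (𝓡 n) ω M) {y : EuclideanSpace ℝ (Fin n)}
    (hy : y ∈ e.target) {v : EuclideanSpace ℝ (Fin n)} (hv : v ≠ 0) :
    0 < ∑ i, ∑ j, dataComp e g₀ y i j * (v i * v j) := by
  have h1 : symmDeriv e y v ≠ 0 := fun h => hv (by
    rw [← chartDeriv_symmDeriv he hy v, h, map_zero])
  let H : LinearMap.BilinForm ℝ (EuclideanSpace ℝ (Fin n)) := g₀ (e.symm y)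
  have h2 : 0 < H (symmDeriv e y v) (symmDeriv e y v) := (hdata.metric (e.symm y)).2 _ h1
  have h3 : symmDeriv e y v = ∑ k, v k • symmDeriv e y (spaceDir k) := by
    conv_lhs => rw [← spaceDir_sum v]
    rw [map_sum]
    simp only [map_smul]
  rw [h3, bilin_sum_smul] at h2
  refine h2.trans_eq (Finset.sum_congr rfl fun i _ => Finset.sum_congr rfl fun j _ => ?_)
  exact mul_comm _ _

theorem exists_isEvolutionOn (hdata : IsAnalyticInitialData g₀ K₀) (hU : IsOpen U)
    (hslice : ∀ x : M, (x, (0 : ℝ)) ∈ U) (hG : IsAnalyticGauge U N β)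
    (hρ : IsAnalyticSymmetric U ρ) (x : M) : ∃ O ⊆ U, IsOpen O ∧ IsVertical O ∧ (x, (0 : ℝ)) ∈ O ∧
      ∃ g K : (p : M × ℝ) → LinearMap.BilinForm ℝ (TangentSpace (𝓡 n) p.1),
        IsEvolutionOn O N β ρ g₀ K₀ g K := by
  let e := chartAt (EuclideanSpace ℝ (Fin n)) x
  have he : e ∈ IsManifold.maximalAtlas (𝓡 n) ω M := IsManifold.chart_mem_maximalAtlas x
  have hx : x ∈ e.source := mem_chart_source _ x
  have hy : e x ∈ e.target := mem_chart_target _ x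
  have h0 : (e x, (0 : ℝ)) ∈ chartDomain e U := ⟨hy, hslice _⟩
  obtain ⟨g, K, hg, hK, hKs, hini, hev⟩ := exists_local_evolution (N := scalarComp e N)
    (β := vecComp e β) (ρ := spatialPart e ρ) (hG.analytic_lapse e he _ h0)
    (fun i => hG.analytic_shift e he i _ h0)
    (fun i j => hρ.analytic e he (Sum.inl i) (Sum.inl j) _ h0)
    ((eventually_chartDomain hU h0).mono fun z hz i j => hρ.symm _ hz.2 _ _)
    (isMetricAt_dataComp hdata he hy) (fun i j => hdata.analytic_curvature e he i j _ hy)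
    (Eventually.of_forall fun z i j => hdata.symm _ _ _)
  have hpos := eventually_posDef (fun i j => (hg.analytic i j).continuousAt) fun v hv => by
    have h1 := dataComp_pos hdata he hy hv
    rwa [← hini.self_of_nhds.1] at h1
  have hKa : ∀ᶠ z in 𝓝 (e x, (0 : ℝ)), ∀ i j, AnalyticAt ℝ (fun z => K z i j) z :=
    eventually_all.2 fun i => eventually_all.2 fun j => (hK i j).eventually_analyticAt
  have hini' : ∀ᶠ z : EuclideanSpace ℝ (Fin n) × ℝ in 𝓝 (e x, (0 : ℝ)),
      g (z.1, 0) = dataComp e g₀ z.1 ∧ K (z.1, 0) = dataComp e K₀ z.1 :=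
    (continuous_fst.tendsto (e x, (0 : ℝ))).eventually hini
  obtain ⟨r, hr, hball⟩ := Metric.eventually_nhds_iff_ball.1
    (((eventually_chartDomain hU h0).and (hg.eventually.and (hKa.and hKs))).and
      (hini'.and (hev.and hpos)))
  -- A ball for the maximum metric of the product, centred on the slice; it contains with each point
  -- those of smaller `|t|`, so `O` is vertical.
  let O : Set (M × ℝ) := {p | p.1 ∈ e.source ∧ spacetimeCoord e p ∈ Metric.ball (e x, 0) r}
  have hOe : ∀ p ∈ O, p.1 ∈ e.source := fun p hp => hp.1
  have hOb : ∀ q ∈ chartDomain e O, q ∈ Metric.ball (e x, (0 : ℝ)) r := by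
    intro q hq
    have h1 := hq.2.2
    have h2 : spacetimeCoord e (e.symm q.1, q.2) = q := Prod.ext (e.right_inv hq.1) rfl
    rwa [h2] at h1
  have hO : IsOpen O := isOpen_iff_mem_nhds.2 fun p hp => (eventually_mem_source hp.1).and
    ((continuousAt_spacetimeCoord hp.1).eventually (Metric.isOpen_ball.mem_nhds hp.2))
  have hOU : O ⊆ U := by
    intro p hp
    have h1 := (hball _ hp.2).1.1.2
    have h2 : (e.symm (spacetimeCoord e p).1, (spacetimeCoord e p).2) = p :=
      Prod.ext (e.left_inv hp.1) rfl
    rwa [h2] at h1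
  have hcomp : ∀ H : EuclideanSpace ℝ (Fin n) × ℝ → Matrix (Fin n) (Fin n) ℝ,
      ∀ q ∈ chartDomain e O, H =ᶠ[𝓝 q] spaceComp e (formOf e H) := fun H q hq => by
    filter_upwards [eventually_chartDomain hO hq] with z hz
    exact (spaceComp_formOf he hz.1 H).symm
  refine ⟨O, hOU, hO, ?_, ⟨hx, Metric.mem_ball_self hr⟩, formOf e g, formOf e K,
    isEvolutionOn_of_chart hG hOU hO he hOe ?_ ?_ ?_ ?_ ?_ ?_⟩
  · rintro p ⟨h1, h2⟩ s hs
    refine ⟨h1, ?_⟩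
    rw [Metric.mem_ball, Prod.dist_eq, max_lt_iff] at h2 ⊢
    refine ⟨h2.1, lt_of_le_of_lt ?_ h2.2⟩
    simpa [Real.dist_eq, spacetimeCoord] using hs
  · intro p hp
    have h1 := hball _ hp.2
    exact isInnerForm_formOf he hp.1 h1.1.2.1.symm.self_of_nhds h1.2.2.2
  · intro p hp
    exact formOf_symm (hball _ hp.2).1.2.2.2
  · intro i j q hq
    exact ((hball q (hOb q hq)).1.2.1.analytic i j).congr
      ((hcomp g q hq).mono fun z hz => by simp only [hz])
  · intro i j q hq
    exact ((hball q (hOb q hq)).1.2.2.1 i j).congr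
      ((hcomp K q hq).mono fun z hz => by simp only [hz])
  · intro x' hx'
    have h1 := (hball _ hx'.2).2.1
    exact ⟨formOf_eq_data he hx'.1 h1.1, formOf_eq_data he hx'.1 h1.2⟩
  · intro q hq
    exact evolutionAt_congr (hcomp g q hq) (hcomp K q hq) (hball q (hOb q hq)).2.2.1

end LocalExistence

/-! ### Lorentzian signature, extrinsic curvature and the vacuum case. -/

section VacuumDevelopment

open Topology Filter

variable {n : ℕ} {M : Type*} [TopologicalSpace M] [ChartedSpace (EuclideanSpace ℝ (Fin n)) M]
  [IsManifold (𝓡 n) ω M]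
  {e : OpenPartialHomeomorph M (EuclideanSpace ℝ (Fin n))} {p : M × ℝ}
  {q : EuclideanSpace ℝ (Fin n) × ℝ} {U V : Set (M × ℝ)}
  {N : M × ℝ → ℝ} {β : (p : M × ℝ) → TangentSpace (𝓡 n) p.1}
  {g K : (p : M × ℝ) → LinearMap.BilinForm ℝ (TangentSpace (𝓡 n) p.1)}
  {ρ : (p : M × ℝ) → LinearMap.BilinForm ℝ (TangentSpace (𝓡 n) p.1 × ℝ)}
  {g₀ K₀ : (x : M) → LinearMap.BilinForm ℝ (TangentSpace (𝓡 n) x)}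

theorem spacetimeMetric_apply (v w : TangentSpace (𝓡 n) p.1 × ℝ) : spacetimeMetric N β g p v w =
    g p (v.1 + v.2 • β p) (w.1 + w.2 • β p) - N p ^ 2 * (v.2 * w.2) := rfl

/-- The timelike vector is `e₀ = (-β, 1)`. Its orthogonal complement is the tangent space of the
slice, where the form is `g`. -/
theorem isLorentzForm_spacetimeMetric (hN : 0 < N p) (hg : IsInnerForm (g p)) :
    IsLorentzForm (spacetimeMetric N β g p) := by
  refine ⟨fun v w => ?_, (-β p, 1), ?_, fun w h1 h2 => ?_⟩
  · rw [spacetimeMetric_apply, spacetimeMetric_apply, hg.1, mul_comm v.2]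
  · rw [spacetimeMetric_apply]
    simp only [one_smul, neg_add_cancel, map_zero, mul_one]
    linarith [pow_pos hN 2]
  · rw [spacetimeMetric_apply] at h1 ⊢
    simp only [one_smul, neg_add_cancel, map_zero, LinearMap.zero_apply, one_mul, zero_sub,
      neg_eq_zero, mul_eq_zero, (pow_pos hN 2).ne', false_or] at h1
    have h3 : w.1 ≠ 0 := fun h => h2 (Prod.ext h h1)
    simp only [h1, zero_smul, add_zero, mul_zero, sub_zero]
    exact hg.2 _ h3

theorem isAnalyticGauge_geodesic (U : Set (M × ℝ)) :
    IsAnalyticGauge U (fun _ => 1) (fun p => (0 : TangentSpace (𝓡 n) p.1)) where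
  lapse_pos := fun _ _ => one_pos
  analytic_lapse := fun _ _ _ _ => analyticAt_const
  analytic_shift := fun e _ i q _ => by
    have h1 : (fun q => vecComp e (fun p => (0 : TangentSpace (𝓡 n) p.1)) q i) = fun _ => 0 := by
      funext z
      exact congrArg (fun v : EuclideanSpace ℝ (Fin n) => v i) (map_zero (chartDeriv e z.1))
    rw [h1]
    exact analyticAt_const

theorem isAnalyticSymmetric_zero (U : Set (M × ℝ)) :
    IsAnalyticSymmetric U (fun p => (0 : LinearMap.BilinForm ℝ (TangentSpace (𝓡 n) p.1 × ℝ))) where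
  symm := fun _ _ _ _ => rfl
  analytic := fun _ _ _ _ _ _ => analyticAt_const

theorem conservationLaws_zero (V : Set (M × ℝ))
    (G : (p : M × ℝ) → LinearMap.BilinForm ℝ (TangentSpace (𝓡 n) p.1 × ℝ)) :
    ConservationLaws V G (fun _ => 0) := by
  intro e he q hq j
  have h0 : spacetimeComp e (fun p => (0 : LinearMap.BilinForm ℝ (TangentSpace (𝓡 n) p.1 × ℝ))) =
      fun _ => 0 := rfl
  have h1 : ∀ z, tr (spacetimeComp e G) (fun _ => 0) z = 0 := fun z => by simp [tr]
  simp only [h0, h1, mul_zero, zero_smul, sub_zero]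
  simp [divergence, covDerivTensor, pd_const]

theorem constraints_of_vacuum (h : VacuumConstraints g₀ K₀) :
    Constraints (fun _ => 1) (fun p => (0 : TangentSpace (𝓡 n) p.1)) (fun _ => 0) g₀ K₀ := by
  intro e he y hy
  obtain ⟨h1, h2⟩ := h e he y hy
  have h0 : ∀ z i j, spatialPart e
      (fun p => (0 : LinearMap.BilinForm ℝ (TangentSpace (𝓡 n) p.1 × ℝ))) z i j = 0 :=
    fun _ _ _ => rfl
  simp only [h0, h1, h2, LinearMap.zero_apply, mul_zero, Finset.sum_const_zero, sub_zero, add_zero]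
  exact ⟨fun _ => trivial, trivial⟩

/-- The extrinsic curvature of the slices in a solution of the evolution equation of the metric. -/
theorem IsAnalyticEvolution.extrinsicCurvature_eq (hs : IsAnalyticEvolution V N β ρ g₀ K₀ g K)
    (hG : IsAnalyticGauge U N β) (hVU : V ⊆ U) (hV : IsOpen V)
    (he : e ∈ IsManifold.maximalAtlas (𝓡 n) ω M) (hq : q ∈ chartDomain e V) (i j : Fin n) :
    extrinsicCurvature e (spacetimeMetric N β g) i j q = spaceComp e K q i j := by
  have hk := hs.isKinematicAt hG hVU hV he hq
  have hN : 0 < scalarComp e N q := hG.lapse_pos _ (hVU hq.2)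
  have hc : spacetimeComp e (spacetimeMetric N β g) =ᶠ[𝓝 q]
      splitMetric (scalarComp e N) (vecComp e β) (spaceComp e g) := by
    filter_upwards [eventually_chartDomain hV hq] with w hw
    exact spacetimeComp_spacetimeMetric he hw.1
  -- As `G^{tt} = -1 / N²` and `N > 0`, the unit conormal is `N dt`.
  have hν : unitConormal e (spacetimeMetric N β g) q (Sum.inr ()) = scalarComp e N q := by
    change (Real.sqrt (-(spacetimeComp e (spacetimeMetric N β g) q)⁻¹ (Sum.inr ()) (Sum.inr ())))⁻¹ = _
    rw [hc.self_of_nhds, splitMetric_inv hk.toIsSplitAt, splitInverse, neg_neg, one_div,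
      Real.sqrt_inv, Real.sqrt_sq hN.le, inv_inv]
  -- The space components of `ν` vanish identically, so `∇_i ν_j = -N Γ^t_{ij}`, which is `K_{ij}`
  -- by the evolution equation of the metric.
  have h1 : ∀ i j, covDerivCovector spacetimeDir (spacetimeComp e (spacetimeMetric N β g))
      (unitConormal e (spacetimeMetric N β g)) (Sum.inl i) (Sum.inl j) q = spaceComp e K q i j := by
    intro i j
    have h2 : (fun z => unitConormal e (spacetimeMetric N β g) z (Sum.inl j)) = fun _ => 0 := rfl
    have h3 : ∀ l, unitConormal e (spacetimeMetric N β g) q (Sum.inl l) = 0 := fun _ => rfl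
    rw [covDerivCovector, h2, pd_const, sum_space_add_time, hν]
    simp only [h3, mul_zero, Finset.sum_const_zero, zero_add, zero_sub]
    rw [christoffel_congr hc, (metricRate_iff hk.toIsSplitAt i j).1 (hk.rate.self_of_nhds i j)]
    ring
  rw [extrinsicCurvature, h1, h1, hk.curvature_symm.self_of_nhds j i]
  ring

theorem IsAnalyticEvolution.isVacuumDevelopment
    (hs : IsAnalyticEvolution V N β (fun _ => 0) g₀ K₀ g K)
    (hG : IsAnalyticGauge V N β) (hV : IsSliceNeighborhood V)
    (hc : Constraints N β (fun _ => 0) g₀ K₀) :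
    IsVacuumDevelopment V (spacetimeMetric N β g) g₀ K₀ where
  nhd := hV
  lorentzian := fun p hp => isLorentzForm_spacetimeMetric (hG.lapse_pos p hp) (hs.metric p hp)
  analytic :=
    { symm := fun p hp => (isLorentzForm_spacetimeMetric (hG.lapse_pos p hp) (hs.metric p hp)).1
      analytic := fun e he i j q hq =>
        (hs.isMetricOn hG subset_rfl hV.isOpen e he q hq).analytic i j }
  vacuum := hs.einsteinEquations hG (isAnalyticSymmetric_zero V) subset_rfl hV
    (conservationLaws_zero V _) hc
  induced_metric := fun x v w => by
    rw [spacetimeMetric_apply, hs.initial_metric]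
    simp only [zero_smul, add_zero, mul_zero, sub_zero]
  extrinsic_curvature := fun e he y hy i j => by
    rw [hs.extrinsicCurvature_eq hG subset_rfl hV.isOpen he ⟨hy, hV.slice_mem _⟩]
    exact congrArg (fun h : LinearMap.BilinForm ℝ (TangentSpace (𝓡 n) (e.symm y)) =>
      h (coordVec e y i) (coordVec e y j)) (hs.initial_curvature (e.symm y))

end VacuumDevelopment

end

end EinsteinCauchy

/-! ### The three parts assembled. -/

theorem mainTheorem2 (n : ℕ) (M : Type*) [TopologicalSpace M]
    [ChartedSpace (EuclideanSpace ℝ (Fin n)) M] [IsManifold (𝓡 n) ω M]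
    (g₀ K₀ : (x : M) → LinearMap.BilinForm ℝ (TangentSpace (𝓡 n) x))
    (hdata : IsAnalyticInitialData g₀ K₀) :
    (∀ (U : Set (M × ℝ)) (N : M × ℝ → ℝ) (β : (p : M × ℝ) → TangentSpace (𝓡 n) p.1)
        (ρ : (p : M × ℝ) → LinearMap.BilinForm ℝ (TangentSpace (𝓡 n) p.1 × ℝ)),
        IsOpen U → (∀ x : M, (x, (0 : ℝ)) ∈ U) →
        IsAnalyticGauge U N β → IsAnalyticSymmetric U ρ →
        (∃ V ⊆ U, IsSliceNeighborhood V ∧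
          ∃ g K : (p : M × ℝ) → LinearMap.BilinForm ℝ (TangentSpace (𝓡 n) p.1),
            IsAnalyticEvolution V N β ρ g₀ K₀ g K) ∧
        (∀ V ⊆ U, IsSliceNeighborhood V →
          ∀ g K : (p : M × ℝ) → LinearMap.BilinForm ℝ (TangentSpace (𝓡 n) p.1),
            IsAnalyticEvolution V N β ρ g₀ K₀ g K →
            ConservationLaws V (spacetimeMetric N β g) ρ →
            Constraints N β ρ g₀ K₀ →
            EinsteinEquations V (spacetimeMetric N β g) ρ)) ∧
    (VacuumConstraints g₀ K₀ →
      ∃ (V : Set (M × ℝ))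
        (G : (p : M × ℝ) → LinearMap.BilinForm ℝ (TangentSpace (𝓡 n) p.1 × ℝ)),
        IsVacuumDevelopment V G g₀ K₀) := by
  refine ⟨fun U N β ρ hU hslice hG hρ => ⟨?_, ?_⟩, fun hvac => ?_⟩
  · exact exists_isAnalyticEvolution hG hρ (exists_isEvolutionOn hdata hU hslice hG hρ)
  · exact fun V hVU hV g K hs hcons hc => hs.einsteinEquations hG hρ hVU hV hcons hc
  -- The gauge with lapse `1`, shift `0` and zero sources is defined on all of `M × ℝ`.
  · obtain ⟨V, -, hV, g, K, hs⟩ := exists_isAnalyticEvolution (isAnalyticGauge_geodesic Set.univ)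
      (isAnalyticSymmetric_zero Set.univ) (exists_isEvolutionOn hdata isOpen_univ
        (fun _ => Set.mem_univ _) (isAnalyticGauge_geodesic Set.univ)
        (isAnalyticSymmetric_zero Set.univ))
    exact ⟨V, _, hs.isVacuumDevelopment (isAnalyticGauge_geodesic V) hV
      (constraints_of_vacuum hvac)⟩
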